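/- Let $\Bbbk$ be a field of characteristic zero and let $A\in\mathbb Z^{d\times n}$ be an integer matrix with columns $\mathbf a_1,\dots,\mathbf a_n$, with independent rows, whose maximal minors generate the unit ideal of $\mathbb Z$ (so $\mathbb ZA=\mathbb Z^d$ and $\Bbbk A=\Bbbk^d$), and which is pointed: some $\mathbb Z$-linear functional on $\mathbb Z^d$ is positive on every $\mathbf a_j$. Write $X_A=\Bbbk^n$, $T_A=\operatorname{Spec}\Bbbk[\mathbb ZA]$, so $\dim X_A=n$ and $\dim T_A=d$. Let $R_A=\Bbbk[\partial_1,\dots,\partial_n]$, graded by $\deg\partial_j=\mathbf a_j$, let $D_A=\Bbbk[x_1,\dots,x_n]\langle\partial_1,\dots,\partial_n\rangle\supseteq R_A$ be the Weyl algebra, $\partial_AD_A=\sum_j\partial_jD_A$, $E_i=\sum_ja_{ij}x_j\partial_j$ ($1\le i\le d$), and $S_A=\Bbbk[\mathbb NA]$, an $A$-graded $R_A$-module on which $\partial_j$ acts as multiplication by $t^{\mathbf a_j}$. Let $\beta\in\Bbbk A$. For an $A$-graded $R_A$-module $N=\bigoplus_{\alpha\in\mathbb Z^d}N_\alpha$ let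 $K_\bullet(N;E-\beta)$ be the homological Koszul complex of the commuting left $D_A$-linear operators $(E_i-\beta_i)\circ$ on $D_A\otimes_{R_A}N$, where $E_i\circ(P\otimes\nu)=(E_i+\deg_i P+\deg_i\nu)P\otimes\nu$ for homogeneous $P,\nu$; the term $D_A\otimes_{R_A}N$ at the end of the complex has degree $0$. Let $H^i_{\partial_A}(N)$ be the $A$-graded local cohomology modules, i.e. the right derived functors, on $A$-graded $R_A$-modules, of $\Gamma_{\partial_A}(N)=\{m\in N\mid \partial_j^\kappa m=0\ \forall \kappa\gg0,\ \forall j\}$. For an $A$-graded module $M$ and $\beta\in\Bbbk A$, $M_\beta$ is the graded piece of degree $\beta$, which is $0$ if $\beta\notin\mathbb ZA$, and $\beta$ is called a degree of $M$ if $\beta\in\mathbb ZA$ and $M_\beta\ne0$. All indices below are cohomological: $H^p$ is the homology in homological degree $-p$, so $H^p\bigl((D_A/\partial_AD_A)\otimes^L_{D_A}K\bigr)=\operatorname{Tor}^{D_A}_{-p}(D_A/\partial_AD_A,K)$, and $(C[r])^p=C^{p+r}$. **Theorem.** 1. There are isomorphisms in the derived category of $\Bbbk$-vector spaces $$(D_A/\partial_AD_A)\otimes^L_{D_A}K_\bullet(N;E-\beta)\;\simeq\;\Bigl(\bigoplus_iH^i_{\partial_A}(N)\Bigr)_\beta\otimes_\Bbbk\bigwedge(\Bbbk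 A)\,[\dim X_A]$$ for all $A$-graded $R_A$-modules $N$, where the right side is a complex with zero differential in which, before the shift, $H^i_{\partial_A}(N)_\beta\otimes\bigwedge^j(\Bbbk A)$ sits in degree $i-j$. They are natural with respect to $A$-graded morphisms $N\to N'$ of degree zero. 2. In particular, $(D_A/\partial_AD_A)\otimes^L_{D_A}K_\bullet(N;E-\beta)\simeq 0$ whenever $\beta$ is not a degree of any $H^i_{\partial_A}(N)$. 3. Suppose that $\beta$ is not strongly exceptional, i.e. is not a degree of $H^i_{\partial_A}(S_A)$ for any $i<\dim T_A$. If $\beta$ is a degree of $H^{\dim T_A}_{\partial_A}(S_A)$, then for all $p\in\mathbb Z$ $$H^p\bigl((D_A/\partial_AD_A)\otimes^L_{D_A}K_\bullet(S_A;E-\beta)\bigr)\;\cong\;H_{dR}^{p+\dim X_A}(T_A;\Bbbk),$$ the algebraic de Rham cohomology of the torus $T_A$. If $\beta$ is not a degree of $H^{\dim T_A}_{\partial_A}(S_A)$, then $H^p\bigl((D_A/\partial_AD_A)\otimes^L_{D_A}K_\bullet(S_A;E-\beta)\bigr)=0$ for all $p\in\mathbb Z$. -/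

import Mathlib

open CategoryTheory TensorProduct

universe w u

namespace EulerKoszul

noncomputable section

section Matrices

variable {d n : ℕ}

/-- The integer matrix `A` (with columns `a_1, …, a_n ∈ ℤ^d`) has independent rows, its maximal
minors generate the unit ideal of `ℤ` (equivalently `ℤA = ℤ^d`), and `A` is pointed: some
`ℤ`-linear functional is positive on every column. -/
structure IsAdmissible (A : Matrix (Fin d) (Fin n) ℤ) : Prop where
  rows_independent : LinearIndependent ℤ (fun i => A i)
  minors : Ideal.span (Set.range fun c : Fin d → Fin n => (A.submatrix id c).det) = ⊤
  pointed : ∃ φ : (Fin d → ℤ) →ₗ[ℤ] ℤ, ∀ j, 0 < φ (fun i => A i j)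

/-- The `A`-degree `A · u = ∑ j, u_j a_j` of the monomial `∂^u`. -/
def weight (A : Matrix (Fin d) (Fin n) ℤ) (u : Fin n → ℕ) : Fin d → ℤ :=
  A.mulVec fun j => (u j : ℤ)

theorem weight_zero (A : Matrix (Fin d) (Fin n) ℤ) : weight A 0 = 0 := by
  ext i; simp [weight, Matrix.mulVec, dotProduct]

theorem weight_add (A : Matrix (Fin d) (Fin n) ℤ) (u v : Fin n → ℕ) :
    weight A (u + v) = weight A u + weight A v := by
  ext i; simp [weight, Matrix.mulVec, dotProduct, mul_add, Finset.sum_add_distrib]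

theorem weight_single (A : Matrix (Fin d) (Fin n) ℤ) (j : Fin n) (i : Fin d) :
    weight A (Pi.single j 1) i = A i j := by
  simp [weight, Matrix.mulVec, dotProduct, Pi.single_apply]

/-- The semigroup `ℕA` generated by the columns of `A`. -/
def columnMonoid (A : Matrix (Fin d) (Fin n) ℤ) : AddSubmonoid (Fin d → ℤ) :=
  AddSubmonoid.closure (Set.range fun j i => A i j)

theorem weight_mem (A : Matrix (Fin d) (Fin n) ℤ) (u : Fin n → ℕ) :
    weight A u ∈ columnMonoid A := by
  have : weight A u = ∑ j, u j • (fun i => A i j) := by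
    ext i; simp [weight, Matrix.mulVec, dotProduct, mul_comm]
  rw [this]
  exact sum_mem fun j _ => nsmul_mem (AddSubmonoid.subset_closure (Set.mem_range_self j)) _

end Matrices

section PolynomialMaps

open scoped IsMulCommutative

variable {k : Type u} [Field k] {n : ℕ} {S : Type u} [Ring S] [Algebra k S]

/-- The `k`-algebra map `k[y_1, …, y_n] → S` sending `y_j` to `f j`, for pairwise commuting elements
`f j` of a possibly noncommutative `k`-algebra `S`. -/
def polyHom (f : Fin n → S) (hf : ∀ i j, f i * f j = f j * f i) :
    MvPolynomial (Fin n) k →ₐ[k] S :=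
  haveI : IsMulCommutative (Algebra.adjoin k (Set.range f)) :=
    Algebra.isMulCommutative_adjoin k (by rintro _ ⟨i, rfl⟩ _ ⟨j, rfl⟩; exact hf i j)
  (Algebra.adjoin k (Set.range f)).val.comp
    (MvPolynomial.aeval (S₁ := Algebra.adjoin k (Set.range f))
      fun j => ⟨f j, Algebra.subset_adjoin (Set.mem_range_self j)⟩)

theorem polyHom_X (f : Fin n → S) (hf : ∀ i j, f i * f j = f j * f i) (j : Fin n) :
    polyHom (k := k) f hf (MvPolynomial.X j) = f j := by
  simp [polyHom]

end PolynomialMaps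

section Weyl

variable (k : Type u) [Field k] (n : ℕ)

/-- Multiplication by `x_j` on `k[x_1, …, x_n]`. -/
def mulX (j : Fin n) : Module.End k (MvPolynomial (Fin n) k) :=
  LinearMap.mulLeft k (MvPolynomial.X j)

/-- The partial derivative `∂/∂x_j` on `k[x_1, …, x_n]`. -/
def diffX (j : Fin n) : Module.End k (MvPolynomial (Fin n) k) :=
  (MvPolynomial.pderiv j).toLinearMap

/-- The subalgebra of `End_k(k[x_1, …, x_n])` generated by the multiplications by the variables
and the partial derivatives. -/
def weylSubalgebra : Subalgebra k (Module.End k (MvPolynomial (Fin n) k)) :=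
  Algebra.adjoin k (Set.range (mulX k n) ∪ Set.range (diffX k n))

/-- The ring `D_A` of `k`-linear differential operators on `O_A = k[x_1, …, x_n]` (the `n`-th Weyl
algebra), for `k` of characteristic zero. -/
def WeylAlgebra : Type u := weylSubalgebra k n

instance : Ring (WeylAlgebra k n) := inferInstanceAs (Ring (weylSubalgebra k n))

instance : Algebra k (WeylAlgebra k n) := inferInstanceAs (Algebra k (weylSubalgebra k n))

/-- The element `x_j` of `D_A`. -/
def xD (j : Fin n) : WeylAlgebra k n :=
  ⟨mulX k n j, Algebra.subset_adjoin (Or.inl ⟨j, rfl⟩)⟩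

/-- The element `∂_j` of `D_A`. -/
def dD (j : Fin n) : WeylAlgebra k n :=
  ⟨diffX k n j, Algebra.subset_adjoin (Or.inr ⟨j, rfl⟩)⟩

variable {k n}

/-- A differential operator as an endomorphism of the polynomial ring. -/
def toEnd : WeylAlgebra k n →ₐ[k] Module.End k (MvPolynomial (Fin n) k) :=
  (weylSubalgebra k n).val

theorem weyl_ext {P Q : WeylAlgebra k n} (h : ∀ f, toEnd P f = toEnd Q f) : P = Q :=
  Subtype.ext (LinearMap.ext h)

theorem toEnd_mul (P Q : WeylAlgebra k n) (f : MvPolynomial (Fin n) k) :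
    toEnd (P * Q) f = toEnd P (toEnd Q f) := rfl

theorem toEnd_xD (j : Fin n) (f : MvPolynomial (Fin n) k) :
    toEnd (xD k n j) f = MvPolynomial.X j * f := rfl

theorem toEnd_dD (j : Fin n) (f : MvPolynomial (Fin n) k) :
    toEnd (dD k n j) f = MvPolynomial.pderiv j f := rfl

theorem dD_comm (i j : Fin n) : dD k n i * dD k n j = dD k n j * dD k n i := by
  refine weyl_ext fun f => ?_
  simp only [toEnd_mul, toEnd_dD]
  induction f using MvPolynomial.induction_on with
  | C a => simp
  | add p q hp hq => simp only [map_add, hp, hq]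
  | mul_X p l hp =>
    simp only [Derivation.leibniz, smul_eq_mul, map_add, MvPolynomial.pderiv_X, hp]
    have h (a b : Fin n) : MvPolynomial.pderiv a
        ((Pi.single b 1 : Fin n → MvPolynomial (Fin n) k) l) = 0 := by
      by_cases hb : l = b
      · subst hb; simp
      · simp [hb]
    rw [h, h]; ring

theorem dD_mul_xD (i j : Fin n) :
    dD k n i * xD k n j = xD k n j * dD k n i + if i = j then 1 else 0 := by
  refine weyl_ext fun f => ?_
  rw [map_add, LinearMap.add_apply]
  simp only [toEnd_mul, toEnd_dD, toEnd_xD, Derivation.leibniz, smul_eq_mul, MvPolynomial.pderiv_X]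
  split_ifs with h
  · subst h; simp
  · simp [Ne.symm h]

theorem xD_comm (i j : Fin n) : xD k n i * xD k n j = xD k n j * xD k n i := by
  refine weyl_ext fun f => ?_
  simp only [toEnd_mul, toEnd_xD]; ring

/-- The inclusion `R_A = k[∂_1, …, ∂_n] → D_A`; the `j`-th polynomial variable goes to `∂_j`. -/
def inclR : MvPolynomial (Fin n) k →ₐ[k] WeylAlgebra k n := polyHom (dD k n) dD_comm

/-- `D_A` as a right `R_A`-module: `r • P = P · r`. -/
instance weylRight : Module (MvPolynomial (Fin n) k) (WeylAlgebra k n) where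
  smul r P := P * inclR r
  one_smul P := by change P * inclR 1 = P; simp
  mul_smul r s P := by
    change P * inclR (r * s) = P * inclR s * inclR r
    rw [mul_comm r s, map_mul, mul_assoc]
  smul_zero r := by change 0 * inclR r = 0; simp
  smul_add r P Q := by change (P + Q) * inclR r = P * inclR r + Q * inclR r; rw [add_mul]
  add_smul r s P := by change P * inclR (r + s) = P * inclR r + P * inclR s; rw [map_add, mul_add]
  zero_smul P := by change P * inclR 0 = 0; simp

theorem weylRight_smul (r : MvPolynomial (Fin n) k) (P : WeylAlgebra k n) :
    r • P = P * inclR r := rfl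

instance : SMulCommClass (MvPolynomial (Fin n) k) (WeylAlgebra k n) (WeylAlgebra k n) where
  smul_comm r P Q := by simp only [weylRight_smul, smul_eq_mul, mul_assoc]

variable {d : ℕ}

/-- The Euler operator `E_i = ∑ j, a_{ij} x_j ∂_j`. -/
def euler (k : Type u) [Field k] (A : Matrix (Fin d) (Fin n) ℤ) (i : Fin d) : WeylAlgebra k n :=
  ∑ j, A i j • (xD k n j * dD k n j)

theorem theta_comm (i j : Fin n) :
    (xD k n i * dD k n i) * (xD k n j * dD k n j) =
      (xD k n j * dD k n j) * (xD k n i * dD k n i) := by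
  by_cases h : i = j
  · rw [h]
  · have h1 : dD k n i * xD k n j = xD k n j * dD k n i := by simp [dD_mul_xD, h]
    have h2 : dD k n j * xD k n i = xD k n i * dD k n j := by simp [dD_mul_xD, Ne.symm h]
    calc _ = xD k n i * (dD k n i * xD k n j) * dD k n j := by simp only [mul_assoc]
      _ = (xD k n i * xD k n j) * (dD k n i * dD k n j) := by rw [h1]; simp only [mul_assoc]
      _ = xD k n j * (xD k n i * dD k n j) * dD k n i := by
        rw [xD_comm i j, dD_comm i j]; simp only [mul_assoc]
      _ = _ := by rw [← h2]; simp only [mul_assoc]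

theorem euler_comm (A : Matrix (Fin d) (Fin n) ℤ) (i l : Fin d) :
    euler k A i * euler k A l = euler k A l * euler k A i := by
  simp only [euler, Finset.sum_mul_sum, smul_mul_assoc, mul_smul_comm]
  rw [Finset.sum_comm]
  refine Finset.sum_congr rfl fun j _ => Finset.sum_congr rfl fun j' _ => ?_
  rw [theta_comm, smul_comm]

theorem dD_mul_euler (A : Matrix (Fin d) (Fin n) ℤ) (i : Fin d) (j : Fin n) :
    dD k n j * euler k A i = euler k A i * dD k n j + A i j • dD k n j := by
  have key : ∀ l, dD k n j * (xD k n l * dD k n l) =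
      xD k n l * dD k n l * dD k n j + if j = l then dD k n l else 0 := by
    intro l
    rw [← mul_assoc, dD_mul_xD, add_mul, mul_assoc, dD_comm j l, ← mul_assoc]
    split_ifs <;> simp
  simp only [euler, Finset.mul_sum, Finset.sum_mul, mul_smul_comm, smul_mul_assoc, key, smul_add,
    Finset.sum_add_distrib]
  simp

end Weyl
section Graded

variable {d n : ℕ}

/-- The degrees `α ∈ ℤ^d = ℤA`, as objects of a category whose morphisms `α ⟶ β` are the monomials
`∂^u` with `α + deg_A(∂^u) = β`; composition is the product of monomials. -/
@[ext]
structure DegreeCat (A : Matrix (Fin d) (Fin n) ℤ) : Type where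
  deg : Fin d → ℤ

instance (A : Matrix (Fin d) (Fin n) ℤ) : DecidableEq (DegreeCat A) := fun a b =>
  decidable_of_iff (a.deg = b.deg) DegreeCat.ext_iff.symm

instance (A : Matrix (Fin d) (Fin n) ℤ) : SmallCategory (DegreeCat A) where
  Hom α β := {u : Fin n → ℕ // α.deg + weight A u = β.deg}
  id α := ⟨0, by rw [weight_zero, add_zero]⟩
  comp u v := ⟨u.1 + v.1, by rw [weight_add, ← add_assoc, u.2, v.2]⟩
  id_comp u := Subtype.ext (zero_add u.1)
  comp_id u := Subtype.ext (add_zero u.1)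
  assoc u v w := Subtype.ext (add_assoc u.1 v.1 w.1)

variable (A : Matrix (Fin d) (Fin n) ℤ)

/-- The degree `α + deg_A(∂^u)`. -/
def DegreeCat.translate {A : Matrix (Fin d) (Fin n) ℤ} (α : DegreeCat A) (u : Fin n → ℕ) :
    DegreeCat A := ⟨α.deg + weight A u⟩

/-- The monomial `∂^u`, as a morphism out of the degree `α`. -/
def DegreeCat.mon {A : Matrix (Fin d) (Fin n) ℤ} (α : DegreeCat A) (u : Fin n → ℕ) :
    α ⟶ α.translate u := ⟨u, rfl⟩

/-- The category of `A`-graded `R_A`-modules, where `R_A = k[∂_1, …, ∂_n]` and `deg ∂_j = a_j`.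
An `A`-graded module `N = ⨁_{α ∈ ℤ^d} N_α` is given by its graded pieces `N_α` together with the
multiplication maps `∂^u : N_α → N_{α + A u}` by monomials; its morphisms are the families of
`k`-linear maps `N_α → N'_α` that commute with the `∂^u`, that is, the `R_A`-linear maps of degree
zero. The underlying `R_A`-module is `Total N` below. -/
abbrev GradedModule (k : Type u) [Field k] := DegreeCat A ⥤ ModuleCat.{u} k

variable {A} {k : Type u} [Field k]

/-- The underlying module `⨁_α N_α` of an `A`-graded module. -/
def Total (N : GradedModule A k) : Type u := DirectSum (DegreeCat A) fun α => N.obj α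

instance (N : GradedModule A k) : AddCommGroup (Total N) :=
  inferInstanceAs (AddCommGroup (DirectSum (DegreeCat A) fun α => N.obj α))

instance (N : GradedModule A k) : Module k (Total N) :=
  inferInstanceAs (Module k (DirectSum (DegreeCat A) fun α => N.obj α))

/-- The inclusion of the graded piece `N_α` into `N`. -/
def incl (N : GradedModule A k) (α : DegreeCat A) : N.obj α →ₗ[k] Total N :=
  DirectSum.lof k (DegreeCat A) (fun α => N.obj α) α

/-- The `k`-linear map out of `N = ⨁_α N_α` with given restrictions to the graded pieces. -/
def fromTotal (N : GradedModule A k) {M : Type u} [AddCommGroup M] [Module k M]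
    (f : ∀ α, N.obj α →ₗ[k] M) : Total N →ₗ[k] M :=
  DirectSum.toModule k (DegreeCat A) M f

theorem fromTotal_incl (N : GradedModule A k) {M : Type u} [AddCommGroup M] [Module k M]
    (f : ∀ α, N.obj α →ₗ[k] M) (α : DegreeCat A) (x : N.obj α) :
    fromTotal N f (incl N α x) = f α x := by
  change DirectSum.toModule k (DegreeCat A) M f
    (DirectSum.lof k (DegreeCat A) (fun α => N.obj α) α x) = f α x
  exact DirectSum.toModule_lof (M := fun α => N.obj α) (φ := f) k α x

theorem total_hom_ext {N : GradedModule A k} {M : Type u} [AddCommGroup M] [Module k M]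
    {f g : Total N →ₗ[k] M} (h : ∀ α x, f (incl N α x) = g (incl N α x)) : f = g :=
  DirectSum.linearMap_ext k fun α => LinearMap.ext (h α)

theorem incl_map (N : GradedModule A k) {α β γ : DegreeCat A} (f : α ⟶ β) (g : α ⟶ γ)
    (h : f.1 = g.1) (x : N.obj α) :
    incl N β (N.map f x) = incl N γ (N.map g x) := by
  obtain rfl : β = γ := DegreeCat.ext (by rw [← f.2, ← g.2, h])
  obtain rfl : f = g := Subtype.ext h
  rfl

/-- Multiplication by `∂_j` on `N`. -/
def partialTotal (N : GradedModule A k) (j : Fin n) : Module.End k (Total N) :=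
  fromTotal N fun α => incl N _ ∘ₗ (N.map (α.mon (Pi.single j 1))).hom

theorem partialTotal_incl (N : GradedModule A k) (j : Fin n) (α : DegreeCat A) (x : N.obj α) :
    partialTotal N j (incl N α x) = incl N _ (N.map (α.mon (Pi.single j 1)) x) :=
  fromTotal_incl _ _ _ _

theorem partialTotal_comm (N : GradedModule A k) (i j : Fin n) :
    partialTotal N i * partialTotal N j = partialTotal N j * partialTotal N i := by
  refine total_hom_ext fun α x => ?_
  simp only [Module.End.mul_apply, partialTotal_incl]
  rw [← ModuleCat.comp_apply, ← ModuleCat.comp_apply, ← N.map_comp, ← N.map_comp]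
  exact incl_map N _ _ (add_comm (G := Fin n → ℕ) _ _) x

/-- The `R_A`-module structure of `N`: the `j`-th variable acts as `∂_j`. -/
instance totalModule (N : GradedModule A k) : Module (MvPolynomial (Fin n) k) (Total N) :=
  Module.compHom (Total N)
    (polyHom (k := k) (partialTotal N) (partialTotal_comm N)).toRingHom

theorem totalModule_smul (N : GradedModule A k) (r : MvPolynomial (Fin n) k) (x : Total N) :
    r • x = polyHom (k := k) (partialTotal N) (partialTotal_comm N) r x := rfl

theorem X_smul (N : GradedModule A k) (j : Fin n) (x : Total N) :
    (MvPolynomial.X j : MvPolynomial (Fin n) k) • x = partialTotal N j x := by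
  rw [totalModule_smul, polyHom_X]

theorem C_smul (N : GradedModule A k) (c : k) (x : Total N) :
    (MvPolynomial.C c : MvPolynomial (Fin n) k) • x = c • x := by
  rw [totalModule_smul, ← MvPolynomial.algebraMap_eq, AlgHom.commutes, Module.algebraMap_end_apply]

/-- The `R_A`-linear map underlying a morphism of `A`-graded modules. -/
def totalMapₗ {N N' : GradedModule A k} (φ : N ⟶ N') : Total N →ₗ[k] Total N' :=
  fromTotal N fun α => incl N' α ∘ₗ (φ.app α).hom

theorem totalMapₗ_incl {N N' : GradedModule A k} (φ : N ⟶ N') (α : DegreeCat A) (x : N.obj α) :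
    totalMapₗ φ (incl N α x) = incl N' α (φ.app α x) := fromTotal_incl _ _ _ _

theorem totalMapₗ_partial {N N' : GradedModule A k} (φ : N ⟶ N') (j : Fin n) (x : Total N) :
    totalMapₗ φ (partialTotal N j x) = partialTotal N' j (totalMapₗ φ x) := by
  have : totalMapₗ φ ∘ₗ partialTotal N j = partialTotal N' j ∘ₗ totalMapₗ φ := by
    refine total_hom_ext fun α x => ?_
    simp only [LinearMap.comp_apply, partialTotal_incl, totalMapₗ_incl]
    rw [← ModuleCat.comp_apply, φ.naturality, ModuleCat.comp_apply]
  exact LinearMap.congr_fun this x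

/-- The `R_A`-linear map underlying a morphism of `A`-graded modules. -/
def totalMap {N N' : GradedModule A k} (φ : N ⟶ N') :
    Total N →ₗ[MvPolynomial (Fin n) k] Total N' where
  toFun := totalMapₗ φ
  map_add' := map_add _
  map_smul' r x := by
    change totalMapₗ φ (r • x) = r • totalMapₗ φ x
    induction r using MvPolynomial.induction_on generalizing x with
    | C c => rw [C_smul, C_smul, map_smul]
    | add p q hp hq => rw [add_smul, map_add, hp, hq, add_smul]
    | mul_X p j hp => rw [mul_smul, mul_smul, hp, X_smul, X_smul, totalMapₗ_partial]

/-- The operator on `N` that multiplies a homogeneous element of degree `α` by `α_i`. -/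
def degreeOp (N : GradedModule A k) (i : Fin d) : Module.End k (Total N) :=
  fromTotal N fun α => α.deg i • incl N α

theorem degreeOp_incl (N : GradedModule A k) (i : Fin d) (α : DegreeCat A) (x : N.obj α) :
    degreeOp N i (incl N α x) = α.deg i • incl N α x := fromTotal_incl _ _ _ _

theorem degreeOp_comm (N : GradedModule A k) (i l : Fin d) (x : Total N) :
    degreeOp N i (degreeOp N l x) = degreeOp N l (degreeOp N i x) := by
  have : degreeOp N i ∘ₗ degreeOp N l = degreeOp N l ∘ₗ degreeOp N i := by
    refine total_hom_ext fun α x => ?_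
    simp only [LinearMap.comp_apply, degreeOp_incl, map_zsmul]
    rw [smul_comm]
  exact LinearMap.congr_fun this x

theorem degreeOp_partial (N : GradedModule A k) (i : Fin d) (j : Fin n) (x : Total N) :
    degreeOp N i (partialTotal N j x) =
      partialTotal N j (degreeOp N i x) + A i j • partialTotal N j x := by
  have : degreeOp N i ∘ₗ partialTotal N j =
      partialTotal N j ∘ₗ degreeOp N i + A i j • partialTotal N j := by
    refine total_hom_ext fun α x => ?_
    simp only [LinearMap.add_apply, LinearMap.smul_apply, LinearMap.comp_apply, degreeOp_incl,
      partialTotal_incl, map_zsmul]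
    rw [← add_smul]
    simp [DegreeCat.translate, weight_single]
  exact LinearMap.congr_fun this x

theorem totalMap_degreeOp {N N' : GradedModule A k} (φ : N ⟶ N') (i : Fin d) (x : Total N) :
    totalMap φ (degreeOp N i x) = degreeOp N' i (totalMap φ x) := by
  have : totalMapₗ φ ∘ₗ degreeOp N i = degreeOp N' i ∘ₗ totalMapₗ φ := by
    refine total_hom_ext fun α x => ?_
    simp only [LinearMap.comp_apply, degreeOp_incl, totalMapₗ_incl, map_zsmul]
  exact LinearMap.congr_fun this x

/-- The left `D_A`-module `D_A ⊗_{R_A} N`. -/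
abbrev Induced (N : GradedModule A k) : Type u :=
  WeylAlgebra k n ⊗[MvPolynomial (Fin n) k] Total N

theorem euler_balanced (N : GradedModule A k) (i : Fin d) (r : MvPolynomial (Fin n) k)
    (P : WeylAlgebra k n) (x : Total N) :
    (((r • P) * euler k A i) ⊗ₜ x + (r • P) ⊗ₜ degreeOp N i x : Induced N) =
      (P * euler k A i) ⊗ₜ (r • x) + P ⊗ₜ degreeOp N i (r • x) := by
  induction r using MvPolynomial.induction_on generalizing P x with
  | C c =>
    have h : inclR (MvPolynomial.C c) = algebraMap k (WeylAlgebra k n) c :=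
      AlgHom.commutes inclR c
    rw [C_smul, map_smul, ← C_smul N c x, ← C_smul N c, ← TensorProduct.smul_tmul,
      ← TensorProduct.smul_tmul]
    simp only [weylRight_smul, h, mul_assoc, Algebra.commutes]
  | add p q hp hq =>
    simp only [add_smul, add_mul, TensorProduct.add_tmul, TensorProduct.tmul_add, map_add]
    rw [add_add_add_comm, hp, hq, add_add_add_comm]
  | mul_X p j hp =>
    have hX : inclR (k := k) (n := n) (MvPolynomial.X j) = dD k n j := polyHom_X _ _ _
    have step : ∀ (Q : WeylAlgebra k n) (y : Total N),
        ((((MvPolynomial.X j : MvPolynomial (Fin n) k) • Q) * euler k A i) ⊗ₜ y +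
          ((MvPolynomial.X j : MvPolynomial (Fin n) k) • Q) ⊗ₜ degreeOp N i y : Induced N) =
        (Q * euler k A i) ⊗ₜ ((MvPolynomial.X j : MvPolynomial (Fin n) k) • y) +
          Q ⊗ₜ degreeOp N i ((MvPolynomial.X j : MvPolynomial (Fin n) k) • y) := by
      intro Q y
      have h1 : ((MvPolynomial.X j : MvPolynomial (Fin n) k) • Q) * euler k A i =
          (MvPolynomial.X j : MvPolynomial (Fin n) k) • (Q * euler k A i) +
            A i j • ((MvPolynomial.X j : MvPolynomial (Fin n) k) • Q) := by
        simp only [weylRight_smul, hX, mul_assoc, dD_mul_euler, mul_add, mul_smul_comm]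
      have h2 : ((A i j • ((MvPolynomial.X j : MvPolynomial (Fin n) k) • Q)) ⊗ₜ y : Induced N) =
          Q ⊗ₜ (A i j • ((MvPolynomial.X j : MvPolynomial (Fin n) k) • y)) := by
        rw [TensorProduct.smul_tmul, TensorProduct.smul_tmul,
          smul_comm (MvPolynomial.X j : MvPolynomial (Fin n) k) (A i j) y]
      have h3 : degreeOp N i ((MvPolynomial.X j : MvPolynomial (Fin n) k) • y) =
          (MvPolynomial.X j : MvPolynomial (Fin n) k) • degreeOp N i y +
            A i j • ((MvPolynomial.X j : MvPolynomial (Fin n) k) • y) := by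
        rw [X_smul, X_smul, degreeOp_partial]
      rw [h1, h3, TensorProduct.add_tmul, TensorProduct.tmul_add, h2,
        TensorProduct.smul_tmul _ _ y, TensorProduct.smul_tmul _ _ (degreeOp N i y)]
      abel
    rw [mul_smul p (MvPolynomial.X j) P, mul_comm p (MvPolynomial.X j), mul_smul (MvPolynomial.X j) p x,
      hp, step]


/-- The biadditive map `(P, ν) ↦ P E_i ⊗ ν + P ⊗ deg_i(ν) ν`. -/
def eulerBiadd (N : GradedModule A k) (i : Fin d) : WeylAlgebra k n →+ Total N →+ Induced N :=
  AddMonoidHom.mk' (fun P => AddMonoidHom.mk'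
      (fun ν => ((P * euler k A i) ⊗ₜ[MvPolynomial (Fin n) k] ν +
        P ⊗ₜ[MvPolynomial (Fin n) k] degreeOp N i ν))
      (fun x y => by rw [TensorProduct.tmul_add, map_add, TensorProduct.tmul_add]; abel))
    (fun P Q => by
      ext x
      simp only [AddMonoidHom.mk'_apply, AddMonoidHom.add_apply, add_mul, TensorProduct.add_tmul]
      abel)

/-- The additive map `P ⊗ ν ↦ P E_i ⊗ ν + P ⊗ deg_i(ν) ν` of `D_A ⊗_{R_A} N`. -/
def eulerAdd (N : GradedModule A k) (i : Fin d) : Induced N →+ Induced N :=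
  TensorProduct.liftAddHom (eulerBiadd N i) fun r P ν => euler_balanced N i r P ν

theorem eulerAdd_tmul (N : GradedModule A k) (i : Fin d) (P : WeylAlgebra k n) (ν : Total N) :
    eulerAdd N i (P ⊗ₜ ν) = (P * euler k A i) ⊗ₜ ν + P ⊗ₜ degreeOp N i ν := rfl

/-- The Euler operator `E_i ∘ (P ⊗ ν) = P E_i ⊗ ν + P ⊗ deg_i(ν) ν` on `D_A ⊗_{R_A} N`, for
homogeneous `ν`. Since `P E_i = (E_i + deg_i(P)) P` for homogeneous `P`, this equals
`(E_i + deg_i(P) + deg_i(ν)) P ⊗ ν`. -/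
def eulerAct (N : GradedModule A k) (i : Fin d) : Module.End (WeylAlgebra k n) (Induced N) where
  toFun := eulerAdd N i
  map_add' := map_add _
  map_smul' Q t := by
    rw [RingHom.id_apply]
    induction t using TensorProduct.induction_on with
    | zero => rw [smul_zero, map_zero, smul_zero]
    | add s t hs ht => rw [smul_add, map_add, hs, ht, map_add, smul_add]
    | tmul P ν =>
      rw [TensorProduct.smul_tmul', eulerAdd_tmul, eulerAdd_tmul, smul_add,
        TensorProduct.smul_tmul', TensorProduct.smul_tmul', smul_eq_mul, smul_eq_mul, mul_assoc]

theorem eulerAct_tmul (N : GradedModule A k) (i : Fin d) (P : WeylAlgebra k n) (ν : Total N) :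
    eulerAct N i (P ⊗ₜ ν) = (P * euler k A i) ⊗ₜ ν + P ⊗ₜ degreeOp N i ν :=
  eulerAdd_tmul N i P ν

theorem eulerAct_comm (N : GradedModule A k) (i l : Fin d) :
    eulerAct N i * eulerAct N l = eulerAct N l * eulerAct N i := by
  refine LinearMap.ext fun t => ?_
  simp only [Module.End.mul_apply]
  induction t using TensorProduct.induction_on with
  | zero => simp
  | add s t hs ht => simp only [map_add, hs, ht]
  | tmul P ν =>
    simp only [eulerAct_tmul, map_add]
    rw [mul_assoc, mul_assoc, euler_comm A l i, degreeOp_comm]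
    abel

/-- Multiplication by the scalar `c ∈ k` as a `D_A`-linear endomorphism. -/
def scalarAct (N : GradedModule A k) (c : k) : Module.End (WeylAlgebra k n) (Induced N) where
  toFun t := algebraMap k (WeylAlgebra k n) c • t
  map_add' := smul_add _
  map_smul' Q t := by
    rw [RingHom.id_apply, ← mul_smul, ← mul_smul, Algebra.commutes]

/-- The commuting `D_A`-linear endomorphisms `(E_i - β_i) ∘` of `D_A ⊗_{R_A} N`. -/
def eulerShift (β : Fin d → k) (N : GradedModule A k) (i : Fin d) :
    Module.End (WeylAlgebra k n) (Induced N) :=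
  eulerAct N i - scalarAct N (β i)

theorem eulerShift_comm (β : Fin d → k) (N : GradedModule A k) (i l : Fin d) (t : Induced N) :
    eulerShift β N i (eulerShift β N l t) = eulerShift β N l (eulerShift β N i t) := by
  have h1 : eulerAct N i (eulerAct N l t) = eulerAct N l (eulerAct N i t) :=
    LinearMap.congr_fun (eulerAct_comm N i l) t
  have h2 : ∀ (f : Module.End (WeylAlgebra k n) (Induced N)) (c : k) (s : Induced N),
      f (scalarAct N c s) = scalarAct N c (f s) := fun f c s => f.map_smul _ s
  simp only [eulerShift, LinearMap.sub_apply, map_sub, h1, h2 (eulerAct N _),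
    h2 (scalarAct N _) (β l)]
  abel

/-- The map `id ⊗ φ : D_A ⊗ N → D_A ⊗ N'`. -/
def inducedMap {N N' : GradedModule A k} (φ : N ⟶ N') :
    Induced N →ₗ[WeylAlgebra k n] Induced N' where
  toFun := LinearMap.lTensor (WeylAlgebra k n) (totalMap φ)
  map_add' := map_add _
  map_smul' Q t := by
    dsimp only [RingHom.id_apply]
    induction t using TensorProduct.induction_on with
    | zero => simp
    | add s t hs ht => rw [smul_add, map_add, hs, ht, map_add, smul_add]
    | tmul P ν => simp only [TensorProduct.smul_tmul', LinearMap.lTensor_tmul]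

theorem inducedMap_tmul {N N' : GradedModule A k} (φ : N ⟶ N') (P : WeylAlgebra k n)
    (ν : Total N) : inducedMap φ (P ⊗ₜ ν) = P ⊗ₜ totalMap φ ν := rfl

theorem inducedMap_eulerShift (β : Fin d → k) {N N' : GradedModule A k} (φ : N ⟶ N') (i : Fin d)
    (t : Induced N) :
    inducedMap φ (eulerShift β N i t) = eulerShift β N' i (inducedMap φ t) := by
  have h : ∀ (c : k), inducedMap φ (scalarAct N c t) = scalarAct N' c (inducedMap φ t) :=
    fun c => (inducedMap φ).map_smul _ t
  simp only [eulerShift, LinearMap.sub_apply, map_sub, h]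
  congr 1
  induction t using TensorProduct.induction_on with
  | zero => simp
  | add s t hs ht =>
    rw [map_add, map_add, map_add, map_add, hs (fun c => (inducedMap φ).map_smul _ s),
      ht (fun c => (inducedMap φ).map_smul _ t)]
  | tmul P ν => simp only [eulerAct_tmul, map_add, inducedMap_tmul, totalMap_degreeOp]

theorem inducedMap_id (N : GradedModule A k) (t : Induced N) : inducedMap (𝟙 N) t = t := by
  have h : ∀ ν : Total N, totalMap (𝟙 N) ν = ν := fun ν => by
    have : totalMapₗ (𝟙 N) = LinearMap.id :=
      total_hom_ext fun α x => by rw [totalMapₗ_incl]; simp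
    exact LinearMap.congr_fun this ν
  induction t using TensorProduct.induction_on with
  | zero => simp
  | add s t hs ht => rw [map_add, hs, ht]
  | tmul P ν => rw [inducedMap_tmul, h]

theorem inducedMap_comp {N N' N'' : GradedModule A k} (φ : N ⟶ N') (ψ : N' ⟶ N'')
    (t : Induced N) : inducedMap (φ ≫ ψ) t = inducedMap ψ (inducedMap φ t) := by
  have h : ∀ ν : Total N, totalMap (φ ≫ ψ) ν = totalMap ψ (totalMap φ ν) := fun ν => by
    have : totalMapₗ (φ ≫ ψ) = totalMapₗ ψ ∘ₗ totalMapₗ φ :=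
      total_hom_ext fun α x => by
        rw [LinearMap.comp_apply, totalMapₗ_incl, totalMapₗ_incl, totalMapₗ_incl]; simp
    exact LinearMap.congr_fun this ν
  induction t using TensorProduct.induction_on with
  | zero => simp
  | add s t hs ht => simp only [map_add, hs, ht]
  | tmul P ν => simp only [inducedMap_tmul, h]

end Graded

section Koszul

variable {S : Type u} [Ring S] {M : Type u} [AddCommGroup M] [Module S M] {d : ℕ}

/-- The sign `(-1)^{#{j ∈ s : j < i}}` with which `e_i` enters the exterior monomial `e_s`. -/
def wedgeSign (i : Fin d) (s : Finset (Fin d)) : ℤ := (-1) ^ (s.filter (· < i)).card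

theorem wedgeSign_insert {i l : Fin d} {s : Finset (Fin d)} (hi : i ∉ s) :
    wedgeSign l (insert i s) = (if i < l then -1 else 1) * wedgeSign l s := by
  unfold wedgeSign
  rw [Finset.filter_insert]
  split_ifs with h
  · rw [Finset.card_insert_of_notMem (by simp [hi]), pow_succ, mul_comm]
  · rw [one_mul]

theorem wedgeSign_anti {i l : Fin d} (hil : i ≠ l) {s : Finset (Fin d)} (hi : i ∉ s)
    (hl : l ∉ s) :
    wedgeSign i s * wedgeSign l (insert i s) = -(wedgeSign l s * wedgeSign i (insert l s)) := by
  rw [wedgeSign_insert hi, wedgeSign_insert hl]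
  rcases lt_or_gt_of_ne hil with h | h
  · rw [if_pos h, if_neg h.asymm]; ring
  · rw [if_neg h.asymm, if_pos h]; ring

/-- The Koszul differential of operators `f_1, …, f_d` on `M ⊗ ⋀ ℤ^d`: it sends
`m ⊗ e_t` to `∑_{i ∈ t} ± f_i(m) ⊗ e_{t ∖ i}`. An element `∑_s m_s ⊗ e_s` is
written as the function `s ↦ m_s`. -/
def koszulDiff (f : Fin d → Module.End S M) :
    (Finset (Fin d) → M) →ₗ[S] (Finset (Fin d) → M) :=
  LinearMap.pi fun s => ∑ i ∈ sᶜ, wedgeSign i s • (f i ∘ₗ LinearMap.proj (insert i s))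

theorem koszulDiff_apply (f : Fin d → Module.End S M) (ω : Finset (Fin d) → M)
    (s : Finset (Fin d)) :
    koszulDiff f ω s = ∑ i ∈ sᶜ, wedgeSign i s • f i (ω (insert i s)) := by
  simp [koszulDiff]

theorem koszulDiff_sq (f : Fin d → Module.End S M) (hf : ∀ i l m, f i (f l m) = f l (f i m))
    (ω : Finset (Fin d) → M) : koszulDiff f (koszulDiff f ω) = 0 := by
  ext s
  simp only [koszulDiff_apply, map_sum, map_zsmul, Finset.smul_sum, smul_smul, Pi.zero_apply]
  rw [Finset.sum_sigma']
  refine Finset.sum_involution (fun x _ => ⟨x.2, x.1⟩) ?_ ?_ ?_ ?_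
  · rintro ⟨i, l⟩ h
    simp only [Finset.mem_sigma, Finset.mem_compl, Finset.mem_insert, not_or] at h
    obtain ⟨hi, hli, hl⟩ := h
    dsimp only
    rw [hf i l, Finset.insert_comm l i, wedgeSign_anti (Ne.symm hli) hi hl, neg_smul,
      neg_add_cancel]
  · rintro ⟨i, l⟩ h _ he
    simp only [Finset.mem_sigma, Finset.mem_compl, Finset.mem_insert, not_or] at h
    simp only [Sigma.mk.injEq] at he
    exact h.2.1 he.1
  · rintro ⟨i, l⟩ h
    simp only [Finset.mem_sigma, Finset.mem_compl, Finset.mem_insert, not_or] at h ⊢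
    exact ⟨h.2.2, fun e => h.2.1 e.symm, h.1⟩
  · rintro ⟨i, l⟩ h
    rfl

/-- The de Rham-type differential of operators `f_1, …, f_d` on `M ⊗ ⋀ ℤ^d`: it sends
`m ⊗ e_s` to `∑_i f_i(m) ⊗ e_i ∧ e_s`. -/
def wedgeDiff (f : Fin d → Module.End S M) :
    (Finset (Fin d) → M) →ₗ[S] (Finset (Fin d) → M) :=
  LinearMap.pi fun t => ∑ i ∈ t, wedgeSign i t • (f i ∘ₗ LinearMap.proj (t.erase i))

theorem wedgeDiff_apply (f : Fin d → Module.End S M) (ω : Finset (Fin d) → M)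
    (t : Finset (Fin d)) :
    wedgeDiff f ω t = ∑ i ∈ t, wedgeSign i t • f i (ω (t.erase i)) := by
  simp [wedgeDiff]

theorem wedgeSign_erase_self (i : Fin d) (t : Finset (Fin d)) :
    wedgeSign i (t.erase i) = wedgeSign i t := by
  unfold wedgeSign
  congr 2
  ext j
  simp only [Finset.mem_filter, Finset.mem_erase]
  exact ⟨fun h => ⟨h.1.2, h.2⟩, fun h => ⟨⟨ne_of_lt h.2, h.1⟩, h.2⟩⟩

theorem wedgeDiff_sq (f : Fin d → Module.End S M) (hf : ∀ i l m, f i (f l m) = f l (f i m))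
    (ω : Finset (Fin d) → M) : wedgeDiff f (wedgeDiff f ω) = 0 := by
  ext t
  simp only [wedgeDiff_apply, map_sum, map_zsmul, Finset.smul_sum, smul_smul, Pi.zero_apply]
  rw [Finset.sum_sigma']
  refine Finset.sum_involution (fun x _ => ⟨x.2, x.1⟩) ?_ ?_ ?_ ?_
  · rintro ⟨i, l⟩ h
    simp only [Finset.mem_sigma, Finset.mem_erase] at h
    obtain ⟨hi, hli, hl⟩ := h
    dsimp only
    have key : wedgeSign i t * wedgeSign l (t.erase i) =
        -(wedgeSign l t * wedgeSign i (t.erase l)) := by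
      have e1 : insert l ((t.erase i).erase l) = t.erase i :=
        Finset.insert_erase (Finset.mem_erase.2 ⟨hli, hl⟩)
      have e2 : insert i ((t.erase i).erase l) = t.erase l := by
        rw [Finset.erase_right_comm]
        exact Finset.insert_erase (Finset.mem_erase.2 ⟨Ne.symm hli, hi⟩)
      have := wedgeSign_anti hli (s := (t.erase i).erase l) (by simp) (by simp)
      rw [e1, e2, wedgeSign_erase_self, wedgeSign_erase_self] at this
      have h4 : wedgeSign i ((t.erase i).erase l) = wedgeSign i (t.erase l) := by
        rw [Finset.erase_right_comm, wedgeSign_erase_self]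
      rw [h4, wedgeSign_erase_self] at this
      linear_combination this
    rw [hf i l, Finset.erase_right_comm, key, neg_smul, neg_add_cancel]
  · rintro ⟨i, l⟩ h _ he
    simp only [Finset.mem_sigma, Finset.mem_erase] at h
    simp only [Sigma.mk.injEq] at he
    exact h.2.1 he.1
  · rintro ⟨i, l⟩ h
    simp only [Finset.mem_sigma, Finset.mem_erase] at h ⊢
    exact ⟨h.2.2, fun e => h.2.1 e.symm, h.1⟩
  · rintro ⟨i, l⟩ h
    rfl

variable (S M)

/-- The elements of `M ⊗ ⋀^c ℤ^d`, that is, families indexed by the `c`-element subsets. -/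
abbrev Homog (d : ℕ) (c : ℤ) : Type u := {s : Finset (Fin d) // (s.card : ℤ) = c} → M

/-- Extension by zero `M ⊗ ⋀^c ℤ^d → M ⊗ ⋀ ℤ^d`. -/
def extHomog (d : ℕ) (c : ℤ) : Homog M d c →ₗ[S] (Finset (Fin d) → M) where
  toFun ω s := if h : (s.card : ℤ) = c then ω ⟨s, h⟩ else 0
  map_add' ω η := by ext s; by_cases h : (s.card : ℤ) = c <;> simp [h]
  map_smul' a ω := by ext s; by_cases h : (s.card : ℤ) = c <;> simp [h]

/-- The projection `M ⊗ ⋀ ℤ^d → M ⊗ ⋀^c ℤ^d`. -/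
def resHomog (d : ℕ) (c : ℤ) : (Finset (Fin d) → M) →ₗ[S] Homog M d c :=
  LinearMap.pi fun s => LinearMap.proj s.1

variable {S M}

theorem extHomog_apply_of_ne {c : ℤ} (ω : Homog M d c) {s : Finset (Fin d)}
    (h : (s.card : ℤ) ≠ c) : extHomog S M d c ω s = 0 := dif_neg h

theorem ext_res_of_support {c : ℤ} (ω : Finset (Fin d) → M)
    (h : ∀ s : Finset (Fin d), (s.card : ℤ) ≠ c → ω s = 0) :
    extHomog S M d c (resHomog S M d c ω) = ω := by
  ext s
  by_cases hs : (s.card : ℤ) = c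
  · exact dif_pos hs
  · rw [extHomog_apply_of_ne _ hs, h s hs]

theorem koszulDiff_support (f : Fin d → Module.End S M) {c : ℤ} (ω : Homog M d c)
    {s : Finset (Fin d)} (h : (s.card : ℤ) + 1 ≠ c) :
    koszulDiff f (extHomog S M d c ω) s = 0 := by
  rw [koszulDiff_apply]
  refine Finset.sum_eq_zero fun i hi => ?_
  rw [extHomog_apply_of_ne, map_zero, smul_zero]
  rw [Finset.card_insert_of_notMem (Finset.mem_compl.1 hi)]
  simpa using h

theorem wedgeDiff_support (f : Fin d → Module.End S M) {c : ℤ} (ω : Homog M d c)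
    {s : Finset (Fin d)} (h : (s.card : ℤ) ≠ c + 1) :
    wedgeDiff f (extHomog S M d c ω) s = 0 := by
  rw [wedgeDiff_apply]
  refine Finset.sum_eq_zero fun i hi => ?_
  rw [extHomog_apply_of_ne, map_zero, smul_zero]
  have := Finset.card_erase_add_one hi
  intro h'
  apply h
  rw [← h', ← this]
  push_cast
  ring

/-- The homological Koszul complex of commuting endomorphisms `f_1, …, f_d` of an `S`-module `M`,
written as a cochain complex: cohomological degree `p` is `M ⊗ ⋀^{-p} ℤ^d`, so that `M` itself
sits in degree `0` and the complex lives in degrees `-d, …, 0`. -/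
def koszulComplex (f : Fin d → Module.End S M) (hf : ∀ i l m, f i (f l m) = f l (f i m)) :
    CochainComplex (ModuleCat.{u} S) ℤ where
  X p := ModuleCat.of S (Homog M d (-p))
  d p q := ModuleCat.ofHom (resHomog S M d (-q) ∘ₗ koszulDiff f ∘ₗ extHomog S M d (-p))
  shape p q h := by
    refine ModuleCat.hom_ext (LinearMap.ext fun ω => funext fun s => ?_)
    refine koszulDiff_support f ω fun e => h ?_
    have := s.2
    change p + 1 = q
    omega
  d_comp_d' p q r hpq _ := by
    refine ModuleCat.hom_ext (LinearMap.ext fun ω => ?_)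
    change resHomog S M d (-r) (koszulDiff f (extHomog S M d (-q) (resHomog S M d (-q)
      (koszulDiff f (extHomog S M d (-p) ω))))) = 0
    rw [ext_res_of_support, koszulDiff_sq f hf, map_zero]
    intro s hs
    refine koszulDiff_support f ω fun e => hs ?_
    change p + 1 = q at hpq
    omega

/-- The complex `M → M ⊗ ℤ^d → M ⊗ ⋀^2 ℤ^d → …` of commuting endomorphisms `f_1, …, f_d` of `M`,
with differential `m ⊗ e_s ↦ ∑_i f_i(m) ⊗ e_i ∧ e_s` and `M` in degree `0`. -/
def wedgeComplex (f : Fin d → Module.End S M) (hf : ∀ i l m, f i (f l m) = f l (f i m)) :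
    CochainComplex (ModuleCat.{u} S) ℤ where
  X p := ModuleCat.of S (Homog M d p)
  d p q := ModuleCat.ofHom (resHomog S M d q ∘ₗ wedgeDiff f ∘ₗ extHomog S M d p)
  shape p q h := by
    refine ModuleCat.hom_ext (LinearMap.ext fun ω => funext fun s => ?_)
    refine wedgeDiff_support f ω fun e => h ?_
    have := s.2
    change p + 1 = q
    omega
  d_comp_d' p q r hpq _ := by
    refine ModuleCat.hom_ext (LinearMap.ext fun ω => ?_)
    change resHomog S M d r (wedgeDiff f (extHomog S M d q (resHomog S M d q
      (wedgeDiff f (extHomog S M d p ω))))) = 0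
    rw [ext_res_of_support, wedgeDiff_sq f hf, map_zero]
    intro s hs
    refine wedgeDiff_support f ω fun e => hs ?_
    change p + 1 = q at hpq
    omega

/-- The map of Koszul complexes induced by a linear map that commutes with the operators. -/
def koszulMap {M' : Type u} [AddCommGroup M'] [Module S M']
    {f : Fin d → Module.End S M} (hf : ∀ i l m, f i (f l m) = f l (f i m))
    {f' : Fin d → Module.End S M'} (hf' : ∀ i l m, f' i (f' l m) = f' l (f' i m))
    (g : M →ₗ[S] M') (hg : ∀ i m, g (f i m) = f' i (g m)) :
    koszulComplex f hf ⟶ koszulComplex f' hf' where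
  f p := ModuleCat.ofHom (LinearMap.pi fun s => g ∘ₗ LinearMap.proj s)
  comm' p q _ := by
    refine ModuleCat.hom_ext (LinearMap.ext fun ω => funext fun s => ?_)
    have hext : ∀ t, extHomog S M' d (-p) (fun s => g (ω s)) t = g (extHomog S M d (-p) ω t) := by
      intro t
      by_cases ht : (t.card : ℤ) = -p <;> simp [extHomog, ht]
    change koszulDiff f' (extHomog S M' d (-p) (fun s => g (ω s))) s.1 =
      g (koszulDiff f (extHomog S M d (-p) ω) s.1)
    simp only [koszulDiff_apply, map_sum, map_zsmul, hext, hg]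

end Koszul

section EulerKoszulFunctor

variable {d n : ℕ} {A : Matrix (Fin d) (Fin n) ℤ} {k : Type u} [Field k]

/-- The Euler–Koszul functor `N ↦ K_•(N; E - β)`, from `A`-graded `R_A`-modules to complexes of
left `D_A`-modules: the homological Koszul complex of `(E_i - β_i)∘` on `D_A ⊗_{R_A} N`, whose
terminal module `D_A ⊗_{R_A} N` sits in cohomological degree `0`. -/
def eulerKoszul (A : Matrix (Fin d) (Fin n) ℤ) (β : Fin d → k) :
    GradedModule A k ⥤ CochainComplex (ModuleCat.{u} (WeylAlgebra k n)) ℤ where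
  obj N := koszulComplex (eulerShift β N) (eulerShift_comm β N)
  map φ := koszulMap _ _ (inducedMap φ) (inducedMap_eulerShift β φ)
  map_id N := by
    ext p : 1
    refine ModuleCat.hom_ext (LinearMap.ext fun ω => funext fun s => ?_)
    exact inducedMap_id N _
  map_comp φ ψ := by
    ext p : 1
    refine ModuleCat.hom_ext (LinearMap.ext fun ω => funext fun s => ?_)
    exact inducedMap_comp φ ψ _

end EulerKoszulFunctor
section LocalCohomology

variable {d n : ℕ} {A : Matrix (Fin d) (Fin n) ℤ} {k : Type u} [Field k]

/-- A category of functors from a small category to vector spaces has enough injectives. -/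
theorem enoughInjectives_functor (C : Type) [SmallCategory C] (k : Type u) [Field k] :
    EnoughInjectives (C ⥤ ModuleCat.{u} k) := by
  let ι : Discrete C ⥤ C := Discrete.functor id
  have hinj : ∀ X : Discrete C ⥤ ModuleCat.{u} k, Injective X := fun X => by
    refine ⟨fun {Y Z} g f hf => ?_⟩
    have hm : ∀ c, ∃ r : Z.obj c ⟶ Y.obj c, f.app c ≫ r = 𝟙 _ := fun c => by
      have : Mono (f.app c) := inferInstance
      obtain ⟨r, hr⟩ := LinearMap.exists_leftInverse_of_injective (f.app c).hom
        (LinearMap.ker_eq_bot.2 ((ModuleCat.mono_iff_injective _).1 this))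
      exact ⟨ModuleCat.ofHom r, ModuleCat.hom_ext hr⟩
    choose r hr using hm
    refine ⟨Discrete.natTrans fun c => r c ≫ g.app c, ?_⟩
    ext c : 2
    simp [reassoc_of% (hr c)]
  have : EnoughInjectives (Discrete C ⥤ ModuleCat.{u} k) :=
    ⟨fun X => ⟨{ J := X, injective := hinj X, f := 𝟙 X }⟩⟩
  have : ((Functor.whiskeringLeft (Discrete C) C (ModuleCat.{u} k)).obj ι).PreservesMonomorphisms :=
    ⟨fun {X Y} f _ => by
      rw [NatTrans.mono_iff_mono_app]
      intro c
      exact inferInstanceAs (Mono (f.app c.as))⟩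
  have : ((Functor.whiskeringLeft (Discrete C) C (ModuleCat.{u} k)).obj ι).ReflectsMonomorphisms :=
    ⟨fun {X Y} f hf => by
      rw [NatTrans.mono_iff_mono_app] at hf ⊢
      exact fun c => hf ⟨c⟩⟩
  exact EnoughInjectives.of_adjunction (ι.ranAdjunction (ModuleCat.{u} k))

instance : EnoughInjectives (GradedModule A k) := enoughInjectives_functor (DegreeCat A) k

/-- The part `{m ∈ N_α | ∂_j^κ m = 0 for all κ ≫ 0 and all j}` of `Γ_∂(N)` of degree `α`. -/
def torsionPiece (N : GradedModule A k) (α : DegreeCat A) : Submodule k (N.obj α) where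
  carrier := {m | ∀ j : Fin n, ∃ κ₀ : ℕ, ∀ κ ≥ κ₀, N.map (α.mon (Pi.single j κ)) m = 0}
  zero_mem' _ := ⟨0, fun _ _ => map_zero _⟩
  add_mem' {x y} hx hy j := by
    obtain ⟨a, ha⟩ := hx j
    obtain ⟨b, hb⟩ := hy j
    refine ⟨max a b, fun κ hκ => ?_⟩
    rw [map_add, ha κ (le_trans (le_max_left _ _) hκ), hb κ (le_trans (le_max_right _ _) hκ),
      add_zero]
  smul_mem' c x hx j := by
    obtain ⟨a, ha⟩ := hx j
    exact ⟨a, fun κ hκ => by rw [map_smul, ha κ hκ, smul_zero]⟩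

theorem torsion_map (N : GradedModule A k) {α β : DegreeCat A} (f : α ⟶ β) (x : N.obj α)
    (hx : x ∈ torsionPiece N α) : N.map f x ∈ torsionPiece N β := by
  intro j
  obtain ⟨a, ha⟩ := hx j
  refine ⟨a, fun κ hκ => ?_⟩
  have hdeg : (α.translate (Pi.single j κ)).deg + weight A f.1 =
      (β.translate (Pi.single j κ)).deg := by
    simp only [DegreeCat.translate, ← f.2]
    abel
  let g : α.translate (Pi.single j κ) ⟶ β.translate (Pi.single j κ) := ⟨f.1, hdeg⟩
  have hcomm : f ≫ β.mon (Pi.single j κ) = α.mon (Pi.single j κ) ≫ g :=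
    Subtype.ext (add_comm f.1 (Pi.single j κ))
  rw [← ModuleCat.comp_apply, ← N.map_comp, hcomm, N.map_comp, ModuleCat.comp_apply, ha κ hκ,
    map_zero]

theorem torsion_app {N N' : GradedModule A k} (φ : N ⟶ N') (α : DegreeCat A) (x : N.obj α)
    (hx : x ∈ torsionPiece N α) : φ.app α x ∈ torsionPiece N' α := by
  intro j
  obtain ⟨a, ha⟩ := hx j
  refine ⟨a, fun κ hκ => ?_⟩
  rw [← ModuleCat.comp_apply, ← φ.naturality, ModuleCat.comp_apply, ha κ hκ, map_zero]

/-- The `∂_A`-torsion functor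
`Γ_∂(N) = {m ∈ N | ∂_j^κ m = 0 for all κ ≫ 0 and all j}` on `A`-graded `R_A`-modules. -/
def torsion (A : Matrix (Fin d) (Fin n) ℤ) (k : Type u) [Field k] :
    GradedModule A k ⥤ GradedModule A k where
  obj N :=
    { obj := fun α => ModuleCat.of k (torsionPiece N α)
      map := fun {α β} f => ModuleCat.ofHom ((N.map f).hom.restrict (torsion_map N f))
      map_id := fun α => by
        refine ModuleCat.hom_ext (LinearMap.ext fun x => Subtype.ext ?_)
        change N.map (𝟙 α) x.1 = x.1
        simp
      map_comp := fun f g => by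
        refine ModuleCat.hom_ext (LinearMap.ext fun x => Subtype.ext ?_)
        change N.map (f ≫ g) x.1 = N.map g (N.map f x.1)
        simp }
  map {N N'} φ :=
    { app := fun α => ModuleCat.ofHom ((φ.app α).hom.restrict (torsion_app φ α))
      naturality := fun α β f => by
        refine ModuleCat.hom_ext (LinearMap.ext fun x => Subtype.ext ?_)
        change φ.app β (N.map f x.1) = N'.map f (φ.app α x.1)
        rw [← ModuleCat.comp_apply, φ.naturality, ModuleCat.comp_apply] }
  map_id N := by
    ext α x
    rfl
  map_comp φ ψ := by
    ext α x
    rfl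

instance : (torsion A k).Additive where
  map_add {N N'} φ ψ := by
    ext α x
    rfl

/-- The `A`-graded local cohomology module `H^i_∂(N)`: the `i`-th right derived functor of `Γ_∂` on
the category of `A`-graded `R_A`-modules. -/
def gradedLocalCohomology (A : Matrix (Fin d) (Fin n) ℤ) (k : Type u) [Field k] (i : ℕ) :
    GradedModule A k ⥤ GradedModule A k :=
  (torsion A k).rightDerived i

/-- The integral degrees `α ∈ ℤA` whose image in `kA = k^d` is `β`; there is at most one if `k` has
characteristic zero. -/
abbrev DegreeOver (A : Matrix (Fin d) (Fin n) ℤ) {k : Type u} [Field k] (β : Fin d → k) : Type :=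
  {α : DegreeCat A // (fun i => (α.deg i : k)) = β}

/-- The graded piece `N_β` of an `A`-graded module for `β ∈ kA = k^d`, which is zero
when `β` is not in `ℤA`. -/
def degreePart (A : Matrix (Fin d) (Fin n) ℤ) {k : Type u} [Field k] (β : Fin d → k) :
    GradedModule A k ⥤ ModuleCat.{u} k where
  obj N := ModuleCat.of k (DirectSum (DegreeOver A β) fun α => N.obj α.1)
  map φ := ModuleCat.ofHom (DirectSum.lmap fun α => (φ.app α.1).hom)
  map_id N := by
    refine ModuleCat.hom_ext (DirectSum.linearMap_ext k fun α => LinearMap.ext fun x => ?_)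
    simp
  map_comp φ ψ := by
    refine ModuleCat.hom_ext (DirectSum.linearMap_ext k fun α => LinearMap.ext fun x => ?_)
    simp

/-- The set `deg_A(N) = {α ∈ ℤA | N_α ≠ 0}`, as a subset of `kA = k^d`. -/
def degrees (N : GradedModule A k) : Set (Fin d → k) :=
  {β | ∃ α : DegreeOver A β, Nontrivial (N.obj α.1)}

/-- The set of `A`-degrees of `RΓ_∂(N)`. -/
def degreesRΓ (N : GradedModule A k) : Set (Fin d → k) :=
  ⋃ i : ℕ, degrees ((gradedLocalCohomology A k i).obj N)

end LocalCohomology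

section SemigroupRing

variable {d n : ℕ}

/-- The coordinate ring `k[ℤA] = k[t_1^±, …, t_d^±]` of the torus `T_A`, where `ℤA = ℤ^d`. -/
abbrev Laurent (k : Type u) [Field k] (d : ℕ) : Type u := AddMonoidAlgebra k (Fin d → ℤ)

/-- The part of degree `α` of the semigroup ring `k[ℕA] ⊆ k[ℤA]`: the line `k t^α` if
`α ∈ ℕA`, and zero otherwise. -/
def semigroupPiece (A : Matrix (Fin d) (Fin n) ℤ) (k : Type u) [Field k] (α : DegreeCat A) :
    Submodule k (Laurent k d) :=
  Submodule.span k {f | α.deg ∈ columnMonoid A ∧ f = AddMonoidAlgebra.single α.deg 1}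

theorem semigroup_map (A : Matrix (Fin d) (Fin n) ℤ) (k : Type u) [Field k] {α β : DegreeCat A}
    (u : α ⟶ β) (f : Laurent k d) (hf : f ∈ semigroupPiece A k α) :
    LinearMap.mulLeft k (AddMonoidAlgebra.single (weight A u.1) (1 : k)) f ∈
      semigroupPiece A k β := by
  induction hf using Submodule.span_induction with
  | mem f hf =>
    obtain ⟨hα, rfl⟩ := hf
    refine Submodule.subset_span ⟨?_, ?_⟩
    · rw [← u.2]; exact add_mem hα (weight_mem A u.1)
    · rw [LinearMap.mulLeft_apply, AddMonoidAlgebra.single_mul_single, one_mul, add_comm, u.2]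
  | zero => rw [map_zero]; exact zero_mem _
  | add f g _ _ hf hg => rw [map_add]; exact add_mem hf hg
  | smul c f _ hf => rw [map_smul]; exact Submodule.smul_mem _ c hf

/-- The toric ring `S_A = R_A / I_A ≃ k[ℕA]` as an `A`-graded `R_A`-module: `∂^u` acts on
`k[ℕA] ⊆ k[ℤA]` as multiplication by `t^{A u}`. -/
def toricRing (A : Matrix (Fin d) (Fin n) ℤ) (k : Type u) [Field k] : GradedModule A k where
  obj α := ModuleCat.of k (semigroupPiece A k α)
  map u := ModuleCat.ofHom ((LinearMap.mulLeft k
    (AddMonoidAlgebra.single (weight A u.1) (1 : k))).restrict (semigroup_map A k u))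
  map_id α := by
    refine ModuleCat.hom_ext (LinearMap.ext fun x => Subtype.ext ?_)
    change AddMonoidAlgebra.single (weight A 0) (1 : k) * x.1 = x.1
    rw [weight_zero, ← AddMonoidAlgebra.one_def, one_mul]
  map_comp u v := by
    refine ModuleCat.hom_ext (LinearMap.ext fun x => Subtype.ext ?_)
    change AddMonoidAlgebra.single (weight A (u.1 + v.1)) (1 : k) * x.1 =
      AddMonoidAlgebra.single (weight A v.1) (1 : k) *
        (AddMonoidAlgebra.single (weight A u.1) (1 : k) * x.1)
    rw [← mul_assoc, AddMonoidAlgebra.single_mul_single, one_mul, weight_add, add_comm]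

/-- `β` is strongly `A`-exceptional if it is a degree of `H^i_∂(S_A)` for some `i < dim T_A`. -/
def StronglyExceptional (A : Matrix (Fin d) (Fin n) ℤ) {k : Type u} [Field k]
    (β : Fin d → k) : Prop :=
  ∃ i < d, β ∈ degrees ((gradedLocalCohomology A k i).obj (toricRing A k))

/-- The derivation `∂/∂t_i` of `k[t_1^±, …, t_d^±]`, sending `t^α` to `α_i t^{α - e_i}`. -/
def torusDeriv (k : Type u) [Field k] {d : ℕ} (i : Fin d) : Module.End k (Laurent k d) :=
  (AddMonoidAlgebra.coeffLinearEquiv k).symm.toLinearMap ∘ₗ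
    Finsupp.lsum k (fun α : Fin d → ℤ => (α i : k) • Finsupp.lsingle (α - Pi.single i 1)) ∘ₗ
      (AddMonoidAlgebra.coeffLinearEquiv k).toLinearMap

theorem torusDeriv_single (k : Type u) [Field k] {d : ℕ} (i : Fin d) (α : Fin d → ℤ) (c : k) :
    torusDeriv k i (AddMonoidAlgebra.single α c) =
      AddMonoidAlgebra.single (α - Pi.single i 1) (α i * c) := by
  change AddMonoidAlgebra.ofCoeff (Finsupp.lsum k
    (fun α : Fin d → ℤ => (α i : k) • Finsupp.lsingle (α - Pi.single i 1))
      (Finsupp.single α c)) = _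
  rw [Finsupp.lsum_single, LinearMap.smul_apply, Finsupp.lsingle_apply, Finsupp.smul_single]
  rfl

theorem torusDeriv_comm (k : Type u) [Field k] {d : ℕ} (i l : Fin d) (f : Laurent k d) :
    torusDeriv k i (torusDeriv k l f) = torusDeriv k l (torusDeriv k i f) := by
  have : torusDeriv k i ∘ₗ torusDeriv k l = torusDeriv k l ∘ₗ torusDeriv k i := by
    refine AddMonoidAlgebra.lhom_ext' fun α => LinearMap.ext fun c => ?_
    change torusDeriv k i (torusDeriv k l (AddMonoidAlgebra.single α c)) =
      torusDeriv k l (torusDeriv k i (AddMonoidAlgebra.single α c))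
    simp only [torusDeriv_single]
    by_cases h : i = l
    · rw [h]
    · congr 1
      · abel
      · simp [h, Ne.symm h]; ring
  exact LinearMap.congr_fun this f

/-- The algebraic de Rham complex `Ω^•(T_A)` of the torus `T_A = Spec k[t_1^±, …, t_d^±]`. Since
`Ω^1(T_A)` is free over `k[t^±]` on `dt_1, …, dt_d`, a `p`-form is
`∑_{|s| = p} f_s dt_s`, and `d(f dt_s) = ∑_i ∂f/∂t_i dt_i ∧ dt_s`. As `T_A` is smooth and
affine, its cohomology is the algebraic de Rham cohomology `H_dR^•(T_A; k)`. -/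
def deRhamTorus (k : Type u) [Field k] (d : ℕ) : CochainComplex (ModuleCat.{u} k) ℤ :=
  wedgeComplex (d := d) (torusDeriv k) (torusDeriv_comm k)

end SemigroupRing
section BalancedTensor

variable (k : Type u) [Field k] {D : Type u} [Ring D] [Algebra k D]

open scoped ModuleCat.Algebra

/-- The relations `y a ⊗ m = y ⊗ a m` defining the tensor product of a right `D`-module `Y` and
a left `D`-module `M` over the (noncommutative) `k`-algebra `D`. -/
def balancedRel (Y : Type u) [AddCommGroup Y] [Module k Y] [Module Dᵐᵒᵖ Y]
    (M : Type u) [AddCommGroup M] [Module k M] [Module D M] : Submodule k (Y ⊗[k] M) :=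
  Submodule.span k {t | ∃ (y : Y) (a : D) (m : M),
    t = (MulOpposite.op a • y) ⊗ₜ[k] m - y ⊗ₜ[k] (a • m)}

/-- A `D`-linear map, regarded as a `k`-linear map. -/
def restrictK {M M' : ModuleCat.{u} D} (f : M ⟶ M') : M →ₗ[k] M' where
  toFun := f
  map_add' := map_add _
  map_smul' c m := f.hom.map_smul (algebraMap k D c) m

theorem balancedRel_map (Y : Type u) [AddCommGroup Y] [Module k Y] [Module Dᵐᵒᵖ Y]
    {M M' : ModuleCat.{u} D} (f : M ⟶ M') :
    balancedRel k (D := D) Y M ≤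
      (balancedRel k (D := D) Y M').comap (LinearMap.lTensor Y (restrictK k f)) := by
  refine Submodule.span_le.2 ?_
  rintro _ ⟨y, a, m, rfl⟩
  refine Submodule.subset_span ⟨y, a, f m, ?_⟩
  rw [map_sub, LinearMap.lTensor_tmul, LinearMap.lTensor_tmul]
  congr 2
  exact f.hom.map_smul a m

/-- The functor `Y ⊗_D (-)` from left `D`-modules to `k`-vector spaces, for a right
`D`-module `Y`. -/
def balancedTensor (Y : Type u) [AddCommGroup Y] [Module k Y] [Module Dᵐᵒᵖ Y] :
    ModuleCat.{u} D ⥤ ModuleCat.{u} k where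
  obj M := ModuleCat.of k ((Y ⊗[k] M) ⧸ balancedRel k (D := D) Y M)
  map f := ModuleCat.ofHom (Submodule.mapQ _ _ _ (balancedRel_map k Y f))
  map_id M := by
    refine ModuleCat.hom_ext (Submodule.linearMap_qext _ (TensorProduct.ext' fun y m => ?_))
    rfl
  map_comp f g := by
    refine ModuleCat.hom_ext (Submodule.linearMap_qext _ (TensorProduct.ext' fun y m => ?_))
    rfl

instance (Y : Type u) [AddCommGroup Y] [Module k Y] [Module Dᵐᵒᵖ Y] :
    (balancedTensor k (D := D) Y).Additive where
  map_add {M M'} f g := by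
    refine ModuleCat.hom_ext (Submodule.linearMap_qext _ (TensorProduct.ext' fun y m => ?_))
    exact congrArg (Submodule.Quotient.mk (p := balancedRel k (D := D) Y M'))
      (TensorProduct.tmul_add y (f m) (g m))

end BalancedTensor

section DeRham

variable (k : Type u) [Field k] (n : ℕ)

/-- The right ideal `∂_A D_A = ∂_1 D_A + ⋯ + ∂_n D_A`. -/
def partialIdeal : Submodule (WeylAlgebra k n)ᵐᵒᵖ (WeylAlgebra k n) :=
  Submodule.span (WeylAlgebra k n)ᵐᵒᵖ (Set.range (dD k n))

/-- The functor `(D_A / ∂_A D_A) ⊗_{D_A} (-)` from left `D_A`-modules to `k`-vector spaces. -/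
def deRhamFunctor : ModuleCat.{u} (WeylAlgebra k n) ⥤ ModuleCat.{u} k :=
  balancedTensor k (D := WeylAlgebra k n) (WeylAlgebra k n ⧸ partialIdeal k n)

instance : (deRhamFunctor k n).Additive :=
  inferInstanceAs (balancedTensor k _).Additive

/-- The functor `(D_A / ∂_A D_A) ⊗_{D_A} (-)` applied termwise to complexes. -/
def deRhamComplex : CochainComplex (ModuleCat.{u} (WeylAlgebra k n)) ℤ ⥤
    CochainComplex (ModuleCat.{u} k) ℤ :=
  (deRhamFunctor k n).mapHomologicalComplex (ComplexShape.up ℤ)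

end DeRham

/-- A K-projective resolution of a complex `K` of left `D`-modules: a K-projective complex `P` with
a quasi-isomorphism `P → K`. The derived tensor product `Y ⊗^L_D K` is the complex
`Y ⊗_D P`, and `Tor^D_{-p}(Y, K) = H^p(Y ⊗_D P)`. -/
structure KProjectiveResolution {D : Type u} [Ring D]
    (K : CochainComplex (ModuleCat.{u} D) ℤ) where
  complex : CochainComplex (ModuleCat.{u} D) ℤ
  isKProjective : complex.IsKProjective
  π : complex ⟶ K
  quasiIso : QuasiIso π

section Target

variable {d n : ℕ} (A : Matrix (Fin d) (Fin n) ℤ) {k : Type u} [Field k] (β : Fin d → k)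

/-- The term of cohomological degree `p` of `(⨁_i H^i_∂(N))_β ⊗ ⋀ (kA)`: the sum of the
`H^i_∂(N)_β ⊗ ⋀^j (kA)` with `i - j = p`. Here `kA = k^d`. -/
def targetTerm (N : GradedModule A k) (p : ℤ) : ModuleCat.{u} k :=
  ModuleCat.of k (DirectSum {q : ℕ × ℕ // (q.1 : ℤ) - q.2 = p} fun q =>
    ((degreePart A β).obj ((gradedLocalCohomology A k q.1.1).obj N)) ⊗[k] ⋀[k]^q.1.2 (Fin d → k))

/-- The map of the terms of degree `p` induced by a morphism of `A`-graded modules. -/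
def targetMap {N N' : GradedModule A k} (φ : N ⟶ N') (p : ℤ) :
    targetTerm A β N p ⟶ targetTerm A β N' p :=
  ModuleCat.ofHom (DirectSum.lmap fun q =>
    LinearMap.rTensor (⋀[k]^q.1.2 (Fin d → k))
      ((degreePart A β).map ((gradedLocalCohomology A k q.1.1).map φ)).hom)

theorem targetMap_id (N : GradedModule A k) (p : ℤ) : targetMap A β (𝟙 N) p = 𝟙 _ := by
  refine ModuleCat.hom_ext (DirectSum.linearMap_ext k fun q => TensorProduct.ext' fun x y => ?_)
  simp [targetMap]
  rfl

theorem targetMap_comp {N N' N'' : GradedModule A k} (φ : N ⟶ N') (ψ : N' ⟶ N'') (p : ℤ) :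
    targetMap A β (φ ≫ ψ) p = targetMap A β φ p ≫ targetMap A β ψ p := by
  refine ModuleCat.hom_ext ?_
  simp only [targetMap, Functor.map_comp, ModuleCat.hom_comp, LinearMap.rTensor_comp]
  exact DirectSum.lmap_comp _ _

/-- The functor sending an `A`-graded module `N` to the complex with zero differential
`(⨁_i H^i_∂(N))_β ⊗ ⋀ (kA)`, in which `H^i_∂(N)_β ⊗ ⋀^j (kA)` has cohomological degree
`i - j`. -/
def targetComplex : GradedModule A k ⥤ CochainComplex (ModuleCat.{u} k) ℤ where
  obj N := { X := targetTerm A β N, d := fun _ _ => 0 }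
  map φ := { f := targetMap A β φ }
  map_id N := by
    ext p : 1
    exact targetMap_id A β N p
  map_comp φ ψ := by
    ext p : 1
    exact targetMap_comp A β φ ψ p

end Target

end

end EulerKoszul

open EulerKoszul

/-! The derived tensor product is computed on an explicit complex of free D-modules. With R the
polynomial ring in the ∂_j, the module D ⊗_R N is the cokernel of the commuting operators ρ_j : P ⊗
ν ↦ P∂_j ⊗ ν − P ⊗ ∂_jν on the free module D ⊗_k N. Normal ordering in the Weyl algebra gives each
ρ_j a left inverse that commutes with the other ρ_i, so the Koszul complex of the ρ_j is a
resolution. The Euler operators lift to it once they are corrected by the weight of the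
complementary exterior monomial, and the total complex resolves the Euler–Koszul complex
(`quasiIso_freeAugmentation`). Being bounded above with projective terms it is K-projective, hence
homotopy equivalent to any other K-projective resolution.

Modulo ∂D the Weyl algebra becomes k[x], where right multiplication by ∂_j is −∂/∂x_j. In
coordinates with respect to (−1)^|v| x^v / v! this is a shift of exponents. So the tensored complex
consists of finitely supported functions f : ℕ^n → N, with ρ_j acting by f ↦ (v ↦ f(v + e_j) − ∂_j
f(v)). In the component of s, a value at v of degree μ + A(v + 1_s) is multiplied by μ_i − β_i under
the i-th Euler operator. Off μ = β one of these scalars is invertible and the complex is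
contractible (`exists_sub_degreeProjection`). In degree β they all vanish, and what remains is ⋀ k^d
tensored with the finitely supported functions of degree β.

The same difference operators on arbitrary functions give an injective resolution of N that is
functorial in N (`gradedResolution`). Its terms are coinduced, ∂^u acts on them by translation, and
its 0-cocycles are v ↦ ∂^v x. A family of functions is torsion exactly when it has finite support
(`mem_torsionPiece_iff`), so the functions of degree β compute the degree β part of local
cohomology. Over a field a complex is quasi-isomorphic to its homology by a choice of
representatives. Such choices are not natural, but maps out of a complex with zero differential are
determined up to homotopy by their effect on homology; this gives the natural isomorphism in the
derived category, and the second claim follows from it.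

For the toric ring two facts are needed: local cohomology vanishes above degree d, and the graded
pieces of the d-th one are at most lines. In degree γ the complex consists of scalar functions, and
summing them over boxes compares it with the Čech complex on the sets J with γ ∈ ℕA − ℕA_J;
injectivity on cohomology suffices (`exists_primitive_of_boxSum`). By Farkas' lemma this family of
sets depends only on the faces of the cone over A that its members generate. For such families
`cechVanishing` proves both facts by deleting and contracting one column at a time. Hence for β not
strongly exceptional only a line in degree d survives, tensored with ⋀ k^d. Its part ⋀^{d−q} is
matched with ⋀^q by complementation, and ⋀^q k^d is the de Rham cohomology of the torus, represented
by invariant logarithmic forms (`torusCohomologyEquiv`). -/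

namespace EulerKoszul
noncomputable section

/-! ### Homology of complexes of modules through explicit cycles and boundaries. -/

section HomologyClasses

open HomologicalComplex

variable {S : Type u} [Ring S] {ι : Type} {c : ComplexShape ι}

/-- The homology class of a cycle in a complex of modules. -/
def homologyClass (K : HomologicalComplex (ModuleCat.{u} S) c) (j l : ι) (hl : c.next j = l) :
    LinearMap.ker (K.d j l).hom →ₗ[S] K.homology j :=
  (K.liftCycles (A := ModuleCat.of S (LinearMap.ker (K.d j l).hom))
    (ModuleCat.ofHom (LinearMap.ker (K.d j l).hom).subtype) l hl
    (ModuleCat.hom_ext (LinearMap.ext fun x => x.2)) ≫ K.homologyπ j).hom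

variable {K L : HomologicalComplex (ModuleCat.{u} S) c} {i j l : ι}

theorem homologyClass_surjective (hl : c.next j = l) :
    Function.Surjective (homologyClass K j l hl) := by
  intro y
  obtain ⟨z, rfl⟩ := (ModuleCat.epi_iff_surjective (K.homologyπ j)).1 inferInstance y
  refine ⟨⟨K.iCycles j z, ?_⟩, ?_⟩
  · change (K.iCycles j ≫ K.d j l) z = 0
    rw [iCycles_d]; rfl
  · change K.homologyπ j _ = _
    congr 1
    apply (ModuleCat.mono_iff_injective (K.iCycles j)).1 inferInstance
    change (K.liftCycles _ l hl _ ≫ K.iCycles j) _ = _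
    rw [liftCycles_i]
    rfl

theorem homologyClass_eq_zero_iff (hi : c.prev j = i) (hl : c.next j = l)
    (x : LinearMap.ker (K.d j l).hom) :
    homologyClass K j l hl x = 0 ↔ ∃ y, K.d i j y = x.1 := by
  have hi' : ∀ y, K.iCycles j (K.toCycles i j y) = K.d i j y := fun y => by
    rw [← ModuleCat.comp_apply, toCycles_i]
  constructor
  · intro h
    have hex := (ShortComplex.exact_of_g_is_cokernel (S := ShortComplex.mk _ _
      (K.toCycles_comp_homologyπ i j)) (K.homologyIsCokernel i j hi))
    obtain ⟨y, hy⟩ := (ShortComplex.moduleCat_exact_iff _).1 hex _ h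
    refine ⟨y, ?_⟩
    rw [← hi']
    erw [hy]
    change (K.liftCycles _ l hl _ ≫ K.iCycles j) _ = _
    rw [liftCycles_i]
    rfl
  · rintro ⟨y, hy⟩
    change K.homologyπ j _ = _
    have : (K.liftCycles (A := ModuleCat.of S (LinearMap.ker (K.d j l).hom))
        (ModuleCat.ofHom (LinearMap.ker (K.d j l).hom).subtype) l hl
        (ModuleCat.hom_ext (LinearMap.ext fun x => x.2))) x = K.toCycles i j y := by
      apply (ModuleCat.mono_iff_injective (K.iCycles j)).1 inferInstance
      rw [hi']
      change (K.liftCycles _ l hl _ ≫ K.iCycles j) _ = _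
      rw [liftCycles_i]
      exact hy.symm
    refine (congrArg (K.homologyπ j) this).trans ?_
    rw [← ModuleCat.comp_apply, toCycles_comp_homologyπ]
    rfl

theorem homologyClass_map (f : K ⟶ L) (hl : c.next j = l) (x : LinearMap.ker (K.d j l).hom)
    (hx : (L.d j l) (f.f j x.1) = 0) :
    homologyMap f j (homologyClass K j l hl x) = homologyClass L j l hl ⟨f.f j x.1, hx⟩ := by
  change homologyMap f j (K.homologyπ j _) = L.homologyπ j _
  rw [← ModuleCat.comp_apply, homologyπ_naturality, ModuleCat.comp_apply]
  congr 1
  apply (ModuleCat.mono_iff_injective (L.iCycles j)).1 inferInstance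
  rw [← ModuleCat.comp_apply, cyclesMap_i, ModuleCat.comp_apply]
  change f.f j ((K.liftCycles _ l hl _ ≫ K.iCycles j) _) = (L.liftCycles _ l hl _ ≫ L.iCycles j) _
  rw [liftCycles_i, liftCycles_i]
  rfl

theorem cycle_map (f : K ⟶ L) {x : K.X j} (hx : K.d j l x = 0) : L.d j l (f.f j x) = 0 := by
  rw [← ModuleCat.comp_apply, f.comm, ModuleCat.comp_apply, hx, map_zero]

/-- A map of complexes of modules is a quasi-isomorphism if it induces bijections between cycles
modulo boundaries. -/
theorem quasiIso_of_cycles (f : CochainComplex (ModuleCat.{u} S) ℤ) (g : CochainComplex (ModuleCat.{u} S) ℤ)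
    (φ : f ⟶ g)
    (hs : ∀ (p : ℤ) (x : g.X p), g.d p (p + 1) x = 0 →
      ∃ y, f.d p (p + 1) y = 0 ∧ ∃ z : g.X (p - 1), x = φ.f p y + g.d (p - 1) p z)
    (hi : ∀ (p : ℤ) (y : f.X p), f.d p (p + 1) y = 0 → ∀ z : g.X (p - 1), φ.f p y = g.d (p - 1) p z →
      ∃ w : f.X (p - 1), y = f.d (p - 1) p w) : QuasiIso φ := by
  refine ⟨fun p => ?_⟩
  rw [quasiIsoAt_iff_isIso_homologyMap, ConcreteCategory.isIso_iff_bijective]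
  have hn : (ComplexShape.up ℤ).next p = p + 1 := by simp
  have hp : (ComplexShape.up ℤ).prev p = p - 1 := by simp
  constructor
  · rw [injective_iff_map_eq_zero]
    intro y hy
    obtain ⟨y, rfl⟩ := homologyClass_surjective hn y
    erw [homologyClass_map φ hn y (cycle_map φ y.2)] at hy
    obtain ⟨z, hz⟩ := (homologyClass_eq_zero_iff hp hn _).1 hy
    obtain ⟨w, hw⟩ := hi p y.1 y.2 z hz.symm
    exact (homologyClass_eq_zero_iff hp hn _).2 ⟨w, hw.symm⟩
  · intro x
    obtain ⟨x, rfl⟩ := homologyClass_surjective hn x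
    obtain ⟨y, hy, z, hz⟩ := hs p x.1 x.2
    refine ⟨homologyClass f p (p + 1) hn ⟨y, hy⟩, ?_⟩
    erw [homologyClass_map φ hn ⟨y, hy⟩ (cycle_map φ hy)]
    rw [← sub_eq_zero, ← map_sub, homologyClass_eq_zero_iff hp]
    refine ⟨-z, ?_⟩
    rw [map_neg]
    change _ = φ.f p y - x.1
    rw [hz]; abel

end HomologyClasses

/-! ### Homotopy formulas for contraction and exterior multiplication. -/

section Cartan

variable {S : Type u} [Ring S] {M : Type u} [AddCommGroup M] [Module S M] {d : ℕ}

theorem wedgeSign_mul_self (i : Fin d) (s : Finset (Fin d)) : wedgeSign i s * wedgeSign i s = 1 := by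
  unfold wedgeSign
  rw [← mul_pow]; simp

theorem wedgeSign_insert_self {i : Fin d} (s : Finset (Fin d)) :
    wedgeSign i (insert i s) = wedgeSign i s := by
  unfold wedgeSign
  rw [Finset.filter_insert, if_neg (lt_irrefl i)]

/-- The contraction `m ⊗ e_j ∧ e_s ↦ h(m) ⊗ e_s`, zero on the `e_s` with `j ∉ s`. -/
def contraction {M' : Type*} [AddCommGroup M'] (j : Fin d) (h : M →+ M') : (Finset (Fin d) → M) →+ (Finset (Fin d) → M') where
  toFun ω s := if j ∈ s then 0 else wedgeSign j s • h (ω (insert j s))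
  map_zero' := by ext s; simp
  map_add' ω η := by ext s; by_cases hs : j ∈ s <;> simp [hs]

theorem contraction_apply {M' : Type*} [AddCommGroup M'] (j : Fin d) (h : M →+ M') (ω : Finset (Fin d) → M) (s : Finset (Fin d)) :
    contraction j h ω s = if j ∈ s then 0 else wedgeSign j s • h (ω (insert j s)) := rfl

/-- Cartan's formula. -/
theorem wedgeDiff_contraction (φ : Fin d → Module.End S M) (j : Fin d) (h : M →+ M)
    (hc : ∀ i, i ≠ j → ∀ m, φ i (h m) = h (φ i m)) (ω : Finset (Fin d) → M)
    (s : Finset (Fin d)) :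
    wedgeDiff φ (contraction j h ω) s + contraction j h (wedgeDiff φ ω) s =
      if j ∈ s then φ j (h (ω s)) else h (φ j (ω s)) := by
  by_cases hj : j ∈ s
  · rw [if_pos hj, contraction_apply, if_pos hj, add_zero, wedgeDiff_apply,
      Finset.sum_eq_single_of_mem j hj]
    · rw [contraction_apply, if_neg (Finset.notMem_erase j s), Finset.insert_erase hj, map_zsmul,
        smul_smul, wedgeSign_erase_self, wedgeSign_mul_self, one_smul]
    · intro i hi hij
      rw [contraction_apply, if_pos (Finset.mem_erase.2 ⟨hij.symm, hj⟩), map_zero, smul_zero]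
  · rw [if_neg hj, contraction_apply, if_neg hj, wedgeDiff_apply, wedgeDiff_apply,
      Finset.sum_insert hj, map_add, smul_add, map_zsmul, smul_smul, wedgeSign_insert_self,
      wedgeSign_mul_self, one_smul, Finset.erase_insert hj, map_sum, Finset.smul_sum, add_comm,
      add_assoc, ← Finset.sum_add_distrib]
    -- The remaining terms, one pair for each i ∈ s, cancel: contraction with e_j anticommutes with
    -- multiplication by e_i, and h commutes with φ_i.
    rw [Finset.sum_eq_zero, add_zero]
    intro i hi
    have hij : i ≠ j := fun e => hj (e ▸ hi)
    rw [contraction_apply, if_neg (fun e => hj (Finset.mem_of_mem_erase e)), map_zsmul, map_zsmul, hc i hij,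
      smul_smul, smul_smul, Finset.erase_insert_of_ne hij.symm, ← add_smul]
    have := wedgeSign_anti hij (Finset.notMem_erase i s)
      (fun e => hj (Finset.mem_of_mem_erase e))
    rw [Finset.insert_erase hi, wedgeSign_erase_self] at this
    have h3 : wedgeSign i (insert j s) = wedgeSign i (insert j (s.erase i)) := by
      rw [← Finset.erase_insert_of_ne hij.symm, wedgeSign_erase_self]
    rw [h3]
    have h4 : wedgeSign j s * wedgeSign i (insert j (s.erase i)) +
        wedgeSign i s * wedgeSign j (s.erase i) = 0 := by
      have h1 := wedgeSign_mul_self j s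
      have h2 := wedgeSign_mul_self j (s.erase i)
      linear_combination (wedgeSign j s * wedgeSign j (s.erase i)) * this -
        (wedgeSign i s * wedgeSign j (s.erase i)) * h1 -
        (wedgeSign j s * wedgeSign i (insert j (s.erase i))) * h2
    rw [h4, zero_smul]

/-- The multiplication `m ⊗ e_t ↦ c(m) ⊗ e_i ∧ e_t`. -/
def wedgeBy {M' : Type*} [AddCommGroup M'] (i : Fin d) (c : M →+ M') : (Finset (Fin d) → M) →+ (Finset (Fin d) → M') where
  toFun ω t := if i ∈ t then wedgeSign i t • c (ω (t.erase i)) else 0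
  map_zero' := by ext s; simp
  map_add' ω η := by ext s; by_cases hs : i ∈ s <;> simp [hs]

theorem wedgeBy_apply {M' : Type*} [AddCommGroup M'] (i : Fin d) (c : M →+ M') (ω : Finset (Fin d) → M) (t : Finset (Fin d)) :
    wedgeBy i c ω t = if i ∈ t then wedgeSign i t • c (ω (t.erase i)) else 0 := rfl

/-- Multiplication by e_i anticommutes with the removal of every other e_l, so only the contribution
of f_i survives. When c inverts f_i this contracts the Koszul complex. -/
theorem koszulDiff_wedgeBy (f : Fin d → Module.End S M) (i : Fin d) (c : M →+ M)
    (hc : ∀ l m, f l (c m) = c (f l m)) (ω : Finset (Fin d) → M) (t : Finset (Fin d)) :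
    koszulDiff f (wedgeBy i c ω) t + wedgeBy i c (koszulDiff f ω) t = c (f i (ω t)) := by
  by_cases hi : i ∈ t
  · rw [wedgeBy_apply, if_pos hi, koszulDiff_apply, koszulDiff_apply]
    have hcompl : (t.erase i)ᶜ = insert i tᶜ := by
      ext x; by_cases hx : x = i <;> simp [hx]
    rw [hcompl, Finset.sum_insert (by simp [hi]), Finset.insert_erase hi, map_add, smul_add,
      map_zsmul, smul_smul, wedgeSign_erase_self, wedgeSign_mul_self, one_smul, map_sum,
      Finset.smul_sum, add_left_comm, ← Finset.sum_add_distrib, Finset.sum_eq_zero, add_zero]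
    intro l hl
    have hlt : l ∉ t := Finset.mem_compl.1 hl
    have hli : l ≠ i := fun e => hlt (e ▸ hi)
    rw [wedgeBy_apply, if_pos (Finset.mem_insert_of_mem hi), map_zsmul, hc, map_zsmul, smul_smul,
      smul_smul, Finset.erase_insert_of_ne hli, ← add_smul]
    have := wedgeSign_anti hli (s := t.erase i) (fun e => hlt (Finset.mem_of_mem_erase e))
      (Finset.notMem_erase i t)
    rw [Finset.insert_erase hi, wedgeSign_erase_self] at this
    have h3 : wedgeSign i (insert l t) = wedgeSign i (insert l (t.erase i)) := by
      rw [← Finset.erase_insert_of_ne hli, wedgeSign_erase_self]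
    rw [h3, show wedgeSign l t * wedgeSign i (insert l (t.erase i)) + wedgeSign i t * wedgeSign l (t.erase i) = 0 by
      have h1 := wedgeSign_mul_self l t
      have h2 := wedgeSign_mul_self l (t.erase i)
      linear_combination (wedgeSign l t * wedgeSign l (t.erase i)) * this - (wedgeSign i t * wedgeSign l (t.erase i)) * h1 - (wedgeSign l t * wedgeSign i (insert l (t.erase i)))* h2, zero_smul]
  · rw [wedgeBy_apply, if_neg hi, add_zero, koszulDiff_apply,
      Finset.sum_eq_single_of_mem i (Finset.mem_compl.2 hi)]
    · rw [wedgeBy_apply, if_pos (Finset.mem_insert_self i t), map_zsmul, smul_smul,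
        wedgeSign_insert_self, wedgeSign_mul_self, one_smul, Finset.erase_insert hi, hc]
    · intro l hl hli
      rw [wedgeBy_apply, if_neg (by simp [hi, Ne.symm hli]), map_zero, smul_zero]

end Cartan
end
end EulerKoszul

namespace EulerKoszul
noncomputable section

/-! ### Exactness from one-sided inverses of commuting operators. -/

section CartanInduction

variable {S : Type u} [Ring S] {M : Type u} [AddCommGroup M] [Module S M] {n : ℕ}

/-- Successive application of Cartan's formula for contracting operators `h_1, …, h_n`. -/
theorem cartan_induction (φ : Fin n → Module.End S M)
    (hφ : ∀ i l m, φ i (φ l m) = φ l (φ i m)) (h : Fin n → M →+ M)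
    (hc : ∀ j i, i ≠ j → ∀ m, φ i (h j m) = h j (φ i m))
    (W : Finset (Fin n) → AddSubgroup M)
    (hφW : ∀ s, ∀ j ∈ s, ∀ m ∈ W (s.erase j), φ j m ∈ W s)
    (hhW : ∀ s j, j ∉ s → ∀ m ∈ W (insert j s), h j m ∈ W s)
    (Q : Finset (Fin n) → (Finset (Fin n) → M) → Prop)
    (step : ∀ J j ω, j ∉ J → wedgeDiff φ ω = 0 → (∀ s, ω s ∈ W s) → Q J ω →
      Q (insert j J) (fun s => if j ∈ s then ω s - φ j (h j (ω s)) else ω s - h j (φ j (ω s))))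
    (ω : Finset (Fin n) → M) (hω : wedgeDiff φ ω = 0) (hωW : ∀ s, ω s ∈ W s) (h0 : Q ∅ ω) :
    ∃ η : Finset (Fin n) → M, (∀ s, η s ∈ W s) ∧ η Finset.univ = 0 ∧
      Q Finset.univ (ω - wedgeDiff φ η) := by
  have hWD : ∀ η : Finset (Fin n) → M, (∀ s, η s ∈ W s) → ∀ s, wedgeDiff φ η s ∈ W s := by
    intro η hη s
    rw [wedgeDiff_apply]
    exact sum_mem fun i hi => zsmul_mem (hφW s i hi _ (hη _)) _
  suffices H : ∀ J : Finset (Fin n), ∃ η : Finset (Fin n) → M, (∀ s, η s ∈ W s) ∧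
      η Finset.univ = 0 ∧ Q J (ω - wedgeDiff φ η) from H _
  intro J
  induction J using Finset.induction_on with
  | empty => exact ⟨0, fun s => zero_mem _, rfl, by simpa using h0⟩
  | insert j J hj ih =>
    obtain ⟨η, hη, hη0, hQ⟩ := ih
    have hcyc : wedgeDiff φ (ω - wedgeDiff φ η) = 0 := by
      rw [map_sub, hω, wedgeDiff_sq φ hφ, sub_zero]
    have hW' : ∀ s, (ω - wedgeDiff φ η) s ∈ W s := fun s => sub_mem (hωW s) (hWD η hη s)
    -- The contraction of the current cocycle is added to the primitive. By Cartan's formula this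
    -- changes the cocycle exactly as in `step`; it stays in W, and the new term vanishes at the
    -- full set, which contains j.
    refine ⟨η + contraction j (h j) (ω - wedgeDiff φ η), fun s => add_mem (hη s) ?_, ?_, ?_⟩
    · rw [contraction_apply]
      split_ifs with hs
      · exact zero_mem _
      · exact zsmul_mem (hhW s j hs _ (hW' _)) _
    · rw [Pi.add_apply, hη0, contraction_apply, if_pos (Finset.mem_univ j), add_zero]
    · convert step J j _ hj hcyc hW' hQ using 1
      funext s
      have := wedgeDiff_contraction φ j (h j) (hc j) (ω - wedgeDiff φ η) s
      rw [hcyc, map_zero, Pi.zero_apply, add_zero] at this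
      rw [map_add, ← sub_sub, Pi.sub_apply, this]
      split_ifs <;> rfl

/-- Exactness of `M → M ⊗ ⋀^1 → M ⊗ ⋀^2 → …` away from the start, for operators with right
inverses. -/
theorem wedgeDiff_exact_of_rightInverse (φ : Fin n → Module.End S M)
    (hφ : ∀ i l m, φ i (φ l m) = φ l (φ i m)) (h : Fin n → M →+ M)
    (hc : ∀ j i, i ≠ j → ∀ m, φ i (h j m) = h j (φ i m))
    (hinv : ∀ j m, φ j (h j m) = m)
    (W : Finset (Fin n) → AddSubgroup M)
    (hφW : ∀ s, ∀ j ∈ s, ∀ m ∈ W (s.erase j), φ j m ∈ W s)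
    (hhW : ∀ s j, j ∉ s → ∀ m ∈ W (insert j s), h j m ∈ W s)
    (ω : Finset (Fin n) → M) (hω : wedgeDiff φ ω = 0) (hωW : ∀ s, ω s ∈ W s) :
    ∃ η : Finset (Fin n) → M, (∀ s, η s ∈ W s) ∧
      ∀ s, s ≠ ∅ → ω s = wedgeDiff φ η s := by
  -- As φ_j h_j = 1, step j kills the components with j ∈ s, and later steps keep them zero. After
  -- all steps only s = ∅ can survive.
  obtain ⟨η, hη, -, hQ⟩ := cartan_induction φ hφ h hc W hφW hhW
    (fun J ω => ∀ s, ∀ j ∈ J, j ∈ s → ω s = 0) (by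
      intro J j ω _ hω _ hQ s i hi his
      rcases Finset.mem_insert.1 hi with rfl | hi
      · dsimp only
        rw [if_pos his, hinv, sub_self]
      · have h0 : ω s = 0 := hQ s i hi his
        simp [h0]) ω hω hωW (by simp)
  refine ⟨η, hη, fun s hs => ?_⟩
  obtain ⟨j, hj⟩ := Finset.nonempty_iff_ne_empty.2 hs
  exact sub_eq_zero.1 (hQ s j (Finset.mem_univ j) hj)

/-- Exactness of `… → M ⊗ ⋀^{n-1} → M ⊗ ⋀^n → Z` for operators with left inverses and the
cokernel `Z` of `M ⊗ ⋀^{n-1} → M`. -/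
theorem wedgeDiff_exact_of_leftInverse (φ : Fin n → Module.End S M)
    (hφ : ∀ i l m, φ i (φ l m) = φ l (φ i m)) (h : Fin n → M →+ M)
    (hc : ∀ j i, i ≠ j → ∀ m, φ i (h j m) = h j (φ i m))
    (hinv : ∀ j m, h j (φ j m) = m) {Z : Type*} [AddCommGroup Z] (q : M →+ Z)
    (hq : ∀ j m, q (φ j m) = 0)
    (hker : ∀ m, q m = 0 → ∃ y : Fin n → M, m = ∑ j, φ j (y j))
    (ω : Finset (Fin n) → M) (hω : wedgeDiff φ ω = 0) (hωq : q (ω Finset.univ) = 0) :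
    ∃ η : Finset (Fin n) → M, η Finset.univ = 0 ∧ wedgeDiff φ η = ω := by
  -- As h_j φ_j = 1, step j kills the components with j ∉ s, so only the top component survives.
  -- There q vanishes, and `hker` writes it as a sum of images.
  obtain ⟨η, -, hη0, hQ⟩ := cartan_induction φ hφ h hc (fun _ => ⊤) (by simp) (by simp)
    (fun J ω => ∀ s, ∀ j ∈ J, j ∉ s → ω s = 0) (by
      intro J j ω _ hω _ hQ s i hi his
      rcases Finset.mem_insert.1 hi with rfl | hi
      · dsimp only
        rw [if_neg his, hinv, sub_self]
      · have h0 : ω s = 0 := hQ s i hi his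
        simp [h0]) ω hω (by simp) (by simp)
  have hqD : ∀ η : Finset (Fin n) → M, q (wedgeDiff φ η Finset.univ) = 0 := fun η => by
    rw [wedgeDiff_apply, map_sum]
    exact Finset.sum_eq_zero fun i _ => by rw [map_zsmul, hq, smul_zero]
  obtain ⟨y, hy⟩ := hker ((ω - wedgeDiff φ η) Finset.univ) (by
    rw [Pi.sub_apply, map_sub, hωq, hqD, sub_zero])
  -- The elements y_j are placed, with sign, at the complements of single indices. The top component
  -- of the differential of ζ is then ∑ φ_j(y_j), and all other components vanish.
  let ζ : Finset (Fin n) → M := fun s => ∑ j, if s = Finset.univ.erase j then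
    wedgeSign j (Finset.univ : Finset (Fin n)) • y j else 0
  have hne : ∀ j : Fin n, (Finset.univ : Finset (Fin n)).erase j ≠ Finset.univ := fun j e => by
    have := Finset.mem_univ j
    rw [← e] at this
    simp at this
  refine ⟨η + ζ, ?_, ?_⟩
  · rw [Pi.add_apply, hη0, zero_add]
    exact Finset.sum_eq_zero fun j _ => if_neg (hne j).symm
  · rw [map_add]
    funext s
    rw [Pi.add_apply, ← eq_sub_iff_add_eq']
    change _ = (ω - wedgeDiff φ η) s
    by_cases hs : s = Finset.univ
    · subst hs
      rw [hy, wedgeDiff_apply]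
      refine Finset.sum_congr rfl fun i _ => ?_
      have : ζ (Finset.univ.erase i) = wedgeSign i Finset.univ • y i := by
        refine (Finset.sum_eq_single i (fun j _ hji => if_neg fun e => hji ?_) (by simp)).trans
          (if_pos rfl)
        have h1 : i ∉ (Finset.univ : Finset (Fin n)).erase j := by rw [← e]; simp
        by_contra hne
        exact h1 (Finset.mem_erase.2 ⟨Ne.symm hne, Finset.mem_univ _⟩)
      rw [this, map_zsmul, smul_smul, wedgeSign_mul_self, one_smul]
    · obtain ⟨j, hj⟩ : ∃ j, j ∉ s := by
        by_contra! h
        exact hs (Finset.eq_univ_iff_forall.2 h)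
      rw [hQ s j (Finset.mem_univ j) hj, wedgeDiff_apply]
      refine Finset.sum_eq_zero fun i hi => ?_
      have : ζ (s.erase i) = 0 := by
        refine Finset.sum_eq_zero fun l _ => if_neg fun e => ?_
        have h1 : i ∉ Finset.univ.erase l := by rw [← e]; simp
        have h2 : j ∉ Finset.univ.erase l := by rw [← e]; simp [hj]
        simp only [Finset.mem_erase, Finset.mem_univ, and_true, not_not] at h1 h2
        exact hj (h2 ▸ h1 ▸ hi)
      rw [this, map_zero, smul_zero]

end CartanInduction

/-! ### Complexes given by one operator on families indexed by a graded set. -/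

section IndexedComplex

variable (S : Type u) [Ring S] {I : Type} (deg : I → ℤ)
  (X : Type u) [AddCommGroup X] [Module S X]

/-- Extension by zero from the indices of degree `p`. -/
def extDeg (p : ℤ) : ({i // deg i = p} → X) →ₗ[S] (I → X) where
  toFun ω i := if h : deg i = p then ω ⟨i, h⟩ else 0
  map_add' ω η := by ext i; by_cases h : deg i = p <;> simp [h]
  map_smul' a ω := by ext i; by_cases h : deg i = p <;> simp [h]

/-- Restriction to the indices of degree `p`. -/
def resDeg (p : ℤ) : (I → X) →ₗ[S] ({i // deg i = p} → X) :=
  LinearMap.pi fun i => LinearMap.proj i.1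

variable {S deg X}

theorem resDeg_extDeg {p : ℤ} (ω : {i // deg i = p} → X) :
    resDeg S deg X p (extDeg S deg X p ω) = ω :=
  funext fun i => dif_pos i.2

theorem extDeg_apply_of_ne {p : ℤ} (ω : {i // deg i = p} → X) {i : I} (h : deg i ≠ p) :
    extDeg S deg X p ω i = 0 := dif_neg h

theorem extDeg_resDeg_apply {p : ℤ} (ω : I → X) {i : I} (h : deg i = p) :
    extDeg S deg X p (resDeg S deg X p ω) i = ω i := dif_pos h

theorem extDeg_resDeg {p : ℤ} (ω : I → X) (h : ∀ i, deg i ≠ p → ω i = 0) :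
    extDeg S deg X p (resDeg S deg X p ω) = ω := by
  ext i
  by_cases hi : deg i = p
  · exact dif_pos hi
  · rw [extDeg_apply_of_ne _ hi, h i hi]

/-- A differential on families of elements indexed by a graded set, of degree one. -/
structure IsDegreeOne (deg : I → ℤ) (D : (I → X) →ₗ[S] (I → X)) : Prop where
  sq : ∀ ω, D (D ω) = 0
  degree : ∀ p ω, (∀ i, deg i = p → ω i = 0) → ∀ i, deg i = p + 1 → D ω i = 0

variable {D : (I → X) →ₗ[S] (I → X)}

theorem IsDegreeOne.support (h : IsDegreeOne deg D) {p : ℤ} {ω : I → X}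
    (hω : ∀ i, deg i ≠ p → ω i = 0) (i : I) (hi : deg i ≠ p + 1) : D ω i = 0 :=
  h.degree (deg i - 1) ω (fun l hl => hω l (by omega)) i (by omega)

theorem IsDegreeOne.apply_extDeg_resDeg (h : IsDegreeOne deg D) (p : ℤ) (ω : I → X) (i : I)
    (hi : deg i = p + 1) : D (extDeg S deg X p (resDeg S deg X p ω)) i = D ω i := by
  rw [← sub_eq_zero, ← Pi.sub_apply, ← map_sub]
  refine h.degree p _ (fun l hl => ?_) i hi
  rw [Pi.sub_apply, extDeg_resDeg_apply _ hl, sub_self]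

/-- The cochain complex of a differential of degree one. -/
def indexedComplex (deg : I → ℤ) (D : (I → X) →ₗ[S] (I → X)) (h : IsDegreeOne deg D) :
    CochainComplex (ModuleCat.{u} S) ℤ where
  X p := ModuleCat.of S ({i // deg i = p} → X)
  d p q := ModuleCat.ofHom (resDeg S deg X q ∘ₗ D ∘ₗ extDeg S deg X p)
  shape p q hpq := by
    refine ModuleCat.hom_ext (LinearMap.ext fun ω => funext fun i => ?_)
    refine h.support (fun l hl => extDeg_apply_of_ne ω hl) i.1 fun e => hpq ?_
    have := i.2
    change p + 1 = q
    omega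
  d_comp_d' p q r hpq _ := by
    refine ModuleCat.hom_ext (LinearMap.ext fun ω => ?_)
    change resDeg S deg X r (D (extDeg S deg X q (resDeg S deg X q
      (D (extDeg S deg X p ω))))) = 0
    rw [extDeg_resDeg, h.sq, map_zero]
    intro i hi
    refine h.support (fun l hl => extDeg_apply_of_ne ω hl) i fun e => hi ?_
    change p + 1 = q at hpq
    omega

theorem indexedComplex_d (h : IsDegreeOne deg D) (p q : ℤ) (ω : {i // deg i = p} → X) :
    (indexedComplex deg D h).d p q ω = resDeg S deg X q (D (extDeg S deg X p ω)) := rfl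

theorem IsDegreeOne.extDeg_d (h : IsDegreeOne deg D) {p q : ℤ} (hq : p + 1 = q)
    (ω : {i // deg i = p} → X) :
    extDeg S deg X q ((indexedComplex deg D h).d p q ω) = D (extDeg S deg X p ω) :=
  extDeg_resDeg _ fun i hi =>
    h.support (fun l hl => extDeg_apply_of_ne ω hl) i (by omega)

theorem indexedComplex_d_eq_zero_iff (h : IsDegreeOne deg D) (p : ℤ) (ω : {i // deg i = p} → X) :
    (indexedComplex deg D h).d p (p + 1) ω = 0 ↔ D (extDeg S deg X p ω) = 0 := by
  constructor
  · intro e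
    rw [← h.extDeg_d rfl, e]
    exact map_zero (extDeg S deg X (p + 1))
  · intro e
    rw [indexedComplex_d, e, map_zero]
    rfl

/-- A linear map commuting with the differentials induces a map of complexes. -/
def indexedMap {X' : Type u} [AddCommGroup X'] [Module S X'] {D' : (I → X') →ₗ[S] (I → X')}
    (h : IsDegreeOne deg D) (h' : IsDegreeOne deg D') (g : X →ₗ[S] X')
    (hg : ∀ ω i, D' (fun l => g (ω l)) i = g (D ω i)) :
    indexedComplex deg D h ⟶ indexedComplex deg D' h' where
  f p := ModuleCat.ofHom (LinearMap.pi fun i => g ∘ₗ LinearMap.proj i)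
  comm' p q _ := by
    refine ModuleCat.hom_ext (LinearMap.ext fun ω => funext fun i => ?_)
    have hext : extDeg S deg X' p (fun i => g (ω i)) = fun i => g (extDeg S deg X p ω i) := by
      ext i
      by_cases hi : deg i = p <;> simp [extDeg, hi]
    change D' (extDeg S deg X' p (fun i => g (ω i))) i.1 = g (D (extDeg S deg X p ω) i.1)
    rw [hext, hg]

end IndexedComplex

/-! ### The total complex of the ρ-direction and the Euler direction. -/

section TotalDifferential

variable {S : Type u} [Ring S] {X : Type u} [AddCommGroup X] [Module S X] {d n : ℕ}

/-- The total differential of the Koszul complex of operators `E_1, …, E_d` on the complex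
`X → X ⊗ ⋀^1 → …` of operators `ρ_1, …, ρ_n`, where the `E_i` depend on the exterior monomials. -/
def totDiff (ρ : Fin n → Module.End S X) (E : Finset (Fin n) → Fin d → Module.End S X) :
    (Finset (Fin d) × Finset (Fin n) → X) →ₗ[S] (Finset (Fin d) × Finset (Fin n) → X) :=
  LinearMap.pi fun i =>
    ((-1 : ℤ) ^ i.1.card) • (LinearMap.proj i.2 ∘ₗ wedgeDiff ρ ∘ₗ LinearMap.pi fun s => LinearMap.proj (i.1, s)) +
      LinearMap.proj i.1 ∘ₗ koszulDiff (E i.2) ∘ₗ LinearMap.pi fun t => LinearMap.proj (t, i.2)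

theorem totDiff_apply (ρ : Fin n → Module.End S X) (E : Finset (Fin n) → Fin d → Module.End S X)
    (ω : Finset (Fin d) × Finset (Fin n) → X) (t : Finset (Fin d)) (s : Finset (Fin n)) :
    totDiff ρ E ω (t, s) = ((-1 : ℤ) ^ t.card) • wedgeDiff ρ (fun s => ω (t, s)) s +
      koszulDiff (E s) (fun t => ω (t, s)) t := rfl

/-- The cohomological degree of the exterior monomial `e_t ⊗ e_s`. -/
def totDegree {d n : ℕ} (i : Finset (Fin d) × Finset (Fin n)) : ℤ := i.2.card - n - i.1.card

/-- The conditions on operators `ρ` and `E` under which `totDiff` is a differential. -/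
structure TotCompatible (ρ : Fin n → Module.End S X) (E : Finset (Fin n) → Fin d → Module.End S X) :
    Prop where
  rho_comm : ∀ i l m, ρ i (ρ l m) = ρ l (ρ i m)
  euler_comm : ∀ s i l m, E s i (E s l m) = E s l (E s i m)
  euler_rho : ∀ s, ∀ j ∈ s, ∀ i m, E s i (ρ j m) = ρ j (E (s.erase j) i m)

variable {ρ : Fin n → Module.End S X} {E : Finset (Fin n) → Fin d → Module.End S X}

/-- Each direction squares to zero, and `euler_rho` says that the two directions commute. The sign
(−1)^|t| changes when an index is inserted into t, which turns commutation into anticommutation. -/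
theorem TotCompatible.isDegreeOne (h : TotCompatible ρ E) : IsDegreeOne totDegree (totDiff ρ E) where
  sq ω := by
    funext ⟨t, s⟩
    rw [totDiff_apply, Pi.zero_apply]
    have h1 : (fun s => totDiff ρ E ω (t, s)) = ((-1 : ℤ) ^ t.card) • wedgeDiff ρ (fun s => ω (t, s)) +
        fun s => koszulDiff (E s) (fun t => ω (t, s)) t := rfl
    have h2 : (fun t => totDiff ρ E ω (t, s)) =
        (fun t => ((-1 : ℤ) ^ t.card) • wedgeDiff ρ (fun s => ω (t, s)) s) +
          koszulDiff (E s) (fun t => ω (t, s)) := rfl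
    rw [h1, h2, map_add, map_add, map_zsmul, wedgeDiff_sq ρ h.rho_comm, smul_zero, zero_add,
      koszulDiff_sq (E s) (h.euler_comm s), add_zero, wedgeDiff_apply, koszulDiff_apply]
    simp only [koszulDiff_apply, wedgeDiff_apply, map_sum, map_zsmul, Finset.smul_sum]
    rw [Finset.sum_comm, ← Finset.sum_add_distrib]
    refine Finset.sum_eq_zero fun i hi => ?_
    rw [← Finset.sum_add_distrib]
    refine Finset.sum_eq_zero fun j hj => ?_
    rw [h.euler_rho s j hj, Finset.card_insert_of_notMem (Finset.mem_compl.1 hi), smul_smul,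
      smul_smul, smul_smul, smul_smul, ← add_smul, pow_succ]
    convert zero_smul ℤ _
    ring
  degree p ω hω i hi := by
    obtain ⟨t, s⟩ := i
    have hts : (s.card : ℤ) - n - t.card = p + 1 := hi
    rw [totDiff_apply, wedgeDiff_apply, koszulDiff_apply, Finset.sum_eq_zero, smul_zero, zero_add,
      Finset.sum_eq_zero]
    · intro i hi
      rw [hω, map_zero, smul_zero]
      change (s.card : ℤ) - n - (insert i t).card = p
      rw [Finset.card_insert_of_notMem (Finset.mem_compl.1 hi)]
      push_cast
      omega
    · intro j hj
      rw [hω, map_zero, smul_zero]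
      change ((s.erase j).card : ℤ) - n - t.card = p
      have := Finset.card_erase_add_one hj
      omega

/-- Acyclicity of the kernel of the augmentation to the Koszul complex on the cokernel of the
operators `ρ`, when these have left inverses. -/
theorem TotCompatible.exact_of_leftInverse (h : TotCompatible ρ E) (G : Fin n → X →+ X)
    (hc : ∀ j i, i ≠ j → ∀ m, ρ i (G j m) = G j (ρ i m))
    (hinv : ∀ j m, G j (ρ j m) = m) {Z : Type*} [AddCommGroup Z] (q : X →+ Z)
    (hq : ∀ j m, q (ρ j m) = 0)
    (hker : ∀ m, q m = 0 → ∃ y : Fin n → X, m = ∑ j, ρ j (y j))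
    (ω : Finset (Fin d) × Finset (Fin n) → X) (hω : totDiff ρ E ω = 0)
    (hωq : ∀ t, q (ω (t, Finset.univ)) = 0) :
    ∃ η : Finset (Fin d) × Finset (Fin n) → X, (∀ t, η (t, Finset.univ) = 0) ∧
      totDiff ρ E η = ω := by
  -- Induction on a bound m for the cardinality of the t that occur. The Koszul term at t comes from
  -- larger sets, so the rows of maximal |t| are cocycles for ρ alone and can be removed one
  -- cardinality at a time.
  suffices H : ∀ (m : ℕ) (ω : Finset (Fin d) × Finset (Fin n) → X), totDiff ρ E ω = 0 →
      (∀ t, q (ω (t, Finset.univ)) = 0) → (∀ t s, m ≤ t.card → ω (t, s) = 0) →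
      ∃ η : Finset (Fin d) × Finset (Fin n) → X, (∀ t, η (t, Finset.univ) = 0) ∧
      totDiff ρ E η = ω from
    H (d + 1) ω hω hωq fun t s ht => by
      have := t.card_le_univ
      rw [Fintype.card_fin] at this
      omega
  intro m
  induction m with
  | zero =>
    intro ω _ _ h0
    exact ⟨0, fun _ => rfl, by rw [map_zero]; funext i; exact (h0 i.1 i.2 (Nat.zero_le _)).symm⟩
  | succ m ih =>
    intro ω hω hωq hm
    have hrow : ∀ t : Finset (Fin d), ∃ η : Finset (Fin n) → X, η Finset.univ = 0 ∧
        (t.card = m → ∀ s, ((-1 : ℤ) ^ t.card) • wedgeDiff ρ η s = ω (t, s)) ∧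
        (t.card ≠ m → η = 0) := by
      intro t
      by_cases ht : t.card = m
      · obtain ⟨η, hη, hη'⟩ := wedgeDiff_exact_of_leftInverse ρ h.rho_comm G hc hinv q hq hker
          (fun s => ω (t, s)) (by
            funext s
            have h1 := congrFun hω (t, s)
            rw [totDiff_apply, koszulDiff_apply, Finset.sum_eq_zero, add_zero] at h1
            · have h2 := congrArg (fun x => ((-1 : ℤ) ^ t.card) • x) h1
              rw [smul_smul, ← mul_pow] at h2
              simpa using h2
            · intro i hi
              rw [hm, map_zero, smul_zero]
              rw [Finset.card_insert_of_notMem (Finset.mem_compl.1 hi), ht]) (hωq t)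
        refine ⟨((-1 : ℤ) ^ t.card) • η, by rw [Pi.smul_apply, hη, smul_zero], fun _ s => ?_,
          fun h => absurd ht h⟩
        rw [map_zsmul, Pi.smul_apply, smul_smul, ← mul_pow, hη']
        simp
      · exact ⟨0, rfl, fun h => absurd h ht, fun _ => rfl⟩
    choose η hη hη1 hη2 using hrow
    have hηm : ∀ t s, t.card ≠ m → η t s = 0 := fun t s ht => by rw [hη2 t ht]; rfl
    have hqD : ∀ ζ : Finset (Fin n) → X, q (wedgeDiff ρ ζ Finset.univ) = 0 := fun ζ => by
      rw [wedgeDiff_apply, map_sum]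
      exact Finset.sum_eq_zero fun i _ => by rw [map_zsmul, hq, smul_zero]
    let η' : Finset (Fin d) × Finset (Fin n) → X := fun i => η i.1 i.2
    -- The row primitives vanish at s = univ, so their Koszul terms do not touch the top components.
    -- The ρ-terms there are killed by q, hence the augmentation condition persists.
    obtain ⟨ζ, hζ, hζ'⟩ := ih (ω - totDiff ρ E η') (by
        rw [map_sub, hω, h.isDegreeOne.sq, sub_zero]) (by
        intro t
        rw [Pi.sub_apply, totDiff_apply, map_sub, hωq, map_add, map_zsmul, hqD, smul_zero,
          koszulDiff_apply, Finset.sum_eq_zero]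
        · simp
        · intro i _
          change _ • E _ i (η _ _) = _
          rw [hη, map_zero, smul_zero]) (by
        intro t s ht
        rw [Pi.sub_apply, totDiff_apply]
        have hk : koszulDiff (E s) (fun t => η' (t, s)) t = 0 := by
          rw [koszulDiff_apply]
          refine Finset.sum_eq_zero fun i hi => ?_
          change _ • E _ i (η _ _) = _
          rw [hηm, map_zero, smul_zero]
          rw [Finset.card_insert_of_notMem (Finset.mem_compl.1 hi)]
          omega
        rw [hk, add_zero]
        change ω (t, s) - _ • wedgeDiff ρ (η t) s = 0
        rcases eq_or_lt_of_le ht with ht | ht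
        · rw [hη1 t ht.symm, sub_self]
        · rw [hη2 t (by omega), map_zero, Pi.zero_apply, smul_zero, sub_zero]
          exact hm t s (by omega))
    refine ⟨η' + ζ, fun t => ?_, ?_⟩
    · rw [Pi.add_apply, hζ, add_zero]; exact hη t
    · rw [map_add, hζ', add_sub_cancel]

end TotalDifferential
end
end EulerKoszul

namespace EulerKoszul
noncomputable section

/-! ### Normal ordering in the Weyl algebra. -/

section WeylBasis

variable {k : Type u} [Field k] {n : ℕ}

/-- The inclusion `k[x_1, …, x_n] → D_A`. -/
def inclX : MvPolynomial (Fin n) k →ₐ[k] WeylAlgebra k n := polyHom (xD k n) xD_comm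

theorem inclX_X (j : Fin n) : inclX (k := k) (MvPolynomial.X j) = xD k n j := polyHom_X _ _ _

theorem inclR_X (j : Fin n) : inclR (k := k) (MvPolynomial.X j) = dD k n j := polyHom_X _ _ _

theorem toEnd_inclX (p f : MvPolynomial (Fin n) k) : toEnd (inclX p) f = p * f := by
  induction p using MvPolynomial.induction_on generalizing f with
  | C a =>
    rw [← MvPolynomial.algebraMap_eq, AlgHom.commutes, AlgHom.commutes,
      Module.algebraMap_end_apply, Algebra.smul_def]
  | add p q hp hq => rw [map_add, map_add, LinearMap.add_apply, hp, hq, add_mul]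
  | mul_X p j hp => rw [map_mul, toEnd_mul, inclX_X, toEnd_xD, hp, mul_assoc]

theorem dD_mul_inclX (j : Fin n) (p : MvPolynomial (Fin n) k) :
    dD k n j * inclX p = inclX p * dD k n j + inclX (MvPolynomial.pderiv j p) := by
  refine weyl_ext fun f => ?_
  rw [map_add, LinearMap.add_apply]
  simp only [toEnd_mul, toEnd_dD, toEnd_inclX, Derivation.leibniz, smul_eq_mul]
  ring

/-- The normally ordered operator `∑_u c_u ∂^u`. -/
def normalForm : ((Fin n →₀ ℕ) →₀ MvPolynomial (Fin n) k) →ₗ[k] WeylAlgebra k n :=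
  Finsupp.lsum k fun u =>
    LinearMap.mulRight k (inclR (MvPolynomial.monomial u (1 : k))) ∘ₗ inclX.toLinearMap

theorem normalForm_single (u : Fin n →₀ ℕ) (p : MvPolynomial (Fin n) k) :
    normalForm (Finsupp.single u p) = inclX p * inclR (MvPolynomial.monomial u 1) := by
  simp [normalForm]

theorem inclX_mul_inclR_mem (p q : MvPolynomial (Fin n) k) :
    inclX p * inclR q ∈ LinearMap.range (normalForm (k := k) (n := n)) := by
  induction q using MvPolynomial.induction_on' with
  | monomial u a =>
    refine ⟨Finsupp.single u (a • p), ?_⟩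
    rw [normalForm_single, map_smul, smul_mul_assoc, ← mul_smul_comm, ← map_smul,
      MvPolynomial.smul_monomial, smul_eq_mul, mul_one]
  | add p q hp hq => rw [map_add, mul_add]; exact add_mem hp hq

theorem weyl_adjoin : Algebra.adjoin k (Set.range (xD k n) ∪ Set.range (dD k n)) = ⊤ := by
  have h := Algebra.adjoin_adjoin_coe_preimage (R := k)
    (s := Set.range (mulX k n) ∪ Set.range (diffX k n))
  refine Eq.trans ?_ h
  congr 1
  ext P
  constructor
  · rintro (⟨j, rfl⟩ | ⟨j, rfl⟩)
    · exact Or.inl ⟨j, rfl⟩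
    · exact Or.inr ⟨j, rfl⟩
  · rintro (⟨j, h⟩ | ⟨j, h⟩)
    · exact Or.inl ⟨j, Subtype.ext h⟩
    · exact Or.inr ⟨j, Subtype.ext h⟩

/-- The normally ordered operators contain 1 and are stable under left multiplication by each x_j,
trivially, and by each ∂_j, through the Leibniz rule `dD_mul_inclX`. -/
theorem normalForm_surjective : Function.Surjective (normalForm (k := k) (n := n)) := by
  have hmul : ∀ P ∈ Algebra.adjoin k (Set.range (xD k n) ∪ Set.range (dD k n)),
      ∀ Q ∈ LinearMap.range (normalForm (k := k) (n := n)),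
        P * Q ∈ LinearMap.range (normalForm (k := k) (n := n)) := by
    intro P hP
    induction hP using Algebra.adjoin_induction with
    | mem P hP =>
      rintro _ ⟨c, rfl⟩
      induction c using Finsupp.induction_linear with
      | zero => rw [map_zero, mul_zero]; exact zero_mem _
      | add c c' hc hc' => rw [map_add, mul_add]; exact add_mem hc hc'
      | single u p =>
        rw [normalForm_single]
        rcases hP with ⟨j, rfl⟩ | ⟨j, rfl⟩
        · rw [← mul_assoc, ← inclX_X, ← map_mul]
          exact inclX_mul_inclR_mem _ _
        · rw [← mul_assoc, dD_mul_inclX, add_mul, mul_assoc, ← inclR_X, ← map_mul]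
          exact add_mem (inclX_mul_inclR_mem _ _) (inclX_mul_inclR_mem _ _)
    | algebraMap c =>
      intro Q hQ
      rw [← Algebra.smul_def]
      exact Submodule.smul_mem _ _ hQ
    | add P P' hP hP' h h' =>
      intro Q hQ
      rw [add_mul]
      exact add_mem (h Q hQ) (h' Q hQ)
    | mul P P' hP hP' h h' =>
      intro Q hQ
      rw [mul_assoc]
      exact h _ (h' Q hQ)
  intro P
  have := hmul P (by rw [weyl_adjoin]; trivial) 1
    (by simpa using inclX_mul_inclR_mem (k := k) (n := n) 1 1)
  rwa [mul_one] at this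

theorem weyl_induction {motive : WeylAlgebra k n → Prop} (P : WeylAlgebra k n)
    (add : ∀ P Q, motive P → motive Q → motive (P + Q))
    (monomial : ∀ p u, motive (inclX p * inclR (MvPolynomial.monomial u 1))) : motive P := by
  obtain ⟨c, rfl⟩ := normalForm_surjective P
  induction c using Finsupp.induction_linear with
  | zero => simpa using monomial 0 0
  | add c c' hc hc' => rw [map_add]; exact add _ _ hc hc'
  | single u p => rw [normalForm_single]; exact monomial p u

/-- The multi-factorial `u!`. -/
def multiFactorial (u : Fin n →₀ ℕ) : ℕ := ∏ j, (u j).factorial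

theorem multiFactorial_add_single (u : Fin n →₀ ℕ) (j : Fin n) :
    multiFactorial (u + Finsupp.single j 1) = (u j + 1) * multiFactorial u := by
  unfold multiFactorial
  rw [← Finset.mul_prod_erase _ _ (Finset.mem_univ j),
    ← Finset.mul_prod_erase (a := j) _ (fun j => (u j).factorial) (Finset.mem_univ j), ← mul_assoc]
  congr 1
  · simp [Nat.factorial_succ]
  · refine Finset.prod_congr rfl fun i hi => ?_
    simp [(Finset.ne_of_mem_erase hi).symm]

theorem multiFactorial_ne_zero (u : Fin n →₀ ℕ) : multiFactorial u ≠ 0 :=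
  Finset.prod_ne_zero_iff.2 fun _ _ => Nat.factorial_ne_zero _

/-- Weighting coefficients by factorials turns ∂^u into a pure shift of exponents. In this form the
identity composes along u and reduces to a single derivative. -/
theorem coeff_iterated_pderiv (u v : Fin n →₀ ℕ) (f : MvPolynomial (Fin n) k) :
    multiFactorial v * MvPolynomial.coeff v (toEnd (inclR (MvPolynomial.monomial u 1)) f) =
      multiFactorial (v + u) * MvPolynomial.coeff (v + u) f := by
  induction u using Finsupp.induction_linear generalizing v f with
  | zero =>
    rw [add_zero]
    change _ * MvPolynomial.coeff v (toEnd (inclR (1 : MvPolynomial (Fin n) k)) f) = _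
    rw [map_one, map_one]
    rfl
  | add u u' hu hu' =>
    have : (MvPolynomial.monomial (u + u') (1 : k)) =
        MvPolynomial.monomial u 1 * MvPolynomial.monomial u' 1 := by
      rw [MvPolynomial.monomial_mul, one_mul]
    rw [this, map_mul, toEnd_mul, hu, hu', add_assoc]
  | single j m =>
    induction m generalizing v f with
    | zero =>
      rw [Finsupp.single_zero, add_zero]
      change _ * MvPolynomial.coeff v (toEnd (inclR (1 : MvPolynomial (Fin n) k)) f) = _
      rw [map_one, map_one]
      rfl
    | succ m ih =>
      have : (MvPolynomial.monomial (Finsupp.single j (m + 1)) (1 : k)) =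
          MvPolynomial.X j * MvPolynomial.monomial (Finsupp.single j m) 1 := by
        rw [MvPolynomial.X, MvPolynomial.monomial_mul, one_mul, ← Finsupp.single_add, add_comm]
      rw [this, map_mul, toEnd_mul, inclR_X, toEnd_dD, MvPolynomial.coeff_pderiv, add_comm m 1,
        Finsupp.single_add, ← add_assoc, ← ih, multiFactorial_add_single]
      push_cast
      ring

variable [CharZero k]

/-- Apply the operator to x^u for a minimal exponent u in its support. A term ∂^w acts nontrivially
on x^u only if w ≤ u, so by minimality only c_u ∂^u contributes, and its value u! c_u is nonzero in
characteristic zero. -/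
theorem normalForm_injective : Function.Injective (normalForm (k := k) (n := n)) := by
  rw [injective_iff_map_eq_zero]
  intro c hc
  by_contra hne
  obtain ⟨u, hu, hmin⟩ := c.support.exists_minimal (Finsupp.support_nonempty_iff.2 hne)
  have h0 : toEnd (normalForm c) (MvPolynomial.monomial u 1) =
      c u * toEnd (inclR (MvPolynomial.monomial u 1)) (MvPolynomial.monomial u 1) := by
    rw [normalForm, Finsupp.lsum_apply, Finsupp.sum, map_sum, LinearMap.sum_apply]
    refine (Finset.sum_eq_single_of_mem u hu fun w hw hwu => ?_).trans ?_
    · change toEnd (inclX (c w) * inclR (MvPolynomial.monomial w 1)) _ = 0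
      have : toEnd (inclR (MvPolynomial.monomial w (1 : k))) (MvPolynomial.monomial u (1 : k)) = 0 := by
        ext v
        have h1 := coeff_iterated_pderiv (k := k) w v (MvPolynomial.monomial u 1)
        rw [MvPolynomial.coeff_monomial, if_neg, mul_zero, mul_eq_zero] at h1
        · exact h1.resolve_left (Nat.cast_ne_zero.2 (multiFactorial_ne_zero v))
        · intro e
          have hle : w ≤ u := by rw [e]; exact le_add_self
          exact hwu (le_antisymm hle (hmin hw hle))
      rw [toEnd_mul, this, map_zero]
    · change toEnd (inclX (c u) * inclR (MvPolynomial.monomial u 1)) _ = _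
      rw [toEnd_mul, toEnd_inclX]
  rw [hc, map_zero, LinearMap.zero_apply, eq_comm, mul_eq_zero] at h0
  refine h0.elim (Finsupp.mem_support_iff.1 hu) fun h => ?_
  have h1 := coeff_iterated_pderiv (k := k) u 0 (MvPolynomial.monomial u 1)
  rw [h, MvPolynomial.coeff_zero, mul_zero, zero_add, MvPolynomial.coeff_monomial, if_pos rfl,
    mul_one, eq_comm, Nat.cast_eq_zero] at h1
  exact multiFactorial_ne_zero u h1

/-- The basis theorem for the Weyl algebra: every operator is uniquely of the form `∑_u c_u ∂^u`
with `c_u ∈ k[x_1, …, x_n]`. -/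
def weylEquiv : ((Fin n →₀ ℕ) →₀ MvPolynomial (Fin n) k) ≃ₗ[k] WeylAlgebra k n :=
  LinearEquiv.ofBijective normalForm ⟨normalForm_injective, normalForm_surjective⟩

theorem weylEquiv_symm_apply (u : Fin n →₀ ℕ) (p : MvPolynomial (Fin n) k) :
    weylEquiv.symm (inclX p * inclR (MvPolynomial.monomial u 1)) = Finsupp.single u p := by
  rw [LinearEquiv.symm_apply_eq, ← normalForm_single]
  rfl

end WeylBasis

/-! ### The right module D/∂D as a polynomial ring. -/

section Residue

variable {k : Type u} [Field k] {n : ℕ}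

theorem diffX_comm (i j : Fin n) : diffX k n i * diffX k n j = diffX k n j * diffX k n i := by
  have := congrArg toEnd (dD_comm (k := k) i j)
  rwa [map_mul, map_mul] at this

/-- The action of `k[∂_1, …, ∂_n]` on `k[x_1, …, x_n]` in which `∂_j` acts as `-∂/∂x_j`. -/
def negDiff : MvPolynomial (Fin n) k →ₐ[k] Module.End k (MvPolynomial (Fin n) k) :=
  polyHom (fun j => -diffX k n j) fun i j =>
    (neg_mul_neg (diffX k n i) (diffX k n j)).trans
      ((diffX_comm i j).trans (neg_mul_neg (diffX k n j) (diffX k n i)).symm)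

theorem negDiff_X (j : Fin n) (p : MvPolynomial (Fin n) k) :
    negDiff (MvPolynomial.X j) p = -MvPolynomial.pderiv j p := by
  rw [negDiff, polyHom_X]; rfl

theorem negDiff_mul_X (q p : MvPolynomial (Fin n) k) (j : Fin n) :
    negDiff (q * MvPolynomial.X j) p = -negDiff q (MvPolynomial.pderiv j p) := by
  rw [map_mul, Module.End.mul_apply, negDiff_X, map_neg]

theorem dD_mul_mem_partialIdeal (j : Fin n) (P : WeylAlgebra k n) :
    dD k n j * P ∈ partialIdeal k n :=
  Submodule.smul_mem _ (MulOpposite.op P) (Submodule.subset_span ⟨j, rfl⟩)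

/-- Moving ∂_j to the left past p costs the commutator ∂p/∂x_j, and the operator with ∂_j on the
left lies in the ideal. So each ∂_j on the right becomes −∂/∂x_j. -/
theorem inclX_mul_inclR_sub_mem (q p : MvPolynomial (Fin n) k) :
    inclX p * inclR q - inclX (negDiff q p) ∈ partialIdeal k n := by
  induction q using MvPolynomial.induction_on generalizing p with
  | C a =>
    rw [← MvPolynomial.algebraMap_eq, AlgHom.commutes, AlgHom.commutes,
      Module.algebraMap_end_apply, map_smul, ← Algebra.commutes, ← Algebra.smul_def, sub_self]
    exact zero_mem _
  | add q q' hq hq' =>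
    have := add_mem (hq p) (hq' p)
    simp only [map_add, LinearMap.add_apply, mul_add]
    convert this using 1
    abel
  | mul_X q j hq =>
    have h1 := hq (MvPolynomial.pderiv j p)
    have h2 := dD_mul_mem_partialIdeal j (inclX p * inclR q)
    rw [← mul_assoc, dD_mul_inclX, add_mul] at h2
    convert sub_mem h2 h1 using 1
    rw [negDiff_mul_X, mul_comm q, map_neg, map_mul, inclR_X, mul_assoc]
    abel

variable [CharZero k]

/-- The projection `D_A → D_A / ∂_A D_A ≃ k[x_1, …, x_n]`. -/
def residue : WeylAlgebra k n →ₗ[k] MvPolynomial (Fin n) k :=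
  (Finsupp.lsum k fun u => negDiff (MvPolynomial.monomial u (1 : k))) ∘ₗ weylEquiv.symm.toLinearMap

theorem residue_mul (p q : MvPolynomial (Fin n) k) :
    residue (inclX p * inclR q) = negDiff q p := by
  induction q using MvPolynomial.induction_on' with
  | monomial u a =>
    have : (MvPolynomial.monomial u a : MvPolynomial (Fin n) k) = a • MvPolynomial.monomial u 1 := by
      rw [MvPolynomial.smul_monomial, smul_eq_mul, mul_one]
    rw [this, map_smul, map_smul, mul_smul_comm, map_smul]
    change a • Finsupp.lsum k _ (weylEquiv.symm (inclX p * inclR (MvPolynomial.monomial u 1))) = _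
    rw [weylEquiv_symm_apply, Finsupp.lsum_single, LinearMap.smul_apply]
  | add q q' hq hq' => simp only [map_add, mul_add, hq, hq', LinearMap.add_apply]

theorem residue_inclX (p : MvPolynomial (Fin n) k) : residue (inclX p) = p := by
  have := residue_mul p 1
  rwa [map_one, map_one, mul_one] at this

/-- On a normally ordered p ∂^u the Leibniz rule gives two terms, p ∂_j ∂^u and (∂p/∂x_j) ∂^u, whose
residues are opposite. -/
theorem residue_dD_mul (j : Fin n) (P : WeylAlgebra k n) : residue (dD k n j * P) = 0 := by
  induction P using weyl_induction with
  | add P Q hP hQ => rw [mul_add, map_add, hP, hQ, add_zero]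
  | monomial p u =>
    rw [← mul_assoc, dD_mul_inclX, add_mul, mul_assoc, ← inclR_X, ← map_mul, map_add, residue_mul,
      residue_mul, mul_comm, negDiff_mul_X, neg_add_cancel]

theorem residue_mem (P : WeylAlgebra k n) : P - inclX (residue P) ∈ partialIdeal k n := by
  induction P using weyl_induction with
  | add P Q hP hQ =>
    rw [map_add, map_add, add_sub_add_comm]
    exact add_mem hP hQ
  | monomial p u => rw [residue_mul]; exact inclX_mul_inclR_sub_mem _ _

theorem residue_eq_zero_of_mem {P : WeylAlgebra k n} (hP : P ∈ partialIdeal k n) :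
    residue P = 0 := by
  obtain ⟨c, rfl⟩ := (Submodule.mem_span_range_iff_exists_fun _).1 hP
  rw [map_sum]
  refine Finset.sum_eq_zero fun j _ => ?_
  exact residue_dD_mul j (c j).unop

theorem residue_eq_zero_iff {P : WeylAlgebra k n} : residue P = 0 ↔ P ∈ partialIdeal k n := by
  refine ⟨fun h => ?_, residue_eq_zero_of_mem⟩
  have := residue_mem P
  rwa [h, map_zero, sub_zero] at this

/-- Since ∂D is a right ideal, P may be replaced by its polynomial representative before
multiplication on the right. -/
theorem residue_mul_right (P Q : WeylAlgebra k n) :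
    residue (P * Q) = residue (inclX (residue P) * Q) := by
  rw [← sub_eq_zero, ← map_sub, ← sub_mul, residue_eq_zero_iff]
  exact Submodule.smul_mem _ (MulOpposite.op Q) (residue_mem P)

theorem residue_mul_dD (P : WeylAlgebra k n) (j : Fin n) :
    residue (P * dD k n j) = -MvPolynomial.pderiv j (residue P) := by
  rw [residue_mul_right, ← inclR_X, residue_mul, negDiff_X]

theorem residue_mul_euler {d : ℕ} (A : Matrix (Fin d) (Fin n) ℤ) (P : WeylAlgebra k n) (i : Fin d) :
    residue (P * euler k A i) =
      -∑ j, A i j • MvPolynomial.pderiv j (MvPolynomial.X j * residue P) := by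
  rw [euler, Finset.mul_sum, map_sum, ← Finset.sum_neg_distrib]
  refine Finset.sum_congr rfl fun j _ => ?_
  rw [mul_smul_comm, map_zsmul, ← mul_assoc, residue_mul_dD, residue_mul_right, ← inclX_X,
    ← map_mul, residue_inclX, mul_comm, smul_neg]

end Residue
end
end EulerKoszul

namespace EulerKoszul
noncomputable section

/-! ### The free resolution of the Euler–Koszul complex. -/

section FreeModule

variable {k : Type u} [Field k] {n : ℕ} {T : Type u} [AddCommGroup T] [Module k T]

/-- The `D_A`-linear map `P ⊗ ν ↦ P Q ⊗ g(ν)` of `D_A ⊗_k T`. -/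
def freeOp (Q : WeylAlgebra k n) (g : Module.End k T) :
    Module.End (WeylAlgebra k n) (WeylAlgebra k n ⊗[k] T) :=
  AlgebraTensorModule.map (LinearMap.toSpanSingleton (WeylAlgebra k n) (WeylAlgebra k n) Q) g

theorem freeOp_tmul (Q : WeylAlgebra k n) (g : Module.End k T) (P : WeylAlgebra k n) (ν : T) :
    freeOp Q g (P ⊗ₜ ν) = (P * Q) ⊗ₜ g ν := rfl

end FreeModule

section EulerResolution

variable {d n : ℕ} {A : Matrix (Fin d) (Fin n) ℤ} {k : Type u} [Field k] (β : Fin d → k)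

/-- The operator `P ⊗ ν ↦ P ∂_j ⊗ ν - P ⊗ ∂_j ν` of `D_A ⊗_k N`. -/
def freeRho (N : GradedModule A k) (j : Fin n) :
    Module.End (WeylAlgebra k n) (WeylAlgebra k n ⊗[k] Total N) :=
  freeOp (dD k n j) 1 - freeOp 1 (partialTotal N j)

theorem freeRho_tmul (N : GradedModule A k) (j : Fin n) (P : WeylAlgebra k n) (ν : Total N) :
    freeRho N j (P ⊗ₜ ν) = (P * dD k n j) ⊗ₜ ν - P ⊗ₜ partialTotal N j ν := by
  rw [freeRho, LinearMap.sub_apply, freeOp_tmul, freeOp_tmul, mul_one, Module.End.one_apply]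

/-- The weight of the complementary exterior monomial, shifted by `-β_i`. -/
def eulerConst (A : Matrix (Fin d) (Fin n) ℤ) (s : Finset (Fin n)) (i : Fin d) : k :=
  ((∑ j ∈ sᶜ, A i j : ℤ) : k) - β i

theorem eulerConst_erase (A : Matrix (Fin d) (Fin n) ℤ) {s : Finset (Fin n)} {j : Fin n}
    (hj : j ∈ s) (i : Fin d) :
    eulerConst β A (s.erase j) i = A i j + eulerConst β A s i := by
  have : (s.erase j)ᶜ = insert j sᶜ := by ext x; by_cases hx : x = j <;> simp [hx]
  rw [eulerConst, eulerConst, this, Finset.sum_insert (by simp [hj])]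
  push_cast
  ring

/-- The Euler operators of `D_A ⊗_k N(-∑_{j ∉ s} a_j)`. -/
def freeEuler (N : GradedModule A k) (s : Finset (Fin n)) (i : Fin d) :
    Module.End (WeylAlgebra k n) (WeylAlgebra k n ⊗[k] Total N) :=
  freeOp (euler k A i + algebraMap k _ (eulerConst β A s i)) 1 + freeOp 1 (degreeOp N i)

theorem freeEuler_tmul (N : GradedModule A k) (s : Finset (Fin n)) (i : Fin d)
    (P : WeylAlgebra k n) (ν : Total N) :
    freeEuler β N s i (P ⊗ₜ ν) =
      (P * (euler k A i + algebraMap k _ (eulerConst β A s i))) ⊗ₜ ν + P ⊗ₜ degreeOp N i ν := by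
  rw [freeEuler, LinearMap.add_apply, freeOp_tmul, freeOp_tmul, mul_one, Module.End.one_apply]

theorem freeTensor_ext {M : Type*} [AddCommGroup M] {T : Type u} [AddCommGroup T] [Module k T]
    {f g : WeylAlgebra k n ⊗[k] T →+ M} (h : ∀ P ν, f (P ⊗ₜ ν) = g (P ⊗ₜ ν))
    (x : WeylAlgebra k n ⊗[k] T) : f x = g x := by
  induction x using TensorProduct.induction_on with
  | zero => simp
  | add x y hx hy => rw [map_add, map_add, hx, hy]
  | tmul P ν => exact h P ν

theorem partialTotal_comm_apply (N : GradedModule A k) (i j : Fin n) (x : Total N) :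
    partialTotal N i (partialTotal N j x) = partialTotal N j (partialTotal N i x) :=
  LinearMap.congr_fun (partialTotal_comm N i j) x

/-- The constants `eulerConst` are made for the third condition. Moving E_i past ∂_j and applying
∂_j to an element of N both change the degree by a_j; this is the amount by which the constant grows
when j is removed from s. -/
theorem freeCompatible (N : GradedModule A k) : TotCompatible (freeRho N) (freeEuler β N) where
  rho_comm i l m := by
    refine freeTensor_ext (f := ((freeRho N i * freeRho N l : Module.End _ _) : _ →ₗ[_] _).toAddMonoidHom)
      (g := (freeRho N l * freeRho N i : Module.End _ _).toAddMonoidHom) (fun P ν => ?_) m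
    change freeRho N i (freeRho N l (P ⊗ₜ ν)) = freeRho N l (freeRho N i (P ⊗ₜ ν))
    simp only [freeRho_tmul, map_sub]
    rw [mul_assoc, mul_assoc, dD_comm, partialTotal_comm_apply]
    abel
  euler_comm s i l m := by
    refine freeTensor_ext (f := (freeEuler β N s i * freeEuler β N s l : Module.End _ _).toAddMonoidHom)
      (g := (freeEuler β N s l * freeEuler β N s i : Module.End _ _).toAddMonoidHom) (fun P ν => ?_) m
    change freeEuler β N s i (freeEuler β N s l (P ⊗ₜ ν)) =
      freeEuler β N s l (freeEuler β N s i (P ⊗ₜ ν))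
    simp only [freeEuler_tmul, map_add]
    have : (euler k A l + algebraMap k (WeylAlgebra k n) (eulerConst β A s l)) *
        (euler k A i + algebraMap k (WeylAlgebra k n) (eulerConst β A s i)) =
        (euler k A i + algebraMap k (WeylAlgebra k n) (eulerConst β A s i)) *
        (euler k A l + algebraMap k (WeylAlgebra k n) (eulerConst β A s l)) := by
      simp only [add_mul, mul_add, euler_comm A l i, ← Algebra.commutes (eulerConst β A s _)
        (euler k A _), ← map_mul, mul_comm (eulerConst β A s l)]
      abel
    rw [mul_assoc, mul_assoc, this, degreeOp_comm]
    abel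
  euler_rho s j hj i m := by
    refine freeTensor_ext (f := (freeEuler β N s i * freeRho N j : Module.End _ _).toAddMonoidHom)
      (g := (freeRho N j * freeEuler β N (s.erase j) i : Module.End _ _).toAddMonoidHom) (fun P ν => ?_) m
    change freeEuler β N s i (freeRho N j (P ⊗ₜ ν)) =
      freeRho N j (freeEuler β N (s.erase j) i (P ⊗ₜ ν))
    simp only [freeEuler_tmul, freeRho_tmul, map_add, map_sub, degreeOp_partial]
    have h1 : P * dD k n j * (euler k A i + algebraMap k _ (eulerConst β A s i)) =
        P * (euler k A i + algebraMap k _ (eulerConst β A (s.erase j) i)) * dD k n j := by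
      rw [eulerConst_erase β A hj, mul_assoc, mul_assoc, mul_add, dD_mul_euler, map_add, add_mul,
        add_mul, ← Algebra.commutes (eulerConst β A s i) (dD k n j), map_intCast, ← zsmul_eq_mul,
        add_assoc]
    have h2 : P * (euler k A i + algebraMap k (WeylAlgebra k n) (eulerConst β A (s.erase j) i)) =
        P * (euler k A i + algebraMap k _ (eulerConst β A s i)) + A i j • P := by
      rw [eulerConst_erase β A hj, map_add, map_intCast, mul_add, mul_add, mul_add,
        ← zsmul_one (A i j), mul_smul_comm, mul_one]
      abel
    rw [h1, h2, TensorProduct.add_tmul, TensorProduct.tmul_add, TensorProduct.tmul_smul,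
      TensorProduct.smul_tmul']
    abel

/-- The map `id ⊗ φ : D_A ⊗_k N → D_A ⊗_k N'`. -/
def freeMap {N N' : GradedModule A k} (φ : N ⟶ N') :
    WeylAlgebra k n ⊗[k] Total N →ₗ[WeylAlgebra k n] WeylAlgebra k n ⊗[k] Total N' :=
  AlgebraTensorModule.map LinearMap.id (totalMapₗ φ)

theorem freeMap_tmul {N N' : GradedModule A k} (φ : N ⟶ N') (P : WeylAlgebra k n) (ν : Total N) :
    freeMap φ (P ⊗ₜ ν) = P ⊗ₜ totalMapₗ φ ν := rfl

theorem freeRho_freeMap {N N' : GradedModule A k} (φ : N ⟶ N') (j : Fin n)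
    (x : WeylAlgebra k n ⊗[k] Total N) :
    freeRho N' j (freeMap φ x) = freeMap φ (freeRho N j x) := by
  refine freeTensor_ext (f := (freeRho N' j ∘ₗ freeMap φ).toAddMonoidHom)
    (g := (freeMap φ ∘ₗ freeRho N j).toAddMonoidHom) (fun P ν => ?_) x
  change freeRho N' j (P ⊗ₜ totalMapₗ φ ν) = freeMap φ (freeRho N j (P ⊗ₜ ν))
  rw [freeRho_tmul, freeRho_tmul, map_sub, freeMap_tmul, freeMap_tmul, totalMapₗ_partial]

theorem freeEuler_freeMap {N N' : GradedModule A k} (φ : N ⟶ N') (s : Finset (Fin n)) (i : Fin d)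
    (x : WeylAlgebra k n ⊗[k] Total N) :
    freeEuler β N' s i (freeMap φ x) = freeMap φ (freeEuler β N s i x) := by
  refine freeTensor_ext (f := (freeEuler β N' s i ∘ₗ freeMap φ).toAddMonoidHom)
    (g := (freeMap φ ∘ₗ freeEuler β N s i).toAddMonoidHom) (fun P ν => ?_) x
  change freeEuler β N' s i (P ⊗ₜ totalMapₗ φ ν) = freeMap φ (freeEuler β N s i (P ⊗ₜ ν))
  rw [freeEuler_tmul, freeEuler_tmul, map_add, freeMap_tmul, freeMap_tmul]
  exact congrArg _ (congrArg _ (totalMap_degreeOp φ i ν).symm)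

/-- The differential of the free resolution of the Euler–Koszul complex. -/
abbrev freeDiff (N : GradedModule A k) := totDiff (freeRho N) (freeEuler β N)

/-- A complex of free `D_A`-modules resolving the Euler–Koszul complex of `N`. -/
def freeResolution (N : GradedModule A k) : CochainComplex (ModuleCat.{u} (WeylAlgebra k n)) ℤ :=
  indexedComplex totDegree (freeDiff β N) (freeCompatible β N).isDegreeOne

theorem totDiff_map {S : Type u} [Ring S] {X X' : Type u} [AddCommGroup X] [Module S X]
    [AddCommGroup X'] [Module S X']
    {ρ : Fin n → Module.End S X} {E : Finset (Fin n) → Fin d → Module.End S X}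
    {ρ' : Fin n → Module.End S X'} {E' : Finset (Fin n) → Fin d → Module.End S X'}
    (g : X →ₗ[S] X') (hρ : ∀ j x, ρ' j (g x) = g (ρ j x)) (hE : ∀ s i x, E' s i (g x) = g (E s i x))
    (ω : Finset (Fin d) × Finset (Fin n) → X) (l : Finset (Fin d) × Finset (Fin n)) :
    totDiff ρ' E' (fun l => g (ω l)) l = g (totDiff ρ E ω l) := by
  obtain ⟨t, s⟩ := l
  simp only [totDiff_apply, wedgeDiff_apply, koszulDiff_apply, map_add, map_zsmul, map_sum, hρ, hE]

/-- The map of free resolutions induced by a morphism of graded modules. -/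
def freeResolutionMap {N N' : GradedModule A k} (φ : N ⟶ N') :
    freeResolution β N ⟶ freeResolution β N' :=
  indexedMap _ _ (freeMap φ) (totDiff_map _ (freeRho_freeMap φ) (freeEuler_freeMap β φ))

instance (N : GradedModule A k) (p : ℤ) : Projective ((freeResolution β N).X p) :=
  inferInstanceAs (Projective (ModuleCat.of (WeylAlgebra k n)
    ({i : Finset (Fin d) × Finset (Fin n) // totDegree i = p} → WeylAlgebra k n ⊗[k] Total N)))

/-- The degree |s| − n − |t| is never positive, so this is a bounded above complex of projective
modules. -/
theorem isKProjective_freeResolution (N : GradedModule A k) : (freeResolution β N).IsKProjective := by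
  have : (freeResolution β N).IsStrictlyLE 0 := by
    rw [CochainComplex.isStrictlyLE_iff]
    intro p hp
    have : IsEmpty {i : Finset (Fin d) × Finset (Fin n) // totDegree i = p} := ⟨fun ⟨i, hi⟩ => by
      have h1 : ((i.2.card : ℤ)) ≤ n := by exact_mod_cast (Finset.card_le_univ i.2).trans (by simp)
      unfold totDegree at hi
      omega⟩
    exact ModuleCat.isZero_of_subsingleton (ModuleCat.of (WeylAlgebra k n)
      ({i : Finset (Fin d) × Finset (Fin n) // totDegree i = p} → WeylAlgebra k n ⊗[k] Total N))
  exact CochainComplex.isKProjective_of_projective _ 0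

theorem k_smul_tmul_induced (N : GradedModule A k) (c : k) (P : WeylAlgebra k n) (ν : Total N) :
    ((c • P) ⊗ₜ ν : Induced N) = P ⊗ₜ (c • ν) := by
  rw [← C_smul, ← TensorProduct.smul_tmul, weylRight_smul, ← MvPolynomial.algebraMap_eq,
    AlgHom.commutes, ← Algebra.commutes, ← Algebra.smul_def]

/-- The projection `D_A ⊗_k N → D_A ⊗_{R_A} N`. -/
def toInduced (N : GradedModule A k) : WeylAlgebra k n ⊗[k] Total N →ₗ[WeylAlgebra k n] Induced N where
  toFun := TensorProduct.liftAddHom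
    (AddMonoidHom.mk' (fun P => AddMonoidHom.mk' (fun ν => P ⊗ₜ ν) (TensorProduct.tmul_add P))
      (fun P Q => by ext ν; exact TensorProduct.add_tmul P Q ν))
    (fun c P ν => k_smul_tmul_induced N c P ν)
  map_add' := map_add _
  map_smul' Q x := by
    dsimp only [RingHom.id_apply]
    induction x using TensorProduct.induction_on with
    | zero => simp
    | add x y hx hy => rw [smul_add, map_add, hx, hy, map_add, smul_add]
    | tmul P ν =>
      rfl

theorem toInduced_tmul (N : GradedModule A k) (P : WeylAlgebra k n) (ν : Total N) :
    toInduced N (P ⊗ₜ ν) = P ⊗ₜ ν := rfl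

theorem toInduced_surjective (N : GradedModule A k) : Function.Surjective (toInduced N) := by
  intro x
  induction x using TensorProduct.induction_on with
  | zero => exact ⟨0, map_zero _⟩
  | add x y hx hy =>
    obtain ⟨x, rfl⟩ := hx
    obtain ⟨y, rfl⟩ := hy
    exact ⟨x + y, map_add _ _ _⟩
  | tmul P ν => exact ⟨P ⊗ₜ ν, rfl⟩

theorem toInduced_freeRho (N : GradedModule A k) (j : Fin n) (x : WeylAlgebra k n ⊗[k] Total N) :
    toInduced N (freeRho N j x) = 0 := by
  refine freeTensor_ext (f := (toInduced N ∘ₗ freeRho N j).toAddMonoidHom) (g := 0) (fun P ν => ?_) x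
  change toInduced N (freeRho N j (P ⊗ₜ ν)) = 0
  rw [freeRho_tmul, map_sub, toInduced_tmul, toInduced_tmul, ← X_smul, ← TensorProduct.smul_tmul,
    weylRight_smul, inclR_X, sub_self]

theorem toInduced_freeEuler (N : GradedModule A k) (i : Fin d) (x : WeylAlgebra k n ⊗[k] Total N) :
    toInduced N (freeEuler β N Finset.univ i x) = eulerShift β N i (toInduced N x) := by
  refine freeTensor_ext (f := (toInduced N ∘ₗ freeEuler β N Finset.univ i).toAddMonoidHom)
    (g := (eulerShift β N i ∘ₗ toInduced N).toAddMonoidHom) (fun P ν => ?_) x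
  change toInduced N (freeEuler β N Finset.univ i (P ⊗ₜ ν)) = eulerShift β N i (P ⊗ₜ ν)
  rw [freeEuler_tmul, map_add, toInduced_tmul, toInduced_tmul, eulerShift, LinearMap.sub_apply,
    eulerAct_tmul]
  change _ = _ - algebraMap k (WeylAlgebra k n) (β i) • (P ⊗ₜ ν : Induced N)
  rw [TensorProduct.smul_tmul', smul_eq_mul, Algebra.commutes (β i) P, mul_add,
    TensorProduct.add_tmul, eulerConst]
  simp only [Finset.compl_univ, Finset.sum_empty, Int.cast_zero, zero_sub, map_neg, mul_neg,
    TensorProduct.neg_tmul]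
  abel

/-- Modulo the images of the ρ_j tensors are balanced over all of R, since balance has to be checked
only for scalars and the ∂_j. Hence the quotient by these images receives a map back from D ⊗_R N.
-/
theorem exists_of_toInduced_eq_zero (N : GradedModule A k) (x : WeylAlgebra k n ⊗[k] Total N)
    (hx : toInduced N x = 0) : ∃ y : Fin n → WeylAlgebra k n ⊗[k] Total N,
      x = ∑ j, freeRho N j (y j) := by
  let B : Submodule (WeylAlgebra k n) (WeylAlgebra k n ⊗[k] Total N) :=
    LinearMap.range (∑ j, freeRho N j ∘ₗ LinearMap.proj j :
      (Fin n → WeylAlgebra k n ⊗[k] Total N) →ₗ[WeylAlgebra k n] _)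
  have hB : ∀ j y, freeRho N j y ∈ B := fun j y => ⟨Pi.single j y, by
    rw [LinearMap.sum_apply, Finset.sum_eq_single_of_mem j (Finset.mem_univ j)]
    · simp
    · intro i _ hij
      simp [hij]⟩
  have hbal : ∀ (r : MvPolynomial (Fin n) k) (P : WeylAlgebra k n) (ν : Total N),
      (P * inclR r) ⊗ₜ[k] ν - P ⊗ₜ[k] (r • ν) ∈ B := by
    intro r P ν
    induction r using MvPolynomial.induction_on generalizing P ν with
    | C c =>
      rw [C_smul, ← TensorProduct.smul_tmul, ← MvPolynomial.algebraMap_eq,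
        AlgHom.commutes, ← Algebra.commutes, ← Algebra.smul_def, sub_self]
      exact zero_mem _
    | add p q hp hq =>
      rw [map_add, mul_add, add_smul, TensorProduct.add_tmul, TensorProduct.tmul_add,
        add_sub_add_comm]
      exact add_mem (hp P ν) (hq P ν)
    | mul_X p j hp =>
      have h1 := hp P (partialTotal N j ν)
      have h2 := hB j ((P * inclR p) ⊗ₜ ν)
      rw [freeRho_tmul] at h2
      rw [map_mul, inclR_X, ← mul_assoc, mul_smul, X_smul]
      convert add_mem h1 h2 using 1
      abel
  -- The map back from D ⊗_R N; its composite with `toInduced` is the quotient map, so an element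
  -- killed by `toInduced` lies in B.
  let f : Induced N →+ (WeylAlgebra k n ⊗[k] Total N) ⧸ B := TensorProduct.liftAddHom
    (AddMonoidHom.mk' (fun P => AddMonoidHom.mk' (fun ν => B.mkQ (P ⊗ₜ ν))
      (fun x y => by rw [TensorProduct.tmul_add, map_add]))
      (fun P Q => by
        ext ν
        change B.mkQ ((P + Q) ⊗ₜ ν) = B.mkQ (P ⊗ₜ ν) + B.mkQ (Q ⊗ₜ ν)
        rw [TensorProduct.add_tmul, map_add]))
    (fun r P ν => (Submodule.Quotient.eq B).2 (hbal r P ν))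
  have hf : f (toInduced N x) = B.mkQ x :=
    freeTensor_ext (f := f.comp (toInduced N).toAddMonoidHom) (g := B.mkQ.toAddMonoidHom)
      (fun P ν => rfl) x
  rw [hx, map_zero] at hf
  obtain ⟨y, hy⟩ := (Submodule.Quotient.mk_eq_zero B).1 hf.symm
  exact ⟨y, by rw [← hy]; simp [LinearMap.sum_apply]⟩

end EulerResolution
end
end EulerKoszul

namespace EulerKoszul
noncomputable section

/-! ### Left inverses of the operators ρ_j. -/

section LeftInverse

variable {d n : ℕ} {A : Matrix (Fin d) (Fin n) ℤ} {k : Type u} [Field k]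

/-- The monomial `∂^u` of `D_A`. -/
def dMon (k : Type u) [Field k] {n : ℕ} (u : Fin n →₀ ℕ) : WeylAlgebra k n :=
  inclR (MvPolynomial.monomial u 1)

theorem dMon_mul_dD (u : Fin n →₀ ℕ) (j : Fin n) :
    dMon k u * dD k n j = dMon k (u + Finsupp.single j 1) := by
  rw [dMon, dMon, ← inclR_X, ← map_mul, MvPolynomial.X, MvPolynomial.monomial_mul, one_mul]

theorem freeTensor_induction {M : Type*} [AddCommGroup M] {T : Type u} [AddCommGroup T] [Module k T]
    {f g : WeylAlgebra k n ⊗[k] T →+ M}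
    (h : ∀ p u ν, f ((inclX p * dMon k u) ⊗ₜ ν) = g ((inclX p * dMon k u) ⊗ₜ ν))
    (x : WeylAlgebra k n ⊗[k] T) : f x = g x := by
  refine freeTensor_ext (fun P ν => ?_) x
  induction P using weyl_induction with
  | add P Q hP hQ => rw [TensorProduct.add_tmul, map_add, map_add, hP, hQ]
  | monomial p u => exact h p u ν

variable [CharZero k]

/-- A left inverse of `freeRho N j`. -/
def freeRhoInv (N : GradedModule A k) (j : Fin n) :
    WeylAlgebra k n ⊗[k] Total N →ₗ[k] WeylAlgebra k n ⊗[k] Total N :=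
  TensorProduct.lift (Finsupp.lsum k (fun u => ∑ m ∈ Finset.range (u j),
    (TensorProduct.mk k (WeylAlgebra k n) (Total N)).compl₁₂
      (LinearMap.mulRight k (dMon k (u - Finsupp.single j (m + 1))) ∘ₗ inclX.toLinearMap)
      (partialTotal N j ^ m)) ∘ₗ weylEquiv.symm.toLinearMap)

theorem freeRhoInv_tmul (N : GradedModule A k) (j : Fin n) (p : MvPolynomial (Fin n) k)
    (u : Fin n →₀ ℕ) (ν : Total N) :
    freeRhoInv N j ((inclX p * dMon k u) ⊗ₜ ν) = ∑ m ∈ Finset.range (u j),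
      (inclX p * dMon k (u - Finsupp.single j (m + 1))) ⊗ₜ (partialTotal N j ^ m) ν := by
  rw [freeRhoInv, TensorProduct.lift.tmul, LinearMap.comp_apply, LinearEquiv.coe_coe, dMon,
    weylEquiv_symm_apply, Finsupp.lsum_single, LinearMap.sum_apply, LinearMap.sum_apply]
  rfl

/-- With a the right multiplication by ∂_j and b the action of ∂_j on N, ρ_j is a − b, and the
candidate inverse replaces the power a^m by the quotient (a^m − b^m)/(a − b). The sums for u + e_j
and for u telescope and leave the original tensor. -/
theorem freeRhoInv_freeRho (N : GradedModule A k) (j : Fin n) (x : WeylAlgebra k n ⊗[k] Total N) :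
    freeRhoInv N j (freeRho N j x) = x := by
  refine freeTensor_induction (f := (freeRhoInv N j).toAddMonoidHom.comp (freeRho N j).toAddMonoidHom)
    (g := AddMonoidHom.id _) (fun p u ν => ?_) x
  change freeRhoInv N j (freeRho N j _) = _
  rw [freeRho_tmul, map_sub, mul_assoc, dMon_mul_dD, freeRhoInv_tmul, freeRhoInv_tmul,
    Finsupp.add_apply, Finsupp.single_eq_same, Finset.sum_range_succ', pow_zero,
    Module.End.one_apply, zero_add, add_tsub_cancel_right, sub_eq_iff_eq_add, add_comm]
  change _ = (inclX p * dMon k u) ⊗ₜ[k] ν + _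
  congr 1
  refine Finset.sum_congr rfl fun m _ => ?_
  rw [add_comm (m + 1) 1, Finsupp.single_add j 1, add_comm u, add_tsub_add_eq_tsub_left, pow_succ]
  rfl

/-- For i ≠ j the operator ρ_i leaves the exponent of ∂_j unchanged, so the range of the sum is the
same on both sides, and the actions of ∂_i and ∂_j on N commute. -/
theorem freeRho_freeRhoInv (N : GradedModule A k) {i j : Fin n} (hij : i ≠ j)
    (x : WeylAlgebra k n ⊗[k] Total N) :
    freeRho N i (freeRhoInv N j x) = freeRhoInv N j (freeRho N i x) := by
  refine freeTensor_induction (f := (freeRho N i).toAddMonoidHom.comp (freeRhoInv N j).toAddMonoidHom)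
    (g := (freeRhoInv N j).toAddMonoidHom.comp (freeRho N i).toAddMonoidHom) (fun p u ν => ?_) x
  change freeRho N i (freeRhoInv N j ((inclX p * dMon k u) ⊗ₜ[k] ν)) =
    freeRhoInv N j (freeRho N i ((inclX p * dMon k u) ⊗ₜ[k] ν))
  have hc : ∀ (m : ℕ) (x : Total N), partialTotal N i ((partialTotal N j ^ m) x) =
      (partialTotal N j ^ m) (partialTotal N i x) := fun m x =>
    LinearMap.congr_fun ((Commute.pow_right (partialTotal_comm N i j) m) : _ * _ = _ * _) x
  rw [freeRho_tmul, map_sub, mul_assoc, dMon_mul_dD, freeRhoInv_tmul, freeRhoInv_tmul,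
    freeRhoInv_tmul, map_sum, Finsupp.add_apply, Finsupp.single_eq_of_ne hij.symm, add_zero,
    ← Finset.sum_sub_distrib]
  refine Finset.sum_congr rfl fun m hm => ?_
  rw [freeRho_tmul, mul_assoc, dMon_mul_dD, hc]
  congr 4
  ext l
  have hm' : m < u j := Finset.mem_range.1 hm
  by_cases hl : l = j
  · subst hl; simp [Finsupp.single_eq_of_ne hij.symm]
  · simp [Finsupp.single_eq_of_ne hl]

end LeftInverse

/-! ### The augmentation to the Euler–Koszul complex is a quasi-isomorphism. -/

section Augmentation

variable {d n : ℕ} {A : Matrix (Fin d) (Fin n) ℤ} {k : Type u} [Field k] (β : Fin d → k)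

theorem totDegree_univ (t : Finset (Fin d)) :
    totDegree (t, (Finset.univ : Finset (Fin n))) = -t.card := by
  simp [totDegree]

/-- The projection to the top exterior power in the second variable. -/
def topIndex (p : ℤ) (t : {t : Finset (Fin d) // (t.card : ℤ) = -p}) :
    {i : Finset (Fin d) × Finset (Fin n) // totDegree i = p} :=
  ⟨(t.1, Finset.univ), by rw [totDegree_univ, t.2, neg_neg]⟩

theorem toInduced_extDeg (N : GradedModule A k) {p : ℤ}
    (ω : {i : Finset (Fin d) × Finset (Fin n) // totDegree i = p} → WeylAlgebra k n ⊗[k] Total N)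
    (t : Finset (Fin d)) :
    toInduced N (extDeg (WeylAlgebra k n) totDegree (WeylAlgebra k n ⊗[k] Total N) p ω
      (t, Finset.univ)) = extHomog (WeylAlgebra k n) (Induced N) d (-p)
        (fun t => toInduced N (ω (topIndex p t))) t := by
  by_cases ht : (t.card : ℤ) = -p
  · have h2 : totDegree (t, (Finset.univ : Finset (Fin n))) = p := by
      rw [totDegree_univ, ht, neg_neg]
    have e : extHomog (WeylAlgebra k n) (Induced N) d (-p)
        (fun t => toInduced N (ω (topIndex p t))) t = toInduced N (ω (topIndex p ⟨t, ht⟩)) :=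
      dif_pos ht
    rw [e]
    exact congrArg (toInduced N) (dif_pos h2)
  · have h2 : totDegree (t, (Finset.univ : Finset (Fin n))) ≠ p := by
      rw [totDegree_univ]; omega
    rw [extHomog_apply_of_ne _ ht, extDeg_apply_of_ne _ h2, map_zero]

theorem toInduced_freeDiff (N : GradedModule A k)
    (ω : Finset (Fin d) × Finset (Fin n) → WeylAlgebra k n ⊗[k] Total N) (t : Finset (Fin d)) :
    toInduced N (freeDiff β N ω (t, Finset.univ)) =
      koszulDiff (eulerShift β N) (fun t => toInduced N (ω (t, Finset.univ))) t := by
  rw [totDiff_apply, map_add, wedgeDiff_apply, map_zsmul, map_sum, Finset.sum_eq_zero, smul_zero,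
    zero_add, koszulDiff_apply, koszulDiff_apply, map_sum]
  · exact Finset.sum_congr rfl fun i _ => by rw [map_zsmul, toInduced_freeEuler]
  · exact fun i _ => by rw [map_zsmul, toInduced_freeRho, smul_zero]

/-- The augmentation from the free resolution to the Euler–Koszul complex. -/
def freeAugmentation (N : GradedModule A k) : freeResolution β N ⟶ (eulerKoszul A β).obj N where
  f p := ModuleCat.ofHom (LinearMap.pi fun t => toInduced N ∘ₗ LinearMap.proj (topIndex p t))
  comm' p q _ := by
    refine ModuleCat.hom_ext (LinearMap.ext fun ω => funext fun t => ?_)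
    change koszulDiff (eulerShift β N) (extHomog (WeylAlgebra k n) (Induced N) d (-p)
        (fun t => toInduced N (ω (topIndex p t)))) t.1 = toInduced N (freeDiff β N
          (extDeg (WeylAlgebra k n) totDegree (WeylAlgebra k n ⊗[k] Total N) p ω) (t.1, Finset.univ))
    rw [toInduced_freeDiff]
    exact congrFun (congrArg _ (funext fun t => (toInduced_extDeg N ω t).symm)) t.1

theorem freeAugmentation_naturality {N N' : GradedModule A k} (φ : N ⟶ N') :
    freeResolutionMap β φ ≫ freeAugmentation β N' =
      freeAugmentation β N ≫ (eulerKoszul A β).map φ := by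
  ext p : 1
  refine ModuleCat.hom_ext (LinearMap.ext fun ω => funext fun t => ?_)
  change toInduced N' (freeMap φ (ω (topIndex p t))) = inducedMap φ (toInduced N (ω (topIndex p t)))
  refine freeTensor_ext (f := (toInduced N' ∘ₗ freeMap φ).toAddMonoidHom)
    (g := (inducedMap φ ∘ₗ toInduced N).toAddMonoidHom) (fun P ν => rfl) (ω (topIndex p t))

theorem freeAugmentation_surjective (N : GradedModule A k) (p : ℤ) (x : ((eulerKoszul A β).obj N).X p) :
    ∃ y, (freeAugmentation β N).f p y = x := by
  choose g hg using toInduced_surjective N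
  let x' : {t : Finset (Fin d) // (t.card : ℤ) = -p} → Induced N := x
  refine ⟨fun i => if h : (i.1.1.card : ℤ) = -p then g (x' ⟨i.1.1, h⟩) else 0, ?_⟩
  funext t
  change toInduced N (dite _ _ _) = x' t
  exact (congrArg (toInduced N) (dif_pos t.2)).trans (hg _)

variable [CharZero k]

theorem exists_freeDiff_eq (N : GradedModule A k)
    (ω : Finset (Fin d) × Finset (Fin n) → WeylAlgebra k n ⊗[k] Total N)
    (hω : freeDiff β N ω = 0) (hq : ∀ t, toInduced N (ω (t, Finset.univ)) = 0) :
    ∃ η, (∀ t, η (t, Finset.univ) = 0) ∧ freeDiff β N η = ω :=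
  (freeCompatible β N).exact_of_leftInverse (fun j => (freeRhoInv N j).toAddMonoidHom)
    (fun _ _ hij m => freeRho_freeRhoInv N hij m) (freeRhoInv_freeRho N)
    (toInduced N).toAddMonoidHom (toInduced_freeRho N) (exists_of_toInduced_eq_zero N) ω hω hq

/-- The kernel of the augmentation is acyclic. -/
theorem exists_freeResolution_d_eq (N : GradedModule A k) {q p : ℤ} (hpq : q + 1 = p)
    (ω : (freeResolution β N).X p)
    (hω : (freeResolution β N).d p (p + 1) ω = 0) (hq : (freeAugmentation β N).f p ω = 0) :
    ∃ η, (freeAugmentation β N).f q η = 0 ∧ ω = (freeResolution β N).d q p η := by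
  have h1 := (indexedComplex_d_eq_zero_iff (freeCompatible β N).isDegreeOne p ω).1 hω
  obtain ⟨η, hη, hη'⟩ := exists_freeDiff_eq β N _ h1 fun t => by
    refine (toInduced_extDeg N ω t).trans ?_
    refine (congrFun (congrArg _ hq) t).trans ?_
    exact congrFun (map_zero (extHomog (WeylAlgebra k n) (Induced N) d (-p))) t
  refine ⟨resDeg (WeylAlgebra k n) totDegree (WeylAlgebra k n ⊗[k] Total N) q η, ?_, ?_⟩
  · funext t
    exact (congrArg (toInduced N) (hη t.1)).trans (map_zero _)
  · refine (resDeg_extDeg (S := WeylAlgebra k n) (deg := totDegree)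
      (X := WeylAlgebra k n ⊗[k] Total N) ω).symm.trans ?_
    rw [← hη']
    funext i
    exact ((freeCompatible β N).isDegreeOne.apply_extDeg_resDeg q η i.1
      (by rw [i.2, hpq])).symm

/-- The augmentation is surjective in every degree and its kernel is acyclic: arbitrary lifts of
cycles and of bounding elements are corrected by primitives taken inside the kernel. -/
theorem quasiIso_freeAugmentation (N : GradedModule A k) : QuasiIso (freeAugmentation β N) := by
  have hcomm : ∀ p q x, (freeAugmentation β N).f q ((freeResolution β N).d p q x) =
      ((eulerKoszul A β).obj N).d p q ((freeAugmentation β N).f p x) := fun p q x => by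
    rw [← ModuleCat.comp_apply, ← (freeAugmentation β N).comm, ModuleCat.comp_apply]
  refine quasiIso_of_cycles _ _ _ (fun p x hx => ?_) (fun p y hy z hz => ?_)
  · obtain ⟨y, rfl⟩ := freeAugmentation_surjective β N p x
    obtain ⟨η, hη, hη'⟩ := exists_freeResolution_d_eq β N (q := p) rfl
      ((freeResolution β N).d p (p + 1) y)
      (by rw [← ModuleCat.comp_apply, HomologicalComplex.d_comp_d]; rfl) (by rw [hcomm, hx])
    exact ⟨y - η, by rw [map_sub, ← hη', sub_self], 0, by rw [map_sub, hη, map_zero]; simp⟩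
  · obtain ⟨z, rfl⟩ := freeAugmentation_surjective β N (p - 1) z
    obtain ⟨η, -, hη'⟩ := exists_freeResolution_d_eq β N (q := p - 1) (sub_add_cancel p 1)
      (y - (freeResolution β N).d (p - 1) p z)
      (by rw [map_sub, hy, ← ModuleCat.comp_apply, HomologicalComplex.d_comp_d]; exact sub_self _)
      (by rw [map_sub, hz, hcomm, sub_self])
    exact ⟨η + z, by rw [map_add, ← hη']; abel⟩

end Augmentation
end
end EulerKoszul

namespace EulerKoszul
noncomputable section

/-! ### Operators that are scalar on each graded piece. -/

section DiagonalOperators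

variable {d n : ℕ} {A : Matrix (Fin d) (Fin n) ℤ} {k : Type u} [Field k]

/-- The operator on `N` that multiplies a homogeneous element of degree `α` by `c α`. -/
def diagTotal (N : GradedModule A k) (c : (Fin d → ℤ) → k) : Module.End k (Total N) :=
  fromTotal N fun α => c α.deg • incl N α

theorem diagTotal_incl (N : GradedModule A k) (c : (Fin d → ℤ) → k) (α : DegreeCat A)
    (x : N.obj α) : diagTotal N c (incl N α x) = c α.deg • incl N α x :=
  fromTotal_incl _ _ _ _

theorem degreeOp_eq_diagTotal (N : GradedModule A k) (i : Fin d) :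
    degreeOp N i = diagTotal N fun α => (α i : k) := by
  refine total_hom_ext fun α x => ?_
  rw [degreeOp_incl, diagTotal_incl, Int.cast_smul_eq_zsmul]

theorem diagTotal_partial (N : GradedModule A k) (c : (Fin d → ℤ) → k) (j : Fin n) (x : Total N) :
    diagTotal N c (partialTotal N j x) =
      partialTotal N j (diagTotal N (fun α => c (α + weight A (Pi.single j 1))) x) := by
  have : diagTotal N c ∘ₗ partialTotal N j =
      partialTotal N j ∘ₗ diagTotal N (fun α => c (α + weight A (Pi.single j 1))) := by
    refine total_hom_ext fun α x => ?_
    rw [LinearMap.comp_apply, LinearMap.comp_apply, partialTotal_incl, diagTotal_incl,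
      diagTotal_incl, map_smul, partialTotal_incl]
    rfl
  exact LinearMap.congr_fun this x

theorem diagTotal_mul (N : GradedModule A k) (b c : (Fin d → ℤ) → k) (x : Total N) :
    diagTotal N b (diagTotal N c x) = diagTotal N (fun α => b α * c α) x := by
  have : diagTotal N b ∘ₗ diagTotal N c = diagTotal N (fun α => b α * c α) := by
    refine total_hom_ext fun α x => ?_
    rw [LinearMap.comp_apply, diagTotal_incl, map_smul, diagTotal_incl, diagTotal_incl, smul_smul,
      mul_comm]
  exact LinearMap.congr_fun this x

theorem diagTotal_sum {ι : Type*} (S : Finset ι) (N : GradedModule A k) (c : ι → (Fin d → ℤ) → k) (x : Total N) :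
    diagTotal N (fun α => ∑ i ∈ S, c i α) x = ∑ i ∈ S, diagTotal N (c i) x := by
  have : diagTotal N (fun α => ∑ i ∈ S, c i α) = ∑ i ∈ S, diagTotal N (c i) := by
    refine total_hom_ext fun α x => ?_
    rw [diagTotal_incl, LinearMap.sum_apply, Finset.sum_smul]
    exact Finset.sum_congr rfl fun i _ => (diagTotal_incl _ _ _ _).symm
  rw [this, LinearMap.sum_apply]

theorem diagTotal_const (N : GradedModule A k) (c : k) (x : Total N) :
    diagTotal N (fun _ => c) x = c • x := by
  have : diagTotal N (fun _ => c) = c • LinearMap.id := by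
    refine total_hom_ext fun α x => ?_
    rw [diagTotal_incl]
    rfl
  rw [this]
  rfl

theorem diagTotal_add (N : GradedModule A k) (b c : (Fin d → ℤ) → k) (x : Total N) :
    diagTotal N (fun α => b α + c α) x = diagTotal N b x + diagTotal N c x := by
  have : diagTotal N (fun α => b α + c α) = diagTotal N b + diagTotal N c := by
    refine total_hom_ext fun α x => ?_
    rw [LinearMap.add_apply, diagTotal_incl, diagTotal_incl, diagTotal_incl, add_smul]
  rw [this, LinearMap.add_apply]

theorem totalMapₗ_diagTotal {N N' : GradedModule A k} (φ : N ⟶ N') (c : (Fin d → ℤ) → k)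
    (x : Total N) : totalMapₗ φ (diagTotal N c x) = diagTotal N' c (totalMapₗ φ x) := by
  have : totalMapₗ φ ∘ₗ diagTotal N c = diagTotal N' c ∘ₗ totalMapₗ φ := by
    refine total_hom_ext fun α x => ?_
    simp only [LinearMap.comp_apply, diagTotal_incl, totalMapₗ_incl, map_smul]
  exact LinearMap.congr_fun this x

end DiagonalOperators

/-! ### Functions on exponents, with difference and diagonal operators. -/

section ExponentFunctions

variable {d n : ℕ} {A : Matrix (Fin d) (Fin n) ℤ} {k : Type u} [Field k]

/-- The functions from the exponents `ℕ^n` to `N`. -/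
abbrev ExpFun (N : GradedModule A k) : Type u := (Fin n → ℕ) → Total N

/-- The operator `f ↦ (v ↦ f(v + e_j) - ∂_j f(v))`. -/
def diffOp (N : GradedModule A k) (j : Fin n) : Module.End k (ExpFun N) :=
  LinearMap.funLeft k (Total N) (fun v => v + Pi.single j 1) - (partialTotal N j).compLeft (Fin n → ℕ)

theorem diffOp_apply (N : GradedModule A k) (j : Fin n) (f : ExpFun N) (v : Fin n → ℕ) :
    diffOp N j f v = f (v + Pi.single j 1) - partialTotal N j (f v) := rfl

theorem diffOp_comm (N : GradedModule A k) (i j : Fin n) (f : ExpFun N) :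
    diffOp N i (diffOp N j f) = diffOp N j (diffOp N i f) := by
  funext v
  simp only [diffOp_apply, map_sub]
  rw [partialTotal_comm_apply N i j, add_right_comm]
  abel

/-- The exponent of the squarefree monomial of a set of variables. -/
def ind (s : Finset (Fin n)) : Fin n → ℕ := fun j => if j ∈ s then 1 else 0

theorem ind_erase_add {s : Finset (Fin n)} {j : Fin n} (hj : j ∈ s) :
    ind (s.erase j) + Pi.single j 1 = ind s := by
  funext l
  by_cases h : l = j
  · subst h; simp [ind, hj]
  · simp [ind, h]

theorem weight_ind (s : Finset (Fin n)) (i : Fin d) : weight A (ind s) i = ∑ j ∈ s, A i j := by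
  simp [weight, Matrix.mulVec, dotProduct, ind]

/-- The diagonal operators on functions on `ℕ^n`, where the value at `v` of degree `μ + A(v + 1_s)`
is given the degree `μ`. -/
def diagFun (N : GradedModule A k) (s : Finset (Fin n)) (c : (Fin d → ℤ) → k) :
    Module.End k (ExpFun N) :=
  LinearMap.pi fun v => diagTotal N (fun α => c (α - weight A (v + ind s))) ∘ₗ
    LinearMap.proj (R := k) (φ := fun _ => Total N) v

theorem diagFun_apply (N : GradedModule A k) (s : Finset (Fin n)) (c : (Fin d → ℤ) → k)
    (f : ExpFun N) (v : Fin n → ℕ) :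
    diagFun N s c f v = diagTotal N (fun α => c (α - weight A (v + ind s))) (f v) := rfl

/-- The degree attached to a value α at v in component s is α − A(v + 1_s). It is the same for f(v +
e_j) and for ∂_j f(v) when f sits in component s ∖ j, because v + e_j + 1_{s∖j} = v + 1_s and ∂_j
raises degrees by a_j. -/
theorem diagFun_diffOp (N : GradedModule A k) {s : Finset (Fin n)} {j : Fin n} (hj : j ∈ s)
    (c : (Fin d → ℤ) → k) (f : ExpFun N) :
    diagFun N s c (diffOp N j f) = diffOp N j (diagFun N (s.erase j) c f) := by
  funext v
  have h : v + ind s = v + Pi.single j 1 + ind (s.erase j) := by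
    rw [← ind_erase_add hj]; abel
  have h' : ∀ α : Fin d → ℤ, α + weight A (Pi.single j 1) - weight A (v + ind s) =
      α - weight A (v + ind (s.erase j)) := fun α => by
    rw [h, add_right_comm, weight_add _ (v + _)]; abel
  rw [diagFun_apply, diffOp_apply, diffOp_apply, diagFun_apply, diagFun_apply, map_sub,
    diagTotal_partial]
  simp only [h']
  rw [h]

theorem diagFun_mul (N : GradedModule A k) (s : Finset (Fin n)) (b c : (Fin d → ℤ) → k)
    (f : ExpFun N) :
    diagFun N s b (diagFun N s c f) = diagFun N s (fun α => b α * c α) f :=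
  funext fun v => by
    rw [diagFun_apply, diagFun_apply, diagFun_apply]
    exact diagTotal_mul N _ _ (f v)

theorem diagFun_comm (N : GradedModule A k) (s : Finset (Fin n)) (b c : (Fin d → ℤ) → k)
    (f : ExpFun N) : diagFun N s b (diagFun N s c f) = diagFun N s c (diagFun N s b f) := by
  rw [diagFun_mul, diagFun_mul]
  simp only [mul_comm]

/-- The functions of finite support. -/
def finiteFun (N : GradedModule A k) : Submodule k (ExpFun N) where
  carrier := {f | (Function.support f).Finite}
  zero_mem' := by simp
  add_mem' hf hg := (hf.union hg).subset (Function.support_add _ _)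
  smul_mem' c f hf := hf.subset (Function.support_const_smul_subset c f)

theorem diffOp_mem (N : GradedModule A k) (j : Fin n) (f : ExpFun N) (hf : f ∈ finiteFun N) :
    diffOp N j f ∈ finiteFun N := by
  have h1 : (Function.support fun v => f (v + Pi.single j 1)).Finite :=
    Set.Finite.preimage (f := fun v : Fin n → ℕ => v + Pi.single j 1)
      (add_left_injective (Pi.single j 1)).injOn hf
  refine (h1.union hf).subset fun v hv => ?_
  by_contra hv'
  simp only [Set.mem_union, Function.mem_support, not_or, not_not] at hv'
  exact hv (by rw [diffOp_apply, hv'.1, hv'.2, map_zero, sub_zero])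

theorem diagFun_mem (N : GradedModule A k) (s : Finset (Fin n)) (c : (Fin d → ℤ) → k)
    (f : ExpFun N) (hf : f ∈ finiteFun N) : diagFun N s c f ∈ finiteFun N := by
  refine Set.Finite.subset hf fun v hv h => hv ?_
  rw [diagFun_apply, h, map_zero]

/-- The operators `diffOp` on functions of finite support. -/
def finiteDiffOp (N : GradedModule A k) (j : Fin n) : Module.End k (finiteFun N) :=
  (diffOp N j).restrict (diffOp_mem N j)

/-- The operators `diagFun` on functions of finite support. -/
def finiteDiagFun (N : GradedModule A k) (s : Finset (Fin n)) (c : (Fin d → ℤ) → k) :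
    Module.End k (finiteFun N) :=
  (diagFun N s c).restrict (diagFun_mem N s c)

/-- The operator `E_i - β_i` on a homogeneous element of a given degree. -/
abbrev eulerScalar (β : Fin d → k) (i : Fin d) : (Fin d → ℤ) → k := fun μ => (μ i : k) - β i

/-- The image of the Euler operators. -/
def finiteEuler (β : Fin d → k) (N : GradedModule A k) (s : Finset (Fin n)) (i : Fin d) :
    Module.End k (finiteFun N) :=
  finiteDiagFun N s (eulerScalar β i)

theorem finiteCompatible (β : Fin d → k) (N : GradedModule A k) :
    TotCompatible (finiteDiffOp N) (finiteEuler β N) where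
  rho_comm i l f := Subtype.ext (diffOp_comm N i l f.1)
  euler_comm s i l f := Subtype.ext (diagFun_comm N s (eulerScalar β i) (eulerScalar β l) f.1)
  euler_rho _ _ hj i f := Subtype.ext (diagFun_diffOp N hj (eulerScalar β i) f.1)

/-- The map of functions induced by a morphism. -/
def expMap {N N' : GradedModule A k} (φ : N ⟶ N') : ExpFun N →ₗ[k] ExpFun N' :=
  (totalMapₗ φ).compLeft (Fin n → ℕ)

theorem expMap_apply {N N' : GradedModule A k} (φ : N ⟶ N') (f : ExpFun N) (v : Fin n → ℕ) :
    expMap φ f v = totalMapₗ φ (f v) := rfl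

theorem expMap_mem {N N' : GradedModule A k} (φ : N ⟶ N') (f : ExpFun N) (hf : f ∈ finiteFun N) :
    expMap φ f ∈ finiteFun N' := by
  refine Set.Finite.subset hf fun v hv h => hv ?_
  rw [expMap_apply, h, map_zero]

theorem diffOp_expMap {N N' : GradedModule A k} (φ : N ⟶ N') (j : Fin n) (f : ExpFun N) :
    diffOp N' j (expMap φ f) = expMap φ (diffOp N j f) := by
  funext v
  rw [expMap_apply, diffOp_apply, diffOp_apply, map_sub, totalMapₗ_partial]
  rfl

theorem diagFun_expMap {N N' : GradedModule A k} (φ : N ⟶ N') (s : Finset (Fin n))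
    (c : (Fin d → ℤ) → k) (f : ExpFun N) :
    diagFun N' s c (expMap φ f) = expMap φ (diagFun N s c f) :=
  funext fun v => (totalMapₗ_diagTotal φ (fun α => c (α - weight A (v + ind s))) (f v)).symm

/-- The map of functions of finite support induced by a morphism. -/
def finiteMap {N N' : GradedModule A k} (φ : N ⟶ N') : finiteFun N →ₗ[k] finiteFun N' :=
  (expMap φ).restrict (expMap_mem φ)

/-- The complex of functions of finite support on `ℕ^n` that computes the de Rham complex of the
free resolution. -/
def finiteComplex (β : Fin d → k) (N : GradedModule A k) : CochainComplex (ModuleCat.{u} k) ℤ :=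
  indexedComplex totDegree (totDiff (finiteDiffOp N) (finiteEuler β N))
    (finiteCompatible β N).isDegreeOne

/-- The map of complexes of functions induced by a morphism. -/
def finiteComplexMap (β : Fin d → k) {N N' : GradedModule A k} (φ : N ⟶ N') :
    finiteComplex β N ⟶ finiteComplex β N' :=
  indexedMap _ _ (finiteMap φ) (totDiff_map _
    (fun j x => Subtype.ext (diffOp_expMap φ j x.1))
    (fun s i x => Subtype.ext (diagFun_expMap φ s (eulerScalar β i) x.1)))

end ExponentFunctions

/-! ### Coordinates on (D/∂D) ⊗ N. -/

section Residues

variable {d n : ℕ} {A : Matrix (Fin d) (Fin n) ℤ} {k : Type u} [Field k] 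

/-- The coordinates of a polynomial with respect to the basis `(-1)^|v| x^v / v!`. -/
def dividedCoeff (v : Fin n → ℕ) : MvPolynomial (Fin n) k →ₗ[k] k :=
  ((-1) ^ (∑ j, v j) * (∏ j, (v j).factorial : ℕ) : k) •
    MvPolynomial.lcoeff k (Finsupp.equivFunOnFinite.symm v)

theorem dividedCoeff_apply (v : Fin n → ℕ) (p : MvPolynomial (Fin n) k) :
    dividedCoeff v p = ((-1) ^ (∑ j, v j) * (∏ j, (v j).factorial : ℕ) : k) *
      MvPolynomial.coeff (Finsupp.equivFunOnFinite.symm v) p := rfl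

theorem equivFunOnFinite_symm_add (v : Fin n → ℕ) (j : Fin n) :
    Finsupp.equivFunOnFinite.symm (v + Pi.single j 1) =
      Finsupp.equivFunOnFinite.symm v + Finsupp.single j 1 := by
  ext l
  by_cases h : l = j
  · subst h; simp
  · simp [h]

/-- The signs and factorials in the basis are chosen so that −∂/∂x_j, which is right multiplication
by ∂_j on residues, becomes a plain shift of exponents. -/
theorem dividedCoeff_pderiv (v : Fin n → ℕ) (j : Fin n) (p : MvPolynomial (Fin n) k) :
    dividedCoeff v (-MvPolynomial.pderiv j p) = dividedCoeff (v + Pi.single j 1) p := by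
  have h1 : ∑ l, (v + Pi.single j 1 : Fin n → ℕ) l = ∑ l, v l + 1 := by
    simp [Finset.sum_add_distrib]
  have h2 : ∏ l, ((v + Pi.single j 1 : Fin n → ℕ) l).factorial = (v j + 1) * ∏ l, (v l).factorial := by
    rw [← Finset.mul_prod_erase _ _ (Finset.mem_univ j),
      ← Finset.mul_prod_erase (a := j) _ (fun j => (v j).factorial) (Finset.mem_univ j), ← mul_assoc]
    congr 1
    · simp [Nat.factorial_succ]
    · refine Finset.prod_congr rfl fun l hl => ?_
      simp [(Finset.mem_erase.1 hl).1]
  rw [map_neg, dividedCoeff_apply, dividedCoeff_apply, equivFunOnFinite_symm_add,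
    MvPolynomial.coeff_pderiv, h1, h2, Finsupp.equivFunOnFinite_symm_apply_apply]
  push_cast
  ring

theorem dividedCoeff_pderiv_mul (v : Fin n → ℕ) (j : Fin n) (p : MvPolynomial (Fin n) k) :
    dividedCoeff v (MvPolynomial.pderiv j (MvPolynomial.X j * p)) = (v j + 1) * dividedCoeff v p := by
  rw [dividedCoeff_apply, dividedCoeff_apply, MvPolynomial.coeff_pderiv, mul_comm (MvPolynomial.X j),
    MvPolynomial.coeff_mul_X, Finsupp.equivFunOnFinite_symm_apply_apply]
  ring

theorem exists_sum_dD_mul {P : WeylAlgebra k n} (hP : P ∈ partialIdeal k n) :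
    ∃ c : Fin n → WeylAlgebra k n, P = ∑ j, dD k n j * c j := by
  obtain ⟨c, rfl⟩ := (Submodule.mem_span_range_iff_exists_fun _).1 hP
  exact ⟨fun j => (c j).unop, rfl⟩

variable [CharZero k]

/-- The map `D_A ⊗_k N → (D_A / ∂_A D_A) ⊗_k N`, in coordinates. -/
def residueFun (N : GradedModule A k) : WeylAlgebra k n ⊗[k] Total N →ₗ[k] ExpFun N :=
  LinearMap.pi fun v => TensorProduct.lift (LinearMap.lsmul k (Total N) ∘ₗ
    dividedCoeff v ∘ₗ residue)

theorem residueFun_tmul (N : GradedModule A k) (P : WeylAlgebra k n) (ν : Total N) (v : Fin n → ℕ) :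
    residueFun N (P ⊗ₜ ν) v = dividedCoeff v (residue P) • ν := rfl

theorem residueFun_mem (N : GradedModule A k) (x : WeylAlgebra k n ⊗[k] Total N) :
    residueFun N x ∈ finiteFun N := by
  induction x using TensorProduct.induction_on with
  | zero => rw [map_zero]; exact zero_mem _
  | add x y hx hy => rw [map_add]; exact add_mem hx hy
  | tmul P ν =>
    refine Set.Finite.subset (Set.Finite.preimage (f := Finsupp.equivFunOnFinite.symm)
      (Finsupp.equivFunOnFinite.symm.injective).injOn (residue P).support.finite_toSet) fun v hv => ?_
    rw [Set.mem_preimage, Finset.mem_coe, MvPolynomial.mem_support_iff]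
    intro h
    exact hv (by rw [residueFun_tmul, dividedCoeff_apply, h, mul_zero, zero_smul])

theorem residueFun_freeRho (N : GradedModule A k) (j : Fin n) (x : WeylAlgebra k n ⊗[k] Total N) :
    residueFun N (freeRho N j x) = diffOp N j (residueFun N x) := by
  refine freeTensor_ext (f := (residueFun N).toAddMonoidHom.comp (freeRho N j).toAddMonoidHom)
    (g := (diffOp N j ∘ₗ residueFun N).toAddMonoidHom) (fun P ν => funext fun v => ?_) x
  change residueFun N (freeRho N j (P ⊗ₜ ν)) v = diffOp N j (residueFun N (P ⊗ₜ ν)) v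
  rw [freeRho_tmul, map_sub, Pi.sub_apply, diffOp_apply, residueFun_tmul, residueFun_tmul,
    residueFun_tmul, residueFun_tmul, residue_mul_dD, dividedCoeff_pderiv, map_smul]

/-- On the coordinate v, right multiplication by E_i is the scalar −∑_j a_ij(v_j + 1). Adding the
weight of the complement of s from `eulerConst` leaves −A(v + 1_s)_i − β_i, and the degree of ν
supplies the rest. -/
theorem residueFun_freeEuler (β : Fin d → k) (N : GradedModule A k) (s : Finset (Fin n))
    (i : Fin d) (x : WeylAlgebra k n ⊗[k] Total N) :
    residueFun N (freeEuler β N s i x) = diagFun N s (eulerScalar β i) (residueFun N x) := by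
  refine freeTensor_ext (f := (residueFun N).toAddMonoidHom.comp (freeEuler β N s i).toAddMonoidHom)
    (g := (diagFun N s (eulerScalar β i) ∘ₗ residueFun N).toAddMonoidHom)
    (fun P ν => funext fun v => ?_) x
  change residueFun N (freeEuler β N s i (P ⊗ₜ ν)) v = diagFun N s _ (residueFun N (P ⊗ₜ ν)) v
  have h : (fun α : Fin d → ℤ => eulerScalar β i (α - weight A (v + ind s))) =
      fun α => (α i : k) + (-((weight A (v + ind s) i : ℤ) : k) - β i) := by
    funext α
    rw [eulerScalar, Pi.sub_apply, Int.cast_sub]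
    ring
  rw [freeEuler_tmul, map_add, Pi.add_apply, diagFun_apply, residueFun_tmul, residueFun_tmul,
    residueFun_tmul, h, map_smul, diagTotal_add, diagTotal_const, ← degreeOp_eq_diagTotal, smul_add,
    add_comm, smul_smul]
  congr 2
  rw [mul_add, map_add, ← Algebra.commutes, ← Algebra.smul_def, map_smul, map_add,
    residue_mul_euler, map_neg, map_sum, map_smul, smul_eq_mul]
  simp only [map_zsmul, dividedCoeff_pderiv_mul]
  -- Summing over all columns and subtracting those outside s replaces v + 1 by v + 1_s.
  have h2 : ((weight A (v + ind s) i : ℤ) : k) =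
      ∑ j, (A i j : k) * (v j + 1) - ((∑ j ∈ sᶜ, A i j : ℤ) : k) := by
    rw [eq_sub_iff_add_eq, weight_add, Pi.add_apply, weight_ind, ← Int.cast_add, add_assoc,
      Finset.sum_add_sum_compl, weight, Matrix.mulVec, dotProduct, ← Finset.sum_add_distrib,
      Int.cast_sum]
    refine Finset.sum_congr rfl fun j _ => ?_
    push_cast
    ring
  rw [h2, eulerConst]
  simp only [zsmul_eq_mul, ← mul_assoc, ← Finset.sum_mul]
  ring

theorem residueFun_dD_smul (N : GradedModule A k) (j : Fin n) (x : WeylAlgebra k n ⊗[k] Total N) :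
    residueFun N (dD k n j • x) = 0 := by
  induction x using TensorProduct.induction_on with
  | zero => rw [smul_zero, map_zero]
  | add x y hx hy => rw [smul_add, map_add, hx, hy, add_zero]
  | tmul P ν =>
    funext v
    rw [TensorProduct.smul_tmul', residueFun_tmul, smul_eq_mul, residue_dD_mul, map_zero, zero_smul]
    rfl

theorem exists_inclX_rep (N : GradedModule A k) (x : WeylAlgebra k n ⊗[k] Total N) :
    ∃ (f : (Fin n →₀ ℕ) →₀ Total N) (y : Fin n → WeylAlgebra k n ⊗[k] Total N),
      x = (f.sum fun u ν => inclX (MvPolynomial.monomial u 1) ⊗ₜ ν) + ∑ j, dD k n j • y j := by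
  induction x using TensorProduct.induction_on with
  | zero => exact ⟨0, 0, by simp⟩
  | add x x' hx hx' =>
    obtain ⟨f, y, rfl⟩ := hx
    obtain ⟨f', y', rfl⟩ := hx'
    refine ⟨f + f', y + y', ?_⟩
    rw [Finsupp.sum_add_index' (by simp) (by simp [TensorProduct.tmul_add])]
    simp only [Pi.add_apply, smul_add, Finset.sum_add_distrib]
    abel
  | tmul P ν =>
    obtain ⟨c, hc⟩ := exists_sum_dD_mul (residue_mem P)
    have hz := (TensorProduct.equivFinsuppOfBasisLeft
      (MvPolynomial.basisMonomials (Fin n) k)).symm_apply_apply (residue P ⊗ₜ[k] ν)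
    rw [TensorProduct.equivFinsuppOfBasisLeft_symm_apply] at hz
    refine ⟨TensorProduct.equivFinsuppOfBasisLeft (MvPolynomial.basisMonomials (Fin n) k)
        (residue P ⊗ₜ[k] ν), fun j => c j ⊗ₜ ν, ?_⟩
    · have hz' := congrArg (LinearMap.rTensor (Total N) (inclX (k := k) (n := n)).toLinearMap) hz
      rw [Finsupp.sum, map_sum] at hz'
      rw [Finsupp.sum]
      refine Eq.trans ?_ (congrArg (· + _) hz'.symm)
      rw [LinearMap.rTensor_tmul, ← sub_eq_iff_eq_add']
      change P ⊗ₜ[k] ν - inclX (residue P) ⊗ₜ[k] ν = _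
      rw [← TensorProduct.sub_tmul, hc, TensorProduct.sum_tmul]
      rfl

theorem residueFun_inclX_monomial (N : GradedModule A k) (u : Fin n →₀ ℕ) (ν : Total N)
    (v : Fin n → ℕ) :
    residueFun N (inclX (MvPolynomial.monomial u 1) ⊗ₜ ν) v =
      if u = Finsupp.equivFunOnFinite.symm v then
        ((-1) ^ (∑ j, v j) * (∏ j, (v j).factorial : ℕ) : k) • ν else 0 := by
  rw [residueFun_tmul, residue_inclX, dividedCoeff_apply, MvPolynomial.coeff_monomial]
  split_ifs <;> simp

theorem dividedFactor_ne_zero (v : Fin n → ℕ) :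
    ((-1) ^ (∑ j, v j) * (∏ j, (v j).factorial : ℕ) : k) ≠ 0 :=
  mul_ne_zero (by simp) (Nat.cast_ne_zero.2 (Finset.prod_ne_zero_iff.2 fun _ _ =>
    Nat.factorial_ne_zero _))

theorem residueFun_rep (N : GradedModule A k) (f : (Fin n →₀ ℕ) →₀ Total N) (v : Fin n → ℕ) :
    residueFun N (f.sum fun u ν => inclX (MvPolynomial.monomial u 1) ⊗ₜ ν) v =
      ((-1) ^ (∑ j, v j) * (∏ j, (v j).factorial : ℕ) : k) •
        f (Finsupp.equivFunOnFinite.symm v) := by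
  rw [Finsupp.sum, map_sum, Finset.sum_apply]
  simp only [residueFun_inclX_monomial]
  rw [Finset.sum_ite_eq']
  split_ifs with h
  · rfl
  · rw [Finsupp.notMem_support_iff.1 h, smul_zero]

theorem exists_residueFun_eq (N : GradedModule A k) (f : ExpFun N) (hf : f ∈ finiteFun N) :
    ∃ x, residueFun N x = f := by
  have hf' : (Function.support f).Finite := hf
  let g : (Fin n →₀ ℕ) →₀ Total N := Finsupp.onFinset (hf'.toFinset.map
    Finsupp.equivFunOnFinite.symm.toEmbedding)
    (fun u => ((-1) ^ (∑ j, u j) * (∏ j, (u j).factorial : ℕ) : k)⁻¹ • f u) (by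
      intro u hu
      refine Finset.mem_map.2 ⟨u, hf'.mem_toFinset.2 fun h => hu (by rw [h, smul_zero]), ?_⟩
      exact Finsupp.equivFunOnFinite.symm_apply_apply u)
  refine ⟨_, funext fun v => (residueFun_rep N g v).trans ?_⟩
  exact smul_inv_smul₀ (dividedFactor_ne_zero v) (f v)

/-- Modulo the left multiples by the ∂_j the tensor is a finite sum of x^u ⊗ ν_u, and its
coordinates are the ν_u up to factors ± u!, nonzero in characteristic zero. -/
theorem exists_of_residueFun_eq_zero (N : GradedModule A k) (x : WeylAlgebra k n ⊗[k] Total N)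
    (hx : residueFun N x = 0) :
    ∃ y : Fin n → WeylAlgebra k n ⊗[k] Total N, x = ∑ j, dD k n j • y j := by
  obtain ⟨f, y, rfl⟩ := exists_inclX_rep N x
  rw [map_add, map_sum, Finset.sum_eq_zero (fun j _ => residueFun_dD_smul N j _), add_zero] at hx
  have hf : f = 0 := by
    ext u
    have := (residueFun_rep N f u).symm.trans ((congrFun hx u).trans (Pi.zero_apply _))
    exact (smul_eq_zero_iff_right (dividedFactor_ne_zero (k := k) ⇑u)).1
      (by rwa [Finsupp.equivFunOnFinite_symm_coe] at this)
  exact ⟨y, by rw [hf, Finsupp.sum_zero_index, zero_add]⟩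

theorem residueFun_freeMap {N N' : GradedModule A k} (φ : N ⟶ N')
    (x : WeylAlgebra k n ⊗[k] Total N) :
    residueFun N' (freeMap φ x) = expMap φ (residueFun N x) := by
  refine freeTensor_ext (f := (residueFun N').toAddMonoidHom.comp (freeMap φ).toAddMonoidHom)
    (g := (expMap φ ∘ₗ residueFun N).toAddMonoidHom) (fun P ν => funext fun v => ?_) x
  change residueFun N' (freeMap φ (P ⊗ₜ ν)) v = expMap φ (residueFun N (P ⊗ₜ ν)) v
  rw [freeMap_tmul, expMap_apply, residueFun_tmul, residueFun_tmul, map_smul]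

end Residues
end
end EulerKoszul

namespace EulerKoszul
noncomputable section

/-! ### Tensoring the free resolution with D/∂D. -/

section DeRhamResolution

open scoped ModuleCat.Algebra

variable {d n : ℕ} {A : Matrix (Fin d) (Fin n) ℤ} {k : Type u} [Field k]

theorem totDiff_addMap {S S' : Type u} [Ring S] [Ring S'] {X X' : Type u} [AddCommGroup X]
    [Module S X] [AddCommGroup X'] [Module S' X']
    {ρ : Fin n → Module.End S X} {E : Finset (Fin n) → Fin d → Module.End S X}
    {ρ' : Fin n → Module.End S' X'} {E' : Finset (Fin n) → Fin d → Module.End S' X'}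
    (g : X →+ X') (hρ : ∀ j x, ρ' j (g x) = g (ρ j x)) (hE : ∀ s i x, E' s i (g x) = g (E s i x))
    (ω : Finset (Fin d) × Finset (Fin n) → X) (l : Finset (Fin d) × Finset (Fin n)) :
    totDiff ρ' E' (fun l => g (ω l)) l = g (totDiff ρ E ω l) := by
  obtain ⟨t, s⟩ := l
  simp only [totDiff_apply, wedgeDiff_apply, koszulDiff_apply, map_add, map_zsmul, map_sum, hρ, hE]

/-- The class of `P ⊗ ω`. -/
def deRhamMk {M : ModuleCat.{u} (WeylAlgebra k n)} (P : WeylAlgebra k n) (ω : M) :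
    (deRhamFunctor k n).obj M :=
  Submodule.Quotient.mk (p := balancedRel k (D := WeylAlgebra k n)
    (WeylAlgebra k n ⧸ partialIdeal k n) M)
    ((Submodule.Quotient.mk P : WeylAlgebra k n ⧸ partialIdeal k n) ⊗ₜ[k] ω)

theorem deRhamMk_one_smul {M : ModuleCat.{u} (WeylAlgebra k n)} (P : WeylAlgebra k n) (ω : M) :
    deRhamMk P ω = deRhamMk 1 (P • ω) := by
  refine (Submodule.Quotient.eq _).2 (Submodule.subset_span ⟨Submodule.Quotient.mk 1, P, ω, ?_⟩)
  congr 2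

theorem deRhamMk_add {M : ModuleCat.{u} (WeylAlgebra k n)} (P : WeylAlgebra k n) (ω η : M) :
    deRhamMk P (ω + η) = deRhamMk P ω + deRhamMk P η := by
  exact congrArg (Submodule.Quotient.mk (p := balancedRel k (D := WeylAlgebra k n)
    (WeylAlgebra k n ⧸ partialIdeal k n) M)) (TensorProduct.tmul_add _ ω η)

theorem exists_deRhamMk {M : ModuleCat.{u} (WeylAlgebra k n)} (x : (deRhamFunctor k n).obj M) :
    ∃ ω, x = deRhamMk 1 ω := by
  obtain ⟨x, rfl⟩ := Submodule.Quotient.mk_surjective _ x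
  induction x using TensorProduct.induction_on with
  | zero =>
    refine ⟨0, ?_⟩
    exact congrArg (Submodule.Quotient.mk (p := balancedRel k (D := WeylAlgebra k n)
      (WeylAlgebra k n ⧸ partialIdeal k n) M)) (TensorProduct.tmul_zero _ _).symm
  | add x y hx hy =>
    obtain ⟨ω, hω⟩ := hx
    obtain ⟨η, hη⟩ := hy
    exact ⟨ω + η, by rw [deRhamMk_add, ← hω, ← hη]; rfl⟩
  | tmul y ω =>
    obtain ⟨P, rfl⟩ := Submodule.Quotient.mk_surjective _ y
    exact ⟨P • ω, deRhamMk_one_smul P ω⟩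

theorem deRhamMk_dD_smul {M : ModuleCat.{u} (WeylAlgebra k n)} (j : Fin n) (ω : M) :
    deRhamMk (k := k) 1 (dD k n j • ω) = 0 := by
  rw [← deRhamMk_one_smul]
  have : (Submodule.Quotient.mk (dD k n j) : WeylAlgebra k n ⧸ partialIdeal k n) = 0 :=
    (Submodule.Quotient.mk_eq_zero _).2 (Submodule.subset_span ⟨j, rfl⟩)
  rw [deRhamMk, this, TensorProduct.zero_tmul]
  rfl

theorem deRhamMk_sum {M : ModuleCat.{u} (WeylAlgebra k n)} (P : WeylAlgebra k n) {ι : Type}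
    (S : Finset ι) (ω : ι → M) : deRhamMk P (∑ i ∈ S, ω i) = ∑ i ∈ S, deRhamMk P (ω i) :=
  map_sum (AddMonoidHom.mk' (deRhamMk (M := M) P) (deRhamMk_add P)) ω S

theorem deRham_hom_ext {M : ModuleCat.{u} (WeylAlgebra k n)} {Z : ModuleCat.{u} k}
    {f g : (deRhamFunctor k n).obj M ⟶ Z} (h : ∀ P ω, f (deRhamMk P ω) = g (deRhamMk P ω)) :
    f = g := by
  refine ModuleCat.hom_ext (LinearMap.ext fun x => ?_)
  obtain ⟨ω, rfl⟩ := exists_deRhamMk x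
  exact h 1 ω

variable [CharZero k]

/-- The map `residueFun` with values in the functions of finite support. -/
def residueMap (N : GradedModule A k) : WeylAlgebra k n ⊗[k] Total N →ₗ[k] finiteFun N :=
  (residueFun N).codRestrict (finiteFun N) (residueFun_mem N)

theorem residueMap_dD_smul (N : GradedModule A k) (j : Fin n) (x : WeylAlgebra k n ⊗[k] Total N) :
    residueMap N (dD k n j • x) = 0 := Subtype.ext (residueFun_dD_smul N j x)

theorem residueMap_smul_of_mem (N : GradedModule A k) {P : WeylAlgebra k n}
    (hP : P ∈ partialIdeal k n) (x : WeylAlgebra k n ⊗[k] Total N) : residueMap N (P • x) = 0 := by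
  obtain ⟨c, rfl⟩ := exists_sum_dD_mul hP
  rw [Finset.sum_smul, map_sum]
  exact Finset.sum_eq_zero fun j _ => by rw [mul_smul, residueMap_dD_smul]

/-- The module of families of elements of `D_A ⊗_k N`. -/
abbrev freeFamily (I : Type) (N : GradedModule A k) : ModuleCat.{u} (WeylAlgebra k n) :=
  ModuleCat.of (WeylAlgebra k n) (I → WeylAlgebra k n ⊗[k] Total N)

/-- The additive map `P ↦ residue (P ω)`, for a family `ω`. -/
def residueSmul (I : Type) (N : GradedModule A k) (ω : I → WeylAlgebra k n ⊗[k] Total N) :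
    WeylAlgebra k n →+ (I → finiteFun N) where
  toFun P i := residueMap N (P • ω i)
  map_zero' := by funext i; rw [zero_smul, map_zero]; rfl
  map_add' P Q := by funext i; rw [add_smul, map_add]; rfl

/-- The pairing of `D_A / ∂_A D_A` with families of elements of `D_A ⊗_k N`. -/
def residuePairing (I : Type) (N : GradedModule A k) :
    (WeylAlgebra k n ⧸ partialIdeal k n) →ₗ[k] (freeFamily I N) →ₗ[k] (I → finiteFun N) :=
  LinearMap.mk₂ k (fun y ω => QuotientAddGroup.lift (partialIdeal k n).toAddSubgroup
      (residueSmul I N ω) (fun P hP => funext fun i => residueMap_smul_of_mem N hP _) y)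
    (fun y y' ω => map_add _ y y')
    (fun c y ω => by
      obtain ⟨P, rfl⟩ := Submodule.Quotient.mk_surjective _ y
      funext i
      change residueMap N ((c • P) • ω i) = c • residueMap N (P • ω i)
      rw [smul_assoc, map_smul])
    (fun y ω ω' => by
      obtain ⟨P, rfl⟩ := Submodule.Quotient.mk_surjective _ y
      funext i
      change residueMap N (P • (ω i + ω' i)) = residueMap N (P • ω i) + residueMap N (P • ω' i)
      rw [smul_add, map_add])
    (fun c y ω => by
      obtain ⟨P, rfl⟩ := Submodule.Quotient.mk_surjective _ y
      funext i
      change residueMap N (P • (algebraMap k (WeylAlgebra k n) c • ω i)) =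
        c • residueMap N (P • ω i)
      rw [algebraMap_smul, smul_comm, map_smul])

/-- The identification of `(D_A / ∂_A D_A) ⊗_{D_A} (D_A ⊗_k N)^I` with functions. -/
def deRhamEval (I : Type) (N : GradedModule A k) :
    (deRhamFunctor k n).obj (freeFamily I N) →ₗ[k] (I → finiteFun N) :=
  (balancedRel k (D := WeylAlgebra k n) (WeylAlgebra k n ⧸ partialIdeal k n) (freeFamily I N)).liftQ
    (TensorProduct.lift (residuePairing I N)) (by
      refine Submodule.span_le.2 ?_
      rintro _ ⟨y, a, m, rfl⟩
      obtain ⟨P, rfl⟩ := Submodule.Quotient.mk_surjective _ y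
      rw [SetLike.mem_coe, LinearMap.mem_ker, map_sub, TensorProduct.lift.tmul,
        TensorProduct.lift.tmul, sub_eq_zero]
      funext i
      change residueMap N ((P * a) • m i) = residueMap N (P • (a • m i))
      rw [mul_smul])

theorem deRhamEval_mk (I : Type) (N : GradedModule A k) (P : WeylAlgebra k n)
    (ω : freeFamily I N) (i : I) :
    deRhamEval I N (deRhamMk P ω) i =
      residueMap N (P • (show I → WeylAlgebra k n ⊗[k] Total N from ω) i) := rfl

/-- D/∂D is cyclic, so every class has the form 1 ⊗ ω. If all residues of ω vanish then ω is a sum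
of left multiples by the ∂_j, and these annihilate the class of 1 from the right. -/
theorem deRhamEval_bijective (I : Type) (N : GradedModule A k) :
    Function.Bijective (deRhamEval I N) := by
  constructor
  · rw [injective_iff_map_eq_zero]
    intro x hx
    obtain ⟨ω, rfl⟩ := exists_deRhamMk x
    let ω' : I → WeylAlgebra k n ⊗[k] Total N := ω
    have h : ∀ i, ∃ y : Fin n → WeylAlgebra k n ⊗[k] Total N, ω' i = ∑ j, dD k n j • y j := by
      intro i
      refine exists_of_residueFun_eq_zero N _ ?_
      have := congrFun hx i
      rw [deRhamEval_mk, one_smul] at this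
      exact congrArg Subtype.val this
    choose y hy using h
    have : ω = ∑ j, dD k n j • (show freeFamily I N from fun i => y i j) := by
      change ω' = ∑ j, dD k n j • (fun i => y i j)
      funext i
      rw [hy, Finset.sum_apply]
      rfl
    rw [this, deRhamMk_sum]
    exact Finset.sum_eq_zero fun j _ => deRhamMk_dD_smul j _
  · intro f
    choose x hx using fun i => exists_residueFun_eq N (f i).1 (f i).2
    refine ⟨deRhamMk 1 (show freeFamily I N from x), funext fun i => Subtype.ext ?_⟩
    rw [deRhamEval_mk, one_smul]
    exact hx i

variable (β : Fin d → k)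

/-- The comparison of the de Rham complex of the free resolution with functions of finite
support. -/
def deRhamComparison (N : GradedModule A k) :
    (deRhamComplex k n).obj (freeResolution β N) ⟶ finiteComplex β N where
  f p := ModuleCat.ofHom (deRhamEval {i : Finset (Fin d) × Finset (Fin n) // totDegree i = p} N)
  comm' p q _ := by
    refine deRham_hom_ext fun P ω => ?_
    let ω' : {i : Finset (Fin d) × Finset (Fin n) // totDegree i = p} →
      WeylAlgebra k n ⊗[k] Total N := ω
    funext i
    have hext : extDeg k totDegree (finiteFun N) p (fun i => residueMap N (P • ω' i)) =
        fun l => residueMap N (P • extDeg (WeylAlgebra k n) totDegree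
          (WeylAlgebra k n ⊗[k] Total N) p ω' l) := by
      funext l
      by_cases hl : totDegree l = p
      · have e1 : extDeg k totDegree (finiteFun N) p (fun i => residueMap N (P • ω' i)) l =
          residueMap N (P • ω' ⟨l, hl⟩) := dif_pos hl
        have e2 : extDeg (WeylAlgebra k n) totDegree
          (WeylAlgebra k n ⊗[k] Total N) p ω' l = ω' ⟨l, hl⟩ := dif_pos hl
        rw [e1, e2]
      · rw [extDeg_apply_of_ne _ hl, extDeg_apply_of_ne _ hl, smul_zero, map_zero]
    change totDiff (finiteDiffOp N) (finiteEuler β N)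
      (extDeg k totDegree (finiteFun N) p (fun i => residueMap N (P • ω' i))) i.1 =
      residueMap N (P • freeDiff β N (extDeg (WeylAlgebra k n) totDegree
          (WeylAlgebra k n ⊗[k] Total N) p ω') i.1)
    rw [hext, ← Pi.smul_apply, ← map_smul]
    exact totDiff_addMap (residueMap N).toAddMonoidHom
      (fun j x => Subtype.ext (residueFun_freeRho N j x).symm)
      (fun s i x => Subtype.ext (residueFun_freeEuler β N s i x).symm) _ i.1

instance (N : GradedModule A k) : IsIso (deRhamComparison β N) := by
  have : ∀ p, IsIso ((deRhamComparison β N).f p) := fun p =>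
    (ConcreteCategory.isIso_iff_bijective _).2 (deRhamEval_bijective _ N)
  exact HomologicalComplex.Hom.isIso_of_components _

theorem deRhamComparison_naturality {N N' : GradedModule A k} (φ : N ⟶ N') :
    (deRhamComplex k n).map (freeResolutionMap β φ) ≫ deRhamComparison β N' =
      deRhamComparison β N ≫ finiteComplexMap β φ := by
  ext p : 1
  refine deRham_hom_ext fun P ω => funext fun i => Subtype.ext ?_
  let ω' : {i : Finset (Fin d) × Finset (Fin n) // totDegree i = p} →
    WeylAlgebra k n ⊗[k] Total N := ω
  change residueFun N' (P • freeMap φ (ω' i)) = expMap φ (residueFun N (P • ω' i))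
  rw [← map_smul, residueFun_freeMap]

end DeRhamResolution
end
end EulerKoszul

namespace EulerKoszul
noncomputable section

/-! ### The functorial injective resolution of a graded module. -/

section GradePart

variable {S : Type u} [Ring S] {M : Type u} [AddCommGroup M] [Module S M] {n : ℕ}

/-- The projection to the exterior monomials of degree `i`. -/
def gradePart (S : Type u) [Ring S] {M : Type u} [AddCommGroup M] [Module S M] {n : ℕ} (i : ℕ) :
    (Finset (Fin n) → M) →ₗ[S] (Finset (Fin n) → M) where
  toFun ω s := if s.card = i then ω s else 0
  map_add' ω η := by funext s; by_cases h : s.card = i <;> simp [h]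
  map_smul' c ω := by funext s; by_cases h : s.card = i <;> simp [h]

theorem gradePart_apply (i : ℕ) (ω : Finset (Fin n) → M) (s : Finset (Fin n)) :
    gradePart S i ω s = if s.card = i then ω s else 0 := rfl

theorem gradePart_eq_self {i : ℕ} {ω : Finset (Fin n) → M} (h : ∀ s, s.card ≠ i → ω s = 0) :
    gradePart S i ω = ω := by
  funext s
  rw [gradePart_apply]
  split_ifs with hs
  · rfl
  · exact (h s hs).symm

theorem wedgeDiff_gradePart (φ : Fin n → Module.End S M) (i : ℕ) (ω : Finset (Fin n) → M) :
    wedgeDiff φ (gradePart S i ω) = gradePart S (i + 1) (wedgeDiff φ ω) := by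
  funext s
  rw [gradePart_apply, wedgeDiff_apply]
  split_ifs with hs
  · rw [wedgeDiff_apply]
    refine Finset.sum_congr rfl fun j hj => ?_
    rw [gradePart_apply, if_pos]
    have := Finset.card_erase_add_one hj
    omega
  · refine Finset.sum_eq_zero fun j hj => ?_
    rw [gradePart_apply, if_neg, map_zero, smul_zero]
    have := Finset.card_erase_add_one hj
    omega

theorem wedgeDiff_eq_zero_of_card (φ : Fin n → Module.End S M) {i : ℕ} {ω : Finset (Fin n) → M}
    (h : ∀ s, s.card ≠ i → ω s = 0) (s : Finset (Fin n)) (hs : s.card ≠ i + 1) :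
    wedgeDiff φ ω s = 0 := by
  rw [← gradePart_eq_self (S := S) h, wedgeDiff_gradePart, gradePart_apply, if_neg hs]

end GradePart

section Cochains

variable {d n : ℕ} {A : Matrix (Fin d) (Fin n) ℤ} {k : Type u} [Field k]

/-- The homogeneous elements of degree `γ` of `N`. -/
abbrev homPart (N : GradedModule A k) (γ : Fin d → ℤ) : Submodule k (Total N) :=
  LinearMap.range (incl N ⟨γ⟩)

theorem incl_mem_homPart (N : GradedModule A k) (α : DegreeCat A) (γ : Fin d → ℤ)
    (h : α.deg = γ) (x : N.obj α) : incl N α x ∈ homPart N γ := by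
  subst h
  exact ⟨x, rfl⟩

theorem partial_mem_homPart (N : GradedModule A k) {γ : Fin d → ℤ} {x : Total N}
    (hx : x ∈ homPart N γ) (j : Fin n) :
    partialTotal N j x ∈ homPart N (γ + weight A (Pi.single j 1)) := by
  obtain ⟨x, rfl⟩ := hx
  rw [partialTotal_incl]
  exact incl_mem_homPart N _ _ rfl _

theorem totalMap_mem_homPart {N N' : GradedModule A k} (φ : N ⟶ N') {γ : Fin d → ℤ}
    {x : Total N} (hx : x ∈ homPart N γ) : totalMapₗ φ x ∈ homPart N' γ := by
  obtain ⟨x, rfl⟩ := hx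
  exact ⟨_, (totalMapₗ_incl φ _ x).symm⟩

/-- The families of functions on `ℕ^n` of degree `γ`, where the value at `v` in the component
of `s` has degree `γ + A(v + 1_s)`. -/
def homFamilies (N : GradedModule A k) (γ : Fin d → ℤ) :
    Submodule k (Finset (Fin n) → ExpFun N) where
  carrier := {ω | ∀ s v, ω s v ∈ homPart N (γ + weight A (v + ind s))}
  zero_mem' _ _ := zero_mem _
  add_mem' hω hη s v := add_mem (hω s v) (hη s v)
  smul_mem' c _ hω s v := Submodule.smul_mem _ c (hω s v)

/-- The functions on `ℕ^n` that can occur in the component of `s` in `homFamilies N γ`. -/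
def homFun (N : GradedModule A k) (γ : Fin d → ℤ) (s : Finset (Fin n)) :
    Submodule k (ExpFun N) where
  carrier := {f | ∀ v, f v ∈ homPart N (γ + weight A (v + ind s))}
  zero_mem' _ := zero_mem _
  add_mem' hω hη v := add_mem (hω v) (hη v)
  smul_mem' c _ hω v := Submodule.smul_mem _ c (hω v)

theorem diffOp_mem_homFun (N : GradedModule A k) (γ : Fin d → ℤ) (s : Finset (Fin n)) (j : Fin n)
    (hj : j ∈ s) (f : ExpFun N) (hf : f ∈ homFun N γ (s.erase j)) : diffOp N j f ∈ homFun N γ s := by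
  intro v
  rw [diffOp_apply]
  refine sub_mem ?_ ?_
  · have := hf (v + Pi.single j 1)
    rwa [add_assoc, add_comm (Pi.single j 1), ind_erase_add hj] at this
  · have := partial_mem_homPart N (hf v) j
    rwa [add_assoc, ← weight_add, add_assoc, ind_erase_add hj] at this

theorem wedgeDiff_mem_homFamilies (N : GradedModule A k) {γ : Fin d → ℤ}
    {ω : Finset (Fin n) → ExpFun N} (hω : ω ∈ homFamilies N γ) :
    wedgeDiff (diffOp N) ω ∈ homFamilies N γ := by
  intro s
  change wedgeDiff (diffOp N) ω s ∈ homFun N γ s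
  rw [wedgeDiff_apply]
  exact sum_mem fun j hj => zsmul_mem (diffOp_mem_homFun N γ s j hj _ (hω _)) _

theorem gradePart_mem_homFamilies (N : GradedModule A k) {γ : Fin d → ℤ} (i : ℕ)
    {ω : Finset (Fin n) → ExpFun N} (hω : ω ∈ homFamilies N γ) :
    gradePart k i ω ∈ homFamilies N γ := by
  intro s v
  rw [gradePart_apply]
  split_ifs
  · exact hω s v
  · exact zero_mem _

/-- The terms of the injective resolution, in degree `γ`. -/
def cochains (N : GradedModule A k) (i : ℕ) (γ : Fin d → ℤ) :
    Submodule k (Finset (Fin n) → ExpFun N) :=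
  homFamilies N γ ⊓
    { carrier := {ω | ∀ s, s.card ≠ i → ω s = 0}
      zero_mem' := fun _ _ => rfl
      add_mem' := fun hω hη s hs => by rw [Pi.add_apply, hω s hs, hη s hs, add_zero]
      smul_mem' := fun c _ hω s hs => by rw [Pi.smul_apply, hω s hs, smul_zero] }

/-- The translation of functions on `ℕ^n`. -/
def shiftFun (N : GradedModule A k) (u : Fin n → ℕ) :
    (Finset (Fin n) → ExpFun N) →ₗ[k] (Finset (Fin n) → ExpFun N) :=
  (LinearMap.funLeft k (Total N) fun v => v + u).compLeft (Finset (Fin n))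

theorem shiftFun_apply (N : GradedModule A k) (u : Fin n → ℕ) (ω : Finset (Fin n) → ExpFun N)
    (s : Finset (Fin n)) (v : Fin n → ℕ) : shiftFun N u ω s v = ω s (v + u) := rfl

theorem shiftFun_mem (N : GradedModule A k) (i : ℕ) {α β : DegreeCat A} (u : α ⟶ β)
    (ω : Finset (Fin n) → ExpFun N) (hω : ω ∈ cochains N i α.deg) :
    shiftFun N u.1 ω ∈ cochains N i β.deg := by
  refine ⟨fun s v => ?_, fun s hs => ?_⟩
  · have := hω.1 s (v + u.1)
    rwa [add_right_comm, weight_add, add_comm (weight A _), ← add_assoc, u.2] at this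
  · funext v
    rw [shiftFun_apply, hω.2 s hs]
    rfl

theorem wedgeDiff_shiftFun (N : GradedModule A k) (u : Fin n → ℕ)
    (ω : Finset (Fin n) → ExpFun N) :
    wedgeDiff (diffOp N) (shiftFun N u ω) = shiftFun N u (wedgeDiff (diffOp N) ω) := by
  funext s v
  rw [shiftFun_apply, wedgeDiff_apply, wedgeDiff_apply, Finset.sum_apply, Finset.sum_apply]
  refine Finset.sum_congr rfl fun j _ => ?_
  rw [Pi.smul_apply, Pi.smul_apply, diffOp_apply, diffOp_apply, shiftFun_apply, shiftFun_apply,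
    add_right_comm]

theorem gradePart_shiftFun (N : GradedModule A k) (u : Fin n → ℕ) (i : ℕ)
    (ω : Finset (Fin n) → ExpFun N) :
    gradePart k i (shiftFun N u ω) = shiftFun N u (gradePart k i ω) := by
  funext s v
  rw [shiftFun_apply, gradePart_apply, gradePart_apply]
  split_ifs <;> rfl

/-- The injective modules of the resolution. -/
def resolutionTerm (N : GradedModule A k) (i : ℕ) : GradedModule A k where
  obj α := ModuleCat.of k (cochains N i α.deg)
  map u := ModuleCat.ofHom ((shiftFun N u.1).restrict (shiftFun_mem N i u))
  map_id α := ModuleCat.hom_ext (LinearMap.ext fun _ => rfl)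
  map_comp u v := by
    refine ModuleCat.hom_ext (LinearMap.ext fun ω => Subtype.ext (funext fun s => funext fun x => ?_))
    change ω.1 s (x + (u.1 + v.1)) = ω.1 s (x + v.1 + u.1)
    rw [add_assoc, add_comm u.1]

/-- The term is coinduced from graded vector spaces. Since ∂^v acts by translation, the value at v
is the value at 0 of the translate, so a morphism into the term is the same as a family of linear
maps describing values at 0. These extend along linear retractions r of f, with no compatibility
required between the chosen r. -/
theorem resolutionTerm_injective (N : GradedModule A k) (i : ℕ) : Injective (resolutionTerm N i) := by
  refine ⟨fun {Y Z} g f hf => ?_⟩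
  have hm : ∀ c, ∃ r : Z.obj c ⟶ Y.obj c, f.app c ≫ r = 𝟙 _ := fun c => by
    have : Mono (f.app c) := inferInstance
    obtain ⟨r, hr⟩ := LinearMap.exists_leftInverse_of_injective (f.app c).hom
      (LinearMap.ker_eq_bot.2 ((ModuleCat.mono_iff_injective _).1 this))
    exact ⟨ModuleCat.ofHom r, ModuleCat.hom_ext hr⟩
  choose r hr using hm
  let F : ∀ δ, Z.obj δ →ₗ[k] Finset (Fin n) → Total N := fun δ =>
    (LinearMap.proj (R := k) (φ := fun _ => Total N) (0 : Fin n → ℕ)).compLeft (Finset (Fin n)) ∘ₗ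
      (cochains N i δ.deg).subtype ∘ₗ (r δ ≫ g.app δ).hom
  have hF : ∀ δ z s, F δ z s = (show cochains N i δ.deg from g.app δ (r δ z)).1 s 0 :=
    fun _ _ _ => rfl
  have hFmap : ∀ {α δ δ' : DegreeCat A} (a : α ⟶ δ) (b : α ⟶ δ') (_ : a.1 = b.1) (z : Z.obj α),
      F δ (Z.map a z) = F δ' (Z.map b z) := by
    intro α δ δ' a b hab z
    obtain rfl : δ = δ' := DegreeCat.ext (by rw [← a.2, ← b.2, hab])
    obtain rfl : a = b := Subtype.ext hab
    rfl
  let H : ∀ α, Z.obj α →ₗ[k] Finset (Fin n) → ExpFun N := fun α =>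
    LinearMap.pi fun s => LinearMap.pi fun v =>
      LinearMap.proj (R := k) (φ := fun _ => Total N) s ∘ₗ F _ ∘ₗ (Z.map (α.mon v)).hom
  have hH : ∀ α z s v, H α z s v = F _ (Z.map (α.mon v) z) s := fun _ _ _ _ => rfl
  have hmem : ∀ α z, H α z ∈ cochains N i α.deg := by
    intro α z
    refine ⟨fun s v => ?_, fun s hs => funext fun v => ?_⟩
    · rw [hH, hF]
      have := (show cochains N i (α.translate v).deg from g.app _ (r _ (Z.map (α.mon v) z))).2.1 s 0
      change _ ∈ homPart N (α.deg + weight A v + weight A (0 + ind s)) at this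
      rwa [zero_add, add_assoc, ← weight_add] at this
    · rw [hH, hF]
      exact congrFun ((show cochains N i (α.translate v).deg from
        g.app _ (r _ (Z.map (α.mon v) z))).2.2 s hs) 0
  refine ⟨{ app := fun α => ModuleCat.ofHom ((H α).codRestrict _ (hmem α)), naturality := ?_ }, ?_⟩
  · intro α α' u
    refine ModuleCat.hom_ext (LinearMap.ext fun z => Subtype.ext (funext fun s => funext fun v => ?_))
    change H α' (Z.map u z) s v = H α z s (v + u.1)
    rw [hH, hH, ← ModuleCat.comp_apply, ← Z.map_comp]
    exact congrFun (hFmap _ _ (add_comm (G := Fin n → ℕ) _ _) z) s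
  · ext α : 2
    refine ModuleCat.hom_ext (LinearMap.ext fun y => Subtype.ext (funext fun s => funext fun v => ?_))
    change H α (f.app α y) s v = (show cochains N i α.deg from g.app α y).1 s v
    have e1 : Z.map (α.mon v) (f.app α y) = f.app _ (Y.map (α.mon v) y) := by
      rw [← ModuleCat.comp_apply, ← f.naturality, ModuleCat.comp_apply]
    have e2 : r _ (f.app _ (Y.map (α.mon v) y)) = Y.map (α.mon v) y := by
      rw [← ModuleCat.comp_apply, hr]; rfl
    have e3 : g.app _ (Y.map (α.mon v) y) = (resolutionTerm N i).map (α.mon v) (g.app α y) := by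
      rw [← ModuleCat.comp_apply, g.naturality, ModuleCat.comp_apply]
    rw [hH, hF, e1, e2, e3]
    change (show cochains N i α.deg from g.app α y).1 s (0 + v) = _
    rw [zero_add]

/-- The differentials of the resolution. -/
def resolutionD (N : GradedModule A k) (i j : ℕ) : resolutionTerm N i ⟶ resolutionTerm N j where
  app α := ModuleCat.ofHom ((gradePart k j ∘ₗ wedgeDiff (diffOp N)).restrict fun ω hω =>
    ⟨gradePart_mem_homFamilies N j (wedgeDiff_mem_homFamilies N hω.1),
      fun s hs => if_neg hs⟩)
  naturality α β u := by
    refine ModuleCat.hom_ext (LinearMap.ext fun ω => Subtype.ext ?_)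
    change gradePart k j (wedgeDiff (diffOp N) (shiftFun N u.1 ω.1)) =
      shiftFun N u.1 (gradePart k j (wedgeDiff (diffOp N) ω.1))
    rw [wedgeDiff_shiftFun, gradePart_shiftFun]

theorem resolutionD_coe (N : GradedModule A k) (i : ℕ) (α : DegreeCat A)
    (ω : cochains N i α.deg) :
    (show cochains N (i + 1) α.deg from (resolutionD N i (i + 1)).app α ω).1 =
      wedgeDiff (diffOp N) ω.1 :=
  gradePart_eq_self (S := k) (wedgeDiff_eq_zero_of_card _ ω.2.2)

/-- The injective resolution, as a complex. -/
def resolutionComplex (N : GradedModule A k) : CochainComplex (GradedModule A k) ℕ where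
  X i := resolutionTerm N i
  d i j := resolutionD N i j
  shape i j hij := by
    ext α : 2
    refine ModuleCat.hom_ext (LinearMap.ext fun ω => Subtype.ext (funext fun s => ?_))
    change gradePart k j (wedgeDiff (diffOp N) ω.1) s = 0
    rw [gradePart_apply]
    split_ifs with hs
    · exact wedgeDiff_eq_zero_of_card _ ω.2.2 s fun h => hij (h.symm.trans hs)
    · rfl
  d_comp_d' i j l hij hjl := by
    obtain rfl : i + 1 = j := hij
    obtain rfl : i + 1 + 1 = l := hjl
    ext α : 2
    refine ModuleCat.hom_ext (LinearMap.ext fun ω => Subtype.ext ?_)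
    refine (resolutionD_coe N (i + 1) α _).trans ?_
    refine (congrArg _ (resolutionD_coe N i α ω)).trans ?_
    exact wedgeDiff_sq _ (diffOp_comm N) _

/-- The functoriality of the resolution. -/
def resolutionMap {N N' : GradedModule A k} (φ : N ⟶ N') :
    resolutionComplex N ⟶ resolutionComplex N' where
  f i := 
    { app := fun α => ModuleCat.ofHom (((expMap φ).compLeft (Finset (Fin n))).restrict
        fun ω (hω : ω ∈ cochains N i α.deg) => ⟨fun s v => totalMap_mem_homPart φ (hω.1 s v),
          fun s hs => by
            funext v
            change totalMapₗ φ (ω s v) = 0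
            rw [hω.2 s hs]
            exact map_zero _⟩)
      naturality := fun α β u => ModuleCat.hom_ext (LinearMap.ext fun ω => rfl) }
  comm' i j _ := by
    ext α : 2
    refine ModuleCat.hom_ext (LinearMap.ext fun ω => Subtype.ext (funext fun s => funext fun v => ?_))
    change gradePart k j (wedgeDiff (diffOp N') (fun s => expMap φ (ω.1 s))) s v =
      totalMapₗ φ (gradePart k j (wedgeDiff (diffOp N) ω.1) s v)
    rw [gradePart_apply, gradePart_apply]
    split_ifs
    · rw [wedgeDiff_apply, wedgeDiff_apply]
      simp only [diffOp_expMap, ← map_zsmul, ← map_sum]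
      rfl
    · exact (map_zero _).symm

end Cochains
end
end EulerKoszul

namespace EulerKoszul
noncomputable section

/-! ### Exactness of the injective resolution. -/

section Resolution

variable {d n : ℕ} {A : Matrix (Fin d) (Fin n) ℤ} {k : Type u} [Field k]

theorem incl_injective (N : GradedModule A k) (α : DegreeCat A) : Function.Injective (incl N α) :=
  DirectSum.of_injective (β := fun α => N.obj α) α

theorem ind_empty : ind (∅ : Finset (Fin n)) = 0 := by
  funext j; simp [ind]

theorem partialTotal_incl_map (N : GradedModule A k) (α : DegreeCat A) (j : Fin n) (v : Fin n → ℕ)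
    (x : N.obj α) : partialTotal N j (incl N _ (N.map (α.mon v) x)) =
      incl N _ (N.map (α.mon (v + Pi.single j 1)) x) := by
  rw [partialTotal_incl, ← ModuleCat.comp_apply, ← N.map_comp]
  exact incl_map N (α.mon v ≫ (α.translate v).mon (Pi.single j 1)) (α.mon (v + Pi.single j 1)) rfl x

/-- The coaugmentation, on homogeneous elements. -/
def coaugmentationFun (N : GradedModule A k) (α : DegreeCat A) :
    N.obj α →ₗ[k] (Finset (Fin n) → ExpFun N) :=
  LinearMap.pi fun s => if s = ∅ then LinearMap.pi fun v => incl N _ ∘ₗ (N.map (α.mon v)).hom else 0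

theorem coaugmentationFun_empty (N : GradedModule A k) (α : DegreeCat A) (x : N.obj α)
    (v : Fin n → ℕ) : coaugmentationFun N α x ∅ v = incl N _ (N.map (α.mon v) x) := rfl

theorem coaugmentationFun_of_ne (N : GradedModule A k) (α : DegreeCat A) (x : N.obj α)
    {s : Finset (Fin n)} (hs : s ≠ ∅) : coaugmentationFun N α x s = 0 := by
  rw [coaugmentationFun, LinearMap.pi_apply, if_neg hs]
  rfl

theorem coaugmentationFun_mem (N : GradedModule A k) (α : DegreeCat A) (x : N.obj α) :
    coaugmentationFun N α x ∈ cochains N 0 α.deg := by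
  refine ⟨fun s v => ?_, fun s hs => coaugmentationFun_of_ne N α x fun h => hs (by simp [h])⟩
  by_cases hs : s = ∅
  · subst hs
    rw [coaugmentationFun_empty]
    exact incl_mem_homPart N _ _ (by rw [ind_empty, add_zero]; rfl) _
  · rw [coaugmentationFun_of_ne N α x hs]
    exact zero_mem _

theorem wedgeDiff_coaugmentationFun (N : GradedModule A k) (α : DegreeCat A) (x : N.obj α) :
    wedgeDiff (diffOp N) (coaugmentationFun N α x) = 0 := by
  funext s
  rw [wedgeDiff_apply]
  refine Finset.sum_eq_zero fun j _ => ?_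
  by_cases hs : s.erase j = ∅
  · have : diffOp N j (coaugmentationFun N α x (s.erase j)) = 0 := by
      funext v
      rw [hs, diffOp_apply, coaugmentationFun_empty, coaugmentationFun_empty,
        partialTotal_incl_map, sub_self]
      rfl
    rw [this, smul_zero]
  · rw [coaugmentationFun_of_ne N α x hs, map_zero, smul_zero]

/-- The coaugmentation of the injective resolution. -/
def coaugmentation (N : GradedModule A k) : N ⟶ resolutionTerm N 0 where
  app α := ModuleCat.ofHom ((coaugmentationFun N α).codRestrict _ (coaugmentationFun_mem N α))
  naturality α β u := by
    refine ModuleCat.hom_ext (LinearMap.ext fun x => Subtype.ext (funext fun s => funext fun v => ?_))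
    change coaugmentationFun N β (N.map u x) s v = coaugmentationFun N α x s (v + u.1)
    by_cases hs : s = ∅
    · subst hs
      rw [coaugmentationFun_empty, coaugmentationFun_empty, ← ModuleCat.comp_apply, ← N.map_comp]
      exact incl_map N _ _ (add_comm (G := Fin n → ℕ) _ _) x
    · rw [coaugmentationFun_of_ne N _ _ hs, coaugmentationFun_of_ne N _ _ hs]
      rfl

theorem coaugmentation_injective (N : GradedModule A k) (α : DegreeCat A) (x : N.obj α)
    (hx : coaugmentationFun N α x = 0) : x = 0 := by
  have h := congrFun (congrFun hx ∅) 0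
  rw [coaugmentationFun_empty, incl_map N (α.mon 0) (𝟙 α) rfl x, N.map_id] at h
  exact incl_injective N α (h.trans (map_zero _).symm)

/-- The cocycle condition in exterior degree 0 reads f(v + e_j) = ∂_j f(v). By induction on ∑ v_j it
forces f(v) = ∂^v f(0). -/
theorem exists_coaugmentationFun_eq (N : GradedModule A k) (α : DegreeCat A)
    (ω : Finset (Fin n) → ExpFun N) (hω : ω ∈ cochains N 0 α.deg)
    (h : wedgeDiff (diffOp N) ω = 0) : ∃ x, coaugmentationFun N α x = ω := by
  have hrec : ∀ j v, ω ∅ (v + Pi.single j 1) = partialTotal N j (ω ∅ v) := by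
    intro j v
    have h1 := congrFun (congrFun h {j}) v
    rw [wedgeDiff_apply, Finset.sum_singleton, Finset.erase_singleton] at h1
    have h2 : wedgeSign j {j} = 1 := by
      rw [← wedgeSign_erase_self, Finset.erase_singleton]; simp [wedgeSign]
    rw [h2, one_smul, diffOp_apply] at h1
    exact sub_eq_zero.1 h1
  obtain ⟨x, hx⟩ : ω ∅ 0 ∈ homPart N α.deg := by
    have := hω.1 ∅ 0
    rwa [ind_empty, add_zero, weight_zero, add_zero] at this
  refine ⟨x, funext fun s => ?_⟩
  by_cases hs : s = ∅
  · subst hs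
    have key : ∀ (m : ℕ) (v : Fin n → ℕ), ∑ j, v j = m →
        coaugmentationFun N α x ∅ v = ω ∅ v := by
      intro m
      induction m with
      | zero =>
        intro v hv
        obtain rfl : v = 0 := funext fun j => Finset.sum_eq_zero_iff.1 hv j (Finset.mem_univ j)
        rw [← hx, coaugmentationFun_empty, incl_map N (α.mon 0) (𝟙 α) rfl x, N.map_id]
        rfl
      | succ m ih =>
        intro v hv
        obtain ⟨j, -, hj⟩ : ∃ j ∈ Finset.univ, v j ≠ 0 :=
          Finset.exists_ne_zero_of_sum_ne_zero (by rw [hv]; exact Nat.succ_ne_zero m)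
        have hle : Pi.single j 1 ≤ v := by
          intro l
          by_cases hl : l = j
          · subst hl; simpa using Nat.one_le_iff_ne_zero.2 hj
          · simp [hl]
        have hvj := tsub_add_cancel_of_le hle
        rw [← hvj, hrec, ← ih (v - Pi.single j 1), coaugmentationFun_empty,
          coaugmentationFun_empty, partialTotal_incl_map]
        rw [← hvj] at hv
        simp only [Pi.add_apply, Finset.sum_add_distrib, Finset.sum_pi_single', Finset.mem_univ,
          if_true] at hv
        omega
    exact funext fun v => key _ v rfl
  · rw [coaugmentationFun_of_ne N α x hs, hω.2 s (by rwa [Ne, Finset.card_eq_zero])]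

/-- A right inverse of `diffOp N j`. -/
def diffOpInv (N : GradedModule A k) (j : Fin n) : ExpFun N →+ ExpFun N where
  toFun g v := ∑ m ∈ Finset.range (v j), (partialTotal N j ^ m) (g (v - Pi.single j (m + 1)))
  map_zero' := by funext v; simp
  map_add' f g := by
    funext v
    simp only [Pi.add_apply, map_add, Finset.sum_add_distrib]

theorem diffOpInv_apply (N : GradedModule A k) (j : Fin n) (g : ExpFun N) (v : Fin n → ℕ) :
    diffOpInv N j g v = ∑ m ∈ Finset.range (v j),
      (partialTotal N j ^ m) (g (v - Pi.single j (m + 1))) := rfl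

/-- The sum is the solution h of the recursion h(v + e_j) = ∂_j h(v) + g(v) that vanishes where v_j
= 0. -/
theorem diffOp_diffOpInv (N : GradedModule A k) (j : Fin n) (g : ExpFun N) :
    diffOp N j (diffOpInv N j g) = g := by
  funext v
  rw [diffOp_apply, diffOpInv_apply, diffOpInv_apply, Pi.add_apply, Pi.single_eq_same,
    Finset.sum_range_succ', pow_zero, Module.End.one_apply, zero_add, add_tsub_cancel_right,
    map_sum, add_sub_assoc, add_comm, sub_add, sub_eq_self, sub_eq_zero]
  refine Finset.sum_congr rfl fun m _ => ?_
  have e : (Pi.single j (m + 1 + 1) : Fin n → ℕ) = Pi.single j (m + 1) + Pi.single j 1 :=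
    Pi.single_add (f := fun _ : Fin n => ℕ) j (m + 1) 1
  rw [e, add_tsub_add_eq_tsub_right, pow_succ']
  rfl

theorem partialTotal_pow_comm (N : GradedModule A k) (i j : Fin n) (m : ℕ) (x : Total N) :
    partialTotal N i ((partialTotal N j ^ m) x) = (partialTotal N j ^ m) (partialTotal N i x) :=
  LinearMap.congr_fun ((Commute.pow_right (partialTotal_comm N i j) m) : _ * _ = _ * _) x

theorem diffOp_diffOpInv_comm (N : GradedModule A k) {i j : Fin n} (hij : i ≠ j) (g : ExpFun N) :
    diffOp N i (diffOpInv N j g) = diffOpInv N j (diffOp N i g) := by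
  funext v
  rw [diffOp_apply, diffOpInv_apply, diffOpInv_apply, diffOpInv_apply, Pi.add_apply,
    Pi.single_eq_of_ne hij.symm, add_zero, map_sum, ← Finset.sum_sub_distrib]
  refine Finset.sum_congr rfl fun m hm => ?_
  rw [diffOp_apply, map_sub, partialTotal_pow_comm]
  have : v + Pi.single i 1 - Pi.single j (m + 1) = v - Pi.single j (m + 1) + Pi.single i 1 := by
    have hm' : m < v j := Finset.mem_range.1 hm
    funext l
    by_cases hl : l = j
    · subst hl; simp [hij.symm]
    · simp [hl]
  rw [this]

theorem partialPow_mem_homPart (N : GradedModule A k) {γ : Fin d → ℤ} {x : Total N}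
    (hx : x ∈ homPart N γ) (j : Fin n) (m : ℕ) :
    (partialTotal N j ^ m) x ∈ homPart N (γ + weight A (Pi.single j m)) := by
  induction m with
  | zero => rwa [Pi.single_zero, weight_zero, add_zero, pow_zero]
  | succ m ih =>
    have := partial_mem_homPart N ih j
    rw [add_assoc, ← weight_add, ← Pi.single_add] at this
    rwa [pow_succ']

theorem diffOpInv_mem (N : GradedModule A k) (γ : Fin d → ℤ) (s : Finset (Fin n)) (j : Fin n)
    (hj : j ∉ s) (g : ExpFun N) (hg : g ∈ homFun N γ (insert j s)) :
    diffOpInv N j g ∈ homFun N γ s := by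
  intro v
  rw [diffOpInv_apply]
  refine sum_mem fun m hm => ?_
  have hle : Pi.single j (m + 1) ≤ v := by
    intro l
    by_cases hl : l = j
    · subst hl; simpa using Finset.mem_range.1 hm
    · simp [hl]
  have := partialPow_mem_homPart N (hg (v - Pi.single j (m + 1))) j m
  have e : v - Pi.single j (m + 1) + ind (insert j s) + Pi.single j m = v + ind s := by
    have h1 : ind (insert j s) = ind s + Pi.single j 1 := by
      rw [← ind_erase_add (Finset.mem_insert_self j s), Finset.erase_insert hj]
    have h2 := tsub_add_cancel_of_le hle
    rw [Pi.single_add] at h2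
    rw [h1]
    conv_rhs => rw [← h2]
    rw [Pi.single_add]
    generalize v - (Pi.single j m + Pi.single j 1) = w
    funext l
    simp only [Pi.add_apply]
    omega
  rwa [add_assoc, ← weight_add, e] at this

/-- The difference operators have right inverses, so `wedgeDiff_exact_of_rightInverse` applies
within degree γ and gives primitives on every nonempty s. The part of exterior degree i is the only
one needed. -/
theorem exists_wedgeDiff_eq (N : GradedModule A k) (i : ℕ) (γ : Fin d → ℤ)
    (ω : Finset (Fin n) → ExpFun N) (hω : ω ∈ cochains N (i + 1) γ)
    (h : wedgeDiff (diffOp N) ω = 0) : ∃ η ∈ cochains N i γ, wedgeDiff (diffOp N) η = ω := by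
  obtain ⟨η, hη, hη'⟩ := wedgeDiff_exact_of_rightInverse (diffOp N) (diffOp_comm N) (diffOpInv N)
    (fun j i hij m => diffOp_diffOpInv_comm N hij m) (diffOp_diffOpInv N)
    (fun s => (homFun N γ s).toAddSubgroup) (diffOp_mem_homFun N γ) (diffOpInv_mem N γ) ω h hω.1
  refine ⟨gradePart k i η, ⟨gradePart_mem_homFamilies N i hη, fun s hs => if_neg hs⟩, ?_⟩
  rw [wedgeDiff_gradePart]
  funext s
  rw [gradePart_apply]
  split_ifs with hs
  · exact (hη' s (by rintro rfl; simp at hs)).symm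
  · exact (hω.2 s hs).symm

theorem coaugmentation_comp_d (N : GradedModule A k) :
    coaugmentation N ≫ (resolutionComplex N).d 0 1 = 0 := by
  ext α : 2
  refine ModuleCat.hom_ext (LinearMap.ext fun x => Subtype.ext ?_)
  refine (resolutionD_coe N 0 α _).trans ?_
  exact wedgeDiff_coaugmentationFun N α x

/-- The coaugmentation, as a map of complexes. -/
def resolutionι (N : GradedModule A k) :
    (CochainComplex.single₀ (GradedModule A k)).obj N ⟶ resolutionComplex N :=
  (CochainComplex.fromSingle₀Equiv _ _).symm ⟨coaugmentation N, coaugmentation_comp_d N⟩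

theorem resolutionι_f_zero (N : GradedModule A k) : (resolutionι N).f 0 = coaugmentation N :=
  CochainComplex.fromSingle₀Equiv_symm_apply_f_zero _ _

theorem quasiIsoAt_zero_of_injective {S : Type u} [Ring S]
    {K L : CochainComplex (ModuleCat.{u} S) ℕ} (Φ : K ⟶ L) (hK : K.d 0 1 = 0)
    (hi : ∀ y, Φ.f 0 y = 0 → y = 0) (hs : ∀ x, L.d 0 1 x = 0 → ∃ y, Φ.f 0 y = x) :
    QuasiIsoAt Φ 0 := by
  rw [quasiIsoAt_iff_isIso_homologyMap, ConcreteCategory.isIso_iff_bijective]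
  have hn : (ComplexShape.up ℕ).next 0 = 1 := by simp
  have hp : (ComplexShape.up ℕ).prev 0 = 0 := by simp
  constructor
  · rw [injective_iff_map_eq_zero]
    intro y hy
    obtain ⟨y, rfl⟩ := homologyClass_surjective hn y
    erw [homologyClass_map Φ hn y (cycle_map Φ y.2)] at hy
    obtain ⟨z, hz⟩ := (homologyClass_eq_zero_iff hp hn _).1 hy
    have : y = 0 := Subtype.ext (hi _ (by
      rw [L.shape 0 0 (by simp)] at hz
      exact hz.symm))
    rw [this, map_zero]
  · intro x
    obtain ⟨x, rfl⟩ := homologyClass_surjective hn x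
    obtain ⟨y, hy⟩ := hs x.1 x.2
    have hy0 : K.d 0 1 y = 0 := by rw [hK]; rfl
    refine ⟨homologyClass _ 0 1 hn ⟨y, hy0⟩, ?_⟩
    erw [homologyClass_map Φ hn ⟨y, hy0⟩ (cycle_map Φ hy0)]
    exact congrArg _ (Subtype.ext hy)

theorem quasiIso_resolutionι (N : GradedModule A k) : QuasiIso (resolutionι N) := by
  rw [HomologicalComplex.quasiIso_iff_evaluation]
  intro α
  refine ⟨fun i => ?_⟩
  cases i with
  | zero =>
    have hf : ∀ x : N.obj α, (show cochains N 0 α.deg from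
        ((((evaluation _ _).obj α).mapHomologicalComplex _).map (resolutionι N)).f 0 x).1 =
          coaugmentationFun N α x := fun x =>
      congrArg (fun f => (show cochains N 0 α.deg from f.app α x).1) (resolutionι_f_zero N)
    refine quasiIsoAt_zero_of_injective _ rfl (fun y hy => ?_) (fun x hx => ?_)
    · exact coaugmentation_injective N α y ((hf y).symm.trans (congrArg Subtype.val hy))
    · have hx : wedgeDiff (diffOp N) (show cochains N 0 α.deg from x).1 = 0 :=
        (resolutionD_coe N 0 α _).symm.trans (congrArg Subtype.val hx)
      obtain ⟨y, hy⟩ := exists_coaugmentationFun_eq N α _ (show cochains N 0 α.deg from x).2 hx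
      exact ⟨y, Subtype.ext ((hf y).trans hy)⟩
  | succ i =>
    rw [quasiIsoAt_iff_exactAt]
    · rw [HomologicalComplex.exactAt_iff' _ i (i + 1) (i + 2) (by simp) (by simp),
        ShortComplex.moduleCat_exact_iff]
      intro x hx
      have hx' : wedgeDiff (diffOp N) (show cochains N (i + 1) α.deg from x).1 = 0 :=
        (resolutionD_coe N (i + 1) α _).symm.trans (congrArg Subtype.val hx)
      obtain ⟨η, hη, hη'⟩ := exists_wedgeDiff_eq N i _ _ (show cochains N (i + 1) α.deg from x).2 hx'
      exact ⟨(⟨η, hη⟩ : cochains N i α.deg), Subtype.ext ((resolutionD_coe N i α _).trans hη')⟩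
    · exact HomologicalComplex.ExactAt.of_isZero (((evaluation _ _).obj α).map_isZero
        (HomologicalComplex.isZero_single_obj_X _ _ _ _ (by simp)))

/-- The functorial injective resolution of a graded module. -/
def gradedResolution (N : GradedModule A k) : InjectiveResolution N where
  cocomplex := resolutionComplex N
  injective := resolutionTerm_injective N
  ι := resolutionι N
  quasiIso := quasiIso_resolutionι N

theorem totalMapₗ_coaugmentationFun {N N' : GradedModule A k} (φ : N ⟶ N') (α : DegreeCat A)
    (x : N.obj α) (s : Finset (Fin n)) (v : Fin n → ℕ) :
    totalMapₗ φ (coaugmentationFun N α x s v) = coaugmentationFun N' α (φ.app α x) s v := by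
  by_cases hs : s = ∅
  · subst hs
    rw [coaugmentationFun_empty, coaugmentationFun_empty, totalMapₗ_incl, ← ModuleCat.comp_apply,
      φ.naturality, ModuleCat.comp_apply]
  · rw [coaugmentationFun_of_ne N _ _ hs, coaugmentationFun_of_ne N' _ _ hs]
    exact map_zero _

theorem gradedResolution_naturality {N N' : GradedModule A k} (φ : N ⟶ N') :
    (gradedResolution N).ι.f 0 ≫ (resolutionMap φ).f 0 = φ ≫ (gradedResolution N').ι.f 0 := by
  refine (congrArg (· ≫ (resolutionMap φ).f 0) (resolutionι_f_zero N)).trans ?_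
  refine Eq.trans ?_ (congrArg (φ ≫ ·) (resolutionι_f_zero N').symm)
  ext α : 2
  refine ModuleCat.hom_ext (LinearMap.ext fun x => Subtype.ext (funext fun s => funext fun v => ?_))
  exact totalMapₗ_coaugmentationFun φ α x s v

end Resolution

/-! ### Local cohomology classes as finitely supported cocycles. -/

section LocalCohomologyClasses

variable {d n : ℕ} {A : Matrix (Fin d) (Fin n) ℤ} {k : Type u} [Field k]

/-- The powers of ∂_j act by translation in direction j, so being killed by all large powers means
vanishing for large v_j. Imposed for every j, this bounds the support. -/
theorem mem_torsionPiece_iff (N : GradedModule A k) (i : ℕ) (α : DegreeCat A)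
    (ω : cochains N i α.deg) :
    ω ∈ torsionPiece (resolutionTerm N i) α ↔ ∀ s, ω.1 s ∈ finiteFun N := by
  constructor
  · intro h s
    choose κ hκ using h
    refine Set.Finite.subset (Set.Finite.pi' fun j => Set.finite_lt_nat (κ j)) fun v hv => ?_
    intro j
    by_contra hj
    have hj : κ j ≤ v j := not_lt.1 hj
    -- Evaluation at the point with j-th coordinate set to zero: translating it by v_j in direction
    -- j lands on v.
    have h1 := congrFun (congrFun (congrArg Subtype.val (hκ j (v j) hj)) s)
      (Function.update v j 0)
    have h2 : Function.update v j 0 + Pi.single j (v j) = v := by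
      funext l
      by_cases hl : l = j
      · subst hl; simp
      · simp [hl]
    have h3 : ω.1 s (Function.update v j 0 + Pi.single j (v j)) = 0 := h1
    rw [h2] at h3
    exact hv h3
  · intro h j
    have hfin : (⋃ s, Function.support (ω.1 s)).Finite := Set.finite_iUnion h
    obtain ⟨b, hb⟩ := (hfin.image fun v => v j).bddAbove
    refine ⟨b + 1, fun κ hκ => Subtype.ext (funext fun s => funext fun v => ?_)⟩
    change ω.1 s (v + Pi.single j κ) = 0
    by_contra hne
    have := hb ⟨_, Set.mem_iUnion.2 ⟨s, hne⟩, rfl⟩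
    simp only [Pi.add_apply, Pi.single_eq_same] at this
    omega

/-- The cocycles of finite support and degree `γ`. -/
def localCocycles (N : GradedModule A k) (i : ℕ) (γ : Fin d → ℤ) :
    Submodule k (Finset (Fin n) → ExpFun N) :=
  cochains N i γ ⊓ Submodule.pi Set.univ (fun _ => finiteFun N) ⊓
    LinearMap.ker (wedgeDiff (diffOp N))

/-- The part of degree `α` of the torsion of the injective resolution. -/
def torsionComplex (N : GradedModule A k) (α : DegreeCat A) : CochainComplex (ModuleCat.{u} k) ℕ :=
  (((evaluation (DegreeCat A) (ModuleCat.{u} k)).obj α).mapHomologicalComplex (ComplexShape.up ℕ)).obj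
    (((torsion A k).mapHomologicalComplex (ComplexShape.up ℕ)).obj (resolutionComplex N))

/-- The map of torsion complexes induced by a morphism. -/
def torsionComplexMap {N N' : GradedModule A k} (φ : N ⟶ N') (α : DegreeCat A) :
    torsionComplex N α ⟶ torsionComplex N' α :=
  (((evaluation (DegreeCat A) (ModuleCat.{u} k)).obj α).mapHomologicalComplex (ComplexShape.up ℕ)).map
    (((torsion A k).mapHomologicalComplex (ComplexShape.up ℕ)).map (resolutionMap φ))

/-- The homology of the torsion complex is local cohomology. -/
def torsionComplexIso (N : GradedModule A k) (α : DegreeCat A) (i : ℕ) :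
    (torsionComplex N α).homology i ≅ ((gradedLocalCohomology A k i).obj N).obj α :=
  (ShortComplex.homologyFunctorIso ((evaluation (DegreeCat A) (ModuleCat.{u} k)).obj α)).app
      ((((torsion A k).mapHomologicalComplex (ComplexShape.up ℕ)).obj (resolutionComplex N)).sc i) ≪≫
    (((gradedResolution N).isoRightDerivedObj (torsion A k) i).app α).symm

theorem torsionComplexIso_naturality {N N' : GradedModule A k} (φ : N ⟶ N') (α : DegreeCat A)
    (i : ℕ) :
    HomologicalComplex.homologyMap (torsionComplexMap φ α) i ≫ (torsionComplexIso N' α i).hom =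
      (torsionComplexIso N α i).hom ≫ ((gradedLocalCohomology A k i).map φ).app α := by
  have h1 := congrArg (fun f => f.app α) (InjectiveResolution.isoRightDerivedObj_inv_naturality φ
    (gradedResolution N) (gradedResolution N') (resolutionMap φ) (gradedResolution_naturality φ)
    (torsion A k) i)
  have h2 := (ShortComplex.homologyFunctorIso
    ((evaluation (DegreeCat A) (ModuleCat.{u} k)).obj α)).hom.naturality
    ((HomologicalComplex.shortComplexFunctor _ _ i).map
      (((torsion A k).mapHomologicalComplex (ComplexShape.up ℕ)).map (resolutionMap φ)))
  refine (Category.assoc _ _ _).symm.trans ?_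
  refine (congrArg (· ≫ ((gradedResolution N').isoRightDerivedObj (torsion A k) i).inv.app α)
    h2).trans ?_
  refine (Category.assoc _ _ _).trans (Eq.trans ?_ (Category.assoc _ _ _).symm)
  exact congrArg (_ ≫ ·) h1.symm

/-- The cocycle of the torsion complex given by a family of functions. -/
def toTorsionCycle (N : GradedModule A k) (i : ℕ) (α : DegreeCat A) :
    localCocycles N i α.deg →ₗ[k] LinearMap.ker ((torsionComplex N α).d i (i + 1)).hom where
  toFun ω := ⟨(⟨(⟨ω.1, ω.2.1.1⟩ : cochains N i α.deg), (mem_torsionPiece_iff N i α _).2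
    fun s => ω.2.1.2 s (Set.mem_univ s)⟩ : torsionPiece (resolutionTerm N i) α),
      Subtype.ext (Subtype.ext ((resolutionD_coe N i α _).trans ω.2.2))⟩
  map_add' _ _ := rfl
  map_smul' _ _ := rfl

/-- The local cohomology class of a cocycle. -/
def localClass (N : GradedModule A k) (i : ℕ) (α : DegreeCat A) :
    localCocycles N i α.deg →ₗ[k] ((gradedLocalCohomology A k i).obj N).obj α :=
  (torsionComplexIso N α i).hom.hom ∘ₗ homologyClass (torsionComplex N α) i (i + 1) (by simp) ∘ₗ
    toTorsionCycle N i α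

theorem localClass_surjective (N : GradedModule A k) (i : ℕ) (α : DegreeCat A) :
    Function.Surjective (localClass N i α) := by
  intro y
  obtain ⟨x, rfl⟩ := (ConcreteCategory.bijective_of_isIso (torsionComplexIso N α i).hom).2 y
  obtain ⟨x, rfl⟩ := homologyClass_surjective (l := i + 1) (by simp) x
  let x' : torsionPiece (resolutionTerm N i) α := x.1
  have hx : wedgeDiff (diffOp N) (show cochains N i α.deg from x'.1).1 = 0 :=
    (resolutionD_coe N i α _).symm.trans (congrArg (fun z => z.1.1) x.2)
  exact ⟨⟨(show cochains N i α.deg from x'.1).1, ⟨(show cochains N i α.deg from x'.1).2,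
    fun s _ => (mem_torsionPiece_iff N i α _).1 x'.2 s⟩, hx⟩, rfl⟩

/-- The primitive need not be homogeneous in exterior degree, since its part one degree below
already has the differential ω. For i = 0 there are no coboundaries, and consistently any ω of the
given form vanishes, because the differential at s = ∅ is an empty sum. -/
theorem localClass_eq_zero_iff (N : GradedModule A k) (i : ℕ) (α : DegreeCat A)
    (ω : localCocycles N i α.deg) :
    localClass N i α ω = 0 ↔ ∃ η ∈ homFamilies N α.deg, (∀ s, η s ∈ finiteFun N) ∧
      wedgeDiff (diffOp N) η = ω.1 := by
  have h0 : localClass N i α ω = 0 ↔ homologyClass (torsionComplex N α) i (i + 1) (by simp)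
      (toTorsionCycle N i α ω) = 0 := by
    constructor
    · intro h
      exact (ConcreteCategory.bijective_of_isIso (torsionComplexIso N α i).hom).1
        (h.trans (map_zero _).symm)
    · intro h
      exact (congrArg (torsionComplexIso N α i).hom h).trans (map_zero _)
  rw [h0]
  cases i with
  | zero =>
    rw [homologyClass_eq_zero_iff (i := 0) (by simp)]
    constructor
    · rintro ⟨y, hy⟩
      refine ⟨0, zero_mem _, fun _ => zero_mem _, ?_⟩
      rw [map_zero]
      have h1 : (torsionComplex N α).d 0 0 = 0 := (torsionComplex N α).shape 0 0 (by simp)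
      have h2 := congrArg (fun f => f y) h1
      exact congrArg (fun z : torsionPiece (resolutionTerm N 0) α =>
        (show cochains N 0 α.deg from z.1).1) (h2.symm.trans hy)
    · rintro ⟨η, -, -, hη⟩
      refine ⟨0, (map_zero _).trans (Subtype.ext (Subtype.ext (funext fun s => ?_)))⟩
      change 0 = ω.1 s
      by_cases hs : s = ∅
      · rw [← hη, hs, wedgeDiff_apply, Finset.sum_empty]
      · exact (ω.2.1.1.2 s (by rwa [Ne, Finset.card_eq_zero])).symm
  | succ i =>
    rw [homologyClass_eq_zero_iff (i := i) (by simp)]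
    constructor
    · rintro ⟨y, hy⟩
      let y' : torsionPiece (resolutionTerm N i) α := y
      refine ⟨(show cochains N i α.deg from y'.1).1, (show cochains N i α.deg from y'.1).2.1,
        (mem_torsionPiece_iff N i α _).1 y'.2, ?_⟩
      refine (resolutionD_coe N i α _).symm.trans ?_
      exact congrArg (fun z : torsionPiece (resolutionTerm N (i + 1)) α =>
        (show cochains N (i + 1) α.deg from z.1).1) hy
    · rintro ⟨η, hη1, hη2, hη3⟩
      have hmem : gradePart k i η ∈ cochains N i α.deg :=
        ⟨gradePart_mem_homFamilies N i hη1, fun s hs => if_neg hs⟩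
      refine ⟨(⟨⟨gradePart k i η, hmem⟩, (mem_torsionPiece_iff N i α _).2 fun s => ?_⟩ :
        torsionPiece (resolutionTerm N i) α), Subtype.ext (Subtype.ext ?_)⟩
      · change gradePart k i η s ∈ _
        rw [gradePart_apply]
        split_ifs
        · exact hη2 s
        · exact zero_mem _
      · refine (resolutionD_coe N i α ⟨_, hmem⟩).trans ?_
        rw [wedgeDiff_gradePart, hη3]
        exact gradePart_eq_self ω.2.1.1.2

theorem expMap_mem_localCocycles {N N' : GradedModule A k} (φ : N ⟶ N') (i : ℕ) (γ : Fin d → ℤ)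
    (ω : Finset (Fin n) → ExpFun N) (hω : ω ∈ localCocycles N i γ) :
    (expMap φ).compLeft (Finset (Fin n)) ω ∈ localCocycles N' i γ := by
  refine ⟨⟨⟨fun s v => totalMap_mem_homPart φ (hω.1.1.1 s v), fun s hs => ?_⟩,
    fun s _ => expMap_mem φ _ (hω.1.2 s (Set.mem_univ s))⟩, ?_⟩
  · change expMap φ (ω s) = 0
    rw [hω.1.1.2 s hs, map_zero]
  · funext s
    have h : wedgeDiff (diffOp N) ω s = 0 := congrFun hω.2 s
    rw [wedgeDiff_apply] at h ⊢
    refine Eq.trans ?_ ((congrArg (expMap φ) h).trans (map_zero _))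
    rw [map_sum]
    refine Finset.sum_congr rfl fun j _ => ?_
    rw [map_zsmul, ← diffOp_expMap]
    rfl

theorem localClass_naturality {N N' : GradedModule A k} (φ : N ⟶ N') (i : ℕ) (α : DegreeCat A)
    (ω : localCocycles N i α.deg) :
    ((gradedLocalCohomology A k i).map φ).app α (localClass N i α ω) =
      localClass N' i α ⟨_, expMap_mem_localCocycles φ i α.deg ω.1 ω.2⟩ := by
  have h := congrArg (fun f => f (homologyClass (torsionComplex N α) i (i + 1) (by simp)
    (toTorsionCycle N i α ω))) (torsionComplexIso_naturality φ α i)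
  refine h.symm.trans (congrArg (torsionComplexIso N' α i).hom ?_)
  exact homologyClass_map (torsionComplexMap φ α) _ _ (cycle_map _ (toTorsionCycle N i α ω).2)

end LocalCohomologyClasses
end
end EulerKoszul

namespace EulerKoszul
noncomputable section

/-! ### Homology classes of indexed complexes. -/

section IndexedClasses

variable {S : Type u} [Ring S] {I : Type} {deg : I → ℤ} {X : Type u} [AddCommGroup X] [Module S X]
  {D : (I → X) →ₗ[S] (I → X)}

/-- The cocycles of an indexed complex. -/
def indexedCycles (S : Type u) [Ring S] {X : Type u} [AddCommGroup X] [Module S X] (deg : I → ℤ)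
    (D : (I → X) →ₗ[S] (I → X)) (p : ℤ) : Submodule S ({i // deg i = p} → X) :=
  LinearMap.ker (D ∘ₗ extDeg S deg X p)

/-- The class of a cocycle of an indexed complex. -/
def indexedClass (h : IsDegreeOne deg D) (p : ℤ) :
    indexedCycles S deg D p →ₗ[S] (indexedComplex deg D h).homology p :=
  homologyClass (indexedComplex deg D h) p (p + 1) (by simp) ∘ₗ
    Submodule.inclusion (p' := LinearMap.ker ((indexedComplex deg D h).d p (p + 1)).hom)
      fun ω hω => (indexedComplex_d_eq_zero_iff h p ω).2 hω

theorem indexedClass_surjective (h : IsDegreeOne deg D) (p : ℤ) :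
    Function.Surjective (indexedClass h p) := by
  intro y
  obtain ⟨x, rfl⟩ := homologyClass_surjective (l := p + 1) (by simp) y
  exact ⟨⟨x.1, (indexedComplex_d_eq_zero_iff h p _).1 x.2⟩, rfl⟩

theorem indexedClass_eq_zero_iff (h : IsDegreeOne deg D) (p : ℤ) (ω : indexedCycles S deg D p) :
    indexedClass h p ω = 0 ↔ ∃ η : I → X, D η = extDeg S deg X p ω.1 := by
  refine (homologyClass_eq_zero_iff (i := p - 1) (by simp) _ _).trans ⟨?_, ?_⟩
  · rintro ⟨y, hy⟩
    refine ⟨extDeg S deg X (p - 1) y, ?_⟩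
    exact (h.extDeg_d (sub_add_cancel p 1) y).symm.trans (congrArg (extDeg S deg X p) hy)
  · rintro ⟨η, hη⟩
    refine ⟨resDeg S deg X (p - 1) η, funext fun i => ?_⟩
    have h1 := h.apply_extDeg_resDeg (p - 1) η i.1 (by rw [i.2]; ring)
    refine h1.trans ?_
    rw [hη]
    exact dif_pos i.2

theorem extDeg_map {X' : Type u} [AddCommGroup X'] [Module S X'] (g : X →ₗ[S] X') {p : ℤ}
    (ω : {i // deg i = p} → X) :
    extDeg S deg X' p (fun i => g (ω i)) = fun i => g (extDeg S deg X p ω i) := by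
  ext i
  by_cases hi : deg i = p <;> simp [extDeg, hi]

theorem indexedCycles_map {X' : Type u} [AddCommGroup X'] [Module S X'] {D' : (I → X') →ₗ[S] (I → X')}
    (g : X →ₗ[S] X') (hg : ∀ ω i, D' (fun l => g (ω l)) i = g (D ω i)) {p : ℤ}
    (ω : {i // deg i = p} → X) (hω : ω ∈ indexedCycles S deg D p) :
    (fun i => g (ω i)) ∈ indexedCycles S deg D' p := by
  change D' (extDeg S deg X' p _) = 0
  funext i
  rw [extDeg_map, hg]
  exact (congrArg g (congrFun hω i)).trans (map_zero g)

theorem indexedClass_map {X' : Type u} [AddCommGroup X'] [Module S X'] {D' : (I → X') →ₗ[S] (I → X')}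
    (h : IsDegreeOne deg D) (h' : IsDegreeOne deg D') (g : X →ₗ[S] X')
    (hg : ∀ ω i, D' (fun l => g (ω l)) i = g (D ω i)) (p : ℤ) (ω : indexedCycles S deg D p) :
    HomologicalComplex.homologyMap (indexedMap h h' g hg) p (indexedClass h p ω) =
      indexedClass h' p ⟨_, indexedCycles_map g hg ω.1 ω.2⟩ :=
  homologyClass_map (indexedMap h h' g hg) _
    (⟨ω.1, (indexedComplex_d_eq_zero_iff h p ω.1).2 ω.2⟩ :
      LinearMap.ker ((indexedComplex deg D h).d p (p + 1)).hom)
    ((indexedComplex_d_eq_zero_iff h' p _).2 (indexedCycles_map g hg ω.1 ω.2))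

end IndexedClasses

/-! ### The contracting homotopy in the Euler direction. -/

section Contracting

variable {S : Type u} [Ring S] {X : Type u} [AddCommGroup X] [Module S X] {d n : ℕ}
  {ρ : Fin n → Module.End S X} {E : Finset (Fin n) → Fin d → Module.End S X}

/-- The multiplication by `∑_i e_i c_i`. -/
def wedgeSum (c : Finset (Fin n) → Fin d → X →+ X) (ω : Finset (Fin d) × Finset (Fin n) → X) :
    Finset (Fin d) × Finset (Fin n) → X :=
  fun x => ∑ i, wedgeBy i (c x.2 i) (fun t => ω (t, x.2)) x.1

/-- In the Euler direction this is `koszulDiff_wedgeBy` summed over i. The ρ-terms cancel, because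
multiplication by e_i changes |t| by one and so flips the sign (−1)^|t|. -/
theorem totDiff_wedgeSum (c : Finset (Fin n) → Fin d → X →+ X)
    (hE : ∀ s i l m, E s l (c s i m) = c s i (E s l m))
    (hρ : ∀ s, ∀ j ∈ s, ∀ i m, c s i (ρ j m) = ρ j (c (s.erase j) i m))
    (ω : Finset (Fin d) × Finset (Fin n) → X) (t : Finset (Fin d)) (s : Finset (Fin n)) :
    totDiff ρ E (wedgeSum c ω) (t, s) + wedgeSum c (totDiff ρ E ω) (t, s) =
      ∑ i, c s i (E s i (ω (t, s))) := by
  have h1 : (fun t => wedgeSum c ω (t, s)) = ∑ i, wedgeBy i (c s i) (fun t => ω (t, s)) := by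
    funext t
    simp [wedgeSum]
  have h2 : ∀ i, wedgeBy i (c s i) (fun t => totDiff ρ E ω (t, s)) t =
      -(((-1 : ℤ) ^ t.card) • wedgeDiff ρ (fun s => wedgeBy i (c s i) (fun t => ω (t, s)) t) s) +
        wedgeBy i (c s i) (koszulDiff (E s) fun t => ω (t, s)) t := by
    intro i
    rw [wedgeBy_apply, wedgeBy_apply, wedgeDiff_apply]
    split_ifs with hi
    · rw [totDiff_apply, map_add, smul_add]
      congr 1
      rw [map_zsmul, wedgeDiff_apply, map_sum, Finset.smul_sum, Finset.smul_sum, Finset.smul_sum,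
        ← Finset.sum_neg_distrib]
      refine Finset.sum_congr rfl fun j hj => ?_
      rw [wedgeBy_apply, if_pos hi, map_zsmul, map_zsmul, hρ s j hj, smul_smul, smul_smul, smul_smul,
        smul_smul, ← neg_smul]
      congr 1
      have := Finset.card_erase_add_one hi
      rw [← this, pow_succ]
      ring
    · rw [Finset.sum_eq_zero, smul_zero, neg_zero, add_zero]
      intro j _
      rw [wedgeBy_apply, if_neg hi, map_zero, smul_zero]
  have h3 : wedgeDiff ρ (fun s => wedgeSum c ω (t, s)) s =
      ∑ i, wedgeDiff ρ (fun s => wedgeBy i (c s i) (fun t => ω (t, s)) t) s := by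
    rw [← Finset.sum_apply, ← map_sum]
    refine congrArg (fun η => wedgeDiff ρ η s) (funext fun s => ?_)
    simp [wedgeSum]
  rw [totDiff_apply, h1, h3, map_sum, Finset.sum_apply]
  change _ + ∑ i, wedgeBy i (c s i) (fun t => totDiff ρ E ω (t, s)) t = _
  simp only [h2, Finset.sum_add_distrib, Finset.sum_neg_distrib, ← Finset.smul_sum]
  have h4 : ∀ i, c s i (E s i (ω (t, s))) = koszulDiff (E s) (wedgeBy i (c s i) fun t => ω (t, s)) t +
      wedgeBy i (c s i) (koszulDiff (E s) fun t => ω (t, s)) t := fun i =>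
    (koszulDiff_wedgeBy (E s) i (c s i) (hE s i) (fun t => ω (t, s)) t).symm
  simp only [h4, Finset.sum_add_distrib]
  abel

end Contracting

/-! ### Reduction to the degrees lying over β. -/

section DegreeProjection

variable {d n : ℕ} {A : Matrix (Fin d) (Fin n) ℤ} {k : Type u} [Field k]

open Classical in
/-- The function `1` on the degrees over `β` and zero elsewhere. -/
def degreeIndicator (β : Fin d → k) (μ : Fin d → ℤ) : k :=
  if (fun i => (μ i : k)) = β then 1 else 0

/-- In a degree μ not over β some scalar μ_i − β_i is nonzero, and C inverts one such scalar; over β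
take C = 0. Thus ∑ C_i(E_i − β_i) is the identity outside β. -/
theorem exists_eulerInverse (β : Fin d → k) : ∃ C : Fin d → (Fin d → ℤ) → k,
    ∀ μ, degreeIndicator β μ + ∑ i, C i μ * eulerScalar β i μ = 1 := by
  classical
  have : ∀ μ : Fin d → ℤ, ∃ C : Fin d → k,
      degreeIndicator β μ + ∑ i, C i * eulerScalar β i μ = 1 := by
    intro μ
    by_cases h : (fun i => (μ i : k)) = β
    · exact ⟨0, by simp [degreeIndicator, h]⟩
    · obtain ⟨i, hi⟩ := Function.ne_iff.1 h
      refine ⟨Pi.single i (eulerScalar β i μ)⁻¹, ?_⟩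
      rw [degreeIndicator, if_neg h, zero_add, Finset.sum_eq_single i]
      · rw [Pi.single_eq_same, inv_mul_cancel₀]
        exact sub_ne_zero.2 hi
      · intro l _ hl
        rw [Pi.single_eq_of_ne hl, zero_mul]
      · simp
  choose C hC using this
  exact ⟨fun i μ => C μ i, hC⟩

theorem diagFun_add (N : GradedModule A k) (s : Finset (Fin n)) (b c : (Fin d → ℤ) → k)
    (f : ExpFun N) : diagFun N s (fun α => b α + c α) f = diagFun N s b f + diagFun N s c f :=
  funext fun v => diagTotal_add N (fun α => b (α - weight A (v + ind s)))
    (fun α => c (α - weight A (v + ind s))) (f v)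

theorem diagFun_sum {ι : Type*} (T : Finset ι) (N : GradedModule A k) (s : Finset (Fin n))
    (c : ι → (Fin d → ℤ) → k) (f : ExpFun N) :
    diagFun N s (fun α => ∑ i ∈ T, c i α) f = ∑ i ∈ T, diagFun N s (c i) f := by
  funext v
  rw [diagFun_apply, Finset.sum_apply]
  exact diagTotal_sum T N _ (f v)

theorem diagFun_const (N : GradedModule A k) (s : Finset (Fin n)) (c : k) (f : ExpFun N) :
    diagFun N s (fun _ => c) f = c • f :=
  funext fun v => diagTotal_const N c (f v)

theorem finiteDiagFun_finiteDiffOp (N : GradedModule A k) {s : Finset (Fin n)} {j : Fin n}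
    (hj : j ∈ s) (c : (Fin d → ℤ) → k) (f : finiteFun N) :
    finiteDiagFun N s c (finiteDiffOp N j f) = finiteDiffOp N j (finiteDiagFun N (s.erase j) c f) :=
  Subtype.ext (diagFun_diffOp N hj c f.1)

theorem finiteDiagFun_comm (N : GradedModule A k) (s : Finset (Fin n)) (b c : (Fin d → ℤ) → k)
    (f : finiteFun N) :
    finiteDiagFun N s b (finiteDiagFun N s c f) = finiteDiagFun N s c (finiteDiagFun N s b f) :=
  Subtype.ext (diagFun_comm N s b c f.1)

/-- The projection of families of functions to the part of degree `β`. -/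
def degreeProjection (β : Fin d → k) (N : GradedModule A k) :
    (Finset (Fin d) × Finset (Fin n) → finiteFun N) →ₗ[k]
      (Finset (Fin d) × Finset (Fin n) → finiteFun N) :=
  LinearMap.pi fun x => finiteDiagFun N x.2 (degreeIndicator β) ∘ₗ
    LinearMap.proj (R := k) (φ := fun _ => finiteFun N) x

theorem degreeProjection_apply (β : Fin d → k) (N : GradedModule A k)
    (ω : Finset (Fin d) × Finset (Fin n) → finiteFun N) (t : Finset (Fin d)) (s : Finset (Fin n)) :
    degreeProjection β N ω (t, s) = finiteDiagFun N s (degreeIndicator β) (ω (t, s)) := rfl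

/-- The differential of `finiteComplex`. -/
abbrev finiteDiff (β : Fin d → k) (N : GradedModule A k) :=
  totDiff (finiteDiffOp N) (finiteEuler β N)

theorem finiteDiff_degreeProjection (β : Fin d → k) (N : GradedModule A k)
    (ω : Finset (Fin d) × Finset (Fin n) → finiteFun N) :
    finiteDiff β N (degreeProjection β N ω) = degreeProjection β N (finiteDiff β N ω) := by
  funext ⟨t, s⟩
  rw [degreeProjection_apply, totDiff_apply, totDiff_apply, map_add, map_zsmul, wedgeDiff_apply,
    wedgeDiff_apply, koszulDiff_apply, koszulDiff_apply, map_sum, map_sum]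
  congr 1
  · congr 1
    refine Finset.sum_congr rfl fun j hj => ?_
    rw [map_zsmul, finiteDiagFun_finiteDiffOp N hj]
    rfl
  · refine Finset.sum_congr rfl fun i _ => ?_
    rw [map_zsmul]
    congr 1
    exact finiteDiagFun_comm N s _ _ _

/-- Multiplication by ∑ e_i C_i is a homotopy between ∑ C_i(E_i − β_i), the complement of the degree
projection, and zero. Applied to a cocycle it gives the primitive. -/
theorem exists_sub_degreeProjection (β : Fin d → k) (N : GradedModule A k)
    (ω : Finset (Fin d) × Finset (Fin n) → finiteFun N) (hω : finiteDiff β N ω = 0) :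
    ∃ η, ω - degreeProjection β N ω = finiteDiff β N η := by
  obtain ⟨C, hC⟩ := exists_eulerInverse (d := d) β
  refine ⟨wedgeSum (fun s i => (finiteDiagFun N s (C i)).toAddMonoidHom) ω, funext fun ⟨t, s⟩ => ?_⟩
  have h := totDiff_wedgeSum (ρ := finiteDiffOp N) (E := finiteEuler β N)
    (fun s i => (finiteDiagFun N s (C i)).toAddMonoidHom)
    (fun s i l m => finiteDiagFun_comm N s _ _ m)
    (fun s j hj i m => finiteDiagFun_finiteDiffOp N hj (C i) m) ω t s
  have h0 : wedgeSum (fun s i => (finiteDiagFun N s (C i)).toAddMonoidHom)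
      (finiteDiff β N ω) (t, s) = 0 := by
    rw [hω]
    refine Finset.sum_eq_zero fun i _ => ?_
    exact congrFun (map_zero (wedgeBy i _)) t
  rw [h0, add_zero] at h
  rw [h, Pi.sub_apply, degreeProjection_apply, sub_eq_iff_eq_add']
  refine Subtype.ext ?_
  have h1 : (ω (t, s)).1 = diagFun N s (fun μ => degreeIndicator β μ +
      ∑ i, C i μ * eulerScalar β i μ) (ω (t, s)).1 := by
    simp only [hC]
    rw [diagFun_const, one_smul]
  refine h1.trans ?_
  rw [diagFun_add, diagFun_sum]
  refine congrArg₂ (· + ·) rfl ?_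
  rw [Submodule.coe_sum]
  exact Finset.sum_congr rfl fun i _ => (diagFun_mul N s _ _ _).symm

theorem diagTotal_mem_homPart (N : GradedModule A k) (c : (Fin d → ℤ) → k) (γ : Fin d → ℤ)
    (hc : ∀ μ, μ ≠ γ → c μ = 0) (x : Total N) : diagTotal N c x ∈ homPart N γ := by
  have : (homPart N γ).mkQ ∘ₗ diagTotal N c = 0 := by
    refine total_hom_ext fun α x => ?_
    rw [LinearMap.comp_apply, diagTotal_incl, LinearMap.zero_apply, Submodule.mkQ_apply,
      Submodule.Quotient.mk_eq_zero]
    by_cases h : α.deg = γ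
    · exact Submodule.smul_mem _ _ (incl_mem_homPart N α γ h x)
    · rw [hc _ h, zero_smul]
      exact zero_mem _
  have h := LinearMap.congr_fun this x
  rwa [LinearMap.comp_apply, LinearMap.zero_apply, Submodule.mkQ_apply,
    Submodule.Quotient.mk_eq_zero] at h

theorem diagTotal_of_mem_homPart (N : GradedModule A k) (c : (Fin d → ℤ) → k) {γ : Fin d → ℤ}
    {x : Total N} (hx : x ∈ homPart N γ) : diagTotal N c x = c γ • x := by
  obtain ⟨x, rfl⟩ := hx
  exact diagTotal_incl N c _ x

theorem diagFun_mem_homFun (N : GradedModule A k) (c : (Fin d → ℤ) → k) (γ : Fin d → ℤ)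
    (hc : ∀ μ, μ ≠ γ → c μ = 0) (s : Finset (Fin n)) (f : ExpFun N) :
    diagFun N s c f ∈ homFun N γ s := by
  intro v
  rw [diagFun_apply]
  refine diagTotal_mem_homPart N _ _ (fun μ hμ => hc _ fun e => hμ ?_) _
  rw [← e, sub_add_cancel]

theorem diagFun_of_mem_homFun (N : GradedModule A k) (c : (Fin d → ℤ) → k) {γ : Fin d → ℤ}
    {s : Finset (Fin n)} {f : ExpFun N} (hf : f ∈ homFun N γ s) : diagFun N s c f = c γ • f := by
  funext v
  rw [diagFun_apply, diagTotal_of_mem_homPart N _ (hf v), add_sub_cancel_right]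
  rfl

end DegreeProjection
end
end EulerKoszul

namespace EulerKoszul
noncomputable section

/-! ### Homology of the complex of finitely supported functions. -/

section FiniteHomology

variable {d n : ℕ} {A : Matrix (Fin d) (Fin n) ℤ} {k : Type u} [Field k]

/-- The pairs `(i, t)` with `i - |t| = p`. -/
abbrev TotalIndex (d : ℕ) (p : ℤ) : Type :=
  {x : ℕ × Finset (Fin d) // (x.1 : ℤ) - x.2.card = p}

/-- The families of cocycles of degree `γ`. -/
abbrev CocycleFamilies (N : GradedModule A k) (γ : Fin d → ℤ) (p : ℤ) : Type u :=
  ∀ x : TotalIndex d (p + n), localCocycles N x.1.1 γ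

/-- The cochain of `finiteComplex` given by a family of cocycles. -/
def assembleCochain (N : GradedModule A k) (γ : Fin d → ℤ) (p : ℤ) :
    CocycleFamilies N γ p →ₗ[k]
      ({x : Finset (Fin d) × Finset (Fin n) // totDegree x = p} → finiteFun N) where
  -- The degree |s| − n − |t| = p is the condition |s| − |t| = p + n on the index (|s|, t).
  toFun z x := ⟨(z ⟨(x.1.2.card, x.1.1), by have := x.2; unfold totDegree at this; simp; omega⟩).1 x.1.2,
    (z _).2.1.2 _ (Set.mem_univ _)⟩
  map_add' _ _ := rfl
  map_smul' _ _ := rfl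

theorem extDeg_assembleCochain (N : GradedModule A k) (γ : Fin d → ℤ) (p : ℤ)
    (z : CocycleFamilies N γ p) (y : TotalIndex d (p + n)) (s : Finset (Fin n)) :
    (extDeg k totDegree (finiteFun N) p (assembleCochain N γ p z) (y.1.2, s)).1 = (z y).1 s := by
  obtain ⟨⟨i, t⟩, h⟩ := y
  by_cases hs : s.card = i
  · subst hs
    have h' : totDegree (t, s) = p := by unfold totDegree; simp at h ⊢; omega
    exact congrArg Subtype.val (dif_pos h')
  · have h' : totDegree (t, s) ≠ p := by unfold totDegree; simp at h ⊢; omega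
    rw [extDeg_apply_of_ne _ h']
    exact ((z _).2.1.1.2 s hs).symm

theorem extDeg_assembleCochain_of_ne (N : GradedModule A k) (γ : Fin d → ℤ) (p : ℤ)
    (z : CocycleFamilies N γ p) {t : Finset (Fin d)} (ht : ∀ y : TotalIndex d (p + n), y.1.2 ≠ t)
    (s : Finset (Fin n)) :
    extDeg k totDegree (finiteFun N) p (assembleCochain N γ p z) (t, s) = 0 := by
  refine extDeg_apply_of_ne _ fun h => ht ⟨(s.card, t), ?_⟩ rfl
  unfold totDegree at h
  simp at h ⊢
  omega

theorem coe_wedgeDiff_finiteDiffOp (N : GradedModule A k) (f : Finset (Fin n) → finiteFun N)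
    (s : Finset (Fin n)) :
    (wedgeDiff (finiteDiffOp N) f s).1 = wedgeDiff (diffOp N) (fun s => (f s).1) s := by
  rw [wedgeDiff_apply, wedgeDiff_apply, Submodule.coe_sum]
  rfl

/-- In degree γ over β the Euler operators act by γ_i − β_i = 0, so only the ρ-direction remains and
the rows t decouple. -/
theorem finiteDiff_of_mem_homFun {β : Fin d → k} (N : GradedModule A k) {γ : Fin d → ℤ}
    (hγ : (fun i => (γ i : k)) = β) (ω : Finset (Fin d) × Finset (Fin n) → finiteFun N)
    (hω : ∀ t s, (ω (t, s)).1 ∈ homFun N γ s) (t : Finset (Fin d)) (s : Finset (Fin n)) :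
    (finiteDiff β N ω (t, s)).1 =
      ((-1 : ℤ) ^ t.card) • wedgeDiff (diffOp N) (fun s => (ω (t, s)).1) s := by
  rw [totDiff_apply, koszulDiff_apply, Finset.sum_eq_zero, add_zero, ← coe_wedgeDiff_finiteDiffOp]
  · rfl
  · intro i _
    have : finiteEuler β N s i (ω (insert i t, s)) = 0 := by
      refine Subtype.ext ((diagFun_of_mem_homFun N (eulerScalar β i) (hω _ s)).trans ?_)
      rw [eulerScalar, congrFun hγ i, sub_self, zero_smul]
      rfl
    rw [this, smul_zero]

theorem extDeg_assembleCochain_mem (N : GradedModule A k) (γ : Fin d → ℤ) (p : ℤ)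
    (z : CocycleFamilies N γ p) (t : Finset (Fin d)) (s : Finset (Fin n)) :
    (extDeg k totDegree (finiteFun N) p (assembleCochain N γ p z) (t, s)).1 ∈ homFun N γ s := by
  by_cases h : ∃ y : TotalIndex d (p + n), y.1.2 = t
  · obtain ⟨y, rfl⟩ := h
    rw [extDeg_assembleCochain]
    exact (z y).2.1.1.1 s
  · push Not at h
    rw [extDeg_assembleCochain_of_ne N γ p z h]
    exact zero_mem _

theorem assembleCochain_mem {β : Fin d → k} (N : GradedModule A k) {γ : Fin d → ℤ}
    (hγ : (fun i => (γ i : k)) = β) (p : ℤ) (z : CocycleFamilies N γ p) :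
    assembleCochain N γ p z ∈ indexedCycles k totDegree (finiteDiff β N) p := by
  change finiteDiff β N _ = 0
  funext ⟨t, s⟩
  refine Subtype.ext ?_
  rw [finiteDiff_of_mem_homFun N hγ _ (extDeg_assembleCochain_mem N γ p z)]
  by_cases h : ∃ y : TotalIndex d (p + n), y.1.2 = t
  · obtain ⟨y, rfl⟩ := h
    simp only [extDeg_assembleCochain]
    have : wedgeDiff (diffOp N) (z y).1 s = 0 := congrFun (z y).2.2 s
    exact (congrArg _ this).trans (smul_zero _)
  · push Not at h
    simp only [extDeg_assembleCochain_of_ne N γ p z h]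
    have := congrFun (map_zero (wedgeDiff (diffOp N))) s
    exact (congrArg _ this).trans (smul_zero _)

/-- The class in the homology of `finiteComplex` of a family of cocycles. -/
def totalClass {β : Fin d → k} (N : GradedModule A k) {γ : Fin d → ℤ}
    (hγ : (fun i => (γ i : k)) = β) (p : ℤ) :
    CocycleFamilies N γ p →ₗ[k] (finiteComplex β N).homology p :=
  indexedClass (finiteCompatible β N).isDegreeOne p ∘ₗ
    (assembleCochain N γ p).codRestrict _ (assembleCochain_mem N hγ p)

section Projection

variable {β : Fin d → k} (N : GradedModule A k) {γ : Fin d → ℤ}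

theorem degreeProjection_mem [CharZero k] (hγ : (fun i => (γ i : k)) = β)
    (ω : Finset (Fin d) × Finset (Fin n) → finiteFun N) (t : Finset (Fin d)) (s : Finset (Fin n)) :
    (degreeProjection β N ω (t, s)).1 ∈ homFun N γ s := by
  have h : ∀ μ, μ ≠ γ → degreeIndicator β μ = 0 := fun μ hμ => if_neg fun e => hμ <| by
    funext i
    have := congrFun (e.trans hγ.symm) i
    exact_mod_cast this
  exact diagFun_mem_homFun N (degreeIndicator β) γ h s (ω (t, s)).1

theorem degreeProjection_eq_self (hγ : (fun i => (γ i : k)) = β)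
    (ω : Finset (Fin d) × Finset (Fin n) → finiteFun N)
    (hω : ∀ t s, (ω (t, s)).1 ∈ homFun N γ s) : degreeProjection β N ω = ω := by
  funext ⟨t, s⟩
  refine Subtype.ext ((diagFun_of_mem_homFun N _ (hω t s)).trans ?_)
  rw [degreeIndicator, if_pos hγ, one_smul]

theorem degreeProjection_eq_zero (h : IsEmpty (DegreeOver A β))
    (ω : Finset (Fin d) × Finset (Fin n) → finiteFun N) : degreeProjection β N ω = 0 := by
  funext ⟨t, s⟩
  refine Subtype.ext (funext fun v => ?_)
  have h1 : degreeIndicator β = fun _ : Fin d → ℤ => (0 : k) :=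
    funext fun μ => if_neg fun e => h.elim ⟨⟨μ⟩, e⟩
  change diagFun N s (degreeIndicator β) (ω (t, s)).1 v = 0
  rw [h1, diagFun_const, zero_smul]
  rfl

end Projection

/-- A cocycle may be replaced by its projection to degree γ without changing its class. The rows of
the projection are then cocycles for the difference operators. -/
theorem totalClass_surjective [CharZero k] {β : Fin d → k} (N : GradedModule A k) {γ : Fin d → ℤ}
    (hγ : (fun i => (γ i : k)) = β) (p : ℤ) : Function.Surjective (totalClass N hγ p) := by
  intro y
  obtain ⟨ω, rfl⟩ := indexedClass_surjective _ p y
  set Ω := extDeg k totDegree (finiteFun N) p ω.1 with hΩ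
  have hΩ0 : finiteDiff β N Ω = 0 := ω.2
  have hP := degreeProjection_mem (β := β) N hγ Ω
  have hD : ∀ t s, wedgeDiff (diffOp N) (fun s => (degreeProjection β N Ω (t, s)).1) s = 0 := by
    intro t s
    have h1 := finiteDiff_of_mem_homFun N hγ _ hP t s
    rw [finiteDiff_degreeProjection, hΩ0, map_zero] at h1
    have h2 := congrArg (fun x => ((-1 : ℤ) ^ t.card) • x) h1.symm
    rw [smul_smul, ← mul_pow] at h2
    simpa using h2
  have hsupp : ∀ t s, totDegree (t, s) ≠ p → degreeProjection β N Ω (t, s) = 0 := by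
    intro t s h
    rw [degreeProjection_apply, hΩ, extDeg_apply_of_ne _ h, map_zero]
  -- Row t of the projected cocycle is supported on the sets s with |s| = p + n + |t|, which is the
  -- exterior degree recorded in the index.
  let z : CocycleFamilies N γ p := fun x =>
    ⟨fun s => (degreeProjection β N Ω (x.1.2, s)).1, ⟨⟨fun s => hP x.1.2 s, fun s hs => by
      refine congrArg Subtype.val (hsupp x.1.2 s fun e => hs ?_)
      have := x.2
      unfold totDegree at e
      simp at e
      omega⟩, fun s _ => (degreeProjection β N Ω (x.1.2, s)).2⟩, funext fun s => hD x.1.2 s⟩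
  have hz : extDeg k totDegree (finiteFun N) p (assembleCochain N γ p z) =
      degreeProjection β N Ω := by
    funext ⟨t, s⟩
    by_cases h : ∃ y : TotalIndex d (p + n), y.1.2 = t
    · obtain ⟨y, rfl⟩ := h
      exact Subtype.ext (extDeg_assembleCochain N γ p z y s)
    · push Not at h
      rw [extDeg_assembleCochain_of_ne N γ p z h, hsupp]
      intro e
      refine h ⟨(s.card, t), ?_⟩ rfl
      unfold totDegree at e
      simp at e ⊢
      omega
  refine ⟨z, ?_⟩
  obtain ⟨η, hη⟩ := exists_sub_degreeProjection β N Ω hΩ0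
  have := (indexedClass_eq_zero_iff (finiteCompatible β N).isDegreeOne p
    (ω - (assembleCochain N γ p).codRestrict _ (assembleCochain_mem N hγ p) z)).2 ⟨η, by
      rw [← hη]
      refine Eq.trans ?_ (map_sub (extDeg k totDegree (finiteFun N) p) ω.1 (assembleCochain N γ p z)).symm
      rw [hz]⟩
  exact (sub_eq_zero.1 ((map_sub (indexedClass _ p) ω _).symm.trans this)).symm

/-- A primitive can be projected to degree γ, where its rows, with the sign (−1)^|t|, are primitives
of the given cocycles. Conversely, primitives of the rows assemble, since the Euler terms vanish in
degree γ. -/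
theorem totalClass_eq_zero_iff [CharZero k] {β : Fin d → k} (N : GradedModule A k)
    {γ : DegreeCat A} (hγ : (fun i => (γ.deg i : k)) = β) (p : ℤ) (z : CocycleFamilies N γ.deg p) :
    totalClass N hγ p z = 0 ↔ ∀ x : TotalIndex d (p + n), localClass N x.1.1 γ (z x) = 0 := by
  refine (indexedClass_eq_zero_iff (finiteCompatible β N).isDegreeOne p _).trans ⟨?_, ?_⟩
  · rintro ⟨η, hη⟩ x
    have hη : finiteDiff β N η = extDeg k totDegree (finiteFun N) p (assembleCochain N γ.deg p z) := hη
    have hP := degreeProjection_mem (β := β) N hγ η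
    rw [localClass_eq_zero_iff]
    have hmem : (fun s => (degreeProjection β N η (x.1.2, s)).1) ∈ homFamilies N γ.deg :=
      fun s => hP x.1.2 s
    refine ⟨((-1 : ℤ) ^ x.1.2.card) • fun s => (degreeProjection β N η (x.1.2, s)).1,
      zsmul_mem hmem _, fun s => zsmul_mem (degreeProjection β N η (x.1.2, s)).2 _, funext fun s => ?_⟩
    rw [map_zsmul, Pi.smul_apply, ← finiteDiff_of_mem_homFun N hγ _ hP, finiteDiff_degreeProjection,
      hη, degreeProjection_eq_self N hγ _ (extDeg_assembleCochain_mem N γ.deg p z),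
      extDeg_assembleCochain]
  · intro h
    have : ∀ t : Finset (Fin d), ∃ η : Finset (Fin n) → finiteFun N,
        (∀ s, (η s).1 ∈ homFun N γ.deg s) ∧ ∀ s, ((-1 : ℤ) ^ t.card) •
          wedgeDiff (diffOp N) (fun s => (η s).1) s =
            (extDeg k totDegree (finiteFun N) p (assembleCochain N γ.deg p z) (t, s)).1 := by
      intro t
      by_cases ht : ∃ y : TotalIndex d (p + n), y.1.2 = t
      · obtain ⟨y, rfl⟩ := ht
        obtain ⟨η, hη1, hη2, hη3⟩ := (localClass_eq_zero_iff N _ _ _).1 (h y)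
        have hη1' : ∀ s, η s ∈ homFun N γ.deg s := hη1
        refine ⟨fun s => ((-1 : ℤ) ^ y.1.2.card) • ⟨η s, hη2 s⟩,
          fun s => zsmul_mem (hη1' s) _, fun s => ?_⟩
        have e : (fun s => (((-1 : ℤ) ^ y.1.2.card) • (⟨η s, hη2 s⟩ : finiteFun N)).1) =
          ((-1 : ℤ) ^ y.1.2.card) • η := rfl
        rw [e, map_zsmul, hη3, extDeg_assembleCochain, Pi.smul_apply, smul_smul, ← mul_pow]
        simp
      · push Not at ht
        refine ⟨0, fun s => zero_mem _, fun s => ?_⟩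
        rw [extDeg_assembleCochain_of_ne N γ.deg p z ht]
        have := congrFun (map_zero (wedgeDiff (diffOp N))) s
        exact (congrArg _ this).trans (smul_zero _)
    choose η hη1 hη2 using this
    refine ⟨fun x => η x.1 x.2, funext fun ⟨t, s⟩ => Subtype.ext ?_⟩
    exact (finiteDiff_of_mem_homFun N hγ _ hη1 t s).trans (hη2 t s)

theorem finiteComplex_homology_eq_zero {β : Fin d → k} (N : GradedModule A k)
    (h : IsEmpty (DegreeOver A β)) (p : ℤ) (y : (finiteComplex β N).homology p) : y = 0 := by
  obtain ⟨ω, rfl⟩ := indexedClass_surjective _ p y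
  refine (indexedClass_eq_zero_iff _ p _).2 ?_
  obtain ⟨η, hη⟩ := exists_sub_degreeProjection β N (extDeg k totDegree (finiteFun N) p ω.1) ω.2
  refine ⟨η, ?_⟩
  rw [← hη, degreeProjection_eq_zero N h, sub_zero]

/-- The map of families of cocycles induced by a morphism. -/
def cocycleMap {N N' : GradedModule A k} (φ : N ⟶ N') (γ : Fin d → ℤ) (p : ℤ)
    (z : CocycleFamilies N γ p) : CocycleFamilies N' γ p :=
  fun x => ⟨_, expMap_mem_localCocycles φ x.1.1 γ (z x).1 (z x).2⟩

theorem totalClass_naturality {β : Fin d → k} {N N' : GradedModule A k} (φ : N ⟶ N')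
    {γ : Fin d → ℤ} (hγ : (fun i => (γ i : k)) = β) (p : ℤ) (z : CocycleFamilies N γ p) :
    HomologicalComplex.homologyMap (finiteComplexMap β φ) p (totalClass N hγ p z) =
      totalClass N' hγ p (cocycleMap φ γ p z) :=
  indexedClass_map _ _ _ _ p _

end FiniteHomology
end
end EulerKoszul

namespace EulerKoszul
noncomputable section

/-! ### Coordinates on the target with respect to exterior monomials. -/

section QuotientEquiv

variable {k : Type u} [Field k] {Z H H' : Type u} [AddCommGroup Z] [Module k Z]
  [AddCommGroup H] [Module k H] [AddCommGroup H'] [Module k H']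

/-- Two surjections with the same kernel have isomorphic targets. -/
def equivOfSurjective (f : Z →ₗ[k] H) (hf : Function.Surjective f) (g : Z →ₗ[k] H')
    (hg : Function.Surjective g) (h : ∀ z, f z = 0 ↔ g z = 0) : H ≃ₗ[k] H' :=
  (f.quotKerEquivOfSurjective hf).symm ≪≫ₗ
    Submodule.quotEquivOfEq (LinearMap.ker f) (LinearMap.ker g) (Submodule.ext fun z => h z) ≪≫ₗ g.quotKerEquivOfSurjective hg

theorem equivOfSurjective_apply (f : Z →ₗ[k] H) (hf : Function.Surjective f) (g : Z →ₗ[k] H')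
    (hg : Function.Surjective g) (h : ∀ z, f z = 0 ↔ g z = 0) (z : Z) :
    equivOfSurjective f hf g hg h (f z) = g z := by
  have : (f.quotKerEquivOfSurjective hf).symm (f z) = Submodule.Quotient.mk z := by
    rw [LinearEquiv.symm_apply_eq]
    rfl
  rw [equivOfSurjective, LinearEquiv.trans_apply, LinearEquiv.trans_apply, this]
  rfl

end QuotientEquiv

section TargetCoordinates

variable {k : Type u} [Field k] {d : ℕ} (M : ℕ → Type u) [∀ i, AddCommGroup (M i)]
  [∀ i, Module k (M i)]

instance (p : ℤ) : Finite (TotalIndex d p) :=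
  Finite.of_injective (fun x => x.1.2) fun x y (h : x.1.2 = y.1.2) => by
    have hx := x.2
    have hy := y.2
    refine Subtype.ext (Prod.ext ?_ h)
    rw [h] at hx
    omega

instance (p : ℤ) : Fintype (TotalIndex d p) := Fintype.ofFinite _

/-- The pairs `(i, j)` with `i - j = p`. -/
abbrev Bidegree (p : ℤ) : Type := {q : ℕ × ℕ // (q.1 : ℤ) - q.2 = p}

/-- The sum of the `M_i ⊗ ⋀^j k^d` with `i - j = p`. -/
abbrev ExteriorTerm (k : Type u) [Field k] (d : ℕ) (M : ℕ → Type u) [∀ i, AddCommGroup (M i)]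
    [∀ i, Module k (M i)] (p : ℤ) : Type u :=
  DirectSum (Bidegree p) fun q => M q.1.1 ⊗[k] ⋀[k]^q.1.2 (Fin d → k)

/-- The elements `v ⊗ e_t`. -/
def exteriorElement {p : ℤ} (q : Bidegree p) (t : Set.powersetCard (Fin d) q.1.2) :
    M q.1.1 →ₗ[k] ExteriorTerm k d M p :=
  DirectSum.lof k (Bidegree p) (fun q => M q.1.1 ⊗[k] ⋀[k]^q.1.2 (Fin d → k)) q ∘ₗ
    (TensorProduct.mk k (M q.1.1) (⋀[k]^q.1.2 (Fin d → k))).flip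
      ((Pi.basisFun k (Fin d)).exteriorPower q.1.2 t)

/-- The coefficients at `e_t`. -/
def exteriorCoord {p : ℤ} (q : Bidegree p) (t : Set.powersetCard (Fin d) q.1.2) :
    ExteriorTerm k d M p →ₗ[k] M q.1.1 :=
  (TensorProduct.rid k (M q.1.1)).toLinearMap ∘ₗ
    LinearMap.lTensor _ (((Pi.basisFun k (Fin d)).exteriorPower q.1.2).coord t) ∘ₗ
    DirectSum.component k (Bidegree p) (fun q => M q.1.1 ⊗[k] ⋀[k]^q.1.2 (Fin d → k)) q

theorem exteriorCoord_exteriorElement {p : ℤ} (q : Bidegree p)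
    (t t' : Set.powersetCard (Fin d) q.1.2) (v : M q.1.1) :
    exteriorCoord (k := k) M q t (exteriorElement M q t' v) = if t = t' then v else 0 := by
  rw [exteriorCoord, exteriorElement, LinearMap.comp_apply, LinearMap.comp_apply,
    LinearMap.comp_apply, DirectSum.component.lof_self, LinearMap.flip_apply, TensorProduct.mk_apply,
    LinearMap.lTensor_tmul, Module.Basis.coord_apply, Module.Basis.repr_self, Finsupp.single_apply]
  simp only [LinearEquiv.coe_coe, TensorProduct.rid_tmul, ite_smul, one_smul, zero_smul, eq_comm]

theorem exteriorCoord_exteriorElement_of_ne {p : ℤ} {q q' : Bidegree p} (h : q ≠ q')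
    (t : Set.powersetCard (Fin d) q.1.2) (t' : Set.powersetCard (Fin d) q'.1.2) (v : M q'.1.1) :
    exteriorCoord (k := k) M q t (exteriorElement M q' t' v) = 0 := by
  rw [exteriorCoord, exteriorElement, LinearMap.comp_apply, LinearMap.comp_apply,
    LinearMap.comp_apply, DirectSum.component.of, dif_neg h.symm, map_zero, map_zero]

/-- The bidegree of an index. -/
def TotalIndex.bidegree {p : ℤ} (x : TotalIndex d p) : Bidegree p :=
  ⟨(x.1.1, x.1.2.card), x.2⟩

/-- The exterior monomial of an index. -/
def TotalIndex.monomial {p : ℤ} (x : TotalIndex d p) :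
    Set.powersetCard (Fin d) x.bidegree.1.2 := ⟨x.1.2, rfl⟩

/-- The element with given coefficients. -/
def exteriorExpansion (p : ℤ) : (∀ x : TotalIndex d p, M x.1.1) →ₗ[k] ExteriorTerm k d M p :=
  ∑ x : TotalIndex d p, exteriorElement M x.bidegree x.monomial ∘ₗ
    LinearMap.proj (R := k) (φ := fun x : TotalIndex d p => M x.1.1) x

theorem exteriorExpansion_apply (p : ℤ) (h : ∀ x : TotalIndex d p, M x.1.1) :
    exteriorExpansion (k := k) M p h = ∑ x, exteriorElement (k := k) M x.bidegree x.monomial (h x) := by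
  rw [exteriorExpansion, LinearMap.sum_apply]
  rfl

theorem exteriorCoord_exteriorExpansion (p : ℤ) (h : ∀ x : TotalIndex d p, M x.1.1)
    (x : TotalIndex d p) :
    exteriorCoord (k := k) M x.bidegree x.monomial (exteriorExpansion M p h) = h x := by
  rw [exteriorExpansion_apply, map_sum, Finset.sum_eq_single x]
  · exact (exteriorCoord_exteriorElement M _ _ _ _).trans (if_pos rfl)
  · intro y _ hyx
    by_cases hq : x.bidegree = y.bidegree
    -- Distinct indices of equal bidegree have distinct sets t. The second bidegree is made a
    -- variable so that the equality can be substituted in the dependent types.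
    · have key : ∀ (q : Bidegree p) (hq : x.bidegree = q)
          (t : Set.powersetCard (Fin d) q.1.2) (ht : t.1 ≠ x.1.2) (v : M q.1.1),
          exteriorCoord (k := k) M x.bidegree x.monomial (exteriorElement M q t v) = 0 := by
        rintro q rfl t ht v
        rw [exteriorCoord_exteriorElement, if_neg]
        rintro rfl
        exact ht rfl
      refine key _ hq _ (fun e => hyx ?_) _
      have h1 : x.1.1 = y.1.1 := congrArg (fun q => q.1.1) hq
      exact Subtype.ext (Prod.ext h1.symm e)
    · exact exteriorCoord_exteriorElement_of_ne M hq _ _ _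
  · exact fun hx => absurd (Finset.mem_univ x) hx

theorem exteriorExpansion_injective (p : ℤ) :
    Function.Injective (exteriorExpansion (k := k) (d := d) M p) := by
  intro h h' e
  funext x
  rw [← exteriorCoord_exteriorExpansion (k := k) M p h, e, exteriorCoord_exteriorExpansion]

theorem exteriorExpansion_surjective (p : ℤ) :
    Function.Surjective (exteriorExpansion (k := k) (d := d) M p) := by
  classical
  rw [← LinearMap.range_eq_top, eq_top_iff]
  rintro w -
  have hgen : ∀ (q : Bidegree p) (t : Set.powersetCard (Fin d) q.1.2) (v : M q.1.1),
      exteriorElement M q t v ∈ LinearMap.range (exteriorExpansion (k := k) (d := d) M p) := by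
    rintro ⟨⟨i, j⟩, hq⟩ ⟨t, ht⟩ v
    obtain rfl : t.card = j := ht
    refine ⟨Pi.single (M := fun x : TotalIndex d p => M x.1.1) ⟨(i, t), hq⟩ v, ?_⟩
    rw [exteriorExpansion_apply, Finset.sum_eq_single (⟨(i, t), hq⟩ : TotalIndex d p)]
    · rw [Pi.single_eq_same]
      rfl
    · intro x _ hx
      rw [Pi.single_eq_of_ne hx]
      exact map_zero _
    · exact fun hx => absurd (Finset.mem_univ _) hx
  induction w using DirectSum.induction_on with
  | zero => exact zero_mem _
  | add w w' hw hw' => exact add_mem hw hw'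
  | of q z =>
    rw [← DirectSum.lof_eq_of k]
    induction z using TensorProduct.induction_on with
    | zero => rw [map_zero]; exact zero_mem _
    | add z z' hz hz' => rw [map_add]; exact add_mem hz hz'
    | tmul v a =>
      have ha := ((Pi.basisFun k (Fin d)).exteriorPower q.1.2).mem_span a
      induction ha using Submodule.span_induction with
      | zero => rw [TensorProduct.tmul_zero, map_zero]; exact zero_mem _
      | add a a' _ _ ha ha' => rw [TensorProduct.tmul_add, map_add]; exact add_mem ha ha'
      | smul c a _ ha =>
        rw [TensorProduct.tmul_smul, map_smul]
        exact Submodule.smul_mem _ c ha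
      | mem a ha =>
        obtain ⟨t, rfl⟩ := ha
        exact hgen q t v

theorem subsingleton_exteriorTerm (hM : ∀ i, Subsingleton (M i)) (p : ℤ) :
    Subsingleton (ExteriorTerm k d M p) :=
  (exteriorExpansion_surjective M p).subsingleton

theorem lmap_exteriorElement {M' : ℕ → Type u} [∀ i, AddCommGroup (M' i)] [∀ i, Module k (M' i)]
    (f : ∀ i, M i →ₗ[k] M' i) {p : ℤ} (q : Bidegree p) (t : Set.powersetCard (Fin d) q.1.2)
    (v : M q.1.1) :
    DirectSum.lmap (fun q : Bidegree p => LinearMap.rTensor (⋀[k]^q.1.2 (Fin d → k)) (f q.1.1))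
      (exteriorElement M q t v) = exteriorElement M' q t (f q.1.1 v) := by
  rw [exteriorElement, exteriorElement, LinearMap.comp_apply, LinearMap.comp_apply,
    DirectSum.lmap_lof]
  rfl

theorem lmap_exteriorExpansion {M' : ℕ → Type u} [∀ i, AddCommGroup (M' i)] [∀ i, Module k (M' i)]
    (f : ∀ i, M i →ₗ[k] M' i) (p : ℤ) (h : ∀ x : TotalIndex d p, M x.1.1) :
    DirectSum.lmap (fun q : Bidegree p => LinearMap.rTensor (⋀[k]^q.1.2 (Fin d → k)) (f q.1.1))
        (exteriorExpansion M p h) =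
      exteriorExpansion M' p fun x => f x.1.1 (h x) := by
  rw [exteriorExpansion_apply, exteriorExpansion_apply, map_sum]
  exact Finset.sum_congr rfl fun x _ => lmap_exteriorElement M f x.bidegree x.monomial (h x)

end TargetCoordinates

/-! ### Identification of the homology with local cohomology tensored with ⋀ k^d. -/

section FiniteHomologyTarget

variable {d n : ℕ} {A : Matrix (Fin d) (Fin n) ℤ} {k : Type u} [Field k] {β : Fin d → k}

theorem degreeOver_subsingleton [CharZero k] : Subsingleton (DegreeOver A β) := by
  refine ⟨fun γ γ' => Subtype.ext (DegreeCat.ext (funext fun i => ?_))⟩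
  have := congrFun (γ.2.trans γ'.2.symm) i
  exact_mod_cast this

/-- The inclusion of the part of degree `γ` in the part of degree `β`. -/
def degreePartIncl (γ : DegreeOver A β) (N : GradedModule A k) :
    N.obj γ.1 →ₗ[k] (degreePart A β).obj N :=
  DirectSum.lof k (DegreeOver A β) (fun α => N.obj α.1) γ

theorem degreePartIncl_injective (γ : DegreeOver A β) (N : GradedModule A k) :
    Function.Injective (degreePartIncl γ N) :=
  DirectSum.of_injective (β := fun α : DegreeOver A β => N.obj α.1) γ

/-- In characteristic zero at most one integral degree lies over β, so the direct sum defining the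
degree β part has the single summand γ. -/
theorem degreePartIncl_surjective [CharZero k] (γ : DegreeOver A β) (N : GradedModule A k) :
    Function.Surjective (degreePartIncl γ N) := by
  rw [← LinearMap.range_eq_top, eq_top_iff]
  rintro w -
  induction w using DirectSum.induction_on with
  | zero => exact zero_mem _
  | add w w' hw hw' => exact add_mem hw hw'
  | of γ' v =>
    obtain rfl : γ = γ' := degreeOver_subsingleton.elim _ _
    exact ⟨v, rfl⟩

theorem degreePart_map_degreePartIncl (γ : DegreeOver A β) {N N' : GradedModule A k} (φ : N ⟶ N')
    (v : N.obj γ.1) :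
    (degreePart A β).map φ (degreePartIncl γ N v) = degreePartIncl γ N' (φ.app γ.1 v) :=
  DirectSum.lmap_lof (fun α : DegreeOver A β => (φ.app α.1).hom) γ v

/-- The parametrization of the target complex by local cohomology classes. -/
def targetExpansion (γ : DegreeOver A β) (N : GradedModule A k) (p : ℤ) :
    (∀ x : TotalIndex d p, ((gradedLocalCohomology A k x.1.1).obj N).obj γ.1) →ₗ[k]
      targetTerm A β N p :=
  exteriorExpansion (fun i => (degreePart A β).obj ((gradedLocalCohomology A k i).obj N)) p ∘ₗ
    LinearMap.piMap fun x : TotalIndex d p =>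
      degreePartIncl γ ((gradedLocalCohomology A k x.1.1).obj N)

theorem targetExpansion_injective (γ : DegreeOver A β) (N : GradedModule A k) (p : ℤ) :
    Function.Injective (targetExpansion γ N p) :=
  (exteriorExpansion_injective _ p).comp fun _ _ e => funext fun x =>
    degreePartIncl_injective γ _ (congrFun e x)

theorem targetExpansion_surjective [CharZero k] (γ : DegreeOver A β) (N : GradedModule A k) (p : ℤ) :
    Function.Surjective (targetExpansion γ N p) := by
  refine (exteriorExpansion_surjective
    (fun i => (degreePart A β).obj ((gradedLocalCohomology A k i).obj N)) p).comp fun h => ?_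
  choose g hg using fun x : TotalIndex d p => degreePartIncl_surjective γ
    ((gradedLocalCohomology A k x.1.1).obj N) (h x)
  exact ⟨g, funext hg⟩

theorem targetMap_targetExpansion (γ : DegreeOver A β) {N N' : GradedModule A k} (φ : N ⟶ N')
    (p : ℤ) (h : ∀ x : TotalIndex d p, ((gradedLocalCohomology A k x.1.1).obj N).obj γ.1) :
    targetMap A β φ p (targetExpansion γ N p h) =
      targetExpansion γ N' p fun x => ((gradedLocalCohomology A k x.1.1).map φ).app γ.1 (h x) := by
  refine (lmap_exteriorExpansion _
    (fun i => ((degreePart A β).map ((gradedLocalCohomology A k i).map φ)).hom) p _).trans ?_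
  refine congrArg (exteriorExpansion
    (fun i => (degreePart A β).obj ((gradedLocalCohomology A k i).obj N')) p) (funext fun x => ?_)
  exact degreePart_map_degreePartIncl γ _ (h x)

theorem subsingleton_targetTerm (N : GradedModule A k) (h : β ∉ degreesRΓ N) (p : ℤ) :
    Subsingleton (targetTerm A β N p) := by
  refine subsingleton_exteriorTerm
    (fun i => (degreePart A β).obj ((gradedLocalCohomology A k i).obj N)) (fun i => ?_) p
  refine ⟨fun x y => DirectSum.ext_component k fun γ => ?_⟩
  by_contra hne
  exact h (Set.mem_iUnion.2 ⟨i, γ, ⟨_, _, hne⟩⟩)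

/-- The isomorphisms between the homology of `finiteComplex` and the target complex. -/
theorem exists_finiteHomologyIso [CharZero k] (A : Matrix (Fin d) (Fin n) ℤ) (β : Fin d → k) :
    ∃ e : ∀ (N : GradedModule A k) (p : ℤ),
      (finiteComplex β N).homology p ≅ targetTerm A β N (p + n),
      ∀ (N N' : GradedModule A k) (φ : N ⟶ N') (p : ℤ),
        HomologicalComplex.homologyMap (finiteComplexMap β φ) p ≫ (e N' p).hom =
          (e N p).hom ≫ targetMap A β φ (p + n) := by
  -- If no integral degree lies over β, both sides are zero and naturality is automatic.
  by_cases hβ : IsEmpty (DegreeOver A β)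
  · have hsub : ∀ (N : GradedModule A k) p, Subsingleton (targetTerm A β N p) := fun N p =>
      subsingleton_targetTerm N (fun h => by
        obtain ⟨i, γ, -⟩ := Set.mem_iUnion.1 h
        exact hβ.elim γ) p
    have e : ∀ (N : GradedModule A k) (p : ℤ),
        Nonempty ((finiteComplex β N).homology p ≅ targetTerm A β N (p + n)) := fun N p =>
      have : Subsingleton ((finiteComplex β N).homology p) :=
        ⟨fun x y => by
          rw [finiteComplex_homology_eq_zero N hβ p x, finiteComplex_homology_eq_zero N hβ p y]⟩
      have := hsub N (p + n)
      ⟨(ModuleCat.isZero_of_subsingleton _).iso (ModuleCat.isZero_of_subsingleton _)⟩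
    refine ⟨fun N p => (e N p).some, fun N N' φ p => ?_⟩
    refine ModuleCat.hom_ext (LinearMap.ext fun x => ?_)
    exact (hsub N' (p + n)).elim _ _
  · obtain ⟨γ⟩ := not_isEmpty_iff.1 hβ
    let g : ∀ (N : GradedModule A k) (p : ℤ), CocycleFamilies N γ.1.deg p →ₗ[k]
        targetTerm A β N (p + n) := fun N p =>
      targetExpansion γ N (p + n) ∘ₗ LinearMap.pi fun x : TotalIndex d (p + n) =>
        localClass N x.1.1 γ.1 ∘ₗ LinearMap.proj (R := k)
          (φ := fun x : TotalIndex d (p + n) => localCocycles N x.1.1 γ.1.deg) x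
    have hg : ∀ N p z, g N p z = targetExpansion γ N (p + n)
        fun x : TotalIndex d (p + n) => localClass N x.1.1 γ.1 (z x) := fun N p z => rfl
    have hgs : ∀ N p, Function.Surjective (g N p) := by
      intro N p w
      obtain ⟨h, rfl⟩ := targetExpansion_surjective γ N _ w
      choose z hz using fun x : TotalIndex d (p + n) => localClass_surjective N x.1.1 γ.1 (h x)
      exact ⟨z, by rw [hg]; exact congrArg _ (funext hz)⟩
    have hgk : ∀ N p z, totalClass N γ.2 p z = 0 ↔ g N p z = 0 := by
      intro N p z
      rw [totalClass_eq_zero_iff, hg]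
      constructor
      · intro h
        exact (congrArg _ (funext h)).trans (map_zero _)
      · intro h x
        exact congrFun (targetExpansion_injective γ N _ (h.trans (map_zero _).symm)) x
    -- Both the homology of the finite complex and the target are quotients of the families of
    -- cocycles, with the same kernel. Naturality is checked on the cocycles themselves.
    refine ⟨fun N p => (equivOfSurjective (totalClass N γ.2 p) (totalClass_surjective N γ.2 p) (g N p)
      (hgs N p) (hgk N p)).toModuleIso, fun N N' φ p => ?_⟩
    refine ModuleCat.hom_ext (LinearMap.ext fun y => ?_)
    obtain ⟨z, rfl⟩ := totalClass_surjective N γ.2 p y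
    change equivOfSurjective _ _ (g N' p) (hgs N' p) (hgk N' p)
      (HomologicalComplex.homologyMap (finiteComplexMap β φ) p (totalClass N γ.2 p z)) =
        targetMap A β φ (p + n) (equivOfSurjective _ _ (g N p) (hgs N p) (hgk N p) (totalClass N γ.2 p z))
    rw [totalClass_naturality, equivOfSurjective_apply, equivOfSurjective_apply, hg, hg,
      targetMap_targetExpansion]
    refine congrArg _ (funext fun x => ?_)
    exact (localClass_naturality φ x.1.1 γ.1 (z x)).symm

end FiniteHomologyTarget
end
end EulerKoszul

namespace EulerKoszul
noncomputable section

/-! ### Maps out of K-projective complexes. -/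

section KProjectiveLifting

variable {D : Type u} [Ring D] {K L M : CochainComplex (ModuleCat.{u} D) ℤ}

attribute [local instance] HasDerivedCategory.standard in
-- From a K-projective source, morphisms in the derived category are the same as homotopy classes of
-- maps of complexes.
theorem homotopy_of_Q_map_eq [K.IsKProjective] {f g : K ⟶ L}
    (h : DerivedCategory.Q.map f = DerivedCategory.Q.map g) : Nonempty (Homotopy f g) := by
  refine ⟨HomotopyCategory.homotopyOfEq _ _
    ((CochainComplex.IsKProjective.Qh_map_bijective K _).injective ?_)⟩
  rw [← cancel_mono ((DerivedCategory.quotientCompQhIso _).hom.app L),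
    DerivedCategory.quotientCompQhIso_hom_naturality,
    DerivedCategory.quotientCompQhIso_hom_naturality, h]

attribute [local instance] HasDerivedCategory.standard in
theorem exists_lift_of_quasiIso [K.IsKProjective] (q : L ⟶ M) [QuasiIso q] (f : K ⟶ M) :
    ∃ g : K ⟶ L, Nonempty (Homotopy (g ≫ q) f) := by
  obtain ⟨g, hg⟩ := (CochainComplex.IsKProjective.Qh_map_bijective K _).surjective
    ((DerivedCategory.quotientCompQhIso _).hom.app K ≫ DerivedCategory.Q.map f ≫
      inv (DerivedCategory.Q.map q) ≫ (DerivedCategory.quotientCompQhIso _).inv.app L)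
  obtain ⟨g, rfl⟩ := (HomotopyCategory.quotient _ _).map_surjective g
  refine ⟨g, homotopy_of_Q_map_eq ?_⟩
  rw [← cancel_epi ((DerivedCategory.quotientCompQhIso _).hom.app K), Functor.map_comp,
    ← Category.assoc, ← DerivedCategory.quotientCompQhIso_hom_naturality, hg]
  simp

attribute [local instance] HasDerivedCategory.standard in
theorem homotopy_of_comp_quasiIso [K.IsKProjective] (q : L ⟶ M) [QuasiIso q] {f g : K ⟶ L}
    (h : Homotopy (f ≫ q) (g ≫ q)) : Nonempty (Homotopy f g) := by
  refine homotopy_of_Q_map_eq ?_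
  have := DerivedCategory.Q_map_eq_of_homotopy _ h
  rwa [Functor.map_comp, Functor.map_comp, cancel_mono] at this

/-- A quasi-isomorphism between K-projective complexes is a homotopy equivalence, and additive
functors preserve these. -/
theorem quasiIso_mapHomologicalComplex {k : Type u} [Field k]
    (F : ModuleCat.{u} D ⥤ ModuleCat.{u} k) [F.Additive] [K.IsKProjective] [L.IsKProjective]
    (f : K ⟶ L) (hf : QuasiIso f) :
    QuasiIso ((F.mapHomologicalComplex (ComplexShape.up ℤ)).map f) := by
  obtain ⟨e, rfl⟩ := (CochainComplex.IsKProjective.quasiIso_iff f).1 hf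
  exact (F.mapHomotopyEquiv e).quasiIso_hom

end KProjectiveLifting

/-! ### Complexes of vector spaces and their homology. -/

section Formality

variable {k : Type u} [Field k]

theorem exists_section {V W : Type u} [AddCommGroup V] [Module k V] [AddCommGroup W] [Module k W]
    (f : V →ₗ[k] W) (hf : Function.Surjective f) : ∃ σ : W →ₗ[k] V, ∀ y, f (σ y) = y := by
  obtain ⟨σ, hσ⟩ := f.exists_rightInverse_of_surjective (LinearMap.range_eq_top.2 hf)
  exact ⟨σ, fun y => LinearMap.congr_fun hσ y⟩

/-- Over a field the map from cycles to homology has a linear section, and ψ sends a homology class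
to the chosen representative. The last clause records that ψ realizes the prescribed e, on which the
comparison of different modules rests. -/
theorem exists_quasiIso_of_d_eq_zero (K Z : CochainComplex (ModuleCat.{u} k) ℤ)
    (hZ : ∀ i j, Z.d i j = 0) (e : ∀ p, K.homology p ≅ Z.X p) :
    ∃ ψ : Z ⟶ K, QuasiIso ψ ∧ ∀ p (z : Z.X p), ∃ hz : K.d p (p + 1) (ψ.f p z) = 0,
      (e p).hom (homologyClass K p (p + 1) (by simp) ⟨ψ.f p z, hz⟩) = z := by
  choose σ hσ using fun p => exists_section (homologyClass K p (p + 1) (by simp))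
    (homologyClass_surjective (by simp))
  let ψ : Z ⟶ K :=
    { f := fun p => ModuleCat.ofHom (Submodule.subtype _ ∘ₗ σ p ∘ₗ (e p).inv.hom)
      comm' := fun p q hpq => by
        obtain rfl : p + 1 = q := hpq
        rw [hZ, Limits.zero_comp]
        exact ModuleCat.hom_ext (LinearMap.ext fun z => (σ p ((e p).inv z)).2) }
  have hψ : ∀ p (z : Z.X p), ∃ hz : K.d p (p + 1) (ψ.f p z) = 0,
      (e p).hom (homologyClass K p (p + 1) (by simp) ⟨ψ.f p z, hz⟩) = z := fun p z =>
    ⟨(σ p ((e p).inv z)).2, (congrArg (e p).hom (hσ p ((e p).inv z))).trans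
      (ConcreteCategory.congr_hom (e p).inv_hom_id z)⟩
  refine ⟨ψ, ⟨fun p => ?_⟩, hψ⟩
  have hn : (ComplexShape.up ℤ).next p = p + 1 := by simp
  rw [quasiIsoAt_iff_isIso_homologyMap, ConcreteCategory.isIso_iff_bijective]
  have hmap : ∀ z : LinearMap.ker (Z.d p (p + 1)).hom,
      (e p).hom (HomologicalComplex.homologyMap ψ p (homologyClass Z p (p + 1) hn z)) = z.1 := by
    intro z
    obtain ⟨hz, h⟩ := hψ p z.1
    exact (congrArg (e p).hom (homologyClass_map ψ hn z hz)).trans h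
  constructor
  · rw [injective_iff_map_eq_zero]
    intro y hy
    obtain ⟨z, rfl⟩ := homologyClass_surjective hn y
    have : z = 0 := Subtype.ext ((hmap z).symm.trans ((congrArg (e p).hom hy).trans (map_zero _)))
    rw [this, map_zero]
  · intro y
    have hz : (e p).hom y ∈ LinearMap.ker (Z.d p (p + 1)).hom := by rw [hZ]; rfl
    refine ⟨homologyClass Z p (p + 1) hn ⟨(e p).hom y, hz⟩, ?_⟩
    exact (ConcreteCategory.bijective_of_isIso (e p).hom).1 (hmap ⟨_, hz⟩)

/-- With zero differential on the source, a homotopy is nothing but a linear lift of f − g through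
the boundaries, which exists over a field. This is why non-natural representatives still give a
natural isomorphism in the derived category. -/
theorem homotopy_of_homologyMap_eq {Z K : CochainComplex (ModuleCat.{u} k) ℤ}
    (hZ : ∀ i j, Z.d i j = 0) (f g : Z ⟶ K)
    (h : ∀ p (z : Z.X p), ∃ y, K.d (p - 1) p y = f.f p z - g.f p z) : Nonempty (Homotopy f g) := by
  have hs : ∀ i j, (ComplexShape.up ℤ).Rel j i → ∃ s : Z.X i ⟶ K.X j, s ≫ K.d j i = f.f i - g.f i := by
    intro i j hij
    obtain rfl : j = i - 1 := eq_sub_of_add_eq hij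
    have hle : ∀ z, (f.f i - g.f i).hom z ∈ LinearMap.range (K.d (i - 1) i).hom := fun z => h i z
    obtain ⟨σ, hσ⟩ := exists_section (K.d (i - 1) i).hom.rangeRestrict
      (LinearMap.surjective_rangeRestrict _)
    refine ⟨ModuleCat.ofHom (σ ∘ₗ (f.f i - g.f i).hom.codRestrict _ hle),
      ModuleCat.hom_ext (LinearMap.ext fun z => ?_)⟩
    exact congrArg Subtype.val (hσ _)
  choose s hs using hs
  classical
  refine ⟨{ hom := fun i j => if hij : (ComplexShape.up ℤ).Rel j i then s i j hij else 0,
            zero := fun i j hij => dif_neg hij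
            comm := fun i => ?_ }⟩
  have hr : (ComplexShape.up ℤ).Rel (i - 1) i := by simp
  rw [dNext_eq _ (show (ComplexShape.up ℤ).Rel i (i + 1) by simp), prevD_eq _ hr, hZ, Limits.zero_comp,
    zero_add, dif_pos hr, hs, sub_add_cancel]

end Formality
end
end EulerKoszul

namespace EulerKoszul
noncomputable section

/-! ### Comparison with arbitrary K-projective resolutions. -/

section Comparison

variable {d n : ℕ} {A : Matrix (Fin d) (Fin n) ℤ} {k : Type u} [Field k] [CharZero k]
  {β : Fin d → k}

theorem exists_resolutionComparison (β : Fin d → k) {N : GradedModule A k}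
    (P : KProjectiveResolution ((eulerKoszul A β).obj N)) :
    ∃ c : P.complex ⟶ freeResolution β N, QuasiIso c ∧
      Nonempty (Homotopy (c ≫ freeAugmentation β N) P.π) := by
  have := P.isKProjective
  have := P.quasiIso
  have := quasiIso_freeAugmentation β N
  obtain ⟨c, ⟨hc⟩⟩ := exists_lift_of_quasiIso (freeAugmentation β N) P.π
  have h : QuasiIso (c ≫ freeAugmentation β N) := by
    refine ⟨fun i => ?_⟩
    rw [quasiIsoAt_iff_isIso_homologyMap, hc.homologyMap_eq]
    infer_instance
  exact ⟨c, quasiIso_of_comp_right c (freeAugmentation β N), ⟨hc⟩⟩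

/-- A comparison map from a K-projective resolution to the free resolution. -/
def resolutionComparison {N : GradedModule A k}
    (P : KProjectiveResolution ((eulerKoszul A β).obj N)) : P.complex ⟶ freeResolution β N :=
  (exists_resolutionComparison β P).choose

theorem resolutionComparison_spec {N : GradedModule A k}
    (P : KProjectiveResolution ((eulerKoszul A β).obj N)) :
    QuasiIso (resolutionComparison P) ∧
      Nonempty (Homotopy (resolutionComparison P ≫ freeAugmentation β N) P.π) :=
  (exists_resolutionComparison β P).choose_spec

/-- The two composites become homotopic after the augmentation. This is a quasi-isomorphism, so it
can be cancelled for maps out of a K-projective complex. -/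
theorem resolutionComparison_naturality {N N' : GradedModule A k} (φ : N ⟶ N')
    (P : KProjectiveResolution ((eulerKoszul A β).obj N))
    (P' : KProjectiveResolution ((eulerKoszul A β).obj N')) (f : P.complex ⟶ P'.complex)
    (hf : Homotopy (f ≫ P'.π) (P.π ≫ (eulerKoszul A β).map φ)) :
    Nonempty (Homotopy (f ≫ resolutionComparison P')
      (resolutionComparison P ≫ freeResolutionMap β φ)) := by
  have := P.isKProjective
  have := quasiIso_freeAugmentation β N'
  obtain ⟨-, ⟨h⟩⟩ := resolutionComparison_spec P
  obtain ⟨-, ⟨h'⟩⟩ := resolutionComparison_spec P'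
  refine homotopy_of_comp_quasiIso (freeAugmentation β N') ?_
  refine (Homotopy.ofEq (Category.assoc _ _ _)).trans (((h'.compLeft f).trans hf).trans ?_)
  refine (h.symm.compRight ((eulerKoszul A β).map φ)).trans (Homotopy.ofEq ?_)
  rw [Category.assoc, Category.assoc, freeAugmentation_naturality]

/-- The comparison of the derived tensor product with the complex of functions of finite
support. -/
def finiteComparison {N : GradedModule A k} (P : KProjectiveResolution ((eulerKoszul A β).obj N)) :
    (deRhamComplex k n).obj P.complex ⟶ finiteComplex β N :=
  (deRhamComplex k n).map (resolutionComparison P) ≫ deRhamComparison β N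

theorem quasiIso_finiteComparison {N : GradedModule A k}
    (P : KProjectiveResolution ((eulerKoszul A β).obj N)) : QuasiIso (finiteComparison P) := by
  have := P.isKProjective
  have := isKProjective_freeResolution β N
  have : QuasiIso ((deRhamComplex k n).map (resolutionComparison P)) :=
    quasiIso_mapHomologicalComplex (deRhamFunctor k n) _ (resolutionComparison_spec P).1
  unfold finiteComparison
  infer_instance

theorem finiteComparison_naturality {N N' : GradedModule A k} (φ : N ⟶ N')
    (P : KProjectiveResolution ((eulerKoszul A β).obj N))
    (P' : KProjectiveResolution ((eulerKoszul A β).obj N')) (f : P.complex ⟶ P'.complex)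
    (hf : Homotopy (f ≫ P'.π) (P.π ≫ (eulerKoszul A β).map φ)) :
    Nonempty (Homotopy ((deRhamComplex k n).map f ≫ finiteComparison P')
      (finiteComparison P ≫ finiteComplexMap β φ)) := by
  obtain ⟨h⟩ := resolutionComparison_naturality φ P P' f hf
  have h1 := (Functor.mapHomotopy (deRhamFunctor k n) h).compRight (deRhamComparison β N')
  refine ⟨(Homotopy.ofEq ?_).trans (h1.trans (Homotopy.ofEq ?_))⟩
  · rw [finiteComparison, ← Category.assoc, ← Functor.map_comp]
    rfl
  · refine (congrArg (· ≫ deRhamComparison β N') ((deRhamComplex k n).map_comp _ _)).trans ?_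
    rw [finiteComparison, Category.assoc, Category.assoc, deRhamComparison_naturality]

/-- The two paths around the square may pick different representatives, but by naturality of e these
have the same homology class, so the paths are homotopic. The sign that the shift puts on
differentials is harmless because they are zero. -/
theorem exists_targetComparison (A : Matrix (Fin d) (Fin n) ℤ) (β : Fin d → k) :
    ∃ ψ : ∀ N : GradedModule A k, ((targetComplex A β).obj N)⟦(n : ℤ)⟧ ⟶ finiteComplex β N,
      (∀ N, QuasiIso (ψ N)) ∧ ∀ (N N' : GradedModule A k) (φ : N ⟶ N'),
        Nonempty (Homotopy (((targetComplex A β).map φ)⟦(n : ℤ)⟧' ≫ ψ N')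
          (ψ N ≫ finiteComplexMap β φ)) := by
  obtain ⟨e, he⟩ := exists_finiteHomologyIso A β
  have hd0 : ∀ (N : GradedModule A k) i j, ((targetComplex A β).obj N).d i j = 0 := fun _ _ _ => rfl
  have hd : ∀ (N : GradedModule A k) i j, (((targetComplex A β).obj N)⟦(n : ℤ)⟧).d i j = 0 :=
    fun N i j => by
      rw [CochainComplex.shiftFunctor_obj_d', hd0, smul_zero]
      rfl
  choose ψ hψ hψ' using fun N => exists_quasiIso_of_d_eq_zero (finiteComplex β N)
    (((targetComplex A β).obj N)⟦(n : ℤ)⟧) (hd N) (e N)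
  refine ⟨ψ, hψ, fun N N' φ => homotopy_of_homologyMap_eq (hd N) _ _ fun p z => ?_⟩
  obtain ⟨hz, h⟩ := hψ' N p z
  obtain ⟨hz', h'⟩ := hψ' N' p (targetMap A β φ (p + n) z)
  have hcyc := cycle_map (finiteComplexMap β φ) hz
  have h1 := ConcreteCategory.congr_hom (he N N' φ p)
    (homologyClass (finiteComplex β N) p (p + 1) (by simp) ⟨_, hz⟩)
  have h2 : (e N' p).hom (homologyClass (finiteComplex β N') p (p + 1) (by simp) ⟨_, hcyc⟩) =
      targetMap A β φ (p + n) z :=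
    (congrArg (e N' p).hom (homologyClass_map (finiteComplexMap β φ) (by simp) ⟨_, hz⟩ hcyc).symm).trans
      (h1.trans (congrArg (targetMap A β φ (p + n)) h))
  have h3 := (ConcreteCategory.bijective_of_isIso (e N' p).hom).1 (h'.trans h2.symm)
  exact (homologyClass_eq_zero_iff (i := p - 1) (by simp) (by simp) (⟨_, hz'⟩ - ⟨_, hcyc⟩)).1
    ((map_sub _ _ _).trans (sub_eq_zero.2 h3))

/-- The isomorphism is the roof of two quasi-isomorphisms into the complex of finitely supported
functions: one from the tensored resolution, one from the shifted target. Both are natural up to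
homotopy, which is equality in the derived category. -/
theorem exists_derivedIso [HasDerivedCategory.{w} (ModuleCat.{u} k)]
    (A : Matrix (Fin d) (Fin n) ℤ) (β : Fin d → k) :
    ∃ θ : ∀ (N : GradedModule A k) (P : KProjectiveResolution ((eulerKoszul A β).obj N)),
        DerivedCategory.Q.obj ((deRhamComplex k n).obj P.complex) ≅
          DerivedCategory.Q.obj (((targetComplex A β).obj N)⟦(n : ℤ)⟧),
      ∀ (N N' : GradedModule A k) (φ : N ⟶ N')
        (P : KProjectiveResolution ((eulerKoszul A β).obj N))
        (P' : KProjectiveResolution ((eulerKoszul A β).obj N'))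
        (f : P.complex ⟶ P'.complex),
        Nonempty (Homotopy (f ≫ P'.π) (P.π ≫ (eulerKoszul A β).map φ)) →
          DerivedCategory.Q.map ((deRhamComplex k n).map f) ≫ (θ N' P').hom =
            (θ N P).hom ≫ DerivedCategory.Q.map (((targetComplex A β).map φ)⟦(n : ℤ)⟧') := by
  obtain ⟨ψ, hψ, hψ'⟩ := exists_targetComparison A β
  have := fun (N : GradedModule A k) (P : KProjectiveResolution ((eulerKoszul A β).obj N)) =>
    quasiIso_finiteComparison P
  refine ⟨fun N P => asIso (DerivedCategory.Q.map (finiteComparison P)) ≪≫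
    (asIso (DerivedCategory.Q.map (ψ N))).symm, fun N N' φ P P' f ⟨hf⟩ => ?_⟩
  obtain ⟨h1⟩ := finiteComparison_naturality φ P P' f hf
  obtain ⟨h2⟩ := hψ' N N' φ
  have e1 := DerivedCategory.Q_map_eq_of_homotopy _ h1
  have e2 := DerivedCategory.Q_map_eq_of_homotopy _ h2
  rw [Functor.map_comp, Functor.map_comp] at e1 e2
  simp only [Iso.trans_hom, asIso_hom, Iso.symm_hom, asIso_inv]
  rw [← Category.assoc, e1, Category.assoc, Category.assoc]
  congr 1
  rw [IsIso.comp_inv_eq, Category.assoc, e2, IsIso.inv_hom_id_assoc]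

theorem homology_deRham_iso (N : GradedModule A k)
    (P : KProjectiveResolution ((eulerKoszul A β).obj N)) (p : ℤ) :
    Nonempty (((deRhamComplex k n).obj P.complex).homology p ≅ targetTerm A β N (p + n)) := by
  obtain ⟨e, -⟩ := exists_finiteHomologyIso A β
  have := quasiIso_finiteComparison P
  exact ⟨asIso (HomologicalComplex.homologyMap (finiteComparison P) p) ≪≫ e N p⟩

theorem isZero_derived_of_notMem [HasDerivedCategory.{w} (ModuleCat.{u} k)] (N : GradedModule A k)
    (h : β ∉ degreesRΓ N) (P : KProjectiveResolution ((eulerKoszul A β).obj N)) :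
    Limits.IsZero (DerivedCategory.Q.obj ((deRhamComplex k n).obj P.complex)) := by
  obtain ⟨θ, -⟩ := exists_derivedIso A β
  refine Limits.IsZero.of_iso ?_ (θ N P)
  refine Functor.map_isZero DerivedCategory.Q ?_
  rw [Limits.IsZero.iff_id_eq_zero]
  ext p : 1
  have := subsingleton_targetTerm N h (p + n)
  exact ModuleCat.hom_ext (LinearMap.ext fun z => Subsingleton.elim (α := targetTerm A β N (p + n)) _ _)

end Comparison
end
end EulerKoszul

namespace EulerKoszul
noncomputable section

/-! ### De Rham cohomology of the torus by logarithmic forms. -/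

section TorusDeRham

variable (k : Type u) [Field k] {d : ℕ}

/-- The diagonal operator on functions of finite support on `ℤ^d`. -/
def diagLattice (c : (Fin d → ℤ) → k) : Module.End k ((Fin d → ℤ) →₀ k) :=
  Finsupp.lsum k fun α => c α • Finsupp.lsingle α

variable {k}

theorem diagLattice_apply (c : (Fin d → ℤ) → k) (f : (Fin d → ℤ) →₀ k) (α : Fin d → ℤ) :
    diagLattice k c f α = c α * f α := by
  induction f using Finsupp.induction_linear with
  | zero => simp
  | add f g hf hg => rw [map_add, Finsupp.add_apply, Finsupp.add_apply, hf, hg, mul_add]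
  | single μ x =>
    rw [diagLattice, Finsupp.lsum_single, LinearMap.smul_apply, Finsupp.lsingle_apply,
      Finsupp.smul_apply, smul_eq_mul]
    by_cases h : μ = α
    · rw [h]
    · rw [Finsupp.single_eq_of_ne (Ne.symm h), mul_zero, mul_zero]

theorem diagLattice_comm (b c : (Fin d → ℤ) → k) (f : (Fin d → ℤ) →₀ k) :
    diagLattice k b (diagLattice k c f) = diagLattice k c (diagLattice k b f) := by
  ext α
  simp only [diagLattice_apply]
  ring

/-- The vector `1_s`. -/
def latticeInd (s : Finset (Fin d)) : Fin d → ℤ := fun i => if i ∈ s then 1 else 0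

theorem latticeInd_erase {s : Finset (Fin d)} {i : Fin d} (hi : i ∈ s) :
    latticeInd (s.erase i) = latticeInd s - Pi.single i 1 := by
  funext l
  by_cases h : l = i
  · subst h; simp [latticeInd, hi]
  · simp [latticeInd, h]

/-- The coefficients of `f dt_s` with respect to the logarithmic forms `t^α dt_s / t^{1_s}`. -/
def logCoeff (s : Finset (Fin d)) : Laurent k d ≃ₗ[k] ((Fin d → ℤ) →₀ k) :=
  (AddMonoidAlgebra.coeffLinearEquiv k : Laurent k d ≃ₗ[k] ((Fin d → ℤ) →₀ k)).trans
    (Finsupp.domLCongr (R := k) (M := k) (Equiv.addRight (latticeInd s)))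

theorem logCoeff_single (s : Finset (Fin d)) (α : Fin d → ℤ) (x : k) :
    logCoeff s (AddMonoidAlgebra.single α x) = Finsupp.single (α + latticeInd s) x := by
  change Finsupp.domLCongr (R := k) (M := k) (Equiv.addRight (latticeInd s)) (Finsupp.single α x) = _
  rw [Finsupp.domLCongr_single]
  rfl

/-- The exponent shift by 1_s absorbs the shift by e_i in ∂/∂t_i. On logarithmic coefficients the
derivative is therefore the diagonal operator α ↦ α_i. -/
theorem logCoeff_torusDeriv {s : Finset (Fin d)} {i : Fin d} (hi : i ∈ s) (f : Laurent k d) :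
    logCoeff s (torusDeriv k i f) =
      diagLattice k (eulerScalar 0 i) (logCoeff (s.erase i) f) := by
  have : (logCoeff s).toLinearMap ∘ₗ torusDeriv k i =
      diagLattice k (eulerScalar 0 i) ∘ₗ (logCoeff (s.erase i)).toLinearMap := by
    refine AddMonoidAlgebra.lhom_ext' fun α => LinearMap.ext fun x => ?_
    change logCoeff s (torusDeriv k i (AddMonoidAlgebra.single α x)) =
      diagLattice k (eulerScalar 0 i) (logCoeff (s.erase i) (AddMonoidAlgebra.single α x))
    rw [torusDeriv_single, logCoeff_single, logCoeff_single, diagLattice, Finsupp.lsum_single,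
      LinearMap.smul_apply, Finsupp.lsingle_apply, Finsupp.smul_single, latticeInd_erase hi]
    congr 1
    · abel
    · simp [eulerScalar, latticeInd, hi]
  exact LinearMap.congr_fun this f

/-- The logarithmic coefficients of a differential form. -/
def logForm (ω : Finset (Fin d) → Laurent k d) : Finset (Fin d) → ((Fin d → ℤ) →₀ k) :=
  fun s => logCoeff s (ω s)

/-- The operators `t_i ∂/∂t_i` on logarithmic coefficients. -/
abbrev logDeriv (k : Type u) [Field k] {d : ℕ} (i : Fin d) : Module.End k ((Fin d → ℤ) →₀ k) :=
  diagLattice k (eulerScalar 0 i)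

theorem logForm_wedgeDiff (ω : Finset (Fin d) → Laurent k d) :
    logForm (wedgeDiff (torusDeriv k) ω) = wedgeDiff (logDeriv k) (logForm ω) := by
  funext s
  rw [logForm, wedgeDiff_apply, wedgeDiff_apply, map_sum]
  refine Finset.sum_congr rfl fun i hi => ?_
  rw [map_zsmul, logCoeff_torusDeriv hi]
  rfl

theorem isDegreeOne_wedgeDiff {S : Type u} [Ring S] {M : Type u} [AddCommGroup M] [Module S M]
    (f : Fin d → Module.End S M) (hf : ∀ i l m, f i (f l m) = f l (f i m)) :
    IsDegreeOne (fun s : Finset (Fin d) => (s.card : ℤ)) (wedgeDiff f) where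
  sq := wedgeDiff_sq f hf
  degree p ω hω s hs := by
    rw [wedgeDiff_apply]
    refine Finset.sum_eq_zero fun i hi => ?_
    rw [hω, map_zero, smul_zero]
    have := Finset.card_erase_add_one hi
    push_cast [← this] at hs
    omega

/-- The invariant forms `∑_s c_s dt_s / t^{1_s}`. -/
def invariantForm (q : ℤ) :
    ({s : Finset (Fin d) // (s.card : ℤ) = q} → k) →ₗ[k]
      ({s : Finset (Fin d) // (s.card : ℤ) = q} → Laurent k d) :=
  LinearMap.pi fun s => (logCoeff s.1).symm.toLinearMap ∘ₗ Finsupp.lsingle 0 ∘ₗ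
    LinearMap.proj (R := k) (φ := fun _ => k) s

theorem logForm_invariantForm (q : ℤ) (c : {s : Finset (Fin d) // (s.card : ℤ) = q} → k)
    (s : Finset (Fin d)) :
    logForm (extDeg k (fun s : Finset (Fin d) => (s.card : ℤ)) (Laurent k d) q (invariantForm q c)) s =
      Finsupp.single 0 (extDeg k (fun s : Finset (Fin d) => (s.card : ℤ)) k q c s) := by
  unfold logForm
  by_cases hs : (s.card : ℤ) = q
  · have h1 : extDeg k (fun s : Finset (Fin d) => (s.card : ℤ)) (Laurent k d) q (invariantForm q c) s =
      invariantForm q c ⟨s, hs⟩ := dif_pos hs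
    have h2 : extDeg k (fun s : Finset (Fin d) => (s.card : ℤ)) k q c s = c ⟨s, hs⟩ := dif_pos hs
    rw [h1, h2]
    exact (logCoeff s).apply_symm_apply _
  · rw [extDeg_apply_of_ne (deg := fun s : Finset (Fin d) => (s.card : ℤ)) _ hs, extDeg_apply_of_ne (deg := fun s : Finset (Fin d) => (s.card : ℤ)) _ hs, map_zero, Finsupp.single_zero]

theorem logForm_injective : Function.Injective (logForm (k := k) (d := d)) := fun _ _ h =>
  funext fun s => (logCoeff s).injective (congrFun h s)

/-- All scalars α_i vanish at α = 0, so exact forms have no invariant part. This makes the classes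
of invariant forms independent. -/
theorem wedgeDiff_logDeriv_apply_zero (η : Finset (Fin d) → ((Fin d → ℤ) →₀ k))
    (s : Finset (Fin d)) : wedgeDiff (logDeriv k) η s 0 = 0 := by
  rw [wedgeDiff_apply, Finsupp.finsetSum_apply]
  refine Finset.sum_eq_zero fun i _ => ?_
  rw [Finsupp.smul_apply, diagLattice_apply, eulerScalar]
  simp

theorem invariantForm_mem (q : ℤ) (c : {s : Finset (Fin d) // (s.card : ℤ) = q} → k) :
    invariantForm q c ∈ indexedCycles k (fun s : Finset (Fin d) => (s.card : ℤ))
      (wedgeDiff (torusDeriv k)) q := by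
  refine logForm_injective ?_
  change logForm (wedgeDiff (torusDeriv k) _) = _
  rw [logForm_wedgeDiff]
  funext s
  ext α
  refine Eq.trans ?_ (by simp [logForm] : (0 : k) = logForm 0 s α)
  by_cases hα : α = 0
  · rw [hα, wedgeDiff_logDeriv_apply_zero]
  · rw [wedgeDiff_apply, Finsupp.finsetSum_apply]
    refine Finset.sum_eq_zero fun i _ => ?_
    rw [logForm_invariantForm, Finsupp.smul_apply, diagLattice_apply, Finsupp.single_eq_of_ne hα,
      mul_zero, smul_zero]

/-- The cohomology class of an invariant form. -/
def invariantClass (q : ℤ) :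
    ({s : Finset (Fin d) // (s.card : ℤ) = q} → k) →ₗ[k] (deRhamTorus k d).homology q :=
  indexedClass (isDegreeOne_wedgeDiff (torusDeriv k) (torusDeriv_comm k)) q ∘ₗ
    (invariantForm q).codRestrict _ (invariantForm_mem q)

theorem invariantClass_injective (q : ℤ) : Function.Injective (invariantClass (k := k) (d := d) q) := by
  rw [injective_iff_map_eq_zero]
  intro c hc
  obtain ⟨η, hη⟩ := (indexedClass_eq_zero_iff
    (isDegreeOne_wedgeDiff (torusDeriv k) (torusDeriv_comm k)) q _).1 hc
  funext s
  have h1 := congrFun (congrArg logForm hη) s.1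
  rw [logForm_wedgeDiff] at h1
  have h2 := congrArg (fun f => f 0) (h1.trans (logForm_invariantForm q c s.1))
  have h3 : extDeg k (fun s : Finset (Fin d) => (s.card : ℤ)) k q c s.1 = c s := dif_pos s.2
  simp only [wedgeDiff_logDeriv_apply_zero, Finsupp.single_eq_same, h3] at h2
  exact h2.symm

/-- For α ≠ 0 some α_i is invertible in characteristic zero. Contracting with the inverses C_i of
`exists_eulerInverse` at β = 0, Cartan's formula gives the identity outside α = 0. -/
theorem exists_log_primitive [CharZero k] (ω : Finset (Fin d) → ((Fin d → ℤ) →₀ k))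
    (hω : wedgeDiff (logDeriv k) ω = 0) :
    ∃ η, ∀ s, ω s - Finsupp.single 0 (ω s 0) = wedgeDiff (logDeriv k) η s := by
  obtain ⟨C, hC⟩ := exists_eulerInverse (d := d) (0 : Fin d → k)
  refine ⟨∑ i, contraction i (diagLattice k (C i)).toAddMonoidHom ω, fun s => ?_⟩
  have h1 : ∀ i, wedgeDiff (logDeriv k) (contraction i (diagLattice k (C i)).toAddMonoidHom ω) s =
      diagLattice k (C i) (logDeriv k i (ω s)) := by
    intro i
    have := wedgeDiff_contraction (logDeriv k) i (diagLattice k (C i)).toAddMonoidHom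
      (fun l _ m => diagLattice_comm _ _ m) ω s
    rw [hω, map_zero, Pi.zero_apply, add_zero] at this
    rw [this]
    split_ifs
    · exact diagLattice_comm _ _ _
    · rfl
  rw [map_sum, Finset.sum_apply, Finset.sum_congr rfl fun i _ => h1 i]
  ext α
  rw [Finsupp.finsetSum_apply, Finsupp.sub_apply]
  simp only [diagLattice_apply, ← mul_assoc, ← Finset.sum_mul]
  have h2 := hC α
  by_cases hα : α = 0
  · rw [hα, Finsupp.single_eq_same, sub_self, eq_comm]
    simp [eulerScalar]
  · have h3 : degreeIndicator (0 : Fin d → k) α = 0 := by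
      refine if_neg fun e => hα (funext fun i => ?_)
      have := congrFun e i
      exact Int.cast_eq_zero.1 this
    rw [h3, zero_add] at h2
    rw [h2, one_mul, Finsupp.single_eq_of_ne hα, sub_zero]

/-- The logarithmic coefficients at α = 0 define the invariant form; what is left of the cocycle has
a primitive by `exists_log_primitive`. -/
theorem invariantClass_surjective [CharZero k] (q : ℤ) :
    Function.Surjective (invariantClass (k := k) (d := d) q) := by
  intro y
  obtain ⟨ω, rfl⟩ := indexedClass_surjective
    (isDegreeOne_wedgeDiff (torusDeriv k) (torusDeriv_comm k)) q y
  set Ω := extDeg k (fun s : Finset (Fin d) => (s.card : ℤ)) (Laurent k d) q ω.1 with hΩ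
  obtain ⟨η, hη⟩ := exists_log_primitive (logForm Ω) (by
    rw [← logForm_wedgeDiff, show wedgeDiff (torusDeriv k) Ω = 0 from ω.2]
    funext s
    exact map_zero _)
  refine ⟨fun s => logForm Ω s.1 0, ?_⟩
  set c : {s : Finset (Fin d) // (s.card : ℤ) = q} → k := fun s => logForm Ω s.1 0 with hc
  have := (indexedClass_eq_zero_iff (isDegreeOne_wedgeDiff (torusDeriv k) (torusDeriv_comm k)) q
    (ω - (invariantForm q).codRestrict _ (invariantForm_mem q) c)).2
    ⟨fun s => (logCoeff s).symm (η s), logForm_injective (funext fun s => ?_)⟩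
  · exact (sub_eq_zero.1 ((map_sub (indexedClass _ q) ω _).symm.trans this)).symm
  · rw [logForm_wedgeDiff]
    have h1 : logForm (fun s => (logCoeff s).symm (η s)) = η :=
      funext fun s => (logCoeff s).apply_symm_apply _
    rw [h1, ← hη]
    have h2 : logForm (extDeg k (fun s : Finset (Fin d) => (s.card : ℤ)) (Laurent k d) q
        (ω.1 - invariantForm q c)) s = logForm Ω s - logForm (extDeg k
          (fun s : Finset (Fin d) => (s.card : ℤ)) (Laurent k d) q (invariantForm q c)) s := by
      rw [map_sub]
      exact map_sub (logCoeff s) _ _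
    refine Eq.trans ?_ h2.symm
    rw [logForm_invariantForm]
    congr 2
    by_cases hs : (s.card : ℤ) = q
    · exact (dif_pos hs : extDeg k (fun s : Finset (Fin d) => (s.card : ℤ)) k q c s = c ⟨s, hs⟩).symm
    · rw [extDeg_apply_of_ne (deg := fun s : Finset (Fin d) => (s.card : ℤ)) _ hs, hΩ]
      unfold logForm
      rw [extDeg_apply_of_ne (deg := fun s : Finset (Fin d) => (s.card : ℤ)) _ hs, map_zero (logCoeff s)]
      rfl

/-- The algebraic de Rham cohomology of the torus. -/
def torusCohomologyEquiv [CharZero k] (q : ℤ) :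
    ({s : Finset (Fin d) // (s.card : ℤ) = q} → k) ≃ₗ[k] (deRhamTorus k d).homology q :=
  LinearEquiv.ofBijective (invariantClass q) ⟨invariantClass_injective q, invariantClass_surjective q⟩

end TorusDeRham
end
end EulerKoszul

namespace EulerKoszul
noncomputable section

/-! ### Čech complexes of families of sets, with deletion and link. -/

section Cech

variable {k : Type u} [Field k] {n : ℕ}

/-- The Čech differential of the functions on the subsets of `E`. -/
def cechDiff (k : Type u) [Field k] {n : ℕ} (E : Finset (Fin n)) :
    (Finset (Fin n) → k) →ₗ[k] (Finset (Fin n) → k) :=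
  wedgeDiff fun e => if e ∈ E then (1 : Module.End k k) else 0

theorem cechDiff_apply (E : Finset (Fin n)) (g : Finset (Fin n) → k) (J : Finset (Fin n)) :
    cechDiff k E g J = ∑ e ∈ J, wedgeSign e J • if e ∈ E then g (J.erase e) else 0 := by
  rw [cechDiff, wedgeDiff_apply]
  refine Finset.sum_congr rfl fun e _ => ?_
  split_ifs <;> simp

theorem cechDiff_sq (E : Finset (Fin n)) (g : Finset (Fin n) → k) :
    cechDiff k E (cechDiff k E g) = 0 := by
  refine wedgeDiff_sq _ (fun i l m => ?_) g
  split_ifs <;> simp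

theorem cechDiff_contraction {E : Finset (Fin n)} {e : Fin n} (he : e ∈ E)
    (g : Finset (Fin n) → k) (J : Finset (Fin n)) :
    cechDiff k E (contraction e (AddMonoidHom.id k) g) J +
      contraction e (AddMonoidHom.id k) (cechDiff k E g) J = g J := by
  rw [cechDiff, wedgeDiff_contraction _ e _ (fun i _ m => rfl)]
  simp [he]

theorem cechDiff_erase (E : Finset (Fin n)) (e : Fin n) (g : Finset (Fin n) → k)
    {J : Finset (Fin n)} (hJ : e ∉ J) : cechDiff k (E.erase e) g J = cechDiff k E g J := by
  rw [cechDiff_apply, cechDiff_apply]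
  refine Finset.sum_congr rfl fun l hl => ?_
  have : l ≠ e := fun h => hJ (h ▸ hl)
  simp [this]

theorem cechDiff_erase_of_mem (E : Finset (Fin n)) (e : Fin n) (g : Finset (Fin n) → k)
    (hg : ∀ J, e ∈ J → g J = 0) {J : Finset (Fin n)} (hJ : e ∈ J) :
    cechDiff k (E.erase e) g J = 0 := by
  rw [cechDiff_apply]
  refine Finset.sum_eq_zero fun l _ => ?_
  by_cases h : l = e
  · simp [h]
  · rw [hg _ (Finset.mem_erase.2 ⟨Ne.symm h, hJ⟩)]
    simp

theorem cechDiff_of_notMem (E : Finset (Fin n)) (e : Fin n) (g : Finset (Fin n) → k)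
    (hg : ∀ J, e ∉ J → g J = 0) {J : Finset (Fin n)} (hJ : e ∉ J) : cechDiff k E g J = 0 := by
  rw [cechDiff_apply]
  refine Finset.sum_eq_zero fun l _ => ?_
  rw [hg _ fun h => hJ (Finset.mem_of_mem_erase h)]
  simp

/-- The Čech cochains of degree `i` with support in a family of sets. -/
def cechCochains (k : Type u) [Field k] {n : ℕ} (F : Set (Finset (Fin n))) (i : ℤ) :
    Submodule k (Finset (Fin n) → k) where
  carrier := {g | ∀ J, ¬ (J ∈ F ∧ (J.card : ℤ) = i) → g J = 0}
  zero_mem' _ _ := rfl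
  add_mem' hf hg J hJ := by rw [Pi.add_apply, hf J hJ, hg J hJ, add_zero]
  smul_mem' c f hf J hJ := by rw [Pi.smul_apply, hf J hJ, smul_zero]

/-- The Čech cocycles. -/
def cechCocycles (k : Type u) [Field k] {n : ℕ} (E : Finset (Fin n)) (F : Set (Finset (Fin n)))
    (i : ℤ) : Submodule k (Finset (Fin n) → k) :=
  cechCochains k F i ⊓ LinearMap.ker (cechDiff k E)

/-- The Čech coboundaries. -/
def cechCoboundaries (k : Type u) [Field k] {n : ℕ} (E : Finset (Fin n)) (F : Set (Finset (Fin n)))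
    (i : ℤ) : Submodule k (Finset (Fin n) → k) :=
  (cechCochains k F (i - 1)).map (cechDiff k E)

theorem cechDiff_mem {E : Finset (Fin n)} {F : Set (Finset (Fin n))}
    (hF : ∀ J ∈ F, ∀ e ∈ E, insert e J ∈ F) {i : ℤ} {g : Finset (Fin n) → k}
    (hg : g ∈ cechCochains k F (i - 1)) : cechDiff k E g ∈ cechCochains k F i := by
  intro J hJ
  rw [cechDiff_apply]
  refine Finset.sum_eq_zero fun e he => ?_
  split_ifs with heE
  · rw [hg, smul_zero]
    rintro ⟨h1, h2⟩
    refine hJ ⟨?_, ?_⟩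
    · rw [← Finset.insert_erase he]
      exact hF _ h1 e heE
    · rw [← Finset.card_erase_add_one he]
      push_cast
      omega
  · rw [smul_zero]

/-- A family of sets over which the Čech complex is a cone has no cohomology. -/
theorem cechCocycles_le_of_cone {E : Finset (Fin n)} {F : Set (Finset (Fin n))} {e : Fin n}
    (he : e ∈ E) (hF : ∀ J, insert e J ∈ F → J ∈ F) (i : ℤ) :
    cechCocycles k E F i ≤ cechCoboundaries k E F i := by
  rintro g ⟨hg, hd⟩
  refine ⟨contraction e (AddMonoidHom.id k) g, fun J hJ => ?_, funext fun J => ?_⟩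
  · rw [contraction_apply]
    split_ifs with heJ
    · rfl
    · rw [hg, map_zero, smul_zero]
      rintro ⟨h1, h2⟩
      refine hJ ⟨hF J h1, ?_⟩
      rw [Finset.card_insert_of_notMem heJ] at h2
      push_cast at h2
      omega
  · have := cechDiff_contraction he g J
    rwa [show cechDiff k E g = 0 from hd, map_zero, Pi.zero_apply, add_zero] at this

/-- The sets of the family without `e`. -/
def deletion (F : Set (Finset (Fin n))) (e : Fin n) : Set (Finset (Fin n)) := {J | J ∈ F ∧ e ∉ J}

/-- The sets without `e` that belong to the family after inserting `e`. -/
def link (F : Set (Finset (Fin n))) (e : Fin n) : Set (Finset (Fin n)) :=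
  {J | insert e J ∈ F ∧ e ∉ J}

/-- The restriction of functions to the sets without `e`. -/
def restrictAway (k : Type u) [Field k] {n : ℕ} (e : Fin n) :
    (Finset (Fin n) → k) →ₗ[k] (Finset (Fin n) → k) :=
  LinearMap.pi fun J => if e ∈ J then 0 else LinearMap.proj J

theorem restrictAway_apply (e : Fin n) (g : Finset (Fin n) → k) (J : Finset (Fin n)) :
    restrictAway k e g J = if e ∈ J then 0 else g J := by
  rw [restrictAway, LinearMap.pi_apply]
  split_ifs <;> rfl

/-- The product with `e` from the left. -/
def wedgeLeft (k : Type u) [Field k] {n : ℕ} (e : Fin n) :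
    (Finset (Fin n) → k) →ₗ[k] (Finset (Fin n) → k) :=
  LinearMap.pi fun J => if e ∈ J then wedgeSign e J • LinearMap.proj (J.erase e) else 0

theorem wedgeLeft_apply (e : Fin n) (g : Finset (Fin n) → k) (J : Finset (Fin n)) :
    wedgeLeft k e g J = if e ∈ J then wedgeSign e J • g (J.erase e) else 0 := by
  rw [wedgeLeft, LinearMap.pi_apply]
  split_ifs <;> rfl

theorem restrictAway_mem {E : Finset (Fin n)} {F : Set (Finset (Fin n))} (e : Fin n) {i : ℤ}
    {g : Finset (Fin n) → k} (hg : g ∈ cechCocycles k E F i) :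
    restrictAway k e g ∈ cechCocycles k (E.erase e) (deletion F e) i := by
  refine ⟨fun J hJ => ?_, funext fun J => ?_⟩
  · rw [restrictAway_apply]
    split_ifs with he
    · rfl
    · exact hg.1 J fun h => hJ ⟨⟨h.1, he⟩, h.2⟩
  · by_cases he : e ∈ J
    · exact cechDiff_erase_of_mem E e _ (fun J hJ => by rw [restrictAway_apply, if_pos hJ]) he
    · rw [cechDiff_erase E e _ he]
      refine Eq.trans ?_ (congrFun hg.2 J)
      rw [cechDiff_apply, cechDiff_apply]
      refine Finset.sum_congr rfl fun l _ => ?_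
      rw [restrictAway_apply, if_neg fun h => he (Finset.mem_of_mem_erase h)]

theorem sign_smul_sign (e : Fin n) (J : Finset (Fin n)) (x : k) :
    wedgeSign e J • wedgeSign e J • x = x := by
  rw [smul_smul, wedgeSign, ← pow_add, ← two_mul, pow_mul, neg_one_sq, one_pow, one_smul]

/-- A cocycle whose restriction away from `e` is a coboundary comes from the link of `e`. -/
theorem exists_link_cocycle {E : Finset (Fin n)} {F : Set (Finset (Fin n))} {e : Fin n}
    (he : e ∈ E) (hF : ∀ J ∈ F, ∀ e ∈ E, insert e J ∈ F) {i : ℤ} {g : Finset (Fin n) → k}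
    (hg : g ∈ cechCocycles k E F i)
    (hr : restrictAway k e g ∈ cechCoboundaries k (E.erase e) (deletion F e) i) :
    ∃ g₂ ∈ cechCocycles k (E.erase e) (link F e) (i - 1),
      g - wedgeLeft k e g₂ ∈ cechCoboundaries k E F i := by
  obtain ⟨h, hh, hhr⟩ := hr
  have hhF : h ∈ cechCochains k F (i - 1) := fun J hJ => hh J fun h' => hJ ⟨h'.1.1, h'.2⟩
  -- After subtracting the coboundary of the primitive h, the cocycle vanishes on all sets without
  -- e. Contraction with e then turns it into a cocycle of the link.
  set g₁ := g - cechDiff k E h with hg₁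
  have hg₁C : g₁ ∈ cechCochains k F i := sub_mem hg.1 (cechDiff_mem hF hhF)
  have hg₁d : cechDiff k E g₁ = 0 := by
    rw [hg₁, map_sub, cechDiff_sq, sub_zero]
    exact hg.2
  have hg₁0 : ∀ J, e ∉ J → g₁ J = 0 := fun J hJ => by
    have h1 := congrFun hhr J
    rw [cechDiff_erase E e h hJ, restrictAway_apply, if_neg hJ] at h1
    rw [hg₁, Pi.sub_apply, h1, sub_self]
  set g₂ := contraction e (AddMonoidHom.id k) g₁ with hg₂
  have hg₂0 : ∀ J, e ∈ J → g₂ J = 0 := fun J hJ => by rw [hg₂, contraction_apply, if_pos hJ]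
  have hg₁g₂ : wedgeLeft k e g₂ = g₁ := by
    funext J
    rw [wedgeLeft_apply]
    split_ifs with heJ
    · rw [hg₂, contraction_apply, if_neg (Finset.notMem_erase e J), Finset.insert_erase heJ,
        wedgeSign_erase_self]
      exact sign_smul_sign e J _
    · exact (hg₁0 J heJ).symm
  refine ⟨g₂, ⟨fun J hJ => ?_, funext fun J => ?_⟩, ⟨h, hhF, ?_⟩⟩
  · by_cases heJ : e ∈ J
    · exact hg₂0 J heJ
    · rw [hg₂, contraction_apply, if_neg heJ, hg₁C, map_zero, smul_zero]
      rintro ⟨h1, h2⟩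
      refine hJ ⟨⟨h1, heJ⟩, ?_⟩
      rw [Finset.card_insert_of_notMem heJ] at h2
      push_cast at h2
      omega
  · by_cases heJ : e ∈ J
    · exact cechDiff_erase_of_mem E e _ hg₂0 heJ
    · rw [cechDiff_erase E e _ heJ]
      have := cechDiff_contraction he g₁ J
      rwa [hg₁d, map_zero, Pi.zero_apply, add_zero, hg₁0 J heJ] at this
  · rw [hg₁g₂, hg₁, sub_sub_cancel]

/-- Multiplication by e anticommutes with the differential, so a primitive h on the link gives the
primitive −(e ∧ h). -/
theorem wedgeLeft_mem_cechCoboundaries {E : Finset (Fin n)} {F : Set (Finset (Fin n))} {e : Fin n}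
    (he : e ∈ E) {i : ℤ} {g : Finset (Fin n) → k}
    (hg : g ∈ cechCoboundaries k (E.erase e) (link F e) (i - 1)) :
    wedgeLeft k e g ∈ cechCoboundaries k E F i := by
  obtain ⟨h, hh, rfl⟩ := hg
  have h0 : ∀ J, e ∈ J → h J = 0 := fun J hJ => hh J fun h' => h'.1.2 hJ
  have hw0 : ∀ J, e ∉ J → wedgeLeft k e h J = 0 := fun J hJ => by rw [wedgeLeft_apply, if_neg hJ]
  have hc : contraction e (AddMonoidHom.id k) (wedgeLeft k e h) = h := by
    funext J
    rw [contraction_apply]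
    split_ifs with heJ
    · exact (h0 J heJ).symm
    · rw [wedgeLeft_apply, if_pos (Finset.mem_insert_self e J), Finset.erase_insert heJ,
        ← wedgeSign_erase_self e (insert e J), Finset.erase_insert heJ]
      exact sign_smul_sign e J _
  refine ⟨- wedgeLeft k e h, neg_mem fun J hJ => ?_, funext fun J => ?_⟩
  · rw [wedgeLeft_apply]
    split_ifs with heJ
    · rw [hh, smul_zero]
      rintro ⟨h1, h2⟩
      refine hJ ⟨by rw [← Finset.insert_erase heJ]; exact h1.1, ?_⟩
      rw [← Finset.card_erase_add_one heJ]
      push_cast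
      omega
    · rfl
  · rw [map_neg, Pi.neg_apply, wedgeLeft_apply]
    split_ifs with heJ
    · have h1 := cechDiff_contraction he (wedgeLeft k e h) (J.erase e)
      rw [hc, hw0 _ (Finset.notMem_erase e J), contraction_apply, if_neg (Finset.notMem_erase e J),
        Finset.insert_erase heJ, wedgeSign_erase_self] at h1
      rw [cechDiff_erase E e h (Finset.notMem_erase e J), eq_neg_of_add_eq_zero_left h1, smul_neg]
      exact congrArg Neg.neg (sign_smul_sign e J _).symm
    · rw [cechDiff_of_notMem E e _ hw0 heJ, neg_zero]

/-- This is exactness in the middle of H^{i−1}(link) → H^i(F) → H^i(deletion), used when both ends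
vanish. The next two statements use it when one end vanishes and the other has dimension at most
one. -/
theorem cechCocycles_le_of_link {E : Finset (Fin n)} {F : Set (Finset (Fin n))} {e : Fin n}
    (he : e ∈ E) (hF : ∀ J ∈ F, ∀ e ∈ E, insert e J ∈ F) {i : ℤ}
    (h1 : cechCocycles k (E.erase e) (deletion F e) i ≤
      cechCoboundaries k (E.erase e) (deletion F e) i)
    (h2 : cechCocycles k (E.erase e) (link F e) (i - 1) ≤
      cechCoboundaries k (E.erase e) (link F e) (i - 1)) :
    cechCocycles k E F i ≤ cechCoboundaries k E F i := by
  intro g hg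
  obtain ⟨g₂, hg₂, hgg₂⟩ := exists_link_cocycle he hF hg (h1 (restrictAway_mem e hg))
  simpa using add_mem hgg₂ (wedgeLeft_mem_cechCoboundaries he (h2 hg₂))

/-- The quotient `P / B` has dimension at most one. -/
def AtMostLine {M : Type u} [AddCommGroup M] [Module k M] (P B : Submodule k M) : Prop :=
  ∀ g ∈ P, ∀ g' ∈ P, ∃ c c' : k, (c ≠ 0 ∨ c' ≠ 0) ∧ c • g + c' • g' ∈ B

theorem atMostLine_of_le {M : Type u} [AddCommGroup M] [Module k M] {P B : Submodule k M}
    (h : P ≤ B) : AtMostLine P B := fun g hg g' _ =>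
  ⟨1, 0, Or.inl one_ne_zero, by simpa using h hg⟩

theorem atMostLine_of_link {E : Finset (Fin n)} {F : Set (Finset (Fin n))} {e : Fin n}
    (he : e ∈ E) (hF : ∀ J ∈ F, ∀ e ∈ E, insert e J ∈ F) {i : ℤ}
    (h1 : cechCocycles k (E.erase e) (deletion F e) i ≤
      cechCoboundaries k (E.erase e) (deletion F e) i)
    (h2 : AtMostLine (cechCocycles k (E.erase e) (link F e) (i - 1))
      (cechCoboundaries k (E.erase e) (link F e) (i - 1))) :
    AtMostLine (cechCocycles k E F i) (cechCoboundaries k E F i) := by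
  intro g hg g' hg'
  obtain ⟨g₂, hg₂, hgg₂⟩ := exists_link_cocycle he hF hg (h1 (restrictAway_mem e hg))
  obtain ⟨g₂', hg₂', hgg₂'⟩ := exists_link_cocycle he hF hg' (h1 (restrictAway_mem e hg'))
  obtain ⟨c, c', hc, hcc⟩ := h2 g₂ hg₂ g₂' hg₂'
  refine ⟨c, c', hc, ?_⟩
  convert add_mem (add_mem (Submodule.smul_mem _ c hgg₂) (Submodule.smul_mem _ c' hgg₂'))
    (wedgeLeft_mem_cechCoboundaries he hcc) using 1
  rw [map_add, map_smul, map_smul]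
  module

theorem atMostLine_of_deletion {E : Finset (Fin n)} {F : Set (Finset (Fin n))} {e : Fin n}
    (he : e ∈ E) (hF : ∀ J ∈ F, ∀ e ∈ E, insert e J ∈ F) {i : ℤ}
    (h1 : AtMostLine (cechCocycles k (E.erase e) (deletion F e) i)
      (cechCoboundaries k (E.erase e) (deletion F e) i))
    (h2 : cechCocycles k (E.erase e) (link F e) (i - 1) ≤
      cechCoboundaries k (E.erase e) (link F e) (i - 1)) :
    AtMostLine (cechCocycles k E F i) (cechCoboundaries k E F i) := by
  intro g hg g' hg'
  obtain ⟨c, c', hc, hcc⟩ := h1 _ (restrictAway_mem e hg) _ (restrictAway_mem e hg')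
  refine ⟨c, c', hc, ?_⟩
  rw [← map_smul, ← map_smul, ← map_add] at hcc
  obtain ⟨g₂, hg₂, hgg₂⟩ := exists_link_cocycle he hF
    (add_mem (Submodule.smul_mem _ c hg) (Submodule.smul_mem _ c' hg')) hcc
  simpa using add_mem hgg₂ (wedgeLeft_mem_cechCoboundaries he (h2 hg₂))

end Cech
end
end EulerKoszul

namespace EulerKoszul
noncomputable section

/-! ### Families of sets that depend only on faces of a cone. -/

section Faces

variable {n : ℕ}

/-- The element `m` lies in the face generated by `J`, where the functionals in `V` that are
nonnegative on `E` cut out the cone generated by `E`. -/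
def InFace (V : Submodule ℚ (Fin n → ℚ)) (E J : Finset (Fin n)) (m : Fin n) : Prop :=
  ∀ v ∈ V, (∀ l ∈ E, 0 ≤ v l) → (∀ l ∈ J, v l = 0) → v m = 0

theorem inFace_of_mem {V : Submodule ℚ (Fin n → ℚ)} {E J : Finset (Fin n)} {m : Fin n} (h : m ∈ J) :
    InFace V E J m := fun _ _ _ hv => hv m h

/-- A family of subsets of `E` that is closed under enlargement and that depends only on the faces
generated by its members. -/
structure FaceClosed (V : Submodule ℚ (Fin n → ℚ)) (E : Finset (Fin n))
    (F : Set (Finset (Fin n))) : Prop where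
  sub : ∀ J ∈ F, J ⊆ E
  insert_mem : ∀ J ∈ F, ∀ e ∈ E, insert e J ∈ F
  face : ∀ J ∈ F, ∀ I ⊆ J, (∀ m ∈ J, InFace V E I m) → I ∈ F

/-- The functionals that vanish at `e`. -/
def vanishingAt (V : Submodule ℚ (Fin n → ℚ)) (e : Fin n) : Submodule ℚ (Fin n → ℚ) :=
  V ⊓ LinearMap.ker (LinearMap.proj e)

theorem finrank_vanishingAt_lt {V : Submodule ℚ (Fin n → ℚ)} {e : Fin n} {v : Fin n → ℚ}
    (hv : v ∈ V) (hve : v e ≠ 0) : Module.finrank ℚ (vanishingAt V e) < Module.finrank ℚ V := by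
  refine Submodule.finrank_lt_finrank_of_lt (lt_of_le_of_ne inf_le_left fun h => hve ?_)
  exact (h.ge hv).2

variable {V : Submodule ℚ (Fin n → ℚ)} {E : Finset (Fin n)} {F : Set (Finset (Fin n))} {e : Fin n}

theorem FaceClosed.union_mem (h : FaceClosed V E F) {J : Finset (Fin n)} (hJ : J ∈ F)
    {I : Finset (Fin n)} (hI : I ⊆ E) : I ∪ J ∈ F := by
  induction I using Finset.induction_on with
  | empty => rwa [Finset.empty_union]
  | insert a I ha ih =>
    rw [Finset.insert_union]
    exact h.insert_mem _ (ih ((Finset.subset_insert a I).trans hI)) a (hI (Finset.mem_insert_self a I))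

/-- Deleting e admits more nonnegative functionals, so lying in a face for E ∖ e implies lying in
the corresponding face for E. -/
theorem FaceClosed.deletion (h : FaceClosed V E F) : FaceClosed V (E.erase e) (deletion F e) where
  sub J hJ := fun _ hm => Finset.mem_erase.2 ⟨fun hme => hJ.2 (hme ▸ hm), h.sub J hJ.1 hm⟩
  insert_mem J hJ m hm := ⟨h.insert_mem J hJ.1 m (Finset.mem_of_mem_erase hm), fun h' =>
    (Finset.mem_insert.1 h').elim (fun h' => (Finset.ne_of_mem_erase hm) h'.symm) hJ.2⟩
  face J hJ I hI hf := ⟨h.face J hJ.1 I hI fun m hm v hv hE hvI => hf m hm v hv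
    (fun l hl => hE l (Finset.mem_of_mem_erase hl)) hvI, fun h' => hJ.2 (hI h')⟩

/-- A face containing e is cut out by functionals vanishing at e. This is the place where V is
replaced by a smaller space, so that the rank can drop. -/
theorem FaceClosed.link (h : FaceClosed V E F) :
    FaceClosed (vanishingAt V e) (E.erase e) (link F e) where
  sub J hJ := fun m hm => Finset.mem_erase.2 ⟨fun hme => hJ.2 (hme ▸ hm),
    h.sub _ hJ.1 (Finset.mem_insert_of_mem hm)⟩
  insert_mem J hJ m hm := ⟨by
    rw [Finset.insert_comm]
    exact h.insert_mem _ hJ.1 m (Finset.mem_of_mem_erase hm), fun h' =>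
    (Finset.mem_insert.1 h').elim (fun h' => (Finset.ne_of_mem_erase hm) h'.symm) hJ.2⟩
  face J hJ I hI hf := ⟨h.face _ hJ.1 _ (Finset.insert_subset_insert e hI) fun m hm v hv hE hvI => by
    have hve : v e = 0 := hvI e (Finset.mem_insert_self e I)
    rcases Finset.mem_insert.1 hm with rfl | hm
    · exact hve
    · exact hf m hm v ⟨hv, hve⟩ (fun l hl => hE l (Finset.mem_of_mem_erase hl))
        (fun l hl => hvI l (Finset.mem_insert_of_mem hl)), fun h' => hJ.2 (hI h')⟩

/-- Since v₀ is zero on E ∖ e and nonzero at e, subtracting a multiple of it makes any functional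
vanish at e without changing it on E ∖ e. The functionals vanishing at e therefore detect the same
faces. -/
theorem FaceClosed.deletion_vanishingAt (h : FaceClosed V E F) {v₀ : Fin n → ℚ} (hv₀ : v₀ ∈ V)
    (hv₀E : ∀ m ∈ E.erase e, v₀ m = 0) (hv₀e : v₀ e < 0) :
    FaceClosed (vanishingAt V e) (E.erase e) (EulerKoszul.deletion F e) where
  sub := h.deletion.sub
  insert_mem := h.deletion.insert_mem
  face J hJ I hI hf := ⟨h.face J hJ.1 I hI fun m hm v hv hE hvI => by
    have hme : m ≠ e := fun h' => hJ.2 (h' ▸ hm)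
    have hmE : m ∈ E.erase e := h.deletion.sub J hJ hm
    have hIE : ∀ l ∈ I, l ∈ E.erase e := fun l hl => h.deletion.sub J hJ (hI hl)
    have key := hf m hm (v - (v e / v₀ e) • v₀)
      ⟨sub_mem hv (Submodule.smul_mem _ _ hv₀), by simp [hv₀e.ne]⟩
      (fun l hl => by simpa [hv₀E l hl] using hE l (Finset.mem_of_mem_erase hl))
      (fun l hl => by simpa [hv₀E l (hIE l hl)] using hvI l hl)
    simpa [hv₀E m hmE] using key, fun h' => hJ.2 (hI h')⟩

/-- If no functional separates `e` from the cone of the other elements, then `e` lies in the face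
generated by the other elements of any face containing it. -/
theorem inFace_of_not_separated (he : e ∈ E)
    (hX : ∀ v ∈ V, (∀ m ∈ E.erase e, 0 ≤ v m) → 0 ≤ v e)
    {J I : Finset (Fin n)} (heJ : e ∈ J) (hI : ∀ m ∈ E.erase e, InFace V E J m → m ∈ I) :
    InFace V E I e := by
  intro v hv hvE hvI
  have hw : ∀ m, ∃ w ∈ V, (∀ l ∈ E, 0 ≤ w l) ∧ (∀ l ∈ J, w l = 0) ∧
      (m ∈ E.erase e → m ∉ I → w m ≠ 0) := by
    intro m
    by_cases h : m ∈ E.erase e ∧ m ∉ I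
    · have : ¬ InFace V E J m := fun h' => h.2 (hI m h.1 h')
      unfold InFace at this
      push Not at this
      obtain ⟨w, h1, h2, h3, h4⟩ := this
      exact ⟨w, h1, h2, h3, fun _ _ => h4⟩
    · exact ⟨0, zero_mem _, fun _ _ => le_rfl, fun _ _ => rfl, fun h1 h2 => absurd ⟨h1, h2⟩ h⟩
  choose w hwV hwE hwJ hwm using hw
  -- On E ∖ e this functional is nonnegative: at l ∉ I the l-th summand already equals v_l, and at l
  -- ∈ I one has v_l = 0. At e every w_m vanishes because e ∈ J, so the value is −v_e.
  have h1 := hX (∑ m ∈ E.erase e, (v m / w m m) • w m - v)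
    (sub_mem (sum_mem fun m _ => Submodule.smul_mem _ _ (hwV m)) hv) (by
      intro l hl
      have hlE := Finset.mem_of_mem_erase hl
      have hterm : ∀ m ∈ E.erase e, 0 ≤ v m / w m m * w m l := fun m hm =>
        mul_nonneg (div_nonneg (hvE m (Finset.mem_of_mem_erase hm))
          (hwE m m (Finset.mem_of_mem_erase hm))) (hwE m l hlE)
      rw [Pi.sub_apply, Finset.sum_apply, sub_nonneg]
      simp only [Pi.smul_apply, smul_eq_mul]
      by_cases hlI : l ∈ I
      · rw [hvI l hlI]
        exact Finset.sum_nonneg hterm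
      · refine le_trans (le_of_eq ?_) (Finset.single_le_sum hterm hl)
        rw [div_mul_cancel₀ _ (hwm l hl hlI)])
  have h2 : ∀ m, w m e = 0 := fun m => hwJ m e heJ
  rw [Pi.sub_apply, Finset.sum_apply, Finset.sum_eq_zero (fun m _ => by simp [h2]), zero_sub,
    neg_nonneg] at h1
  exact le_antisymm h1 (hvE e he)

/-- If `e` can be separated from the cone of the other elements, but not strictly, then there is
a supporting functional of the other elements whose zeros generate the whole cone. -/
theorem exists_facet (he : e ∈ E) (hX : ∃ v ∈ V, (∀ m ∈ E.erase e, 0 ≤ v m) ∧ v e < 0)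
    (hX' : ∀ v ∈ V, v e < 0 → ∃ m ∈ E.erase e, v m ≠ 0) :
    ∃ v ∈ V, (∀ m ∈ E.erase e, 0 ≤ v m) ∧ (∃ m ∈ E.erase e, v m ≠ 0) ∧
      ∀ m ∈ E, InFace V E ((E.erase e).filter fun m => v m = 0) m := by
  let P := {v : Fin n → ℚ // v ∈ V ∧ (∀ m ∈ E.erase e, 0 ≤ v m) ∧ v e < 0}
  obtain ⟨v₀, hv₀⟩ := hX
  let f : P → ℕ := fun v => ((E.erase e).filter fun m => v.1 m ≠ 0).card
  have : Nonempty P := ⟨⟨v₀, hv₀⟩⟩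
  -- Among the separating functionals take one with the fewest nonzero values on E ∖ e.
  obtain ⟨⟨v, hv, hvE, hve⟩, hmin⟩ : ∃ v : P, ∀ v' : P, f v ≤ f v' :=
    ⟨Function.argmin f, fun v => Function.argmin_le f v⟩
  refine ⟨v, hv, hvE, hX' v hv hve, ?_⟩
  have key : ∀ w ∈ V, (∀ l ∈ E, 0 ≤ w l) →
      (∀ l ∈ (E.erase e).filter fun m => v m = 0, w l = 0) → ∀ m ∈ E.erase e, w m = 0 := by
    intro w hw hwE hw0
    by_contra hne
    push Not at hne
    obtain ⟨m, hm, hwm⟩ := hne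
    -- The smallest ratio v/w is the largest multiple of w that may be subtracted while v stays
    -- nonnegative on E ∖ e. The value at m₀ becomes zero, no zero of v is lost and e stays
    -- separated, against minimality.
    obtain ⟨m₀, hm₀, hmin₀⟩ := Finset.exists_min_image ((E.erase e).filter fun m => w m ≠ 0)
      (fun m => v m / w m) ⟨m, Finset.mem_filter.2 ⟨hm, hwm⟩⟩
    rw [Finset.mem_filter] at hm₀
    have hpos : ∀ l ∈ E, w l ≠ 0 → 0 < w l := fun l hl h => lt_of_le_of_ne (hwE l hl) (Ne.symm h)
    have ht : 0 ≤ v m₀ / w m₀ :=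
      div_nonneg (hvE m₀ hm₀.1) (hwE m₀ (Finset.mem_of_mem_erase hm₀.1))
    have hu : ∀ l ∈ E.erase e, 0 ≤ (v - (v m₀ / w m₀) • w) l := by
      intro l hl
      rw [Pi.sub_apply, Pi.smul_apply, smul_eq_mul]
      by_cases hwl : w l = 0
      · rw [hwl, mul_zero, sub_zero]
        exact hvE l hl
      · rw [sub_nonneg, ← le_div_iff₀ (hpos l (Finset.mem_of_mem_erase hl) hwl)]
        exact hmin₀ l (Finset.mem_filter.2 ⟨hl, hwl⟩)
    have hue : (v - (v m₀ / w m₀) • w) e < 0 := by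
      rw [Pi.sub_apply, Pi.smul_apply, smul_eq_mul]
      have := mul_nonneg ht (hwE e he)
      linarith
    refine absurd (hmin ⟨_, sub_mem hv (Submodule.smul_mem V (v m₀ / w m₀) hw), hu, hue⟩)
      (not_le.2 (Finset.card_lt_card (Finset.ssubset_iff_of_subset ?_ |>.2 ⟨m₀, ?_, ?_⟩)))
    · intro l hl
      rw [Finset.mem_filter] at hl ⊢
      refine ⟨hl.1, fun h => hl.2 ?_⟩
      have : v l = 0 := h
      simp [this, hw0 l (Finset.mem_filter.2 ⟨hl.1, this⟩)]
    · exact Finset.mem_filter.2 ⟨hm₀.1, fun h => hm₀.2 (hw0 m₀ (Finset.mem_filter.2 ⟨hm₀.1, h⟩))⟩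
    · rw [Finset.mem_filter]
      rintro ⟨-, h⟩
      exact h (by simp [hm₀.2])
  intro m hm w hw hwE hw0
  by_cases hme : m = e
  · subst hme
    by_contra hwe
    -- If w_e > 0, then −w is negative at e and zero on all of E ∖ e, which hX' excludes.
    obtain ⟨l, hl, h⟩ := hX' (-w) (neg_mem hw) (by
      rw [Pi.neg_apply, neg_lt_zero]
      exact lt_of_le_of_ne (hwE m hm) (Ne.symm hwe))
    exact h (by simp [key w hw hwE hw0 l hl])
  · exact key w hw hwE hw0 m (Finset.mem_erase.2 ⟨hme, hm⟩)

end Faces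

/-! ### Vanishing and rank bound for face-closed families. -/

section Vanishing

variable (k : Type u) [Field k] {n : ℕ}

/-- The vanishing and rank statements for the Čech cohomology of face-closed families. -/
structure CechVanishing (V : Submodule ℚ (Fin n → ℚ)) (E : Finset (Fin n))
    (F : Set (Finset (Fin n))) (r : ℤ) : Prop where
  above : ∀ i, r < i → cechCocycles k E F i ≤ cechCoboundaries k E F i
  top : (∃ J ∈ F, ∃ v ∈ V, (∀ m ∈ E, 0 ≤ v m) ∧ (∀ m ∈ J, v m = 0) ∧ ∃ m ∈ E, v m ≠ 0) →
    cechCocycles k E F r ≤ cechCoboundaries k E F r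
  line : AtMostLine (cechCocycles k E F r) (cechCoboundaries k E F r)

variable {k}

theorem cechVanishing_of_cone {V : Submodule ℚ (Fin n → ℚ)} {E : Finset (Fin n)}
    {F : Set (Finset (Fin n))} {e : Fin n} (he : e ∈ E) (hF : ∀ J, insert e J ∈ F → J ∈ F) (r : ℤ) :
    CechVanishing k V E F r where
  above i _ := cechCocycles_le_of_cone he hF i
  top _ := cechCocycles_le_of_cone he hF r
  line := atMostLine_of_le (cechCocycles_le_of_cone he hF r)

theorem cechVanishing_empty {V : Submodule ℚ (Fin n → ℚ)} {F : Set (Finset (Fin n))}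
    (hF : FaceClosed V ∅ F) {r : ℤ} (hr : 0 ≤ r) : CechVanishing k V ∅ F r where
  above i hi g hg := by
    have : g = 0 := funext fun J => hg.1 J fun h => by
      have := h.2
      rw [Finset.subset_empty.1 (hF.sub J h.1), Finset.card_empty] at this
      push_cast at this
      omega
    rw [this]
    exact zero_mem _
  top := fun ⟨_, _, _, _, _, _, m, hm, _⟩ => absurd hm (Finset.notMem_empty m)
  line g hg g' hg' := by
    have h0 : ∀ g ∈ cechCocycles k ∅ F r, ∀ J, J ≠ ∅ → g J = 0 := fun g hg J hJ =>
      hg.1 J fun h => hJ (Finset.subset_empty.1 (hF.sub J h.1))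
    have main : ∀ c c' : k, c * g ∅ + c' * g' ∅ = 0 →
        c • g + c' • g' ∈ cechCoboundaries k ∅ F r := by
      intro c c' h
      have : c • g + c' • g' = 0 := funext fun J => by
        by_cases hJ : J = ∅
        · rw [hJ]
          exact h
        · simp [h0 g hg J hJ, h0 g' hg' J hJ]
      rw [this]
      exact zero_mem _
    by_cases hg0 : g ∅ = 0
    · exact ⟨1, 0, Or.inl one_ne_zero, main 1 0 (by simp [hg0])⟩
    · exact ⟨g' ∅, - g ∅, Or.inr (neg_ne_zero.2 hg0), main _ _ (by ring)⟩

/-- Induction on |E|. Contracting e lowers the degree and the dimension of V by one, while deleting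
e keeps the dimension, so each step needs one of the two ends of the exact sequence to vanish in the
top degree. If e lies in the cone of the other elements, the link is a cone. If e is separated from
them, the top cohomology of the deletion vanishes. The clause `top` is carried along for this second
case. -/
theorem cechVanishing {E : Finset (Fin n)} : ∀ {V : Submodule ℚ (Fin n → ℚ)}
    {F : Set (Finset (Fin n))}, FaceClosed V E F → ∀ {r : ℤ}, (Module.finrank ℚ V : ℤ) ≤ r →
      CechVanishing k V E F r := by
  induction hN : E.card generalizing E with
  | zero =>
    intro V F hF r hr
    obtain rfl := Finset.card_eq_zero.1 hN
    exact cechVanishing_empty hF (le_trans (by positivity) hr)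
  | succ N ih =>
    intro V F hF r hr
    have ih' : ∀ e ∈ E, ∀ {V : Submodule ℚ (Fin n → ℚ)} {F : Set (Finset (Fin n))},
        FaceClosed V (E.erase e) F → ∀ {r : ℤ}, (Module.finrank ℚ V : ℤ) ≤ r →
          CechVanishing k V (E.erase e) F r := fun e he =>
      ih (by rw [Finset.card_erase_of_mem he, hN]; rfl)
    -- If all nonnegative functionals vanish at e, then adjoining e to a set does not enlarge its
    -- face, and the complex is a cone over e.
    by_cases hloop : ∃ e ∈ E, InFace V E ∅ e
    · obtain ⟨e, he, hloop⟩ := hloop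
      refine cechVanishing_of_cone he (fun J hJ => hF.face _ hJ J (Finset.subset_insert e J) ?_) r
      intro m hm v hv hvE hvJ
      rcases Finset.mem_insert.1 hm with rfl | hm
      · exact hloop v hv hvE (by simp)
      · exact hvJ m hm
    push Not at hloop
    have hrank : ∀ e ∈ E, (Module.finrank ℚ (vanishingAt V e) : ℤ) ≤ r - 1 := by
      intro e he
      have := hloop e he
      unfold InFace at this
      push Not at this
      obtain ⟨v, hv, -, -, hve⟩ := this
      have := finrank_vanishingAt_lt hv hve
      omega
    have hdel : ∀ e ∈ E, CechVanishing k V (E.erase e) (deletion F e) r := fun e he =>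
      ih' e he hF.deletion hr
    have hlink : ∀ e ∈ E, CechVanishing k (vanishingAt V e) (E.erase e) (link F e) (r - 1) :=
      fun e he => ih' e he hF.link (hrank e he)
    -- If e is not separated from the others, some m ≠ e lies in the face of e, since otherwise e
    -- would lie in the face of ∅. In the link m can then be removed from any set, so the link is a
    -- cone over m.
    have hlink' : ∀ e ∈ E, (∀ v ∈ V, (∀ m ∈ E.erase e, 0 ≤ v m) → 0 ≤ v e) → ∀ i,
        cechCocycles k (E.erase e) (link F e) i ≤ cechCoboundaries k (E.erase e) (link F e) i := by
      intro e he hX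
      have : ∃ m ∈ E.erase e, InFace V E {e} m := by
        by_contra hne
        push Not at hne
        exact hloop e he (inFace_of_not_separated he hX (Finset.mem_singleton_self e)
          fun m hm h => absurd h (hne m hm))
      obtain ⟨m, hm, hme⟩ := this
      refine cechCocycles_le_of_cone hm fun J hJ => ⟨?_, fun h => hJ.2 (Finset.mem_insert_of_mem h)⟩
      refine hF.face _ hJ.1 _ (Finset.insert_subset_insert e (Finset.subset_insert m J)) ?_
      intro l hl v hv hvE hvJ
      rcases Finset.mem_insert.1 hl with rfl | hl
      · exact hvJ l (Finset.mem_insert_self l J)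
      rcases Finset.mem_insert.1 hl with rfl | hl
      · exact hme v hv hvE fun x hx => by
          rw [Finset.mem_singleton.1 hx]
          exact hvJ e (Finset.mem_insert_self e J)
      · exact hvJ l (Finset.mem_insert_of_mem hl)
    -- If a separating functional can be zero on E ∖ e, the deletion is face-closed over a space of
    -- smaller dimension and degree r is above its range. Otherwise `exists_facet` gives a proper
    -- face of E ∖ e whose elements generate the whole face of E; it belongs to F, and `top` applies
    -- to the deletion.
    have hsep : F.Nonempty → ∀ e ∈ E, (∃ v ∈ V, (∀ m ∈ E.erase e, 0 ≤ v m) ∧ v e < 0) →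
        cechCocycles k (E.erase e) (deletion F e) r ≤
          cechCoboundaries k (E.erase e) (deletion F e) r := by
      rintro ⟨J, hJ⟩ e he hX
      by_cases hX' : ∃ v ∈ V, v e < 0 ∧ ∀ m ∈ E.erase e, v m = 0
      · obtain ⟨v, hv, hve, hvE⟩ := hX'
        exact (ih' e he (hF.deletion_vanishingAt hv hvE hve) (hrank e he)).above r (by omega)
      · push Not at hX'
        obtain ⟨v, hv, hvE, hvne, hface⟩ := exists_facet he hX hX'
        refine (hdel e he).top ⟨(E.erase e).filter fun m => v m = 0, ⟨?_, by simp⟩, v, hv, hvE,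
          fun m hm => (Finset.mem_filter.1 hm).2, hvne⟩
        refine hF.face E ?_ _ ((Finset.filter_subset _ _).trans (Finset.erase_subset e E)) hface
        rw [← Finset.union_eq_left.2 (hF.sub J hJ)]
        exact hF.union_mem hJ subset_rfl
    obtain ⟨e₀, he₀⟩ : E.Nonempty := Finset.card_pos.1 (by omega)
    refine ⟨fun i hi => ?_, ?_, ?_⟩
    · exact cechCocycles_le_of_link he₀ hF.insert_mem ((hdel e₀ he₀).above i hi)
        ((hlink e₀ he₀).above (i - 1) (by omega))
    · rintro ⟨J, hJ, v, hv, hvE, hvJ, m, hm, hvm⟩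
      rcases J.eq_empty_or_nonempty with rfl | ⟨e, heJ⟩
      -- If ∅ ∈ F, then F contains every subset of E, and the full simplex is a cone.
      · refine cechCocycles_le_of_cone he₀ (fun I hI => ?_) r
        have := hF.union_mem hJ ((Finset.subset_insert e₀ I).trans (hF.sub _ hI))
        rwa [Finset.union_empty] at this
      · have he := hF.sub J hJ heJ
        have hve := hvJ e heJ
        have hmE : m ∈ E.erase e := Finset.mem_erase.2 ⟨fun h => hvm (h ▸ hve), hm⟩
        by_cases hX : ∃ v ∈ V, (∀ m ∈ E.erase e, 0 ≤ v m) ∧ v e < 0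
        · refine cechCocycles_le_of_link he hF.insert_mem (hsep ⟨J, hJ⟩ e he hX)
            ((hlink e he).top ⟨J.erase e, ⟨?_, Finset.notMem_erase e J⟩, v, ⟨hv, hve⟩,
              fun l hl => hvE l (Finset.mem_of_mem_erase hl),
              fun l hl => hvJ l (Finset.mem_of_mem_erase hl), m, hmE, hvm⟩)
          rwa [Finset.insert_erase heJ]
        · push Not at hX
          classical
          -- The elements other than e in the face of J. They still generate that face, because e is
          -- not separated, so I belongs to the deletion, and v witnesses that it lies in a proper
          -- face of E ∖ e.
          set I := (E.erase e).filter fun m => InFace V E J m with hI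
          have hIe : InFace V E I e := inFace_of_not_separated he hX heJ
            fun m hm h => Finset.mem_filter.2 ⟨hm, h⟩
          have hIE : I ⊆ E := (Finset.filter_subset _ _).trans (Finset.erase_subset e E)
          refine cechCocycles_le_of_link he hF.insert_mem ((hdel e he).top
            ⟨I, ⟨hF.face _ (hF.union_mem hJ hIE) I Finset.subset_union_left ?_, by simp [hI]⟩, v, hv,
              fun l hl => hvE l (Finset.mem_of_mem_erase hl),
              fun l hl => (Finset.mem_filter.1 hl).2 v hv hvE hvJ, m, hmE, hvm⟩) (hlink' e he hX _)
          intro l hl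
          rcases Finset.mem_union.1 hl with hl | hl
          · exact inFace_of_mem hl
          · by_cases hle : l = e
            · rwa [hle]
            · exact inFace_of_mem (Finset.mem_filter.2
                ⟨Finset.mem_erase.2 ⟨hle, hF.sub J hJ hl⟩, inFace_of_mem hl⟩)
    · rcases F.eq_empty_or_nonempty with rfl | hne
      · refine atMostLine_of_le fun g hg => ?_
        have : g = 0 := funext fun J => hg.1 J fun h => h.1
        rw [this]
        exact zero_mem _
      -- If e₀ is separated, the line comes from the link in degree r − 1; otherwise the link is
      -- acyclic and the line comes from the deletion.
      · by_cases hX : ∃ v ∈ V, (∀ m ∈ E.erase e₀, 0 ≤ v m) ∧ v e₀ < 0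
        · exact atMostLine_of_link he₀ hF.insert_mem (hsep hne e₀ he₀ hX) (hlink e₀ he₀).line
        · push Not at hX
          exact atMostLine_of_deletion he₀ hF.insert_mem (hdel e₀ he₀).line (hlink' e₀ he₀ hX _)

end Vanishing
end
end EulerKoszul

namespace EulerKoszul
noncomputable section

/-! ### Farkas' lemma and the faces of the semigroup ℕA. -/

section Farkas

/-- Farkas' lemma over `ℚ`. -/
theorem farkas {ι W : Type*} [AddCommGroup W] [Module ℚ W] [DecidableEq ι] (s : Finset ι) :
    ∀ (a : ι → W) (b : W),
      (∀ y : Module.Dual ℚ W, (∀ i ∈ s, 0 ≤ y (a i)) → 0 ≤ y b) →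
        ∃ c : ι → ℚ, (∀ i, 0 ≤ c i) ∧ b = ∑ i ∈ s, c i • a i := by
  induction s using Finset.induction_on with
  | empty =>
    intro a b h
    refine ⟨0, fun _ => le_rfl, ?_⟩
    rw [Finset.sum_empty, ← Module.forall_dual_apply_eq_zero_iff ℚ]
    intro y
    refine le_antisymm ?_ (h y (by simp))
    have := h (-y) (by simp)
    rwa [LinearMap.neg_apply, neg_nonneg] at this
  | insert m s hm ih =>
    intro a b h
    have hupd : ∀ (c : ι → ℚ) (x : ℚ), ∑ i ∈ s, Function.update c m x i • a i = ∑ i ∈ s, c i • a i :=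
      fun c x => Finset.sum_congr rfl fun i hi => by
        rw [Function.update_of_ne (ne_of_mem_of_not_mem hi hm)]
    by_cases h0 : ∀ y : Module.Dual ℚ W, (∀ i ∈ s, 0 ≤ y (a i)) → 0 ≤ y b
    · obtain ⟨c, hc, hb⟩ := ih a b h0
      refine ⟨Function.update c m 0, fun i => ?_, ?_⟩
      · by_cases him : i = m
        · simp [him]
        · simpa [him] using hc i
      · rw [Finset.sum_insert hm, Function.update_self, zero_smul, zero_add, hb, hupd]
    · push Not at h0
      obtain ⟨y₁, hy₁, hy₁b⟩ := h0
      have hy₁m : y₁ (a m) < 0 := by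
        by_contra hcon
        push Not at hcon
        refine absurd (h y₁ fun i hi => ?_) (not_le.2 hy₁b)
        rcases Finset.mem_insert.1 hi with rfl | hi
        · exact hcon
        · exact hy₁ i hi
      obtain ⟨t, ht, hty⟩ : ∃ t : ℚ, 0 < t ∧ t * y₁ (a m) = -1 :=
        ⟨-(y₁ (a m))⁻¹, by simpa using hy₁m, by rw [neg_mul, inv_mul_cancel₀ hy₁m.ne]⟩
      set y₀ := t • y₁ with hy₀
      have hy₀m : y₀ (a m) = -1 := hty
      have hy₀s : ∀ i ∈ s, 0 ≤ y₀ (a i) := fun i hi => mul_nonneg ht.le (hy₁ i hi)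
      have hy₀b : y₀ b < 0 := mul_neg_of_pos_of_neg ht hy₁b
      -- These are the projections along a_m to the hyperplane y₀ = 0. If y is nonnegative on them,
      -- then y + y(a_m) y₀ vanishes at a_m and is nonnegative on the other a_i, so the hypothesis
      -- applies to it.
      obtain ⟨c, hc, hb⟩ := ih (fun i => a i + y₀ (a i) • a m) (b + y₀ b • a m) (by
        intro y hy
        have := h (y + y (a m) • y₀) (by
          intro i hi
          rcases Finset.mem_insert.1 hi with rfl | hi
          · simp [hy₀m]
          · simpa [mul_comm] using hy i hi)
        simpa [mul_comm] using this)
      refine ⟨Function.update c m (∑ i ∈ s, c i * y₀ (a i) - y₀ b), fun i => ?_, ?_⟩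
      · by_cases him : i = m
        · rw [him, Function.update_self, sub_nonneg]
          exact hy₀b.le.trans (Finset.sum_nonneg fun i hi => mul_nonneg (hc i) (hy₀s i hi))
        · simpa [him] using hc i
      · rw [Finset.sum_insert hm, Function.update_self, hupd]
        refine (eq_sub_of_add_eq hb).trans ?_
        simp only [smul_add, Finset.sum_add_distrib, smul_smul, ← Finset.sum_smul]
        module

theorem exists_nat_multiple {ι : Type*} [Fintype ι] (c : ι → ℚ) (hc : ∀ i, 0 ≤ c i) :
    ∃ (N : ℕ) (b : ι → ℕ), 0 < N ∧ ∀ i, (N : ℚ) * c i = b i := by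
  have hdvd : ∀ i, (c i).den ∣ ∏ i, (c i).den := fun i => Finset.dvd_prod_of_mem _ (Finset.mem_univ i)
  choose e he using hdvd
  refine ⟨∏ i, (c i).den, fun i => (c i).num.toNat * e i,
    Finset.prod_pos fun i _ => (c i).den_pos, fun i => ?_⟩
  have h1 : (((c i).num.toNat : ℤ) : ℚ) = (c i).num := by
    rw [Int.toNat_of_nonneg (Rat.num_nonneg.2 (hc i))]
  have h2 : c i * (c i).den = (c i).num := Rat.mul_den_eq_num (c i)
  rw [he i]
  push_cast at h1 ⊢
  rw [h1, ← h2]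
  ring

end Farkas

section Semigroup

/-- The sets that contain the support of an element of `U`. -/
def supportSets {n : ℕ} (U : Set (Fin n → ℕ)) : Set (Finset (Fin n)) := {J | ∃ u ∈ U, ∀ j ∉ J, u j = 0}

variable {d n : ℕ} (A : Matrix (Fin d) (Fin n) ℤ)

/-- The functionals on the columns of `A`. -/
def rowSpace : Submodule ℚ (Fin n → ℚ) :=
  LinearMap.range (Matrix.vecMulLinear (A.map (Int.cast : ℤ → ℚ)))

theorem finrank_rowSpace_le : Module.finrank ℚ (rowSpace A) ≤ d :=
  (LinearMap.finrank_range_le _).trans (by simp)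

/-- The exponents `u` of the monomials with `γ + A u ∈ ℕA`. -/
def semigroupExponents (γ : Fin d → ℤ) : Set (Fin n → ℕ) := {u | γ + weight A u ∈ columnMonoid A}

theorem semigroupExponents_mono {A} {γ : Fin d → ℤ} {u v : Fin n → ℕ}
    (hu : u ∈ semigroupExponents A γ) (huv : u ≤ v) : v ∈ semigroupExponents A γ := by
  obtain ⟨w, rfl⟩ := exists_add_of_le huv
  change γ + weight A (u + w) ∈ columnMonoid A
  rw [weight_add, ← add_assoc]
  exact add_mem hu (weight_mem A w)

variable {A}

/-- If y is nonnegative on the columns in I and nonpositive on all columns, then −y defines a face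
containing I, hence J, and y(Au) = 0. By Farkas' lemma Au is a nonnegative rational combination of
the columns in I minus one of all columns. Clearing denominators makes the coefficients integral. -/
theorem exists_weight_eq_of_inFace {I J : Finset (Fin n)}
    (h : ∀ m ∈ J, InFace (rowSpace A) Finset.univ I m) {u : Fin n → ℕ} (hu : ∀ j ∉ J, u j = 0) :
    ∃ z w : Fin n → ℕ, (∀ j ∉ I, z j = 0) ∧ weight A z = weight A u + weight A w := by
  let a : Fin n → (Fin d → ℚ) := fun j i => A i j
  have hweight : ∀ (u : Fin n → ℕ) (i : Fin d), ((weight A u i : ℤ) : ℚ) = (∑ j, (u j : ℚ) • a j) i := by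
    intro u i
    simp [weight, Matrix.mulVec, dotProduct, a, mul_comm]
  have hrow : ∀ y : Module.Dual ℚ (Fin d → ℚ), (fun j => y (a j)) ∈ rowSpace A := by
    intro y
    refine ⟨fun i => y fun l => if i = l then 1 else 0, funext fun j => ?_⟩
    rw [LinearMap.pi_apply_eq_sum_univ y (a j)]
    simp [Matrix.vecMul, dotProduct, mul_comm, a]
  obtain ⟨c, hc, hb⟩ := farkas (I.disjSum Finset.univ)
    (Sum.elim a fun j => - a j) (∑ j, (u j : ℚ) • a j) (by
      intro y hy
      have h1 : ∀ j, 0 ≤ (fun j => (-y) (a j)) j := fun j => by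
        simpa using hy (Sum.inr j) (by simp)
      have h2 : ∀ m ∈ J, (-y) (a m) = 0 := fun m hm =>
        h m hm _ (hrow (-y)) (fun j _ => h1 j) fun j hj =>
          le_antisymm (by simpa using hy (Sum.inl j) (by simpa using hj)) (h1 j)
      rw [map_sum]
      refine Finset.sum_nonneg fun j _ => ?_
      by_cases hj : j ∈ J
      · have := h2 j hj
        rw [LinearMap.neg_apply, neg_eq_zero] at this
        simp [this]
      · simp [hu j hj])
  obtain ⟨N, b, hN, hNb⟩ := exists_nat_multiple c hc
  obtain ⟨M, rfl⟩ := Nat.exists_eq_succ_of_ne_zero hN.ne'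
  -- The cleared equation reads N·Au = Az − Ab, so w = b + (N − 1)u, with M = N − 1.
  refine ⟨fun j => if j ∈ I then b (Sum.inl j) else 0, (fun j => b (Sum.inr j)) + M • u,
    fun j hj => if_neg hj, funext fun i => ?_⟩
  rw [Finset.sum_disjSum] at hb
  have h3 := congrFun hb i
  have h4 : ∑ j ∈ I, (b (Sum.inl j) : ℚ) * a j i =
      (M + 1) * ∑ j ∈ I, c (Sum.inl j) * a j i := by
    rw [Finset.mul_sum]
    refine Finset.sum_congr rfl fun j _ => ?_
    rw [← hNb]
    push_cast
    ring
  have h5 : ∑ j, (b (Sum.inr j) : ℚ) * a j i = (M + 1) * ∑ j, c (Sum.inr j) * a j i := by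
    rw [Finset.mul_sum]
    refine Finset.sum_congr rfl fun j _ => ?_
    rw [← hNb]
    push_cast
    ring
  rw [← Int.cast_inj (α := ℚ), Pi.add_apply, Int.cast_add, hweight, hweight, hweight]
  simp only [Finset.sum_apply, Pi.smul_apply, Pi.add_apply, smul_eq_mul, Sum.elim_inl, Sum.elim_inr,
    Pi.neg_apply, mul_neg, Finset.sum_neg_distrib, Nat.cast_add, Nat.cast_mul, Nat.cast_ite,
    Nat.cast_zero, ite_mul, zero_mul, Finset.sum_ite_mem, Finset.univ_inter, add_mul,
    Finset.sum_add_distrib, mul_assoc, ← Finset.mul_sum] at h3 ⊢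
  linear_combination h4 - h5 - (M + 1) * h3

theorem faceClosed_supportSets (γ : Fin d → ℤ) :
    FaceClosed (rowSpace A) Finset.univ (supportSets (semigroupExponents A γ)) where
  sub J _ := Finset.subset_univ J
  insert_mem := by
    rintro J ⟨u, hu, huJ⟩ e -
    exact ⟨u, hu, fun j hj => huJ j fun h => hj (Finset.mem_insert_of_mem h)⟩
  face := by
    rintro J ⟨u, hu, huJ⟩ I - h
    obtain ⟨z, w, hz, hzw⟩ := exists_weight_eq_of_inFace h huJ
    refine ⟨z, ?_, hz⟩
    change γ + weight A z ∈ columnMonoid A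
    rw [hzw, ← add_assoc]
    exact add_mem hu (weight_mem A w)

end Semigroup
end
end EulerKoszul

namespace EulerKoszul
noncomputable section

/-! ### From functions on ℕ^n to Čech cochains by summation over boxes. -/

section Box

variable {k : Type u} [Field k] {n : ℕ}

/-- The difference operators on functions on `ℕ^n`. -/
def shiftDiff (k : Type u) [Field k] {n : ℕ} (j : Fin n) : Module.End k ((Fin n → ℕ) → k) :=
  LinearMap.funLeft k k (fun v => v + Pi.single j 1) - 1

theorem shiftDiff_apply (j : Fin n) (g : (Fin n → ℕ) → k) (v : Fin n → ℕ) :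
    shiftDiff k j g v = g (v + Pi.single j 1) - g v := rfl

theorem shiftDiff_comm (i j : Fin n) (g : (Fin n → ℕ) → k) :
    shiftDiff k i (shiftDiff k j g) = shiftDiff k j (shiftDiff k i g) := by
  funext v
  simp only [shiftDiff_apply]
  rw [add_right_comm]
  ring

theorem add_single_eq_update (v : Fin n → ℕ) (j : Fin n) :
    v + Pi.single j 1 = Function.update v j (v j + 1) := by
  funext l
  by_cases h : l = j
  · subst h; simp
  · simp [h]

/-- The exponents `v ≤ M` with support in `s`. -/
def box (M : ℕ) (s : Finset (Fin n)) : Finset (Fin n → ℕ) :=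
  Fintype.piFinset fun j => if j ∈ s then Finset.range (M + 1) else {0}

theorem mem_box {M : ℕ} {s : Finset (Fin n)} {v : Fin n → ℕ} :
    v ∈ box M s ↔ (∀ j, v j ≤ M) ∧ ∀ j ∉ s, v j = 0 := by
  rw [box, Fintype.mem_piFinset]
  constructor
  · refine fun h => ⟨fun j => ?_, fun j hj => by simpa [hj] using h j⟩
    have := h j
    split_ifs at this with hj
    · exact Nat.lt_succ_iff.1 (Finset.mem_range.1 this)
    · rw [Finset.mem_singleton.1 this]
      exact Nat.zero_le M
  · intro h j
    split_ifs with hj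
    · exact Finset.mem_range.2 (Nat.lt_succ_iff.2 (h.1 j))
    · exact Finset.mem_singleton.2 (h.2 j hj)

theorem sum_box_erase {M : ℕ} {s : Finset (Fin n)} {j : Fin n} (hj : j ∈ s)
    (g : (Fin n → ℕ) → k) :
    ∑ u ∈ box M s, g u =
      ∑ v ∈ box M (s.erase j), ∑ w ∈ Finset.range (M + 1), g (Function.update v j w) := by
  rw [← Finset.sum_product']
  refine Finset.sum_nbij' (fun u => (Function.update u j 0, u j)) (fun p => Function.update p.1 j p.2)
    ?_ ?_ ?_ ?_ ?_
  · intro u hu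
    rw [mem_box] at hu
    rw [Finset.mem_product, mem_box]
    refine ⟨⟨fun l => ?_, fun l hl => ?_⟩, Finset.mem_range.2 (Nat.lt_succ_iff.2 (hu.1 j))⟩
    · by_cases h : l = j
      · simp [h]
      · simpa [h] using hu.1 l
    · by_cases h : l = j
      · simp [h]
      · simpa [h] using hu.2 l fun h' => hl (Finset.mem_erase.2 ⟨h, h'⟩)
  · rintro ⟨v, w⟩ hp
    rw [Finset.mem_product, mem_box] at hp
    rw [mem_box]
    refine ⟨fun l => ?_, fun l hl => ?_⟩
    · by_cases h : l = j
      · simpa [h] using Nat.lt_succ_iff.1 (Finset.mem_range.1 hp.2)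
      · simpa [h] using hp.1.1 l
    · have h : l ≠ j := fun h => hl (h ▸ hj)
      simpa [h] using hp.1.2 l fun h' => hl (Finset.mem_of_mem_erase h')
  · intro u _
    simp
  · rintro ⟨v, w⟩ hp
    rw [Finset.mem_product, mem_box] at hp
    have : v j = 0 := hp.1.2 j (Finset.notMem_erase j s)
    refine Prod.ext ?_ ?_
    · simp [← this]
    · simp
  · intro u _
    simp

/-- The sum of the values of a function at the exponents with support in `s`. -/
def boxSum (k : Type u) [Field k] {n : ℕ} (M : ℕ) (s : Finset (Fin n)) :
    ((Fin n → ℕ) → k) →ₗ[k] k :=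
  ∑ v ∈ box M s, LinearMap.proj v

theorem boxSum_apply (M : ℕ) (s : Finset (Fin n)) (g : (Fin n → ℕ) → k) :
    boxSum k M s g = ∑ v ∈ box M s, g v := by
  simp [boxSum]

/-- The functions with values only at exponents `v ≤ M` with `v + 1_s ∈ U`. -/
def boxFun (k : Type u) [Field k] {n : ℕ} (U : Set (Fin n → ℕ)) (M : ℕ) (s : Finset (Fin n)) :
    Submodule k ((Fin n → ℕ) → k) where
  carrier := {g | ∀ v, ¬ ((∀ j, v j ≤ M) ∧ v + ind s ∈ U) → g v = 0}
  zero_mem' _ _ := rfl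
  add_mem' hf hg v hv := by rw [Pi.add_apply, hf v hv, hg v hv, add_zero]
  smul_mem' c f hf v hv := by rw [Pi.smul_apply, hf v hv, smul_zero]

/-- The sum in direction j telescopes. The term beyond the box vanishes and the term at v_j = 0
remains, with a minus sign. -/
theorem boxSum_shiftDiff {U : Set (Fin n → ℕ)} {M : ℕ} {s : Finset (Fin n)} {j : Fin n} (hj : j ∈ s)
    {g : (Fin n → ℕ) → k} (hg : g ∈ boxFun k U M (s.erase j)) :
    boxSum k M s (shiftDiff k j g) = - boxSum k M (s.erase j) g := by
  rw [boxSum_apply, boxSum_apply, sum_box_erase hj, ← Finset.sum_neg_distrib]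
  refine Finset.sum_congr rfl fun v hv => ?_
  have h1 : ∀ w, shiftDiff k j g (Function.update v j w) =
      g (Function.update v j (w + 1)) - g (Function.update v j w) := fun w => by
    rw [shiftDiff_apply, add_single_eq_update, Function.update_idem, Function.update_self]
  have h2 : g (Function.update v j (M + 1)) = 0 := hg _ fun h => by
    have := h.1 j
    rw [Function.update_self] at this
    omega
  have h3 : Function.update v j 0 = v := by
    rw [← (mem_box.1 hv).2 j (Finset.notMem_erase j s), Function.update_eq_self]
  rw [Finset.sum_congr rfl fun w _ => h1 w,
    Finset.sum_range_sub fun w => g (Function.update v j w), h2, h3, zero_sub]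

theorem boxSum_wedgeDiff {U : Set (Fin n → ℕ)} {M : ℕ} {ω : Finset (Fin n) → ((Fin n → ℕ) → k)}
    (hω : ∀ s, ω s ∈ boxFun k U M s) :
    (fun s => boxSum k M s (wedgeDiff (shiftDiff k) ω s)) =
      - cechDiff k Finset.univ fun s => boxSum k M s (ω s) := by
  funext s
  rw [Pi.neg_apply, cechDiff_apply, wedgeDiff_apply, map_sum, ← Finset.sum_neg_distrib]
  refine Finset.sum_congr rfl fun j hj => ?_
  rw [map_zsmul, boxSum_shiftDiff hj (hω _), if_pos (Finset.mem_univ j), smul_neg]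

theorem shiftDiff_mem {U : Set (Fin n → ℕ)} (hU : ∀ u ∈ U, ∀ v, u ≤ v → v ∈ U) {M : ℕ}
    {s : Finset (Fin n)} {j : Fin n} (hj : j ∈ s) {g : (Fin n → ℕ) → k}
    (hg : g ∈ boxFun k U M (s.erase j)) : shiftDiff k j g ∈ boxFun k U M s := by
  intro v hv
  rw [shiftDiff_apply, hg, hg, sub_zero]
  · rintro ⟨h1, h2⟩
    refine hv ⟨h1, hU _ h2 _ ?_⟩
    rw [← ind_erase_add hj, ← add_assoc]
    exact le_self_add
  · rintro ⟨h1, h2⟩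
    refine hv ⟨fun l => le_trans ?_ (h1 l), ?_⟩
    · rw [Pi.add_apply]
      exact le_self_add
    · rwa [add_assoc, add_comm (Pi.single j 1), ind_erase_add hj] at h2

/-- Summation in the `j`-th direction within a box. -/
def partialSum (k : Type u) [Field k] {n : ℕ} (M : ℕ) (j : Fin n) :
    ((Fin n → ℕ) → k) →+ ((Fin n → ℕ) → k) where
  toFun g u := if u j ≤ M then ∑ w ∈ Finset.range (u j), g (Function.update u j w) else 0
  map_zero' := by funext u; simp
  map_add' f g := by
    funext u
    rw [Pi.add_apply]
    split_ifs
    · simp [Finset.sum_add_distrib]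
    · rw [add_zero]

theorem partialSum_apply (M : ℕ) (j : Fin n) (g : (Fin n → ℕ) → k) (u : Fin n → ℕ) :
    partialSum k M j g u =
      if u j ≤ M then ∑ w ∈ Finset.range (u j), g (Function.update u j w) else 0 := rfl

theorem shiftDiff_partialSum_comm (M : ℕ) {i j : Fin n} (hij : i ≠ j) (g : (Fin n → ℕ) → k) :
    shiftDiff k i (partialSum k M j g) = partialSum k M j (shiftDiff k i g) := by
  funext u
  have h1 : (u + Pi.single i 1 : Fin n → ℕ) j = u j := by simp [hij.symm]
  rw [shiftDiff_apply, partialSum_apply, partialSum_apply, partialSum_apply, h1]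
  split_ifs
  · rw [← Finset.sum_sub_distrib]
    refine Finset.sum_congr rfl fun w _ => ?_
    rw [shiftDiff_apply, add_single_eq_update, add_single_eq_update, Function.update_comm hij,
      Function.update_of_ne hij]
  · rw [sub_zero]

theorem partialSum_mem {U : Set (Fin n → ℕ)} (hU : ∀ u ∈ U, ∀ v, u ≤ v → v ∈ U) {M : ℕ}
    {s : Finset (Fin n)} {j : Fin n} (hj : j ∉ s) {g : (Fin n → ℕ) → k}
    (hg : g ∈ boxFun k U M (insert j s)) : partialSum k M j g ∈ boxFun k U M s := by
  intro v hv
  rw [partialSum_apply]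
  split_ifs with hM
  · refine Finset.sum_eq_zero fun w hw => hg _ ?_
    rintro ⟨h1, h2⟩
    refine hv ⟨fun l => ?_, hU _ h2 _ fun l => ?_⟩
    · by_cases h : l = j
      · rwa [h]
      · simpa [h] using h1 l
    · have := Finset.mem_range.1 hw
      by_cases h : l = j
      · subst h
        simp [ind, hj]
        omega
      · simp [ind, h]
  · rfl

/-- Subtracting Δ_j Σ_j gathers the sum along each line in direction j at its last point in the box.
The cutoff u_j ≤ M in `partialSum` makes this boundary term appear. -/
theorem sub_shiftDiff_partialSum {U : Set (Fin n → ℕ)} {M : ℕ} {s : Finset (Fin n)} (j : Fin n)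
    {g : (Fin n → ℕ) → k} (hg : g ∈ boxFun k U M s) (u : Fin n → ℕ) :
    (g - shiftDiff k j (partialSum k M j g)) u =
      if u j = M then ∑ w ∈ Finset.range (M + 1), g (Function.update u j w) else 0 := by
  have h1 : (u + Pi.single j 1 : Fin n → ℕ) j = u j + 1 := by simp
  have h2 : ∀ w, Function.update (u + Pi.single j 1) j w = Function.update u j w := fun w => by
    rw [add_single_eq_update, Function.update_idem]
  rw [Pi.sub_apply, shiftDiff_apply, partialSum_apply, partialSum_apply, h1]
  simp only [h2]
  rcases lt_trichotomy (u j) M with h | h | h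
  · rw [if_pos (by omega), if_pos h.le, if_neg h.ne, Finset.sum_range_succ, Function.update_eq_self]
    ring
  · rw [if_neg (by omega), if_pos h.le, if_pos h, h, Finset.sum_range_succ, ← h,
      Function.update_eq_self]
    ring
  · rw [if_neg (by omega), if_neg (by omega), if_neg h.ne', hg u fun h' => absurd (h'.1 j) (by omega)]
    ring

/-- Subtracting Σ_j Δ_j makes a function constant along direction j inside the box, with its value
at u_j = 0. -/
theorem sub_partialSum_shiftDiff {U : Set (Fin n → ℕ)} {M : ℕ} {s : Finset (Fin n)} (j : Fin n)
    {g : (Fin n → ℕ) → k} (hg : g ∈ boxFun k U M s) (u : Fin n → ℕ) :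
    (g - partialSum k M j (shiftDiff k j g)) u =
      if u j ≤ M then g (Function.update u j 0) else 0 := by
  rw [Pi.sub_apply, partialSum_apply]
  split_ifs with h
  · have h1 : ∀ w, shiftDiff k j g (Function.update u j w) =
        g (Function.update u j (w + 1)) - g (Function.update u j w) := fun w => by
      rw [shiftDiff_apply, add_single_eq_update, Function.update_idem, Function.update_self]
    rw [Finset.sum_congr rfl fun w _ => h1 w,
      Finset.sum_range_sub fun w => g (Function.update u j w), Function.update_eq_self]
    ring
  · rw [hg u fun h' => absurd (h'.1 j) (by omega), sub_zero]

/-- A cocycle in a box with vanishing box sums is a coboundary. -/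
theorem exists_primitive_of_boxSum_eq_zero {U : Set (Fin n → ℕ)}
    (hU : ∀ u ∈ U, ∀ v, u ≤ v → v ∈ U) {M : ℕ} {ω : Finset (Fin n) → ((Fin n → ℕ) → k)}
    (hω : ∀ s, ω s ∈ boxFun k U M s) (hd : wedgeDiff (shiftDiff k) ω = 0)
    (h0 : ∀ s, boxSum k M s (ω s) = 0) :
    ∃ η : Finset (Fin n) → ((Fin n → ℕ) → k), (∀ s, η s ∈ boxFun k U M s) ∧
      wedgeDiff (shiftDiff k) η = ω := by
  obtain ⟨η, hη, -, hQ₁, hQ₂, hQ₃⟩ := cartan_induction (shiftDiff k) shiftDiff_comm (partialSum k M)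
    (fun j i hij m => shiftDiff_partialSum_comm M hij m) (fun s => (boxFun k U M s).toAddSubgroup)
    (fun s j hj m hm => shiftDiff_mem hU hj hm) (fun s j hj m hm => partialSum_mem hU hj hm)
    -- After the directions in J are treated, ω_s is concentrated on u_j = M for j ∈ J ∩ s and
    -- constant in u_j for j ∈ J ∖ s, and its box sum is unchanged.
    (fun J ω => (∀ s, boxSum k M s (ω s) = 0) ∧
      (∀ s u, (∃ j ∈ J, j ∈ s ∧ u j ≠ M) → ω s u = 0) ∧
      (∀ s u u', (∀ j, u j ≤ M) → (∀ j, u' j ≤ M) → (∀ j, (j ∈ J → j ∈ s) → u j = u' j) →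
        ω s u = ω s u'))
    (by
      rintro J j ω hj - hω ⟨h1, h2, h3⟩
      have hin : ∀ s, j ∈ s → ∀ u, (ω s - shiftDiff k j (partialSum k M j (ω s))) u = _ :=
        fun s _ u => sub_shiftDiff_partialSum j (hω s) u
      have hout : ∀ s, j ∉ s → ∀ u, (ω s - partialSum k M j (shiftDiff k j (ω s))) u = _ :=
        fun s _ u => sub_partialSum_shiftDiff j (hω s) u
      refine ⟨fun s => ?_, fun s u => ?_, fun s u u' hu hu' huu' => ?_⟩
      · rw [← h1 s, boxSum_apply, boxSum_apply]
        dsimp only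
        split_ifs with hs
        · rw [sum_box_erase hs, sum_box_erase hs]
          refine Finset.sum_congr rfl fun v _ => ?_
          simp only [hin s hs, Function.update_self, Function.update_idem]
          rw [Finset.sum_ite_eq_of_mem' _ _ _ (Finset.mem_range.2 (Nat.lt_succ_self M))]
        · refine Finset.sum_congr rfl fun v hv => ?_
          rw [hout s hs, if_pos ((mem_box.1 hv).1 j), ← (mem_box.1 hv).2 j hs,
            Function.update_eq_self]
      · rintro ⟨i, hi, his, hiM⟩
        have hcase : i ≠ j → ∀ w, ω s (Function.update u j w) = 0 := fun hij w =>
          h2 s _ ⟨i, (Finset.mem_insert.1 hi).resolve_left hij, his, by simpa [hij] using hiM⟩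
        dsimp only
        split_ifs with hs
        · rw [hin s hs]
          split_ifs with hjM
          · exact Finset.sum_eq_zero fun w _ => hcase (fun h => hiM (h ▸ hjM)) w
          · rfl
        · rw [hout s hs]
          split_ifs
          · exact hcase (fun h => hs (h ▸ his)) 0
          · rfl
      · have hagree : ∀ w ≤ M, ω s (Function.update u j w) = ω s (Function.update u' j w) := by
          intro w hw
          refine h3 s _ _ (fun l => ?_) (fun l => ?_) fun l hl => ?_
          · by_cases h : l = j
            · simpa [h] using hw
            · simpa [h] using hu l
          · by_cases h : l = j
            · simpa [h] using hw
            · simpa [h] using hu' l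
          · by_cases h : l = j
            · simp [h]
            · simpa [h] using huu' l fun h' => hl ((Finset.mem_insert.1 h').resolve_left h)
        dsimp only
        split_ifs with hs
        · rw [hin s hs, hin s hs, huu' j fun _ => hs]
          split_ifs
          · exact Finset.sum_congr rfl fun w hw =>
              hagree w (Nat.lt_succ_iff.1 (Finset.mem_range.1 hw))
          · rfl
        · rw [hout s hs, hout s hs, if_pos (hu j), if_pos (hu' j)]
          exact hagree 0 (Nat.zero_le M)) ω hd hω
    ⟨h0, by simp, fun s u u' _ _ h => congrArg (ω s) (funext fun j => h j (by simp))⟩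
  refine ⟨η, hη, (sub_eq_zero.1 ?_).symm⟩
  set ξ := ω - wedgeDiff (shiftDiff k) η with hξ
  have hξM : ∀ s, ξ s ∈ boxFun k U M s := fun s => by
    rw [hξ, Pi.sub_apply, wedgeDiff_apply]
    exact sub_mem (hω s) (sum_mem fun j hj => zsmul_mem (shiftDiff_mem hU hj (hη _)) _)
  funext s u
  by_cases hu : ∀ j, u j ≤ M
  · have h1 := hQ₁ s
    -- In the end ω_s is determined by its value at this corner, and that value is the whole box
    -- sum, hence zero.
    let t : Fin n → ℕ := fun j => if j ∈ s then M else 0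
    have ht : ∀ j, t j ≤ M := fun j => by
      dsimp only [t]
      split_ifs <;> omega
    rw [boxSum_apply, Finset.sum_eq_single_of_mem t (mem_box.2 ⟨ht, fun j hj => if_neg hj⟩)] at h1
    · by_cases h : ∃ j ∈ s, u j ≠ M
      · obtain ⟨j, hj, hjM⟩ := h
        exact hQ₂ s u ⟨j, Finset.mem_univ j, hj, hjM⟩
      · push Not at h
        refine (hQ₃ s u t hu ht fun j hj => ?_).trans h1
        rw [h j (hj (Finset.mem_univ j))]
        exact (if_pos (hj (Finset.mem_univ j))).symm
    · intro v hv hvt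
      obtain ⟨j, hj⟩ := Function.ne_iff.1 hvt
      have hjs : j ∈ s := by
        by_contra hjs
        exact hj (((mem_box.1 hv).2 j hjs).trans (if_neg hjs).symm)
      exact hQ₂ s v ⟨j, Finset.mem_univ j, hjs, fun h => hj (h.trans (if_pos hjs).symm)⟩
  · exact hξM s u fun h => hu h.1

theorem boxFun_mono {U : Set (Fin n → ℕ)} {M M' : ℕ} (h : M ≤ M') (s : Finset (Fin n)) :
    boxFun k U M s ≤ boxFun k U M' s := fun _ hg v hv =>
  hg v fun h' => hv ⟨fun j => (h'.1 j).trans h, h'.2⟩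

theorem boxSum_eq_of_le {U : Set (Fin n → ℕ)} {M M' : ℕ} (h : M ≤ M') {s : Finset (Fin n)}
    {g : (Fin n → ℕ) → k} (hg : g ∈ boxFun k U M s) : boxSum k M s g = boxSum k M' s g := by
  rw [boxSum_apply, boxSum_apply]
  refine Finset.sum_subset (fun v hv => ?_) fun v hv hv' => hg v fun h' => ?_
  · rw [mem_box] at hv ⊢
    exact ⟨fun j => (hv.1 j).trans h, hv.2⟩
  · exact hv' (mem_box.2 ⟨h'.1, (mem_box.1 hv).2⟩)

theorem boxSum_mem_cechCocycles {U : Set (Fin n → ℕ)} {M : ℕ}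
    {ω : Finset (Fin n) → ((Fin n → ℕ) → k)} (hω : ∀ s, ω s ∈ boxFun k U M s)
    (hd : wedgeDiff (shiftDiff k) ω = 0) {i : ℤ} (hi : ∀ s, (s.card : ℤ) ≠ i → ω s = 0) :
    (fun s => boxSum k M s (ω s)) ∈ cechCocycles k Finset.univ (supportSets U) i := by
  refine ⟨fun s hs => ?_, LinearMap.mem_ker.2 (neg_eq_zero.1 ?_)⟩
  · dsimp only
    by_cases hsi : (s.card : ℤ) = i
    · rw [boxSum_apply]
      refine Finset.sum_eq_zero fun v hv => hω s v fun h => hs ⟨⟨_, h.2, fun j hj => ?_⟩, hsi⟩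
      rw [Pi.add_apply, (mem_box.1 hv).2 j hj, ind, if_neg hj]
    · rw [hi s hsi, map_zero]
  · have := boxSum_wedgeDiff hω
    rw [hd] at this
    rw [← this]
    funext s
    exact map_zero _

/-- A cocycle in a box whose box sums form a coboundary is a coboundary. -/
theorem exists_primitive_of_boxSum {U : Set (Fin n → ℕ)}
    (hU : ∀ u ∈ U, ∀ v, u ≤ v → v ∈ U) {M : ℕ} {ω : Finset (Fin n) → ((Fin n → ℕ) → k)}
    (hω : ∀ s, ω s ∈ boxFun k U M s) (hd : wedgeDiff (shiftDiff k) ω = 0) {i : ℤ}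
    (h : (fun s => boxSum k M s (ω s)) ∈ cechCoboundaries k Finset.univ (supportSets U) i) :
    ∃ M', ∃ η : Finset (Fin n) → ((Fin n → ℕ) → k), (∀ s, η s ∈ boxFun k U M' s) ∧
      wedgeDiff (shiftDiff k) η = ω := by
  obtain ⟨g, hg, hgω⟩ := h
  have hu : ∀ s : Finset (Fin n), ∃ u : Fin n → ℕ,
      s ∈ supportSets U → u ∈ U ∧ ∀ j ∉ s, u j = 0 := by
    intro s
    by_cases hs : s ∈ supportSets U
    · obtain ⟨u, h1, h2⟩ := hs
      exact ⟨u, fun _ => ⟨h1, h2⟩⟩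
    · exact ⟨0, fun h => absurd h hs⟩
  choose u hu using hu
  set M' := M + ∑ s, ∑ j, u s j with hM'
  have huM : ∀ s j, u s j ≤ M' := fun s j =>
    (Finset.single_le_sum (f := fun j => u s j) (fun _ _ => Nat.zero_le _)
      (Finset.mem_univ j)).trans ((Finset.single_le_sum (f := fun s => ∑ j, u s j)
        (fun _ _ => Nat.zero_le _) (Finset.mem_univ s)).trans (Nat.le_add_left _ _))
  have hMM : M ≤ M' := Nat.le_add_right _ _
  have hgs : ∀ s, s ∉ supportSets U → g s = 0 := fun s hs => hg s fun h => hs h.1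
  -- The Čech primitive is lifted to point masses at elements u_s of U supported in s; upward
  -- closure of U makes them admissible. The minus sign offsets the one in `boxSum_wedgeDiff`, and
  -- M' is large enough to contain all u_s.
  let κ : Finset (Fin n) → ((Fin n → ℕ) → k) := fun s => Pi.single (u s) (- g s)
  have hκ : ∀ s, κ s ∈ boxFun k U M' s := by
    intro s v hv
    by_cases hvu : v = u s
    · by_cases hs : s ∈ supportSets U
      · exact absurd ⟨fun j => hvu ▸ huM s j, hvu ▸ hU _ (hu s hs).1 _ le_self_add⟩ hv
      · simp [κ, hgs s hs]
    · exact Pi.single_eq_of_ne hvu _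
  have hκsum : ∀ s, boxSum k M' s (κ s) = - g s := by
    intro s
    by_cases hs : s ∈ supportSets U
    · rw [boxSum_apply, Finset.sum_eq_single_of_mem (u s) (mem_box.2 ⟨huM s, (hu s hs).2⟩)
        fun v _ hv => Pi.single_eq_of_ne hv _]
      exact Pi.single_eq_same _ _
    · have : κ s = 0 := by simp [κ, hgs s hs]
      rw [this, map_zero, hgs s hs, neg_zero]
  have hDκ := boxSum_wedgeDiff hκ
  have hDκm : ∀ s, wedgeDiff (shiftDiff k) κ s ∈ boxFun k U M' s := fun s => by
    rw [wedgeDiff_apply]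
    exact sum_mem fun j hj => zsmul_mem (shiftDiff_mem hU hj (hκ _)) _
  obtain ⟨η, hη, hηω⟩ := exists_primitive_of_boxSum_eq_zero hU
    (ω := ω - wedgeDiff (shiftDiff k) κ) (M := M')
    (fun s => sub_mem (boxFun_mono hMM s (hω s)) (hDκm s))
    (by rw [map_sub, hd, wedgeDiff_sq _ shiftDiff_comm, sub_zero])
    (by
      intro s
      have h1 := congrFun hDκ s
      have h2 := congrFun hgω s
      have h3 : (fun s => boxSum k M' s (κ s)) = - g := funext hκsum
      rw [h3, map_neg, neg_neg] at h1
      rw [Pi.sub_apply, map_sub, ← boxSum_eq_of_le hMM (hω s), sub_eq_zero]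
      exact h2.symm.trans h1.symm)
  refine ⟨M', η + κ, fun s => add_mem (hη s) (hκ s), ?_⟩
  rw [map_add, hηω, sub_add_cancel]

end Box
end
end EulerKoszul

namespace EulerKoszul
noncomputable section

/-! ### Local cohomology of the semigroup ring. -/

section ToricRing

variable {d n : ℕ} {A : Matrix (Fin d) (Fin n) ℤ} {k : Type u} [Field k]

/-- The value of a Laurent polynomial at `1`. -/
def augmentation (k : Type u) [Field k] (d : ℕ) : Laurent k d →ₗ[k] k :=
  Finsupp.lsum k (fun _ : Fin d → ℤ => (LinearMap.id : k →ₗ[k] k)) ∘ₗ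
    (AddMonoidAlgebra.coeffLinearEquiv k : Laurent k d ≃ₗ[k] ((Fin d → ℤ) →₀ k)).toLinearMap

theorem augmentation_single (α : Fin d → ℤ) (x : k) :
    augmentation k d (AddMonoidAlgebra.single α x) = x := by
  change Finsupp.lsum k (fun _ : Fin d → ℤ => (LinearMap.id : k →ₗ[k] k)) (Finsupp.single α x) = x
  rw [Finsupp.lsum_single]
  rfl

theorem exists_eq_single_of_mem_semigroupPiece {α : DegreeCat A} {f : Laurent k d}
    (hf : f ∈ semigroupPiece A k α) :
    ∃ c : k, f = AddMonoidAlgebra.single α.deg c ∧ (c ≠ 0 → α.deg ∈ columnMonoid A) := by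
  induction hf using Submodule.span_induction with
  | mem f hf => exact ⟨1, hf.2, fun _ => hf.1⟩
  | zero => exact ⟨0, by simp, fun h => absurd rfl h⟩
  | add f g _ _ hf hg =>
    obtain ⟨a, rfl, ha⟩ := hf
    obtain ⟨b, rfl, hb⟩ := hg
    refine ⟨a + b, (AddMonoidAlgebra.single_add _ _ _).symm, fun h => ?_⟩
    by_cases ha0 : a = 0
    · exact hb fun hb0 => h (by rw [ha0, hb0, add_zero])
    · exact ha ha0
  | smul c f _ hf =>
    obtain ⟨a, rfl, ha⟩ := hf
    exact ⟨c * a, AddMonoidAlgebra.smul_single _ _ _, fun h => ha (right_ne_zero_of_mul h)⟩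

/-- The coefficient of a homogeneous element of the toric ring. -/
def toricScalar (A : Matrix (Fin d) (Fin n) ℤ) (k : Type u) [Field k] :
    Total (toricRing A k) →ₗ[k] k :=
  fromTotal (toricRing A k) fun α => augmentation k d ∘ₗ (semigroupPiece A k α).subtype

theorem toricScalar_incl (α : DegreeCat A) (x : semigroupPiece A k α) :
    toricScalar A k (incl (toricRing A k) α x) = augmentation k d x.1 :=
  fromTotal_incl _ _ _ _

/-- Each ∂_j multiplies by a Laurent monomial, whose value at 1 is 1. So on coefficients ∂_j is the
identity and `diffOp` becomes `shiftDiff`. -/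
theorem toricScalar_partialTotal (j : Fin n) (x : Total (toricRing A k)) :
    toricScalar A k (partialTotal (toricRing A k) j x) = toricScalar A k x := by
  have : toricScalar A k ∘ₗ partialTotal (toricRing A k) j = toricScalar A k := by
    refine total_hom_ext fun α x => ?_
    rw [LinearMap.comp_apply, partialTotal_incl]
    refine (toricScalar_incl _ _).trans (Eq.trans ?_ (toricScalar_incl α x).symm)
    change augmentation k d (AddMonoidAlgebra.single (weight A (Pi.single j 1)) (1 : k) *
      (show semigroupPiece A k α from x).1) = _
    obtain ⟨c, hc, -⟩ := exists_eq_single_of_mem_semigroupPiece (show semigroupPiece A k α from x).2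
    rw [hc, AddMonoidAlgebra.single_mul_single, augmentation_single, augmentation_single, one_mul]
  exact LinearMap.congr_fun this x

theorem toricScalar_injective {γ : Fin d → ℤ} {x : Total (toricRing A k)}
    (hx : x ∈ homPart (toricRing A k) γ) (h : toricScalar A k x = 0) : x = 0 := by
  obtain ⟨x, rfl⟩ := hx
  have h1 := (toricScalar_incl _ x).symm.trans h
  obtain ⟨c, hc, -⟩ := exists_eq_single_of_mem_semigroupPiece (show semigroupPiece A k ⟨γ⟩ from x).2
  rw [hc, augmentation_single] at h1
  have : x = 0 := Subtype.ext (hc.trans (by rw [h1, AddMonoidAlgebra.single_zero]; rfl))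
  rw [this, map_zero]

theorem mem_of_toricScalar_ne_zero {γ : Fin d → ℤ} {x : Total (toricRing A k)}
    (hx : x ∈ homPart (toricRing A k) γ) (h : toricScalar A k x ≠ 0) : γ ∈ columnMonoid A := by
  obtain ⟨x, rfl⟩ := hx
  obtain ⟨c, hc, hc'⟩ :=
    exists_eq_single_of_mem_semigroupPiece (show semigroupPiece A k ⟨γ⟩ from x).2
  refine hc' fun h0 => h ((toricScalar_incl _ x).trans ?_)
  rw [hc, augmentation_single, h0]

theorem exists_toricScalar_eq (γ : Fin d → ℤ) (c : k) (hc : c ≠ 0 → γ ∈ columnMonoid A) :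
    ∃ x ∈ homPart (toricRing A k) γ, toricScalar A k x = c := by
  by_cases h : c = 0
  · exact ⟨0, zero_mem _, by rw [h, map_zero]⟩
  · let x : semigroupPiece A k ⟨γ⟩ :=
      ⟨AddMonoidAlgebra.single γ 1, Submodule.subset_span ⟨hc h, rfl⟩⟩
    refine ⟨c • incl (toricRing A k) ⟨γ⟩ x, Submodule.smul_mem _ _ ⟨x, rfl⟩, ?_⟩
    rw [map_smul]
    refine (congrArg (c • ·) (toricScalar_incl ⟨γ⟩ x)).trans ?_
    rw [augmentation_single, smul_eq_mul, mul_one]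

/-- The coefficients of a family of functions with values in the toric ring. -/
def scalarFamily (A : Matrix (Fin d) (Fin n) ℤ) (k : Type u) [Field k] :
    (Finset (Fin n) → ExpFun (toricRing A k)) →ₗ[k] (Finset (Fin n) → ((Fin n → ℕ) → k)) :=
  LinearMap.pi fun s => (toricScalar A k).compLeft (Fin n → ℕ) ∘ₗ LinearMap.proj s

theorem scalarFamily_apply (ω : Finset (Fin n) → ExpFun (toricRing A k)) (s : Finset (Fin n))
    (v : Fin n → ℕ) : scalarFamily A k ω s v = toricScalar A k (ω s v) := rfl

theorem scalarFamily_wedgeDiff (ω : Finset (Fin n) → ExpFun (toricRing A k)) :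
    scalarFamily A k (wedgeDiff (diffOp (toricRing A k)) ω) =
      wedgeDiff (shiftDiff k) (scalarFamily A k ω) := by
  funext s
  rw [wedgeDiff_apply]
  change (toricScalar A k).compLeft (Fin n → ℕ) (wedgeDiff (diffOp (toricRing A k)) ω s) = _
  rw [wedgeDiff_apply, map_sum]
  refine Finset.sum_congr rfl fun j _ => ?_
  rw [map_zsmul]
  congr 1
  funext v
  change toricScalar A k (diffOp (toricRing A k) j (ω (s.erase j)) v) = _
  rw [diffOp_apply, map_sub, toricScalar_partialTotal]
  rfl

theorem exists_bound {ω : Finset (Fin n) → ExpFun (toricRing A k)} {γ : Fin d → ℤ}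
    (hω : ω ∈ homFamilies (toricRing A k) γ) (hf : ∀ s, ω s ∈ finiteFun (toricRing A k)) :
    ∃ M, ∀ M' ≥ M, ∀ s, scalarFamily A k ω s ∈ boxFun k (semigroupExponents A γ) M' s := by
  have hB : ∀ s, ∃ B : Fin n → ℕ, ∀ v, ω s v ≠ 0 → v ≤ B := fun s => by
    obtain ⟨B, hB⟩ := Set.Finite.bddAbove (hf s)
    exact ⟨B, fun v hv => hB hv⟩
  choose B hB using hB
  refine ⟨∑ s, ∑ j, B s j, fun M' hM' s v hv => ?_⟩
  by_contra h
  rw [scalarFamily_apply] at h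
  refine hv ⟨fun j => ?_, mem_of_toricScalar_ne_zero (hω s v) h⟩
  have h1 : ω s v ≠ 0 := fun h0 => h (by rw [h0, map_zero])
  exact ((hB s v h1 j).trans ((Finset.single_le_sum (f := fun j => B s j)
    (fun _ _ => Nat.zero_le _) (Finset.mem_univ j)).trans (Finset.single_le_sum
      (f := fun s => ∑ j, B s j) (fun _ _ => Nat.zero_le _) (Finset.mem_univ s)))).trans hM'

/-- A primitive of the scalar cocycle lifts back to the toric ring: it is nonzero only where v + 1_s
is in U, that is, where the graded piece is a line. Elements of one degree are determined by their
scalars, so the lift is again a primitive. -/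
theorem localClass_eq_zero_of_boxSum {i : ℕ} {α : DegreeCat A}
    (ω : localCocycles (toricRing A k) i α.deg) {M : ℕ}
    (hM : ∀ s, scalarFamily A k ω.1 s ∈ boxFun k (semigroupExponents A α.deg) M s)
    (h : (fun s => boxSum k M s (scalarFamily A k ω.1 s)) ∈
      cechCoboundaries k Finset.univ (supportSets (semigroupExponents A α.deg)) i) :
    localClass (toricRing A k) i α ω = 0 := by
  have hd : wedgeDiff (diffOp (toricRing A k)) ω.1 = 0 := ω.2.2
  obtain ⟨M', η, hη, hηω⟩ := exists_primitive_of_boxSum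
    (fun u hu v huv => semigroupExponents_mono hu huv) hM
    (by rw [← scalarFamily_wedgeDiff, hd, map_zero]) h
  have hlift : ∀ s v, ∃ x ∈ homPart (toricRing A k) (α.deg + weight A (v + ind s)),
      toricScalar A k x = η s v := fun s v => exists_toricScalar_eq _ _ fun hne => by
    by_contra hmem
    exact hne (hη s v fun h' => hmem h'.2)
  choose ξ hξ hξη using hlift
  have hξη' : scalarFamily A k ξ = η := funext fun s => funext fun v => hξη s v
  refine (localClass_eq_zero_iff _ _ _ _).2 ⟨ξ, hξ, fun s => ?_, ?_⟩
  · refine Set.Finite.subset (Set.Finite.pi' fun _ : Fin n => Set.finite_le_nat M') fun v hv j => ?_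
    by_contra hj
    refine hv (toricScalar_injective (hξ s v) ((hξη s v).trans (hη s v fun h' => hj (h'.1 j))))
  · refine sub_eq_zero.1 (funext fun s => funext fun v => ?_)
    refine toricScalar_injective (sub_mem (wedgeDiff_mem_homFamilies _ hξ) ω.2.1.1.1 s v) ?_
    change scalarFamily A k (wedgeDiff (diffOp (toricRing A k)) ξ - ω.1) s v = 0
    rw [map_sub, scalarFamily_wedgeDiff, hξη', hηω, sub_self]
    rfl

theorem boxSum_scalarFamily_mem {i : ℕ} {α : DegreeCat A}
    (ω : localCocycles (toricRing A k) i α.deg) {M : ℕ}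
    (hM : ∀ s, scalarFamily A k ω.1 s ∈ boxFun k (semigroupExponents A α.deg) M s) :
    (fun s => boxSum k M s (scalarFamily A k ω.1 s)) ∈
      cechCocycles k Finset.univ (supportSets (semigroupExponents A α.deg)) i := by
  have hd : wedgeDiff (diffOp (toricRing A k)) ω.1 = 0 := ω.2.2
  refine boxSum_mem_cechCocycles hM (by rw [← scalarFamily_wedgeDiff, hd, map_zero]) fun s hs => ?_
  have h0 : ω.1 s = 0 := ω.2.1.1.2 s fun h => hs (by rw [h])
  funext v
  rw [scalarFamily_apply, h0]
  exact map_zero _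

theorem cechVanishing_semigroup (k : Type u) [Field k] (γ : Fin d → ℤ) :
    CechVanishing k (rowSpace A) Finset.univ (supportSets (semigroupExponents A γ)) d :=
  cechVanishing (faceClosed_supportSets γ) (Int.ofNat_le.2 (finrank_rowSpace_le A))

/-- The local cohomology of the toric ring vanishes above its dimension. -/
theorem subsingleton_localCohomology_toricRing {i : ℕ} (hi : d < i) (α : DegreeCat A) :
    Subsingleton (((gradedLocalCohomology A k i).obj (toricRing A k)).obj α) := by
  refine subsingleton_of_forall_eq 0 fun x => ?_
  obtain ⟨ω, rfl⟩ := localClass_surjective (toricRing A k) i α x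
  obtain ⟨M, hM⟩ := exists_bound ω.2.1.1.1 fun s => ω.2.1.2 s (Set.mem_univ s)
  exact localClass_eq_zero_of_boxSum ω (hM M le_rfl) ((cechVanishing_semigroup k α.deg).above i
    (Int.ofNat_lt.2 hi) (boxSum_scalarFamily_mem ω (hM M le_rfl)))

/-- The graded pieces of the top local cohomology of the toric ring are at most lines. -/
theorem exists_smul_add_smul_eq_zero (α : DegreeCat A)
    (x y : ((gradedLocalCohomology A k d).obj (toricRing A k)).obj α) :
    ∃ c c' : k, (c ≠ 0 ∨ c' ≠ 0) ∧ c • x + c' • y = 0 := by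
  obtain ⟨ω, rfl⟩ := localClass_surjective (toricRing A k) d α x
  obtain ⟨η, rfl⟩ := localClass_surjective (toricRing A k) d α y
  obtain ⟨M₁, hM₁⟩ := exists_bound ω.2.1.1.1 fun s => ω.2.1.2 s (Set.mem_univ s)
  obtain ⟨M₂, hM₂⟩ := exists_bound η.2.1.1.1 fun s => η.2.1.2 s (Set.mem_univ s)
  have h₁ := hM₁ (M₁ + M₂) (Nat.le_add_right _ _)
  have h₂ := hM₂ (M₁ + M₂) (Nat.le_add_left _ _)
  obtain ⟨c, c', hc, h⟩ := (cechVanishing_semigroup k α.deg).line _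
    (boxSum_scalarFamily_mem ω h₁) _ (boxSum_scalarFamily_mem η h₂)
  refine ⟨c, c', hc, ?_⟩
  rw [← map_smul, ← map_smul, ← map_add]
  have key : ∀ s, scalarFamily A k (c • ω + c' • η).1 s =
      c • scalarFamily A k ω.1 s + c' • scalarFamily A k η.1 s := fun s => by
    change scalarFamily A k (c • ω.1 + c' • η.1) s = _
    rw [map_add, map_smul, map_smul]
    rfl
  refine localClass_eq_zero_of_boxSum _ (M := M₁ + M₂) (fun s => ?_) ?_
  · rw [key]
    exact add_mem (Submodule.smul_mem _ c (h₁ s)) (Submodule.smul_mem _ c' (h₂ s))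
  · convert h using 1
    funext s
    rw [key, map_add, map_smul, map_smul]
    rfl

theorem bijective_smul_of_ne_zero {α : DegreeCat A}
    {x : ((gradedLocalCohomology A k d).obj (toricRing A k)).obj α} (hx : x ≠ 0) :
    Function.Bijective fun c : k => c • x := by
  refine ⟨smul_left_injective k hx, fun y => ?_⟩
  obtain ⟨c, c', hc, h⟩ := exists_smul_add_smul_eq_zero α x y
  have hc' : c' ≠ 0 := by
    rintro rfl
    rw [zero_smul, add_zero] at h
    exact hc.elim (fun hc => hx ((smul_eq_zero.1 h).resolve_left hc)) fun h => h rfl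
  refine ⟨-(c'⁻¹ * c), ?_⟩
  change -(c'⁻¹ * c) • x = y
  rw [neg_smul, mul_smul, eq_neg_of_add_eq_zero_left h, smul_neg, neg_neg, smul_smul,
    inv_mul_cancel₀ hc', one_smul]

end ToricRing

/-! ### A line in degree d and the cohomology of the torus. -/

section TopDegree

variable {k : Type u} [Field k] {d : ℕ}

theorem card_compl_of_totalIndex {q : ℤ} {x : ℕ × Finset (Fin d)} (hx : (x.1 : ℤ) - x.2.card = q)
    (h : x.1 = d) : ((x.2ᶜ).card : ℤ) = q := by
  have := Finset.card_add_card_compl x.2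
  rw [Fintype.card_fin] at this
  omega

/-- A family of vector spaces that is a line in degree `d` and zero in all other degrees, summed
over the total indices. -/
theorem exists_equiv_of_line (H : ℕ → Type u) [∀ i, AddCommGroup (H i)] [∀ i, Module k (H i)]
    (h0 : ∀ i, i ≠ d → Subsingleton (H i)) {x₀ : H d}
    (hx₀ : Function.Bijective fun c : k => c • x₀) (q : ℤ) :
    Nonempty (({s : Finset (Fin d) // (s.card : ℤ) = q} → k) ≃ₗ[k]
      (∀ x : TotalIndex d q, H x.1.1)) := by
  have he : ∀ i, ∃ e : H i, i = d → Function.Bijective fun c : k => c • e := by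
    intro i
    by_cases h : i = d
    · subst h
      exact ⟨x₀, fun _ => hx₀⟩
    · exact ⟨0, fun h' => absurd h' h⟩
  choose e he using he
  -- Only the indices (d, t) with d − |t| = q matter, and they are labelled by the q-element
  -- complements of t.
  let f : ({s : Finset (Fin d) // (s.card : ℤ) = q} → k) →ₗ[k] (∀ x : TotalIndex d q, H x.1.1) :=
    LinearMap.pi fun x => if h : x.1.1 = d then
      LinearMap.toSpanSingleton k (H x.1.1) (e x.1.1) ∘ₗ
        LinearMap.proj (R := k) (φ := fun _ => k) ⟨x.1.2ᶜ, card_compl_of_totalIndex x.2 h⟩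
      else 0
  have hf : ∀ c (x : TotalIndex d q) (h : x.1.1 = d),
      f c x = c ⟨x.1.2ᶜ, card_compl_of_totalIndex x.2 h⟩ • e x.1.1 := by
    intro c x h
    simp only [f, LinearMap.pi_apply, dif_pos h]
    rfl
  have hcompl : ∀ s : {s : Finset (Fin d) // (s.card : ℤ) = q}, (d : ℤ) - (s.1ᶜ).card = q := by
    intro s
    have := Finset.card_add_card_compl s.1
    rw [Fintype.card_fin] at this
    have := s.2
    omega
  refine ⟨LinearEquiv.ofBijective f ⟨fun c c' h => funext fun s => ?_, fun y => ?_⟩⟩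
  · have h1 := congrFun h ⟨(d, s.1ᶜ), hcompl s⟩
    rw [hf c _ rfl, hf c' _ rfl] at h1
    have h2 := (he d rfl).1 h1
    simpa only [compl_compl] using h2
  · choose c hc using fun s : {s : Finset (Fin d) // (s.card : ℤ) = q} =>
      (he d rfl).2 (y ⟨(d, s.1ᶜ), hcompl s⟩)
    refine ⟨c, funext fun x => ?_⟩
    obtain ⟨⟨i, t⟩, hx⟩ := x
    by_cases h : i = d
    · subst h
      rw [hf c _ rfl]
      refine (hc _).trans ?_
      congr 1
      exact Subtype.ext (Prod.ext rfl (compl_compl t))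
    · exact (h0 i h).elim _ _

end TopDegree

section Torus

variable {d n : ℕ} {A : Matrix (Fin d) (Fin n) ℤ} {k : Type u} [Field k] [CharZero k]
variable {β : Fin d → k}

/-- Below d the pieces vanish because β is not strongly exceptional, above d by the toric vanishing
theorem, and in degree d the piece is a line. -/
theorem homology_iso_deRhamTorus (hβ : ¬ StronglyExceptional A β)
    (P : KProjectiveResolution ((eulerKoszul A β).obj (toricRing A k)))
    (h : β ∈ degrees ((gradedLocalCohomology A k d).obj (toricRing A k))) (p : ℤ) :
    Nonempty (((deRhamComplex k n).obj P.complex).homology p ≅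
      (deRhamTorus k d).homology (p + n)) := by
  obtain ⟨γ, hγ⟩ := h
  obtain ⟨x₀, hx₀⟩ := exists_ne (0 : ((gradedLocalCohomology A k d).obj (toricRing A k)).obj γ.1)
  have h0 : ∀ i, i ≠ d →
      Subsingleton (((gradedLocalCohomology A k i).obj (toricRing A k)).obj γ.1) := by
    intro i hi
    rcases lt_or_gt_of_ne hi with h | h
    · rw [← not_nontrivial_iff_subsingleton]
      exact fun hn => hβ ⟨i, h, γ, hn⟩
    · exact subsingleton_localCohomology_toricRing h γ.1
  obtain ⟨e₁⟩ := homology_deRham_iso (toricRing A k) P p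
  obtain ⟨e₂⟩ := exists_equiv_of_line
    (fun i => ((gradedLocalCohomology A k i).obj (toricRing A k)).obj γ.1) h0
    (bijective_smul_of_ne_zero hx₀) (p + n)
  let e₃ := LinearEquiv.ofBijective (targetExpansion γ (toricRing A k) (p + n))
    ⟨targetExpansion_injective γ _ _, targetExpansion_surjective γ _ _⟩
  exact ⟨e₁ ≪≫ (e₃.symm.trans (e₂.symm.trans (torusCohomologyEquiv (p + n)))).toModuleIso⟩

theorem isZero_homology_of_notMem (hβ : ¬ StronglyExceptional A β)
    (P : KProjectiveResolution ((eulerKoszul A β).obj (toricRing A k)))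
    (h : β ∉ degrees ((gradedLocalCohomology A k d).obj (toricRing A k))) (p : ℤ) :
    Limits.IsZero (((deRhamComplex k n).obj P.complex).homology p) := by
  obtain ⟨e⟩ := homology_deRham_iso (toricRing A k) P p
  have := subsingleton_targetTerm (toricRing A k) (β := β) (fun hmem => by
    obtain ⟨i, γ, hn⟩ := Set.mem_iUnion.1 hmem
    rcases lt_trichotomy i d with hi | rfl | hi
    · exact hβ ⟨i, hi, γ, hn⟩
    · exact h ⟨γ, hn⟩
    · exact not_subsingleton_iff_nontrivial.2 hn (subsingleton_localCohomology_toricRing hi γ.1))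
    (p + n)
  exact (ModuleCat.isZero_of_subsingleton (targetTerm A β (toricRing A k) (p + n))).of_iso e

end Torus
end
end EulerKoszul

theorem mainTheorem4 {k : Type u} [Field k] [CharZero k]
    [HasDerivedCategory.{w} (ModuleCat.{u} k)] {d n : ℕ}
    (A : Matrix (Fin d) (Fin n) ℤ) (hA : IsAdmissible A) (β : Fin d → k) :
    (∃ θ : ∀ (N : GradedModule A k) (P : KProjectiveResolution ((eulerKoszul A β).obj N)),
        DerivedCategory.Q.obj ((deRhamComplex k n).obj P.complex) ≅
          DerivedCategory.Q.obj (((targetComplex A β).obj N)⟦(n : ℤ)⟧),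
      ∀ (N N' : GradedModule A k) (φ : N ⟶ N')
        (P : KProjectiveResolution ((eulerKoszul A β).obj N))
        (P' : KProjectiveResolution ((eulerKoszul A β).obj N'))
        (f : P.complex ⟶ P'.complex),
        Nonempty (Homotopy (f ≫ P'.π) (P.π ≫ (eulerKoszul A β).map φ)) →
          DerivedCategory.Q.map ((deRhamComplex k n).map f) ≫ (θ N' P').hom =
            (θ N P).hom ≫ DerivedCategory.Q.map (((targetComplex A β).map φ)⟦(n : ℤ)⟧')) ∧
    (∀ N : GradedModule A k, β ∉ degreesRΓ N →
      ∀ P : KProjectiveResolution ((eulerKoszul A β).obj N),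
        Limits.IsZero (DerivedCategory.Q.obj ((deRhamComplex k n).obj P.complex))) ∧
    (¬ StronglyExceptional A β →
      ∀ P : KProjectiveResolution ((eulerKoszul A β).obj (toricRing A k)),
        (β ∈ degrees ((gradedLocalCohomology A k d).obj (toricRing A k)) →
          ∀ p : ℤ, Nonempty (((deRhamComplex k n).obj P.complex).homology p ≅
            (deRhamTorus k d).homology (p + n))) ∧
        (β ∉ degrees ((gradedLocalCohomology A k d).obj (toricRing A k)) →
          ∀ p : ℤ, Limits.IsZero (((deRhamComplex k n).obj P.complex).homology p))) :=
  ⟨exists_derivedIso A β, fun N h P => isZero_derived_of_notMem N h P, fun hβ P =>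
    ⟨homology_iso_deRhamTorus hβ P, isZero_homology_of_notMem hβ P⟩⟩
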